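/- Let $\gamma>\gamma_c^*:=\tfrac74\sqrt3-2\approx1.031$, let $\beta\in\mathbb R$, and let $\theta:\mathbb R^+\to\mathbb R$ satisfy (H1) $\theta\in L^\infty(\mathbb R^+)$ and, for some $c>0$, $|\theta(r)-1|\le c\,r$ for almost every $r>0$. Write $\hat\xi(\mathbf p)=(2\pi)^{-3/2}\int_{\mathbb R^3}e^{-i\mathbf p\cdot\mathbf y}\xi(\mathbf y)\,d\mathbf y$ for the unitary Fourier transform on $L^2(\mathbb R^3)=L^2(\mathbb R^3;\mathbb C)$, $(\cdot,\cdot)$ for the scalar product of $L^2(\mathbb R^3)$ (antilinear in the first argument) and $\|\cdot\|$ for its norm, $p=|\mathbf p|$, and $\|\xi\|_{H^s}^2=\int(1+p^2)^s|\hat\xi(\mathbf p)|^2d\mathbf p$. For $\lambda>0$ let $\Phi^\lambda$ be the form with domain $H^{1/2}(\mathbb R^3)$ given by $$\Phi^\lambda(\eta,\xi)=\int \overline{\hat\eta(\mathbf p)}\,\sqrt{\tfrac34p^2+\lambda}\;\hat\xi(\mathbf p)\,d\mathbf p-\frac1{\pi^2}\int \overline{\hat\eta(\mathbf p)}\Big(\int\frac{\hat\xi(\mathbf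 q)}{p^2+q^2+\mathbf p\cdot\mathbf q+\lambda}\,d\mathbf q\Big)d\mathbf p+\int\overline{\eta(\mathbf y)}\Big(\beta+\frac{\gamma}{|\mathbf y|}\theta(|\mathbf y|)\Big)\xi(\mathbf y)\,d\mathbf y .$$ Let $\Gamma^\lambda$ be the operator in $L^2(\mathbb R^3)$ associated to $\Phi^\lambda$: its domain $\mathcal D(\Gamma^\lambda)$ consists of the $\xi\in H^{1/2}(\mathbb R^3)$ for which there is $g\in L^2(\mathbb R^3)$ with $\Phi^\lambda(\eta,\xi)=(\eta,g)$ for all $\eta\in H^{1/2}(\mathbb R^3)$, and then $\Gamma^\lambda\xi=g$ (such a $g$ is unique). Call $\Phi^\lambda$ coercive if there is $c_0>0$ with $\Phi^\lambda(\xi,\xi)\ge c_0\|\xi\|_{H^{1/2}}^2$ for all $\xi\in H^{1/2}(\mathbb R^3)$. Then there is $\lambda_0>0$ such that $\Phi^\lambda$ is coercive for all $\lambda>\lambda_0$. Moreover, for every $\lambda>0$ such that $\Phi^\lambda$ is coercive: 1. for every $f\in L^2(\mathbb R^3)$ the equation $\Gamma^\lambda\xi=f$ has exactly one solution $\xi\in\mathcal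 D(\Gamma^\lambda)$; 2. there is $c>0$, independent of $f$ and $\xi$, such that for every $f\in L^2(\mathbb R^3)$ the solution $\xi$ of $\Gamma^\lambda\xi=f$ lies in $H^1(\mathbb R^3)$ and $\|\xi\|_{H^1}\le c\,\|f\|$; 3. $\mathcal D(\Gamma^\lambda)=H^1(\mathbb R^3)$. -/

import Mathlib

open MeasureTheory
open scoped FourierTransform ComplexConjugate SchwartzMap

noncomputable section

namespace ThreeBosons

/-- The space `ℝ³` with its Euclidean norm and Lebesgue measure. -/
abbrev R3 : Type := EuclideanSpace ℝ (Fin 3)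

/-- The Hilbert space `L²(ℝ³)` of complex valued functions. -/
abbrev L2 : Type := Lp ℂ 2 (volume : Measure R3)

/-- The unitary Fourier transform in angular frequency,
`ξ̂(p) = (2π)^(-3/2) ∫ exp(-i p·y) ξ(y) dy`, extended to `L²(ℝ³)` by Plancherel. Mathlib's `𝓕` is
the transform with kernel `exp(-2π i p·y)`, hence the rescaling. -/
def hat (ξ : L2) (p : R3) : ℂ :=
  (((2 * Real.pi) ^ (-(3 / 2) : ℝ) : ℝ) : ℂ) * (𝓕 ξ : L2) ((2 * Real.pi)⁻¹ • p)

/-- The Sobolev space `H^s(ℝ³)`, `s ≥ 0`, as a set of elements of `L²(ℝ³)`. -/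
def sobolev (s : ℝ) : Set L2 :=
  {ξ | TemperedDistribution.MemSobolev s 2 (ξ : 𝓢'(R3, ℂ))}

/-- The norm of `H^s(ℝ³)`, `‖ξ‖² = ∫ (1 + p²)^s |ξ̂(p)|² dp`, for `ξ ∈ H^s(ℝ³)`. -/
def sobolevNorm (s : ℝ) (ξ : L2) : ℝ :=
  √(∫ p : R3, (1 + ‖p‖ ^ 2) ^ s * ‖hat ξ p‖ ^ 2)

/-- Hypothesis (H1) on the real cut-off: `θ ∈ L^∞(ℝ⁺)` and `|θ(r) - 1| ≤ c r` for some `c > 0`. -/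
def CutoffH1 (θ : ℝ → ℝ) : Prop :=
  MemLp θ ⊤ (volume.restrict (Set.Ioi (0 : ℝ))) ∧
    ∃ c : ℝ, 0 < c ∧ ∀ᵐ r ∂(volume.restrict (Set.Ioi (0 : ℝ))), |θ r - 1| ≤ c * r

/-- The multiplication function `Γ_reg(r) = β + (γ / r) θ(r)`, at `r = |y|`. -/
def regFun (β γ : ℝ) (θ : ℝ → ℝ) (r : ℝ) : ℝ := β + γ / r * θ r

/-- Diagonal part of the form, `∫ conj(η̂(p)) √(3/4 p² + lam) ξ̂(p) dp`. -/
def formDiag (lam : ℝ) (η ξ : L2) : ℂ :=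
  ∫ p : R3, conj (hat η p) * ((√(3 / 4 * ‖p‖ ^ 2 + lam) : ℝ) : ℂ) * hat ξ p

/-- Off-diagonal part of the form,
`-π⁻² ∫ conj(η̂(p)) (∫ ξ̂(q) / (p² + q² + p·q + lam) dq) dp`. -/
def formOff (lam : ℝ) (η ξ : L2) : ℂ :=
  -(((1 / Real.pi ^ 2 : ℝ) : ℂ) * ∫ p : R3, conj (hat η p) *
    ∫ q : R3, hat ξ q / ((‖p‖ ^ 2 + ‖q‖ ^ 2 + inner ℝ p q + lam : ℝ) : ℂ))

/-- Regularizing part of the form, in position space,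
`∫ conj(η(y)) (β + (γ / |y|) θ(|y|)) ξ(y) dy`. -/
def formReg (β γ : ℝ) (θ : ℝ → ℝ) (η ξ : L2) : ℂ :=
  ∫ y : R3, conj (η y) * ((regFun β γ θ ‖y‖ : ℝ) : ℂ) * ξ y

/-- The sesquilinear form `Φ^lam(η, ξ)`, antilinear in `η`, of the quadratic form `Φ^lam`; it is used
on the form domain `H^{1/2}(ℝ³)`, where all the integrals converge absolutely. -/
def form (β γ : ℝ) (θ : ℝ → ℝ) (lam : ℝ) (η ξ : L2) : ℂ :=
  formDiag lam η ξ + formOff lam η ξ + formReg β γ θ η ξ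

/-- Coercivity of `Φ^lam` on its domain `H^{1/2}(ℝ³)`. -/
def Coercive (β γ : ℝ) (θ : ℝ → ℝ) (lam : ℝ) : Prop :=
  ∃ c₀ : ℝ, 0 < c₀ ∧ ∀ ξ ∈ sobolev (1 / 2),
    c₀ * sobolevNorm (1 / 2) ξ ^ 2 ≤ (form β γ θ lam ξ ξ).re

/-- `g` represents the antilinear functional `η ↦ Φ^lam(η, ξ)` on `H^{1/2}(ℝ³)`:
`Φ^lam(η, ξ) = (η, g)` for all `η ∈ H^{1/2}(ℝ³)`. -/
def Represents (β γ : ℝ) (θ : ℝ → ℝ) (lam : ℝ) (ξ g : L2) : Prop :=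
  ∀ η ∈ sobolev (1 / 2), form β γ θ lam η ξ = inner ℂ η g

/-- The domain of the operator `Γ^lam` associated to the form `Φ^lam` with domain `H^{1/2}(ℝ³)`. -/
def gammaDomain (β γ : ℝ) (θ : ℝ → ℝ) (lam : ℝ) : Set L2 :=
  {ξ | ξ ∈ sobolev (1 / 2) ∧ ∃ g : L2, Represents β γ θ lam ξ g}

/-- The operator `Γ^lam` on its domain: `Γ^lam ξ` is the `g ∈ L²(ℝ³)` with `Φ^lam(η, ξ) = (η, g)` for
all `η ∈ H^{1/2}(ℝ³)`; it is unique by `gammaOp_eq_iff`. -/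
def gammaOp (β γ : ℝ) (θ : ℝ → ℝ) (lam : ℝ) (ξ : gammaDomain β γ θ lam) : L2 :=
  Classical.choose ξ.2.2

theorem dense_sobolev (s : ℝ) : Dense (sobolev s) := by
  have h := SchwartzMap.denseRange_toLpCLM (E := R3) (F := ℂ) (p := 2)
    (μ := volume) (by norm_num)
  refine h.mono ?_
  rintro _ ⟨f, rfl⟩
  have := f.memSobolev (s := s) (p := 2)
  rw [← Lp.toTemperedDistribution_toLp_eq (p := 2)] at this
  exact this

theorem Represents.unique {β γ : ℝ} {θ : ℝ → ℝ} {lam : ℝ} {ξ g g' : L2}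
    (h : Represents β γ θ lam ξ g) (h' : Represents β γ θ lam ξ g') : g = g' :=
  (dense_sobolev (1 / 2)).eq_of_inner_right ℂ fun η hη => by
    rw [← h η hη, ← h' η hη]

theorem gammaOp_eq_iff {β γ : ℝ} {θ : ℝ → ℝ} {lam : ℝ} (ξ : gammaDomain β γ θ lam) (g : L2) :
    gammaOp β γ θ lam ξ = g ↔ Represents β γ θ lam ξ g :=
  ⟨fun h => h ▸ Classical.choose_spec ξ.2.2, fun h => (Classical.choose_spec ξ.2.2).unique h⟩

/-- The threshold `γ_c* = (7/4) √3 - 2 ≈ 1.031`. -/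
def gammaCStar : ℝ := 7 / 4 * √3 - 2

end ThreeBosons

end

/-!
In momentum space the diagonal part of the form is of order `√3/2 |p|`, and the off-diagonal and the
singular regularizing parts are of the same order. Everything rests on one estimate: if the form is
tested against `|∇| ξ`, then up to lower order terms its real part is at least `c ‖|∇| ξ‖²` with
`c > 0`, as soon as `γ` exceeds the threshold (`exists_regularity_constant`).

The estimate has two ingredients for the regularizing term. The first is the sharp inequality
`Re (|y|⁻¹ ξ, |∇| ξ) ≥ ½ ‖|y|⁻¹ ξ‖²` (`norm_hardyOp_sq_le`). It is obtained for the Poisson semigroup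
`e^(-ε|∇|)`, whose positive kernel acts explicitly on `|y|^(-1/2)` and `|y|^(-3/2)`, by the Schur test
with the weight `|y|^(-1/2)`, and then by differentiation at `ε = 0`. The second is Newton's theorem in
momentum space (`newton_inequality`): `‖|y|⁻¹ ξ‖²` is a multiple of the Coulomb energy of the charge
density `ξ̂`, which decreases under spherical averaging, and the averaged energy has the kernel
`1 / max(|p|, |q|)`. Together they bound the kernel `1 / max(|p|, |q|)`, on `ξ̂`, by the regularizing
term.

The off-diagonal kernel `1 / (p² + q² + p·q)`, symmetrized with the factor `|p|` of the test function,
splits into a part even and a part odd in `p`, which act on the even and odd parts of `ξ̂` separately.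
From the even part a multiple `g ≤ γ` of the Newton kernel is subtracted. The difference is a
nonnegative kernel, and the Schur test with the weight `|q|^(-3/2)`, which is an eigenfunction of both
kernels, gives the constant `4 (√3 - 1) - 2 g` (`bddKernel_screenedKernel`). This is below `√3/2`
exactly when `g > 7/4 √3 - 2`. For the odd part a crude Schur bound `2/(3π) + 1/3 < √3/2` suffices
(`bddKernel_oddDomKernel`).

For coercivity at large `lam` the estimate, which concerns `Re (|∇| ξ, Γ ξ)`, has to be turned into one
on the form. A symmetric operator `T` with `Re (A x, T x) ≥ 0` for a strictly accretive bounded `A` is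
nonnegative (`re_inner_nonneg_of_accretive`): near the bottom `m < 0` of its numerical range `T x` is
almost `m x`. With `A` a truncation of `|∇|` this yields the form inequality for the even part of the
kernel at `lam = 0` (`even_form_bound`). The full kernel at any `lam` is dominated by this even part,
because `1 / (p² + q² - p·q + lam)` is a superposition of Gaussians, hence positive semidefinite and
decreasing in `lam` (`re_kerInt_half_stmKernel_le`). The bounded part of the regularization is absorbed
by a large `lam` (`coercive_of_large`).

If the form is coercive, the Lax-Milgram theorem in `H^{1/2}` gives existence and uniqueness. For
regularity, the same estimate shows that `Γ + μ`, for `μ` large, is coercive as a form on `H^1` tested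
against `(1 + |∇|) ξ`, so that `(Γ + μ) ξ' = g` has a solution in `H^1`; by coercivity in `H^{1/2}` it
agrees with the form solution (`exists_bessel_one_eq_of_represents`). Conversely `Γ` maps `H^1` to `L²`
by Hardy's inequality, so the domain is exactly `H^1`.

Functions in `H^s` are written as `bessel s ψ`, with `ψ ∈ L²` and the multiplier `(1 + |p|)^(-s)`; all
the operators are thereby replaced by bounded ones on `L²`.
-/


open MeasureTheory Filter Set
open scoped FourierTransform ComplexConjugate SchwartzMap Topology ENNReal

noncomputable section

namespace ThreeBosons

/-! ### Integration in zonal and radial coordinates -/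

theorem lintegral_R3_coord (F : ℝ × ℝ → ℝ≥0∞) (hF : Measurable F) :
    ∫⁻ y : R3, F (‖y‖, y 0) =
      ∫⁻ z : ℝ, ∫⁻ w : ℝ × ℝ, F (√(z ^ 2 + (w.1 ^ 2 + w.2 ^ 2)), z) := by
  have h1 : MeasurePreserving (fun y : R3 => (y 0, (y 1, y 2))) volume volume := by
    have a := PiLp.volume_preserving_ofLp (Fin 3)
    have b := volume_preserving_piFinSuccAbove (fun _ : Fin 3 => ℝ) 0
    have c := (MeasurePreserving.id (volume : Measure ℝ)).prod (volume_preserving_finTwoArrow ℝ)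
    have d := c.comp (b.comp a)
    exact d
  have h2 : Measurable (fun v : ℝ × ℝ × ℝ => F (√(v.1 ^ 2 + (v.2.1 ^ 2 + v.2.2 ^ 2)), v.1)) := by
    fun_prop
  have h3 := h1.lintegral_comp h2
  rw [Measure.volume_eq_prod, lintegral_prod _ h2.aemeasurable] at h3
  rw [← h3]
  refine lintegral_congr fun y => ?_
  rw [EuclideanSpace.norm_eq]
  simp [Fin.sum_univ_three, add_assoc]

theorem lintegral_polar (G : ℝ → ℝ≥0∞) (hG : Measurable G) (z : ℝ) :
    ∫⁻ w : ℝ × ℝ, G (√(z ^ 2 + (w.1 ^ 2 + w.2 ^ 2))) =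
      ∫⁻ r in Ioi |z|, ENNReal.ofReal (2 * Real.pi * r) * G r := by
  rw [← lintegral_comp_polarCoord_symm, polarCoord_target, Measure.volume_eq_prod,
    ← Measure.prod_restrict, lintegral_prod _ (by simp only [polarCoord_symm_apply]; fun_prop)]
  have himg : (fun ρ : ℝ => √(z ^ 2 + ρ ^ 2)) '' Ioi 0 = Ioi |z| := by
    ext r
    simp only [mem_image, mem_Ioi]
    constructor
    · rintro ⟨ρ, hρ, rfl⟩
      rw [← Real.sqrt_sq_eq_abs]
      exact Real.sqrt_lt_sqrt (sq_nonneg z) (by nlinarith)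
    · intro hr
      have h0 : z ^ 2 < r ^ 2 := by
        rw [← sq_abs z]; exact pow_lt_pow_left₀ hr (abs_nonneg z) two_ne_zero
      refine ⟨√(r ^ 2 - z ^ 2), Real.sqrt_pos.2 (by linarith), ?_⟩
      rw [Real.sq_sqrt (by linarith)]
      have : z ^ 2 + (r ^ 2 - z ^ 2) = r ^ 2 := by ring
      rw [this, Real.sqrt_sq ((abs_nonneg z).trans hr.le)]
  rw [← himg, lintegral_image_eq_lintegral_abs_deriv_mul (f' := fun ρ => ρ / √(z ^ 2 + ρ ^ 2))
    measurableSet_Ioi]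
  · refine setLIntegral_congr_fun measurableSet_Ioi fun ρ hρ => ?_
    have hρ : 0 < ρ := hρ
    have hs : 0 < √(z ^ 2 + ρ ^ 2) := Real.sqrt_pos.2 (by positivity)
    have h1 : ∀ a : ℝ, (ρ * Real.cos a) ^ 2 + (ρ * Real.sin a) ^ 2 = ρ ^ 2 := fun a => by
      have := Real.sin_sq_add_cos_sq a
      linear_combination ρ ^ 2 * this
    simp only [polarCoord_symm_apply, h1, smul_eq_mul]
    rw [lintegral_const, Measure.restrict_apply_univ, Real.volume_Ioo, mul_right_comm, ← mul_assoc,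
      ← ENNReal.ofReal_mul hρ.le, ← ENNReal.ofReal_mul (abs_nonneg _), abs_of_pos (by positivity)]
    congr 2
    field_simp
    ring
  · intro ρ hρ
    have hρ : 0 < ρ := hρ
    have h := ((hasDerivAt_pow 2 ρ).const_add (z ^ 2)).sqrt (by positivity)
    refine (h.congr_deriv ?_).hasDerivWithinAt
    field_simp
    ring
  · intro a ha b hb hab
    have ha : 0 < a := ha
    have hb : 0 < b := hb
    have := (Real.sqrt_inj (by positivity) (by positivity)).1 hab
    exact (pow_left_inj₀ ha.le hb.le two_ne_zero).1 (by linarith)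

/-- Zonal coordinates: the volume of the set of points at distance `r` from the origin and height
`z` along a unit vector is `2 π r dr dz`, `|z| < r` (Archimedes). -/
theorem lintegral_norm_inner {e : R3} (he : ‖e‖ = 1) (F : ℝ × ℝ → ℝ≥0∞) (hF : Measurable F) :
    ∫⁻ y : R3, F (‖y‖, inner ℝ e y) =
      ∫⁻ r in Ioi (0 : ℝ), ∫⁻ z in Ioo (-r) r, ENNReal.ofReal (2 * Real.pi * r) * F (r, z) := by
  obtain ⟨b, hb⟩ : ∃ b : OrthonormalBasis (Fin 3) ℝ R3, b 0 = e := by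
    have h := Orthonormal.exists_orthonormalBasis_extension_of_card_eq (𝕜 := ℝ) (E := R3)
      (ι := Fin 3) (by simp) (v := fun _ => e) (s := {0})
      ⟨fun i => by simp [he], fun i j hij => absurd (Subsingleton.elim i j) hij⟩
    obtain ⟨b, hb⟩ := h
    exact ⟨b, hb 0 rfl⟩
  have h1 : ∫⁻ y : R3, F (‖y‖, inner ℝ e y) = ∫⁻ y : R3, F (‖y‖, y 0) := by
    rw [← b.measurePreserving_repr.lintegral_comp (f := fun y : R3 => F (‖y‖, y 0)) (by fun_prop)]
    refine lintegral_congr fun y => ?_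
    rw [b.repr.norm_map, b.repr_apply_apply, hb]
  rw [h1, lintegral_R3_coord F hF]
  have h2 : ∀ z : ℝ, ∫⁻ w : ℝ × ℝ, F (√(z ^ 2 + (w.1 ^ 2 + w.2 ^ 2)), z) =
      ∫⁻ r : ℝ, (Ioi |z|).indicator (fun r => ENNReal.ofReal (2 * Real.pi * r) * F (r, z)) r :=
    fun z => by
      rw [lintegral_polar (fun r => F (r, z)) (by fun_prop), lintegral_indicator measurableSet_Ioi]
  simp_rw [h2]
  have hm : Measurable (fun v : ℝ × ℝ => (Ioi |v.1|).indicator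
      (fun r => ENNReal.ofReal (2 * Real.pi * r) * F (r, v.1)) v.2) := by
    have : (fun v : ℝ × ℝ => (Ioi |v.1|).indicator
      (fun r => ENNReal.ofReal (2 * Real.pi * r) * F (r, v.1)) v.2) =
      {v : ℝ × ℝ | |v.1| < v.2}.indicator
        (fun v => ENNReal.ofReal (2 * Real.pi * v.2) * F (v.2, v.1)) := by
      ext v; simp [indicator]
    rw [this]
    refine Measurable.indicator (by fun_prop) (measurableSet_lt (by fun_prop) (by fun_prop))
  rw [lintegral_lintegral_swap hm.aemeasurable, ← lintegral_indicator measurableSet_Ioi]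
  refine lintegral_congr fun r => ?_
  by_cases hr : 0 < r
  · rw [indicator_of_mem (show r ∈ Ioi (0 : ℝ) from hr), ← lintegral_indicator measurableSet_Ioo]
    refine lintegral_congr fun z => ?_
    simp only [indicator, mem_Ioi, mem_Ioo, abs_lt]
  · rw [indicator_of_notMem (show r ∉ Ioi (0 : ℝ) from hr)]
    rw [← lintegral_zero (μ := volume) (α := ℝ)]
    refine lintegral_congr fun z => indicator_of_notMem ?_ _
    simp only [mem_Ioi, not_lt]
    exact (not_lt.1 hr).trans (abs_nonneg z)

theorem lintegral_norm (F : ℝ → ℝ≥0∞) (hF : Measurable F) :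
    ∫⁻ y : R3, F ‖y‖ = ∫⁻ r in Ioi (0 : ℝ), ENNReal.ofReal (4 * Real.pi * r ^ 2) * F r := by
  have h := lintegral_norm_inner (e := EuclideanSpace.single 0 1) (by simp)
    (fun v => F v.1) (by fun_prop)
  rw [h]
  refine setLIntegral_congr_fun measurableSet_Ioi fun r hr => ?_
  have hr : 0 < r := hr
  simp only
  rw [lintegral_const, Measure.restrict_apply_univ, Real.volume_Ioo, mul_right_comm,
    ← ENNReal.ofReal_mul (by positivity)]
  congr 2
  ring

/-- The fundamental theorem of calculus on `(0, ∞)` for a nonnegative derivative. -/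
theorem lintegral_Ioi_of_hasDerivAt {f F : ℝ → ℝ} {L M : ℝ}
    (hd : ∀ x, 0 < x → HasDerivAt F (f x) x) (hf : ∀ x, 0 < x → 0 ≤ f x)
    (h0 : Tendsto F (𝓝[>] 0) (𝓝 L)) (hM : Tendsto F atTop (𝓝 M)) :
    ∫⁻ x in Ioi (0 : ℝ), ENNReal.ofReal (f x) = ENNReal.ofReal (M - L) := by
  set G := Function.update F 0 L with hG
  have hc : ContinuousWithinAt G (Ici 0) 0 := by
    rw [hG, continuousWithinAt_update_same]
    simpa using h0
  have hd' : ∀ x ∈ Ioi (0 : ℝ), HasDerivAt G (f x) x := fun x hx => by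
    refine (hd x hx).congr_of_eventuallyEq ?_
    filter_upwards [isOpen_Ioi.mem_nhds hx] with y hy
    exact Function.update_of_ne (ne_of_gt hy) _ _
  have hM' : Tendsto G atTop (𝓝 M) := by
    refine hM.congr' ?_
    filter_upwards [eventually_gt_atTop 0] with y hy
    exact (Function.update_of_ne (ne_of_gt hy) _ _).symm
  have hi := integrableOn_Ioi_deriv_of_nonneg hc hd' hf hM'
  have hv := integral_Ioi_of_hasDerivAt_of_nonneg hc hd' hf hM'
  rw [← ofReal_integral_eq_lintegral_ofReal hi
    ((ae_restrict_iff' measurableSet_Ioi).2 (ae_of_all _ hf)), hv]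
  simp [hG]

/-! ### The Schur test -/

theorem two_mul_le_add_sq_ennreal (x y : ℝ≥0∞) : 2 * (x * y) ≤ x ^ 2 + y ^ 2 := by
  wlog h : x ≤ y generalizing x y
  · rw [mul_comm x, add_comm]; exact this y x (le_of_not_ge h)
  obtain ⟨d, rfl⟩ := exists_add_of_le h
  have : x ^ 2 + (x + d) ^ 2 = 2 * (x * (x + d)) + d ^ 2 := by ring
  rw [this]
  exact le_self_add

theorem two_mul_le_weighted (F G : ℝ≥0∞) {u v : ℝ≥0∞} (hu : u ≠ 0) (hu' : u ≠ ∞) (hv : v ≠ 0)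
    (hv' : v ≠ ∞) : 2 * (F * G) ≤ F ^ 2 * (v / u) + G ^ 2 * (u / v) := by
  have ht0 : v / u ≠ 0 := ENNReal.div_ne_zero.2 ⟨hv, hu'⟩
  have ht1 : v / u ≠ ∞ := ENNReal.div_ne_top hv' hu
  set s := (v / u) ^ (1 / 2 : ℝ) with hs
  have hs0 : s ≠ 0 := by simp [hs, ht0, ht1]
  have hs1 : s ≠ ∞ := by simp [hs, ht1, ht0]
  have hss : s ^ 2 = v / u := by
    rw [hs, ← ENNReal.rpow_natCast, ← ENNReal.rpow_mul]; norm_num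
  have h := two_mul_le_add_sq_ennreal (F * s) (G * s⁻¹)
  have e1 : F * s * (G * s⁻¹) = F * G := by
    rw [mul_mul_mul_comm, ENNReal.mul_inv_cancel hs0 hs1, mul_one]
  have e2 : (s⁻¹) ^ 2 = u / v := by
    rw [← ENNReal.inv_pow, hss, ENNReal.inv_div (Or.inl hu') (Or.inl hu)]
  rwa [e1, mul_pow, mul_pow, hss, e2] at h

/-- The Schur test with different weights in the two variables. -/
theorem schur_test {k : R3 → R3 → ℝ≥0∞} (hk : Measurable (Function.uncurry k))
    {u v a b : R3 → ℝ≥0∞} (hu : Measurable u) (hv : Measurable v)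
    (hu0 : ∀ᵐ p, u p ≠ 0 ∧ u p ≠ ∞) (hv0 : ∀ᵐ p, v p ≠ 0 ∧ v p ≠ ∞)
    (h1 : ∀ᵐ p, ∫⁻ q, k p q * v q ≤ a p * u p) (h2 : ∀ᵐ q, ∫⁻ p, k p q * u p ≤ b q * v q)
    {F G : R3 → ℝ≥0∞} (hF : AEMeasurable F) (hG : AEMeasurable G) :
    2 * ∫⁻ p, ∫⁻ q, F p * k p q * G q ≤ (∫⁻ p, a p * F p ^ 2) + ∫⁻ q, b q * G q ^ 2 := by
  have hm1 : AEMeasurable (fun z : R3 × R3 => F z.1 ^ 2 / u z.1 * (k z.1 z.2 * v z.2))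
      ((volume : Measure R3).prod volume) :=
    (((hF.comp_quasiMeasurePreserving Measure.quasiMeasurePreserving_fst).pow_const 2).div
      (hu.comp measurable_fst).aemeasurable).mul
      (hk.aemeasurable.mul (hv.comp measurable_snd).aemeasurable)
  have hm2 : AEMeasurable (fun z : R3 × R3 => G z.2 ^ 2 / v z.2 * (k z.1 z.2 * u z.1))
      ((volume : Measure R3).prod volume) :=
    (((hG.comp_quasiMeasurePreserving Measure.quasiMeasurePreserving_snd).pow_const 2).div
      (hv.comp measurable_snd).aemeasurable).mul
      (hk.aemeasurable.mul (hu.comp measurable_fst).aemeasurable)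
  have hm0 : AEMeasurable (fun z : R3 × R3 => F z.1 * k z.1 z.2 * G z.2)
      ((volume : Measure R3).prod volume) :=
    ((hF.comp_quasiMeasurePreserving Measure.quasiMeasurePreserving_fst).mul hk.aemeasurable).mul
      (hG.comp_quasiMeasurePreserving Measure.quasiMeasurePreserving_snd)
  have hu1 := (Measure.quasiMeasurePreserving_fst (μ := (volume : Measure R3))
    (ν := (volume : Measure R3))).ae hu0
  have hv1 := (Measure.quasiMeasurePreserving_snd (μ := (volume : Measure R3))
    (ν := (volume : Measure R3))).ae hv0
  calc 2 * ∫⁻ p, ∫⁻ q, F p * k p q * G q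
      = ∫⁻ z, 2 * (F z.1 * k z.1 z.2 * G z.2) ∂((volume : Measure R3).prod volume) := by
        rw [lintegral_const_mul' _ _ (by simp), lintegral_prod _ hm0]
    _ ≤ ∫⁻ z, (F z.1 ^ 2 / u z.1 * (k z.1 z.2 * v z.2) + G z.2 ^ 2 / v z.2 * (k z.1 z.2 * u z.1))
          ∂((volume : Measure R3).prod volume) := by
        refine lintegral_mono_ae ?_
        filter_upwards [hu1, hv1] with z hz1 hz2
        have h := mul_le_mul_right (two_mul_le_weighted (F z.1) (G z.2) hz1.1 hz1.2 hz2.1 hz2.2)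
          (k z.1 z.2)
        refine le_trans (le_of_eq ?_) (h.trans (le_of_eq ?_))
        · ring
        · simp only [div_eq_mul_inv]; ring
    _ = (∫⁻ p, F p ^ 2 / u p * ∫⁻ q, k p q * v q) + ∫⁻ q, G q ^ 2 / v q * ∫⁻ p, k p q * u p := by
        rw [lintegral_add_left' hm1, lintegral_prod _ hm1, lintegral_prod_symm _ hm2]
        congr 1
        · refine lintegral_congr fun p => ?_
          exact lintegral_const_mul (F p ^ 2 / u p) (f := fun q => k p q * v q)
            ((hk.comp measurable_prodMk_left).mul hv)
        · refine lintegral_congr fun q => ?_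
          exact lintegral_const_mul (G q ^ 2 / v q) (f := fun p => k p q * u p)
            ((hk.comp measurable_prodMk_right).mul hu)
    _ ≤ _ := by
        refine add_le_add (lintegral_mono_ae ?_) (lintegral_mono_ae ?_)
        · filter_upwards [h1, hu0] with p hp hp0
          refine (mul_le_mul_right hp _).trans (le_of_eq ?_)
          rw [div_eq_mul_inv, mul_mul_mul_comm, mul_comm (F p ^ 2), mul_assoc,
            ENNReal.inv_mul_cancel hp0.1 hp0.2, mul_one]
        · filter_upwards [h2, hv0] with p hp hp0
          refine (mul_le_mul_right hp _).trans (le_of_eq ?_)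
          rw [div_eq_mul_inv, mul_mul_mul_comm, mul_comm (G p ^ 2), mul_assoc,
            ENNReal.inv_mul_cancel hp0.1 hp0.2, mul_one]

/-! ### Multiplication and integral operators on `L²` -/

theorem enorm_sq_eq_lintegral (f : L2) : ‖f‖ₑ ^ 2 = ∫⁻ p, ‖f p‖ₑ ^ 2 := by
  rw [Lp.enorm_def, eLpNorm_eq_lintegral_rpow_enorm_toReal (by norm_num) (by norm_num)]
  rw [← ENNReal.rpow_natCast, ← ENNReal.rpow_mul]
  norm_num

theorem memLp_two_iff {f : R3 → ℂ} (hf : AEStronglyMeasurable f) :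
    MemLp f 2 ↔ ∫⁻ p, ‖f p‖ₑ ^ 2 < ∞ := by
  rw [MemLp, and_iff_right hf, eLpNorm_lt_top_iff_lintegral_rpow_enorm_lt_top (by norm_num)
    (by norm_num)]
  norm_num

/-- Multiplication by a function `w`, not necessarily bounded, after a bounded operator `T`. -/
theorem exists_mul_clm (T : L2 →L[ℂ] L2) {w : R3 → ℝ} (hw : AEStronglyMeasurable w) (C : ℝ)
    (h : ∀ ψ : L2, ∫⁻ y, ‖(w y : ℂ) * T ψ y‖ₑ ^ 2 ≤ ENNReal.ofReal C * ‖ψ‖ₑ ^ 2) :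
    ∃ V : L2 →L[ℂ] L2, ∀ ψ : L2, V ψ =ᵐ[volume] fun y => (w y : ℂ) * T ψ y := by
  have hmeas : ∀ ψ : L2, AEStronglyMeasurable (fun y => (w y : ℂ) * T ψ y) := fun ψ =>
    (Complex.continuous_ofReal.comp_aestronglyMeasurable hw).mul (Lp.aestronglyMeasurable _)
  have hmem : ∀ ψ : L2, MemLp (fun y => (w y : ℂ) * T ψ y) 2 := fun ψ =>
    (memLp_two_iff (hmeas ψ)).2 ((h ψ).trans_lt (ENNReal.mul_lt_top ENNReal.ofReal_lt_top
      (by simp)))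
  let L : L2 →ₗ[ℂ] L2 :=
    { toFun := fun ψ => (hmem ψ).toLp _
      map_add' := fun ψ φ => by
        refine Lp.ext ?_
        filter_upwards [(hmem (ψ + φ)).coeFn_toLp, (hmem ψ).coeFn_toLp, (hmem φ).coeFn_toLp,
          Lp.coeFn_add ((hmem ψ).toLp _) ((hmem φ).toLp _), Lp.coeFn_add (T ψ) (T φ)]
          with y h1 h2 h3 h4 h5
        rw [h1, h4, Pi.add_apply, h2, h3, map_add, h5, Pi.add_apply, mul_add]
      map_smul' := fun c ψ => by
        refine Lp.ext ?_
        filter_upwards [(hmem (c • ψ)).coeFn_toLp, (hmem ψ).coeFn_toLp,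
          Lp.coeFn_smul c ((hmem ψ).toLp _), Lp.coeFn_smul c (T ψ)]
          with y h1 h2 h4 h5
        rw [h1, RingHom.id_apply, h4, Pi.smul_apply, h2, map_smul, h5, Pi.smul_apply, smul_eq_mul,
          smul_eq_mul]
        ring }
  refine ⟨L.mkContinuous √C fun ψ => ?_, fun ψ => (hmem ψ).coeFn_toLp⟩
  have h1 : ‖L ψ‖ₑ ^ 2 ≤ ENNReal.ofReal C * ‖ψ‖ₑ ^ 2 := by
    refine le_trans (le_of_eq ?_) (h ψ)
    rw [enorm_sq_eq_lintegral]
    refine lintegral_congr_ae ?_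
    filter_upwards [(hmem ψ).coeFn_toLp] with y hy
    rw [← hy]; rfl
  have h2 : ‖L ψ‖ ^ 2 ≤ max C 0 * ‖ψ‖ ^ 2 := by
    rw [← ENNReal.ofReal_le_ofReal_iff (by positivity), ENNReal.ofReal_mul (by positivity),
      ENNReal.ofReal_pow (norm_nonneg _), ENNReal.ofReal_pow (norm_nonneg _), ofReal_norm,
      ofReal_norm]
    refine h1.trans (mul_le_mul_left ?_ _)
    exact ENNReal.ofReal_le_ofReal (le_max_left _ _)
  refine le_of_sq_le_sq ?_ (by positivity)
  rw [mul_pow]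
  refine h2.trans (le_of_eq ?_)
  congr 1
  rcases le_total 0 C with hC | hC
  · rw [Real.sq_sqrt hC, max_eq_left hC]
  · rw [Real.sqrt_eq_zero_of_nonpos hC, max_eq_right hC]; norm_num

theorem exists_mul_bounded {w : R3 → ℝ} (hw : AEStronglyMeasurable w) (C : ℝ)
    (h : ∀ᵐ y, |w y| ≤ C) :
    ∃ V : L2 →L[ℂ] L2, ∀ ψ : L2, V ψ =ᵐ[volume] fun y => (w y : ℂ) * ψ y := by
  refine exists_mul_clm (ContinuousLinearMap.id ℂ L2) hw (C ^ 2) fun ψ => ?_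
  rw [enorm_sq_eq_lintegral, ← lintegral_const_mul' _ _ ENNReal.ofReal_ne_top]
  refine lintegral_mono_ae ?_
  filter_upwards [h] with y hy
  simp only [ContinuousLinearMap.coe_id', id_eq]
  rw [enorm_mul, mul_pow]
  refine mul_le_mul_left ?_ _
  rw [← ofReal_norm, ← ENNReal.ofReal_pow (norm_nonneg _), Complex.norm_real, Real.norm_eq_abs]
  exact ENNReal.ofReal_le_ofReal (pow_le_pow_left₀ (abs_nonneg _) hy 2)

/-- The integral form `∬ conj(f p) k(p, q) g(q)` is bounded by `C` on `L²`, in absolute value. -/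
def BddKernel (k : R3 → R3 → ℝ) (C : ℝ) : Prop :=
  Measurable (Function.uncurry k) ∧ ∀ f g : L2,
    2 * ∫⁻ p, ∫⁻ q, ‖f p‖ₑ * ‖k p q‖ₑ * ‖g q‖ₑ ≤ ENNReal.ofReal C * (‖f‖ₑ ^ 2 + ‖g‖ₑ ^ 2)

/-- The integrand of the sesquilinear form with real kernel `k`. -/
def kerFun (k : R3 → R3 → ℝ) (f g : R3 → ℂ) (z : R3 × R3) : ℂ :=
  conj (f z.1) * (k z.1 z.2 : ℂ) * g z.2

theorem aestronglyMeasurable_kerFun {k : R3 → R3 → ℝ} (hk : Measurable (Function.uncurry k))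
    {f g : R3 → ℂ} (hf : AEStronglyMeasurable f) (hg : AEStronglyMeasurable g) :
    AEStronglyMeasurable (kerFun k f g) ((volume : Measure R3).prod volume) := by
  have h1 := hf.comp_quasiMeasurePreserving (Measure.quasiMeasurePreserving_fst
    (μ := (volume : Measure R3)) (ν := (volume : Measure R3)))
  have h2 := hg.comp_quasiMeasurePreserving (Measure.quasiMeasurePreserving_snd
    (μ := (volume : Measure R3)) (ν := (volume : Measure R3)))
  exact ((Complex.continuous_conj.comp_aestronglyMeasurable h1).mul
    (Complex.measurable_ofReal.comp hk).aestronglyMeasurable).mul h2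

theorem lintegral_enorm_kerFun {k : R3 → R3 → ℝ} (hk : Measurable (Function.uncurry k))
    {f g : R3 → ℂ} (hf : AEStronglyMeasurable f) (hg : AEStronglyMeasurable g) :
    ∫⁻ z, ‖kerFun k f g z‖ₑ ∂((volume : Measure R3).prod volume) =
      ∫⁻ p, ∫⁻ q, ‖f p‖ₑ * ‖k p q‖ₑ * ‖g q‖ₑ := by
  rw [lintegral_prod _ (aestronglyMeasurable_kerFun hk hf hg).enorm]
  refine lintegral_congr fun p => lintegral_congr fun q => ?_
  simp only [kerFun, enorm_mul, RCLike.enorm_conj]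
  rw [← ofReal_norm (k p q : ℂ), Complex.norm_real, ofReal_norm]

theorem BddKernel.integrable {k : R3 → R3 → ℝ} {C : ℝ} (h : BddKernel k C) (f g : L2) :
    Integrable (kerFun k f g) ((volume : Measure R3).prod volume) := by
  refine ⟨aestronglyMeasurable_kerFun h.1 (Lp.aestronglyMeasurable f) (Lp.aestronglyMeasurable g),
    ?_⟩
  rw [HasFiniteIntegral, lintegral_enorm_kerFun h.1 (Lp.aestronglyMeasurable f)
    (Lp.aestronglyMeasurable g)]
  have h1 : 2 * ∫⁻ p, ∫⁻ q, ‖f p‖ₑ * ‖k p q‖ₑ * ‖g q‖ₑ < ∞ :=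
    (h.2 f g).trans_lt (ENNReal.mul_lt_top ENNReal.ofReal_lt_top (by simp))
  refine lt_of_le_of_lt ?_ h1
  rw [two_mul]
  exact le_self_add

theorem BddKernel.norm_integral_le {k : R3 → R3 → ℝ} {C : ℝ} (hC : 0 ≤ C) (h : BddKernel k C)
    (f g : L2) :
    2 * ‖∫ z, kerFun k f g z ∂((volume : Measure R3).prod volume)‖ ≤ C * (‖f‖ ^ 2 + ‖g‖ ^ 2) := by
  have h1 := h.2 f g
  rw [← lintegral_enorm_kerFun h.1 (Lp.aestronglyMeasurable f) (Lp.aestronglyMeasurable g)] at h1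
  have h2 := (mul_le_mul_right (enorm_integral_le_lintegral_enorm (kerFun k f g)
    (μ := (volume : Measure R3).prod volume)) 2).trans h1
  rw [← ENNReal.ofReal_le_ofReal_iff (by positivity), ENNReal.ofReal_mul (by positivity),
    ENNReal.ofReal_mul hC, ENNReal.ofReal_add (by positivity) (by positivity),
    ENNReal.ofReal_pow (norm_nonneg _), ENNReal.ofReal_pow (norm_nonneg _), ofReal_norm,
    ofReal_norm, ofReal_norm]
  simpa using h2

theorem integrable_kerFun_congr {k : R3 → R3 → ℝ} {f f' g g' : R3 → ℂ} (hf : f =ᵐ[volume] f')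
    (hg : g =ᵐ[volume] g') :
    kerFun k f g =ᵐ[(volume : Measure R3).prod volume] kerFun k f' g' := by
  filter_upwards [(Measure.quasiMeasurePreserving_fst (μ := (volume : Measure R3))
    (ν := (volume : Measure R3))).ae hf, (Measure.quasiMeasurePreserving_snd
    (μ := (volume : Measure R3)) (ν := (volume : Measure R3))).ae hg] with z h1 h2
  simp only [kerFun, h1, h2]

/-- A kernel bounded on `L²` defines a bounded operator. -/
theorem BddKernel.exists_clm {k : R3 → R3 → ℝ} {C : ℝ} (hC : 0 ≤ C) (h : BddKernel k C) :
    ∃ T : L2 →L[ℂ] L2, ∀ f g : L2,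
      inner ℂ f (T g) = ∫ z, kerFun k f g z ∂((volume : Measure R3).prod volume) := by
  let B : L2 →ₗ⋆[ℂ] L2 →ₗ[ℂ] ℂ := LinearMap.mk₂'ₛₗ (starRingEnd ℂ) (RingHom.id ℂ)
    (fun f g => ∫ z, kerFun k f g z ∂((volume : Measure R3).prod volume))
    (fun f f' g => by
      rw [← integral_add (h.integrable f g) (h.integrable f' g)]
      refine integral_congr_ae ((integrable_kerFun_congr (Lp.coeFn_add f f')
        (ae_eq_refl g)).trans (ae_of_all _ fun z => ?_))
      simp only [kerFun, Pi.add_apply, map_add]; ring)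
    (fun c f g => by
      rw [smul_eq_mul, ← integral_const_mul]
      refine integral_congr_ae ((integrable_kerFun_congr (Lp.coeFn_smul c f)
        (ae_eq_refl g)).trans (ae_of_all _ fun z => ?_))
      simp only [kerFun, Pi.smul_apply, smul_eq_mul, map_mul]; ring)
    (fun f g g' => by
      rw [← integral_add (h.integrable f g) (h.integrable f g')]
      refine integral_congr_ae ((integrable_kerFun_congr (ae_eq_refl f)
        (Lp.coeFn_add g g')).trans (ae_of_all _ fun z => ?_))
      simp only [kerFun, Pi.add_apply]; ring)
    (fun c f g => by
      rw [smul_eq_mul, ← integral_const_mul]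
      refine integral_congr_ae ((integrable_kerFun_congr (ae_eq_refl f)
        (Lp.coeFn_smul c g)).trans (ae_of_all _ fun z => ?_))
      simp only [kerFun, Pi.smul_apply, smul_eq_mul, RingHom.id_apply]; ring)
  have hB : ∀ f g : L2, ‖B f g‖ ≤ C * ‖f‖ * ‖g‖ := fun f g => by
    by_cases hf : f = 0
    · simp [hf]
    by_cases hg : g = 0
    · simp [hg]
    have hf' : (‖f‖ : ℂ) ≠ 0 := by simpa using hf
    have hg' : (‖g‖ : ℂ) ≠ 0 := by simpa using hg
    have hf0 : 0 < ‖f‖ := norm_pos_iff.2 hf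
    have hg0 : 0 < ‖g‖ := norm_pos_iff.2 hg
    -- the quadratic bound for the normalized vectors
    have h1 := h.norm_integral_le hC (((‖f‖ : ℂ)⁻¹) • f) (((‖g‖ : ℂ)⁻¹) • g)
    have h2 : ∫ z, kerFun k (((‖f‖ : ℂ)⁻¹) • f : L2) (((‖g‖ : ℂ)⁻¹) • g : L2) z
        ∂((volume : Measure R3).prod volume) =
        B (((‖f‖ : ℂ)⁻¹) • f) (((‖g‖ : ℂ)⁻¹) • g) := rfl
    rw [h2, map_smulₛₗ, LinearMap.map_smulₛₗ₂, RingHom.id_apply, norm_smul, norm_smul, norm_smul,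
      norm_smul] at h1
    simp only [map_inv₀, Complex.conj_ofReal, norm_inv, Complex.norm_real, norm_norm] at h1
    rw [inv_mul_cancel₀ hf0.ne', inv_mul_cancel₀ hg0.ne'] at h1
    have h3 : ‖f‖⁻¹ * (‖g‖⁻¹ * ‖B f g‖) ≤ C := by linarith
    rw [inv_mul_le_iff₀ hf0, inv_mul_le_iff₀ hg0] at h3
    linarith
  let Bc : L2 →L⋆[ℂ] L2 →L[ℂ] ℂ := LinearMap.mkContinuous₂ B C hB
  refine ⟨(InnerProductSpace.continuousLinearMapOfBilin Bc).adjoint, fun f g => ?_⟩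
  rw [ContinuousLinearMap.adjoint_inner_right, InnerProductSpace.continuousLinearMapOfBilin_apply]
  rfl

/-! ### The unitary Fourier transform as an operator -/

theorem map_smul_volume {a : ℝ} (ha : 0 < a) :
    Measure.map (fun p : R3 => a • p) volume =
      ENNReal.ofReal ((a ^ 3)⁻¹) • (volume : Measure R3) := by
  rw [Measure.map_addHaar_smul _ ha.ne']
  simp [abs_of_pos ha]

theorem quasiMeasurePreserving_smul_R3 {a : ℝ} (ha : 0 < a) :
    Measure.QuasiMeasurePreserving (fun p : R3 => a • p) volume volume := by
  refine ⟨measurable_const_smul a, ?_⟩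
  rw [map_smul_volume ha]
  exact Measure.smul_absolutelyContinuous

theorem lintegral_comp_smul_R3 {a : ℝ} (ha : 0 < a) (f : R3 → ℝ≥0∞) :
    ∫⁻ p : R3, f (a • p) = ENNReal.ofReal ((a ^ 3)⁻¹) * ∫⁻ p, f p := by
  have h := lintegral_map_equiv (μ := (volume : Measure R3)) f
    (MeasurableEquiv.smul (Units.mk0 a ha.ne'))
  have h2 : Measure.map (MeasurableEquiv.smul (Units.mk0 a ha.ne')) (volume : Measure R3) =
      ENNReal.ofReal ((a ^ 3)⁻¹) • (volume : Measure R3) := map_smul_volume ha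
  rw [h2, lintegral_smul_measure] at h
  exact h.symm

theorem memLp_comp_smul {a : ℝ} (ha : 0 < a) {f : R3 → ℂ} (hf : MemLp f 2) :
    MemLp (fun p => f (a • p)) 2 := by
  have hm := hf.1.comp_quasiMeasurePreserving (quasiMeasurePreserving_smul_R3 ha)
  refine (memLp_two_iff hm).2 ?_
  change ∫⁻ p, ‖f (a • p)‖ₑ ^ 2 < ∞
  rw [lintegral_comp_smul_R3 ha (fun p => ‖f p‖ₑ ^ 2)]
  exact ENNReal.mul_lt_top ENNReal.ofReal_lt_top ((memLp_two_iff hf.1).1 hf)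

/-- The unitary dilation `g ↦ a^(3/2) g(a ·)`. -/
def dilation (a : ℝ) (ha : 0 < a) : L2 →ₗ[ℂ] L2 where
  toFun g := ((memLp_comp_smul ha (Lp.memLp g)).const_mul ((a ^ (3 / 2 : ℝ) : ℝ) : ℂ)).toLp _
  map_add' g h := by
    refine Lp.ext ?_
    filter_upwards [((memLp_comp_smul ha (Lp.memLp (g + h))).const_mul
        ((a ^ (3 / 2 : ℝ) : ℝ) : ℂ)).coeFn_toLp,
      ((memLp_comp_smul ha (Lp.memLp g)).const_mul ((a ^ (3 / 2 : ℝ) : ℝ) : ℂ)).coeFn_toLp,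
      ((memLp_comp_smul ha (Lp.memLp h)).const_mul ((a ^ (3 / 2 : ℝ) : ℝ) : ℂ)).coeFn_toLp,
      Lp.coeFn_add (((memLp_comp_smul ha (Lp.memLp g)).const_mul
        ((a ^ (3 / 2 : ℝ) : ℝ) : ℂ)).toLp _) (((memLp_comp_smul ha (Lp.memLp h)).const_mul
        ((a ^ (3 / 2 : ℝ) : ℝ) : ℂ)).toLp _),
      (quasiMeasurePreserving_smul_R3 ha).ae (Lp.coeFn_add g h)] with p h1 h2 h3 h4 h5
    rw [h1, h4, Pi.add_apply, h2, h3, h5, Pi.add_apply, mul_add]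
  map_smul' c g := by
    refine Lp.ext ?_
    filter_upwards [((memLp_comp_smul ha (Lp.memLp (c • g))).const_mul
        ((a ^ (3 / 2 : ℝ) : ℝ) : ℂ)).coeFn_toLp,
      ((memLp_comp_smul ha (Lp.memLp g)).const_mul ((a ^ (3 / 2 : ℝ) : ℝ) : ℂ)).coeFn_toLp,
      Lp.coeFn_smul c (((memLp_comp_smul ha (Lp.memLp g)).const_mul
        ((a ^ (3 / 2 : ℝ) : ℝ) : ℂ)).toLp _),
      (quasiMeasurePreserving_smul_R3 ha).ae (Lp.coeFn_smul c g)] with p h1 h2 h4 h5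
    rw [h1, RingHom.id_apply, h4, Pi.smul_apply, h2, h5, Pi.smul_apply, smul_eq_mul, smul_eq_mul]
    ring

theorem dilation_coe (a : ℝ) (ha : 0 < a) (g : L2) :
    dilation a ha g =ᵐ[volume] fun p => ((a ^ (3 / 2 : ℝ) : ℝ) : ℂ) * g (a • p) :=
  ((memLp_comp_smul ha (Lp.memLp g)).const_mul ((a ^ (3 / 2 : ℝ) : ℝ) : ℂ)).coeFn_toLp

theorem norm_dilation (a : ℝ) (ha : 0 < a) (g : L2) : ‖dilation a ha g‖ = ‖g‖ := by
  have h : ‖dilation a ha g‖ₑ ^ 2 = ‖g‖ₑ ^ 2 := by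
    rw [enorm_sq_eq_lintegral, enorm_sq_eq_lintegral]
    have h1 : ∫⁻ p, ‖dilation a ha g p‖ₑ ^ 2 =
        ∫⁻ p, ENNReal.ofReal (a ^ 3) * ‖g (a • p)‖ₑ ^ 2 := by
      refine lintegral_congr_ae ?_
      filter_upwards [dilation_coe a ha g] with p hp
      rw [hp, enorm_mul, mul_pow]
      congr 1
      rw [← ofReal_norm, Complex.norm_real, Real.norm_of_nonneg (by positivity),
        ← ENNReal.ofReal_pow (by positivity), ← Real.rpow_natCast, ← Real.rpow_mul ha.le]
      norm_num
    rw [h1, lintegral_const_mul' _ _ (by simp), lintegral_comp_smul_R3 ha (fun p => ‖g p‖ₑ ^ 2),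
      ← mul_assoc, ← ENNReal.ofReal_mul (by positivity), mul_inv_cancel₀ (by positivity)]
    simp
  have h2 : ‖dilation a ha g‖ ^ 2 = ‖g‖ ^ 2 := by
    have := congrArg ENNReal.toReal h
    simpa using this
  exact (pow_left_inj₀ (norm_nonneg _) (norm_nonneg _) two_ne_zero).1 h2

theorem dilation_dilation_inv (a : ℝ) (ha : 0 < a) (g : L2) :
    dilation a ha (dilation a⁻¹ (inv_pos.2 ha) g) = g := by
  refine Lp.ext ?_
  filter_upwards [dilation_coe a ha (dilation a⁻¹ (inv_pos.2 ha) g),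
    (quasiMeasurePreserving_smul_R3 ha).ae (dilation_coe a⁻¹ (inv_pos.2 ha) g)] with p h1 h2
  rw [h1, h2, smul_smul, inv_mul_cancel₀ ha.ne', one_smul, ← mul_assoc, ← Complex.ofReal_mul,
    ← Real.mul_rpow ha.le (inv_pos.2 ha).le, mul_inv_cancel₀ ha.ne']
  simp

/-- The unitary Fourier transform `ξ ↦ ξ̂` in angular frequency as a unitary operator. -/
def fourierU : L2 ≃ₗᵢ[ℂ] L2 :=
  (Lp.fourierTransformₗᵢ R3 ℂ).trans
    (LinearIsometryEquiv.ofSurjective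
      (⟨dilation (2 * Real.pi)⁻¹ (by positivity), norm_dilation _ (by positivity)⟩ : L2 →ₗᵢ[ℂ] L2)
      fun g => ⟨dilation (2 * Real.pi)⁻¹⁻¹ (by positivity) g, dilation_dilation_inv _ (by positivity) g⟩)

theorem fourierU_apply (ξ : L2) :
    fourierU ξ = dilation (2 * Real.pi)⁻¹ (by positivity) (𝓕 ξ : L2) := rfl

theorem fourierU_coe (ξ : L2) : fourierU ξ =ᵐ[volume] hat ξ := by
  rw [fourierU_apply]
  refine (dilation_coe _ _ _).trans (ae_of_all _ fun p => ?_)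
  simp only [hat]
  rw [Real.inv_rpow (by positivity), ← Real.rpow_neg (by positivity)]

theorem inner_eq_integral (f g : L2) : inner ℂ f g = ∫ p, conj (f p) * g p := by
  rw [L2.inner_def]
  refine integral_congr_ae (ae_of_all _ fun p => ?_)
  simp [RCLike.inner_apply, mul_comm]

theorem integrable_inner_L2 (f g : L2) : Integrable (fun p => conj (f p) * g p) := by
  have := L2.integrable_inner (𝕜 := ℂ) f g
  refine this.congr (ae_of_all _ fun p => ?_)
  simp [RCLike.inner_apply, mul_comm]

/-! ### Fourier multipliers -/

/-- Measurable and bounded real symbols. -/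
def BddSymbol (m : R3 → ℝ) : Prop := Measurable m ∧ ∃ C : ℝ, ∀ p, |m p| ≤ C

theorem BddSymbol.exists_mul {m : R3 → ℝ} (h : BddSymbol m) :
    ∃ V : L2 →L[ℂ] L2, ∀ ψ : L2, V ψ =ᵐ[volume] fun y => (m y : ℂ) * ψ y := by
  obtain ⟨C, hC⟩ := h.2
  exact exists_mul_bounded h.1.aestronglyMeasurable C (ae_of_all _ hC)

open Classical in
/-- Multiplication by a bounded symbol; `0` for other functions. -/
def mulOp (m : R3 → ℝ) : L2 →L[ℂ] L2 :=
  if h : BddSymbol m then h.exists_mul.choose else 0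

theorem mulOp_coe {m : R3 → ℝ} (h : BddSymbol m) (ψ : L2) :
    mulOp m ψ =ᵐ[volume] fun y => (m y : ℂ) * ψ y := by
  rw [mulOp, dif_pos h]
  exact h.exists_mul.choose_spec ψ

/-- The Fourier multiplier with a bounded symbol. -/
def fourierMul (m : R3 → ℝ) : L2 →L[ℂ] L2 :=
  (fourierU.symm : L2 →L[ℂ] L2) ∘L mulOp m ∘L (fourierU : L2 →L[ℂ] L2)

theorem fourierU_fourierMul_eq (m : R3 → ℝ) (ψ : L2) :
    fourierU (fourierMul m ψ) = mulOp m (fourierU ψ) := by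
  simp [fourierMul]

theorem fourierU_fourierMul {m : R3 → ℝ} (h : BddSymbol m) (ψ : L2) :
    fourierU (fourierMul m ψ) =ᵐ[volume] fun p => (m p : ℂ) * fourierU ψ p := by
  rw [fourierU_fourierMul_eq]
  exact mulOp_coe h _

theorem inner_mulOp_left {m : R3 → ℝ} (h : BddSymbol m) (f g : L2) :
    inner ℂ (mulOp m f) g = inner ℂ f (mulOp m g) := by
  rw [inner_eq_integral, inner_eq_integral]
  refine integral_congr_ae ?_
  filter_upwards [mulOp_coe h f, mulOp_coe h g] with p h1 h2
  rw [h1, h2, map_mul, Complex.conj_ofReal]; ring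

theorem inner_fourierMul_left {m : R3 → ℝ} (h : BddSymbol m) (f g : L2) :
    inner ℂ (fourierMul m f) g = inner ℂ f (fourierMul m g) := by
  rw [← fourierU.inner_map_map, ← fourierU.inner_map_map f, fourierU_fourierMul_eq,
    fourierU_fourierMul_eq, inner_mulOp_left h]

/-! ### Sobolev spaces in momentum space -/

theorem aestronglyMeasurable_weight_mul {w : R3 → ℝ} (hw : Measurable w) (g : L2) :
    AEStronglyMeasurable (fun p => (w p : ℂ) * g p) :=
  (Complex.measurable_ofReal.comp hw).aestronglyMeasurable.mul (Lp.aestronglyMeasurable g)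

theorem memLp_weight_mono {w v : R3 → ℝ} (hw : Measurable w) (g : L2)
    (C : ℝ) (h : ∀ p, |w p| ≤ C * |v p|) (hg : MemLp (fun p => (v p : ℂ) * g p) 2) :
    MemLp (fun p => (w p : ℂ) * g p) 2 := by
  refine MemLp.of_le_mul (c := C) hg (aestronglyMeasurable_weight_mul hw g) (ae_of_all _ fun p => ?_)
  rw [norm_mul, norm_mul, Complex.norm_real, Complex.norm_real, ← mul_assoc]
  exact mul_le_mul_of_nonneg_right (h p) (norm_nonneg _)

theorem mem_sobolev_iff_fourier {s : ℝ} {ξ : L2} :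
    ξ ∈ sobolev s ↔
      MemLp (fun x : R3 => (((1 + ‖x‖ ^ 2) ^ (s / 2) : ℝ) : ℂ) * (𝓕 ξ : L2) x) 2 := by
  have htg : (fun x : R3 => (((1 + ‖x‖ ^ 2) ^ (s / 2) : ℝ) : ℂ)).HasTemperateGrowth := by fun_prop
  have hmeas := aestronglyMeasurable_weight_mul (w := fun x => (1 + ‖x‖ ^ 2) ^ (s / 2))
    (by fun_prop) (𝓕 ξ : L2)
  rw [sobolev, mem_ofPred_eq, TemperedDistribution.memSobolev_iff_exists_smulLeftCLM_fourier,
    Lp.fourier_toTemperedDistribution_eq]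
  constructor
  · rintro ⟨f', hf'⟩
    have : f' =ᵐ[volume] fun x : R3 => (((1 + ‖x‖ ^ 2) ^ (s / 2) : ℝ) : ℂ) * (𝓕 ξ : L2) x := by
      refine ae_eq_of_integral_contDiff_smul_eq
        ((Lp.memLp f').locallyIntegrable (by norm_num)) ?_ ?_
      · have h1 := (Lp.memLp (𝓕 ξ : L2)).locallyIntegrable (by norm_num)
        have hc : Continuous (fun x : R3 => (((1 + ‖x‖ ^ 2) ^ (s / 2) : ℝ) : ℂ)) :=
          htg.1.continuous
        rw [← locallyIntegrableOn_univ] at h1 ⊢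
        exact h1.continuousOn_mul hc.continuousOn isOpen_univ.isLocallyClosed
      · intro g g_smooth g_cpt
        have hg₁ : HasCompactSupport (Complex.ofRealCLM ∘ g) := g_cpt.comp_left rfl
        have hg₂ : ContDiff ℝ ((⊤ : ℕ∞) : WithTop ℕ∞) (Complex.ofRealCLM ∘ g) := by fun_prop
        have h1 := congrArg (fun T : 𝓢'(R3, ℂ) => T (hg₁.toSchwartzMap hg₂)) hf'
        simp only [TemperedDistribution.smulLeftCLM_apply_apply,
          Lp.toTemperedDistribution_apply] at h1
        simp only [SchwartzMap.smulLeftCLM_apply_apply htg] at h1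
        have e1 : ∫ x, g x • f' x = ∫ x, (hg₁.toSchwartzMap hg₂) x • f' x := by
          refine integral_congr_ae (ae_of_all _ fun x => ?_)
          simp
        have e2 : ∫ x, g x • ((((1 + ‖x‖ ^ 2) ^ (s / 2) : ℝ) : ℂ) * (𝓕 ξ : L2) x) =
            ∫ x, ((((1 + ‖x‖ ^ 2) ^ (s / 2) : ℝ) : ℂ) • (hg₁.toSchwartzMap hg₂) x) •
              (𝓕 ξ : L2) x := by
          refine integral_congr_ae (ae_of_all _ fun x => ?_)
          simp
          ring
        rw [e1, e2, ← h1]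
    exact (Lp.memLp f').ae_eq this
  · intro h
    refine ⟨h.toLp _, ?_⟩
    ext g
    simp only [TemperedDistribution.smulLeftCLM_apply_apply, Lp.toTemperedDistribution_apply,
      SchwartzMap.smulLeftCLM_apply_apply htg]
    refine integral_congr_ae ?_
    filter_upwards [h.coeFn_toLp] with x hx
    rw [hx]
    simp only [smul_eq_mul]
    ring

/-- `H^s` described by the weight `(1 + |p|)^s`, comparable with `(1 + p²)^(s/2)`. For
`s = 1` it is the symbol of `1 + |∇|`, so that testing against `|∇| ξ` becomes algebra. -/
theorem mem_sobolev_iff {s : ℝ} (hs : 0 ≤ s) {ξ : L2} :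
    ξ ∈ sobolev s ↔
      MemLp (fun p : R3 => (((1 + ‖p‖) ^ s : ℝ) : ℂ) * fourierU ξ p) 2 := by
  have hpi : (1 : ℝ) ≤ 2 * Real.pi := by linarith [Real.pi_gt_three]
  have hpi0 : (0 : ℝ) < 2 * Real.pi := by positivity
  have key : MemLp (fun p : R3 => (((1 + ‖p‖) ^ s : ℝ) : ℂ) * fourierU ξ p) 2 ↔
      MemLp (fun x : R3 => (((1 + 2 * Real.pi * ‖x‖) ^ s : ℝ) : ℂ) * (𝓕 ξ : L2) x) 2 := by
    have hae : (fun p : R3 => (((1 + ‖p‖) ^ s : ℝ) : ℂ) * fourierU ξ p) =ᵐ[volume]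
        fun p : R3 => (((2 * Real.pi) ^ (-(3 / 2) : ℝ) : ℝ) : ℂ) *
          ((((1 + ‖p‖) ^ s : ℝ) : ℂ) * (𝓕 ξ : L2) ((2 * Real.pi)⁻¹ • p)) := by
      filter_upwards [fourierU_coe ξ] with p hp
      rw [hp, hat]; ring
    have hc : (((2 * Real.pi) ^ (-(3 / 2) : ℝ) : ℝ) : ℂ) ≠ 0 := by
      exact_mod_cast (Real.rpow_pos_of_pos hpi0 _).ne'
    rw [memLp_congr_ae hae]
    constructor
    · intro h
      have h2 := memLp_comp_smul hpi0 (h.const_mul (((2 * Real.pi) ^ (-(3 / 2) : ℝ) : ℝ) : ℂ)⁻¹)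
      refine h2.ae_eq (ae_of_all _ fun x => ?_)
      simp only [← mul_assoc, inv_mul_cancel₀ hc, one_mul, norm_smul, smul_smul,
        inv_mul_cancel₀ hpi0.ne', one_smul, Real.norm_of_nonneg hpi0.le]
    · intro h
      have h2 := (memLp_comp_smul (inv_pos.2 hpi0) h).const_mul
        (((2 * Real.pi) ^ (-(3 / 2) : ℝ) : ℝ) : ℂ)
      refine h2.ae_eq (ae_of_all _ fun x => ?_)
      simp only [norm_smul, norm_inv, Real.norm_of_nonneg hpi0.le]
      rw [mul_inv_cancel_left₀ hpi0.ne']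
  rw [key, mem_sobolev_iff_fourier]
  have hsq : ∀ x : R3, ((1 + ‖x‖ ^ 2) ^ (s / 2) : ℝ) = (√(1 + ‖x‖ ^ 2)) ^ s := fun x => by
    rw [Real.sqrt_eq_rpow, ← Real.rpow_mul (by positivity)]
    congr 1; ring
  constructor
  · refine memLp_weight_mono (by fun_prop) _ ((2 * (2 * Real.pi)) ^ s) fun x => ?_
    rw [hsq, abs_of_nonneg (by positivity), abs_of_nonneg (by positivity),
      ← Real.mul_rpow (by positivity) (by positivity)]
    refine Real.rpow_le_rpow (by positivity) ?_ hs
    have h1 : 1 ≤ √(1 + ‖x‖ ^ 2) := Real.one_le_sqrt.2 (by nlinarith [norm_nonneg x])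
    have h2 : ‖x‖ ≤ √(1 + ‖x‖ ^ 2) := Real.le_sqrt_of_sq_le (by linarith)
    nlinarith
  · refine memLp_weight_mono (by fun_prop) _ 1 fun x => ?_
    rw [hsq, abs_of_nonneg (by positivity), abs_of_nonneg (by positivity), one_mul]
    refine Real.rpow_le_rpow (by positivity) ?_ hs
    rw [Real.sqrt_le_left (by positivity)]
    nlinarith [norm_nonneg x, mul_nonneg (sub_nonneg.2 hpi) (norm_nonneg x)]

/-! ### The `L²` Fourier transform of integrable functions -/

theorem ae_eq_of_forall_schwartz {f g : R3 → ℂ} (hf : LocallyIntegrable f) (hg : LocallyIntegrable g)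
    (h : ∀ u : 𝓢(R3, ℂ), ∫ x, u x • f x = ∫ x, u x • g x) : f =ᵐ[volume] g := by
  refine ae_eq_of_integral_contDiff_smul_eq hf hg fun u u_smooth u_cpt => ?_
  have hg₁ : HasCompactSupport (Complex.ofRealCLM ∘ u) := u_cpt.comp_left rfl
  have hg₂ : ContDiff ℝ ((⊤ : ℕ∞) : WithTop ℕ∞) (Complex.ofRealCLM ∘ u) := by fun_prop
  simpa using h (hg₁.toSchwartzMap hg₂)

/-- On integrable functions the `L²` Fourier transform, defined by density, is the integral. -/
theorem fourier_toLp_ae_eq {φ : R3 → ℂ} (h1 : Integrable φ) (h2 : MemLp φ 2) :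
    (𝓕 (h2.toLp φ) : L2) =ᵐ[volume] (𝓕 φ : R3 → ℂ) := by
  have hc : Continuous (𝓕 φ : R3 → ℂ) :=
    VectorFourier.fourierIntegral_continuous Real.continuous_fourierChar continuous_inner h1
  refine ae_eq_of_forall_schwartz ((Lp.memLp _).locallyIntegrable (by norm_num))
    hc.locallyIntegrable fun u => ?_
  have e := congrArg (fun T : 𝓢'(R3, ℂ) => T u)
    (Lp.fourier_toTemperedDistribution_eq (h2.toLp φ))
  simp only [TemperedDistribution.fourier_apply, Lp.toTemperedDistribution_apply] at e
  rw [← e]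
  have e2 := VectorFourier.integral_fourierIntegral_smul_eq_flip (L := innerₗ R3)
    (μ := (volume : Measure R3)) (ν := (volume : Measure R3))
    Real.continuous_fourierChar continuous_inner u.integrable h1
  rw [flip_innerₗ] at e2
  refine Eq.trans ?_ e2
  refine integral_congr_ae ?_
  filter_upwards [h2.coeFn_toLp] with x hx
  rw [hx]
  rfl

theorem fourierInv_toLp_ae_eq {φ : R3 → ℂ} (h1 : Integrable φ) (h2 : MemLp φ 2) :
    (𝓕⁻ (h2.toLp φ) : L2) =ᵐ[volume] (𝓕⁻ φ : R3 → ℂ) := by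
  have hc : Continuous (𝓕 φ : R3 → ℂ) :=
    VectorFourier.fourierIntegral_continuous Real.continuous_fourierChar continuous_inner h1
  have hc' : Continuous (𝓕⁻ φ : R3 → ℂ) := by
    have : (𝓕⁻ φ : R3 → ℂ) = fun x => 𝓕 φ (-x) := by
      ext x; exact Real.fourierInv_eq_fourier_neg φ x
    rw [this]
    exact hc.comp continuous_neg
  refine ae_eq_of_forall_schwartz ((Lp.memLp _).locallyIntegrable (by norm_num))
    hc'.locallyIntegrable fun u => ?_
  have e := congrArg (fun T : 𝓢'(R3, ℂ) => T u)
    (Lp.fourierInv_toTemperedDistribution_eq (h2.toLp φ))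
  simp only [TemperedDistribution.fourierInv_apply, Lp.toTemperedDistribution_apply] at e
  rw [← e]
  have hL : Continuous fun p : R3 × R3 => (-innerₗ R3) p.1 p.2 := by
    simp only [LinearMap.neg_apply, innerₗ_apply_apply]
    fun_prop
  have e2 := VectorFourier.integral_fourierIntegral_smul_eq_flip (L := -innerₗ R3)
    (μ := (volume : Measure R3)) (ν := (volume : Measure R3))
    Real.continuous_fourierChar hL u.integrable h1
  have e3 : (-innerₗ R3).flip = -innerₗ R3 := by
    ext x y
    simp [real_inner_comm]
  rw [e3] at e2
  refine Eq.trans ?_ e2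
  refine integral_congr_ae ?_
  filter_upwards [h2.coeFn_toLp] with x hx
  rw [hx, SchwartzMap.fourierInv_coe]
  rfl

theorem fourier_fourierMul {m : R3 → ℝ} (h : BddSymbol m) (ψ : L2) :
    (𝓕 (fourierMul m ψ) : L2) =ᵐ[volume]
      fun x => (m ((2 * Real.pi) • x) : ℂ) * (𝓕 ψ : L2) x := by
  have hpi0 : (0 : ℝ) < 2 * Real.pi := by positivity
  have h1 := (fourierU_coe (fourierMul m ψ)).symm.trans ((fourierU_fourierMul h ψ).trans
    ((ae_eq_refl (fun p => (m p : ℂ))).mul (fourierU_coe ψ)))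
  filter_upwards [(quasiMeasurePreserving_smul_R3 hpi0).ae h1] with x hx
  have hc : (((2 * Real.pi) ^ (-(3 / 2) : ℝ) : ℝ) : ℂ) ≠ 0 := by
    exact_mod_cast (Real.rpow_pos_of_pos hpi0 _).ne'
  simp only [hat, Pi.mul_apply, smul_smul, inv_mul_cancel₀ hpi0.ne', one_smul] at hx
  refine mul_left_cancel₀ hc (hx.trans ?_)
  ring

/-! ### Bessel potentials with the symbol `(1 + |p|)^(-s)` -/

theorem bddSymbol_bessel {s : ℝ} (hs : 0 ≤ s) : BddSymbol fun p : R3 => (1 + ‖p‖) ^ (-s) := by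
  refine ⟨by fun_prop, 1, fun p => ?_⟩
  rw [abs_of_nonneg (by positivity)]
  exact Real.rpow_le_one_of_one_le_of_nonpos (by linarith [norm_nonneg p]) (by linarith)

/-- The Fourier multiplier with symbol `(1 + |p|)^(-s)`; it maps `L²` onto `H^s`. -/
def bessel (s : ℝ) : L2 →L[ℂ] L2 := fourierMul fun p => (1 + ‖p‖) ^ (-s)

theorem fourierU_bessel {s : ℝ} (hs : 0 ≤ s) (ψ : L2) :
    fourierU (bessel s ψ) =ᵐ[volume] fun p => (((1 + ‖p‖) ^ (-s) : ℝ) : ℂ) * fourierU ψ p :=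
  fourierU_fourierMul (bddSymbol_bessel hs) ψ

theorem fourierU_eq_weight_bessel {s : ℝ} (hs : 0 ≤ s) (ψ : L2) :
    fourierU ψ =ᵐ[volume] fun p => (((1 + ‖p‖) ^ s : ℝ) : ℂ) * fourierU (bessel s ψ) p := by
  filter_upwards [fourierU_bessel hs ψ] with p hp
  rw [hp, ← mul_assoc, ← Complex.ofReal_mul, ← Real.rpow_add (by positivity)]
  simp

theorem bessel_mem_sobolev {s : ℝ} (hs : 0 ≤ s) (ψ : L2) : bessel s ψ ∈ sobolev s :=
  (mem_sobolev_iff hs).2 ((Lp.memLp (fourierU ψ)).ae_eq (fourierU_eq_weight_bessel hs ψ))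

theorem exists_bessel_of_mem_sobolev {s : ℝ} (hs : 0 ≤ s) {ξ : L2} (h : ξ ∈ sobolev s) :
    ∃ ψ : L2, bessel s ψ = ξ := by
  have hm := (mem_sobolev_iff hs).1 h
  refine ⟨fourierU.symm (hm.toLp _), fourierU.injective (Lp.ext ?_)⟩
  filter_upwards [fourierU_bessel hs (fourierU.symm (hm.toLp _)), hm.coeFn_toLp] with p h1 h2
  rw [h1, LinearIsometryEquiv.apply_symm_apply, h2, ← mul_assoc, ← Complex.ofReal_mul,
    ← Real.rpow_add (by positivity)]
  simp

theorem sobolev_mono {s t : ℝ} (hs : 0 ≤ s) (hst : s ≤ t) : sobolev t ⊆ sobolev s := fun ξ hξ => by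
  refine (mem_sobolev_iff hs).2 (memLp_weight_mono (by fun_prop) _ 1 (fun p => ?_)
    ((mem_sobolev_iff (hs.trans hst)).1 hξ))
  rw [one_mul, abs_of_nonneg (by positivity), abs_of_nonneg (by positivity)]
  exact Real.rpow_le_rpow_of_exponent_le (by linarith [norm_nonneg p]) hst

/-! ### The Poisson semigroup -/

theorem tendsto_pow_mul_exp_neg (n : ℕ) {a : ℝ} (ha : 0 < a) :
    Tendsto (fun r : ℝ => r ^ n * Real.exp (-a * r)) atTop (𝓝 0) := by
  simpa [Real.rpow_natCast] using tendsto_rpow_mul_exp_neg_mul_atTop_nhds_zero n a ha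

theorem lintegral_exp_neg_norm {a : ℝ} (ha : 0 < a) :
    ∫⁻ x : R3, ENNReal.ofReal (Real.exp (-a * ‖x‖)) = ENNReal.ofReal (8 * Real.pi / a ^ 3) := by
  rw [lintegral_norm (fun r => ENNReal.ofReal (Real.exp (-a * r))) (by fun_prop)]
  have h : ∀ r ∈ Ioi (0 : ℝ), ENNReal.ofReal (4 * Real.pi * r ^ 2) *
      ENNReal.ofReal (Real.exp (-a * r)) =
      ENNReal.ofReal (4 * Real.pi * (r ^ 2 * Real.exp (-a * r))) := fun r _ => by
    rw [← ENNReal.ofReal_mul (by positivity)]; ring_nf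
  rw [setLIntegral_congr_fun measurableSet_Ioi h, lintegral_Ioi_of_hasDerivAt
    (F := fun r => -(4 * Real.pi) * (Real.exp (-a * r) * (r ^ 2 / a + 2 * r / a ^ 2 + 2 / a ^ 3)))
    (L := -(8 * Real.pi / a ^ 3)) (M := 0)]
  · simp
  · intro r _
    have h1 : HasDerivAt (fun r : ℝ => Real.exp (-a * r)) (Real.exp (-a * r) * (-a)) r := by
      simpa using ((hasDerivAt_id r).const_mul (-a)).exp
    have h2 : HasDerivAt (fun r : ℝ => r ^ 2 / a + 2 * r / a ^ 2 + 2 / a ^ 3)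
        (2 * r / a + 2 / a ^ 2) r := by
      have := ((((hasDerivAt_id r).fun_pow 2).div_const a).fun_add
        (((hasDerivAt_id r).const_mul 2).div_const (a ^ 2))).add_const (2 / a ^ 3)
      simpa using this
    refine ((h1.fun_mul h2).const_mul (-(4 * Real.pi))).congr_deriv ?_
    field_simp
    ring
  · intro r _; positivity
  · have hc : Continuous (fun r : ℝ => -(4 * Real.pi) *
        (Real.exp (-a * r) * (r ^ 2 / a + 2 * r / a ^ 2 + 2 / a ^ 3))) := by fun_prop
    have := (hc.tendsto 0).mono_left (nhdsWithin_le_nhds (s := Ioi 0))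
    refine this.trans (le_of_eq ?_)
    congr 1
    simp
    ring
  · have := ((((tendsto_pow_mul_exp_neg 2 ha).div_const a).add
      (((tendsto_pow_mul_exp_neg 1 ha).const_mul 2).div_const (a ^ 2))).add
      (((tendsto_pow_mul_exp_neg 0 ha).const_mul 2).div_const (a ^ 3))).const_mul
      (-(4 * Real.pi))
    simp only [mul_zero, zero_div, add_zero] at this
    refine this.congr fun r => ?_
    ring

theorem integrable_exp_neg_norm {a : ℝ} (ha : 0 < a) :
    Integrable (fun x : R3 => Real.exp (-a * ‖x‖)) := by
  refine ⟨by fun_prop, ?_⟩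
  rw [hasFiniteIntegral_iff_ofReal (ae_of_all _ fun x => (Real.exp_pos _).le),
    lintegral_exp_neg_norm ha]
  exact ENNReal.ofReal_lt_top

/-- The Fourier integral of `e^(-a |x|)`, subtracted from its value at frequency `0` so that the
integrand is nonnegative and polar coordinates need no integrability. -/
theorem lintegral_exp_neg_norm_one_sub_cos {a b : ℝ} (ha : 0 < a) (hb : 0 < b) {e : R3}
    (he : ‖e‖ = 1) :
    ∫⁻ x : R3, ENNReal.ofReal (Real.exp (-a * ‖x‖) * (1 - Real.cos (b * inner ℝ e x))) =
      ENNReal.ofReal (8 * Real.pi / a ^ 3 - 8 * Real.pi * a / (a ^ 2 + b ^ 2) ^ 2) := by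
  rw [lintegral_norm_inner he
    (fun v => ENNReal.ofReal (Real.exp (-a * v.1) * (1 - Real.cos (b * v.2)))) (by fun_prop)]
  have h : ∀ r ∈ Ioi (0 : ℝ), ∫⁻ z in Ioo (-r) r, ENNReal.ofReal (2 * Real.pi * r) *
      ENNReal.ofReal (Real.exp (-a * r) * (1 - Real.cos (b * z))) =
      ENNReal.ofReal (4 * Real.pi * (Real.exp (-a * r) * (r ^ 2 - r * Real.sin (b * r) / b))) :=
    fun r hr => by
      have hr : 0 < r := hr
      have hi : IntervalIntegrable
          (fun z => 2 * Real.pi * r * (Real.exp (-a * r) * (1 - Real.cos (b * z)))) volume (-r) r :=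
        (by fun_prop : Continuous fun z => 2 * Real.pi * r * (Real.exp (-a * r) *
          (1 - Real.cos (b * z)))).intervalIntegrable _ _
      have h1 : ∀ z ∈ Ioo (-r) r, ENNReal.ofReal (2 * Real.pi * r) *
          ENNReal.ofReal (Real.exp (-a * r) * (1 - Real.cos (b * z))) =
          ENNReal.ofReal (2 * Real.pi * r * (Real.exp (-a * r) * (1 - Real.cos (b * z)))) :=
        fun z _ => (ENNReal.ofReal_mul (by positivity)).symm
      rw [setLIntegral_congr_fun measurableSet_Ioo h1, restrict_Ioo_eq_restrict_Ioc,
        ← ofReal_integral_eq_lintegral_ofReal]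
      · congr 1
        rw [← intervalIntegral.integral_of_le (by linarith), intervalIntegral.integral_const_mul,
          intervalIntegral.integral_const_mul, intervalIntegral.integral_sub (by simp)
            ((by fun_prop : Continuous fun z => Real.cos (b * z)).intervalIntegrable _ _),
          intervalIntegral.integral_comp_mul_left _ hb.ne', integral_cos]
        simp
        field_simp
        ring
      · exact (intervalIntegrable_iff_integrableOn_Ioc_of_le (by linarith)).1 hi
      · refine ae_of_all _ fun z => ?_
        have := Real.cos_le_one (b * z)
        have : 0 ≤ 1 - Real.cos (b * z) := by linarith
        simp only [Pi.zero_apply]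
        positivity
  set D := a ^ 2 + b ^ 2 with hD
  have hD0 : 0 < D := by positivity
  -- the primitive of `e^(-a r) (r² - r sin (b r) / b)`
  rw [setLIntegral_congr_fun measurableSet_Ioi h, lintegral_Ioi_of_hasDerivAt
    (F := fun r => 4 * Real.pi * (Real.exp (-a * r) * (-(r ^ 2 / a + 2 * r / a ^ 2 + 2 / a ^ 3)
      + ((r * a / D + (a ^ 2 - b ^ 2) / D ^ 2) * Real.sin (b * r)
        + (r * b / D + 2 * a * b / D ^ 2) * Real.cos (b * r)) / b)))
    (L := -(8 * Real.pi / a ^ 3 - 8 * Real.pi * a / D ^ 2)) (M := 0)]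
  · congr 1; ring
  · intro r _
    have h1 : HasDerivAt (fun r : ℝ => Real.exp (-a * r)) (Real.exp (-a * r) * (-a)) r := by
      simpa using ((hasDerivAt_id r).const_mul (-a)).exp
    have h2 : HasDerivAt (fun r : ℝ => r ^ 2 / a + 2 * r / a ^ 2 + 2 / a ^ 3)
        (2 * r / a + 2 / a ^ 2) r := by
      have := ((((hasDerivAt_id r).fun_pow 2).div_const a).fun_add
        (((hasDerivAt_id r).const_mul 2).div_const (a ^ 2))).add_const (2 / a ^ 3)
      simpa using this
    have h3 : HasDerivAt (fun r : ℝ => Real.sin (b * r)) (Real.cos (b * r) * b) r := by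
      simpa using ((hasDerivAt_id r).const_mul b).sin
    have h4 : HasDerivAt (fun r : ℝ => Real.cos (b * r)) (-Real.sin (b * r) * b) r := by
      simpa using ((hasDerivAt_id r).const_mul b).cos
    have h5 : HasDerivAt (fun r : ℝ => r * a / D + (a ^ 2 - b ^ 2) / D ^ 2) (a / D) r := by
      simpa using (((hasDerivAt_id r).mul_const a).div_const D).add_const ((a ^ 2 - b ^ 2) / D ^ 2)
    have h6 : HasDerivAt (fun r : ℝ => r * b / D + 2 * a * b / D ^ 2) (b / D) r := by
      simpa using (((hasDerivAt_id r).mul_const b).div_const D).add_const (2 * a * b / D ^ 2)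
    refine ((h1.fun_mul (h2.fun_neg.fun_add (((h5.fun_mul h3).fun_add
      (h6.fun_mul h4)).div_const b))).const_mul (4 * Real.pi)).congr_deriv ?_
    have hD2 : D ≠ 0 := hD0.ne'
    field_simp
    rw [hD]
    ring
  · intro r hr
    have h1 := Real.sin_le (x := b * r) (by positivity)
    have h2 : r * Real.sin (b * r) / b ≤ r ^ 2 := by
      rw [div_le_iff₀ hb]; nlinarith
    have h3 : 0 ≤ r ^ 2 - r * Real.sin (b * r) / b := by linarith
    positivity
  · have hc : Continuous (fun r : ℝ => 4 * Real.pi * (Real.exp (-a * r) *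
        (-(r ^ 2 / a + 2 * r / a ^ 2 + 2 / a ^ 3)
          + ((r * a / D + (a ^ 2 - b ^ 2) / D ^ 2) * Real.sin (b * r)
          + (r * b / D + 2 * a * b / D ^ 2) * Real.cos (b * r)) / b))) := by fun_prop
    have := (hc.tendsto 0).mono_left (nhdsWithin_le_nhds (s := Ioi 0))
    refine this.trans (le_of_eq ?_)
    congr 1
    simp
    field_simp
    ring
  · have t0 := tendsto_pow_mul_exp_neg 0 ha
    have t1 := tendsto_pow_mul_exp_neg 1 ha
    have t2 := tendsto_pow_mul_exp_neg 2 ha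
    have bs : ∀ (f : ℝ → ℝ), Tendsto f atTop (𝓝 0) →
        Tendsto (fun r => f r * Real.sin (b * r)) atTop (𝓝 0) := fun f hf =>
      hf.zero_mul_isBoundedUnder_le (isBoundedUnder_of ⟨1, fun r => by
        simpa using Real.abs_sin_le_one (b * r)⟩)
    have bc : ∀ (f : ℝ → ℝ), Tendsto f atTop (𝓝 0) →
        Tendsto (fun r => f r * Real.cos (b * r)) atTop (𝓝 0) := fun f hf =>
      hf.zero_mul_isBoundedUnder_le (isBoundedUnder_of ⟨1, fun r => by
        simpa using Real.abs_cos_le_one (b * r)⟩)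
    have T := ((((((t2.const_mul (-(1 / a))).add (t1.const_mul (-(2 / a ^ 2)))).add
      (t0.const_mul (-(2 / a ^ 3)))).add ((bs _ t1).const_mul (a / D / b))).add
      ((bs _ t0).const_mul ((a ^ 2 - b ^ 2) / D ^ 2 / b))).add
      (((bc _ t1).const_mul (b / D / b)).add ((bc _ t0).const_mul (2 * a * b / D ^ 2 / b)))).const_mul
      (4 * Real.pi)
    simp only [mul_zero, add_zero] at T
    refine T.congr fun r => ?_
    ring

/-- The Poisson kernel of the half space over `ℝ³`. -/
def poissonKernel (ε : ℝ) (v : R3) : ℝ := ε / (Real.pi ^ 2 * (ε ^ 2 + ‖v‖ ^ 2) ^ 2)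

theorem measurable_poissonKernel (ε : ℝ) : Measurable (poissonKernel ε) := by
  unfold poissonKernel; fun_prop

theorem poissonKernel_nonneg {ε : ℝ} (hε : 0 < ε) (v : R3) : 0 ≤ poissonKernel ε v := by
  unfold poissonKernel; positivity

theorem fourierInv_exp_neg_norm {ε : ℝ} (hε : 0 < ε) {v : R3} (hv : v ≠ 0) :
    𝓕⁻ (fun x : R3 => (Real.exp (-(2 * Real.pi * ε) * ‖x‖) : ℂ)) v = (poissonKernel ε v : ℂ) := by
  set a := 2 * Real.pi * ε with ha
  set b := 2 * Real.pi * ‖v‖ with hb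
  have ha0 : 0 < a := by positivity
  have hv0 : 0 < ‖v‖ := norm_pos_iff.2 hv
  have hb0 : 0 < b := by positivity
  set e : R3 := ‖v‖⁻¹ • v with he
  have he1 : ‖e‖ = 1 := by rw [he, norm_smul, norm_inv, norm_norm, inv_mul_cancel₀ hv0.ne']
  have hE := integrable_exp_neg_norm ha0
  have hin : ∀ x : R3, 2 * Real.pi * inner ℝ x v = b * inner ℝ e x := fun x => by
    rw [he, real_inner_smul_left, real_inner_comm, hb]
    field_simp
  have hcos : Integrable (fun x : R3 => Real.exp (-a * ‖x‖) * Real.cos (b * inner ℝ e x)) := by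
    refine hE.mul_bdd (c := 1) (by fun_prop) (ae_of_all _ fun x => ?_)
    simpa using Real.abs_cos_le_one _
  have hsin : Integrable (fun x : R3 => Real.exp (-a * ‖x‖) * Real.sin (b * inner ℝ e x)) := by
    refine hE.mul_bdd (c := 1) (by fun_prop) (ae_of_all _ fun x => ?_)
    simpa using Real.abs_sin_le_one _
  have hsin0 : ∫ x : R3, Real.exp (-a * ‖x‖) * Real.sin (b * inner ℝ e x) = 0 := by
    have h := integral_neg_eq_self
      (fun x : R3 => Real.exp (-a * ‖x‖) * Real.sin (b * inner ℝ e x)) volume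
    simp only [norm_neg, inner_neg_right, mul_neg, Real.sin_neg, integral_neg] at h
    linarith
  have hval : ∫ x : R3, Real.exp (-a * ‖x‖) * Real.cos (b * inner ℝ e x) =
      8 * Real.pi * a / (a ^ 2 + b ^ 2) ^ 2 := by
    have h1 : ∫ x : R3, Real.exp (-a * ‖x‖) = 8 * Real.pi / a ^ 3 := by
      rw [integral_eq_lintegral_of_nonneg_ae (ae_of_all _ fun x => (Real.exp_pos _).le) hE.1,
        lintegral_exp_neg_norm ha0, ENNReal.toReal_ofReal (by positivity)]
    have h2 : ∫ x : R3, Real.exp (-a * ‖x‖) * (1 - Real.cos (b * inner ℝ e x)) =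
        8 * Real.pi / a ^ 3 - 8 * Real.pi * a / (a ^ 2 + b ^ 2) ^ 2 := by
      rw [integral_eq_lintegral_of_nonneg_ae (ae_of_all _ fun x => ?_) (by fun_prop),
        lintegral_exp_neg_norm_one_sub_cos ha0 hb0 he1, ENNReal.toReal_ofReal]
      · rw [sub_nonneg, div_le_div_iff₀ (by positivity) (by positivity)]
        have : a ^ 4 ≤ (a ^ 2 + b ^ 2) ^ 2 := by nlinarith [sq_nonneg (a * b), sq_nonneg (b ^ 2)]
        have hpi := Real.pi_pos
        nlinarith
      · have := Real.cos_le_one (b * inner ℝ e x)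
        have h3 : 0 ≤ 1 - Real.cos (b * inner ℝ e x) := by linarith
        simp only [Pi.zero_apply]
        positivity
    have h3 : ∫ x : R3, Real.exp (-a * ‖x‖) * (1 - Real.cos (b * inner ℝ e x)) =
        (∫ x : R3, Real.exp (-a * ‖x‖)) -
          ∫ x : R3, Real.exp (-a * ‖x‖) * Real.cos (b * inner ℝ e x) := by
      rw [← integral_sub hE hcos]
      congr 1; ext x; ring
    linarith
  rw [Real.fourierInv_eq']
  have hsplit : ∀ x : R3, Complex.exp ((↑(2 * Real.pi * inner ℝ x v) * Complex.I)) •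
      (Real.exp (-a * ‖x‖) : ℂ) =
      ((Real.exp (-a * ‖x‖) * Real.cos (b * inner ℝ e x) : ℝ) : ℂ) +
        ((Real.exp (-a * ‖x‖) * Real.sin (b * inner ℝ e x) : ℝ) : ℂ) * Complex.I := fun x => by
    rw [hin, Complex.exp_mul_I, smul_eq_mul]
    push_cast
    ring
  simp_rw [hsplit]
  rw [integral_add hcos.ofReal (hsin.ofReal.mul_const _), integral_mul_const,
    integral_complex_ofReal, integral_complex_ofReal, hsin0, hval, poissonKernel]
  simp only [Complex.ofReal_zero, zero_mul, add_zero]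
  congr 1
  rw [ha, hb]
  field_simp
  ring

theorem lintegral_poissonKernel {ε : ℝ} (hε : 0 < ε) :
    ∫⁻ v : R3, ENNReal.ofReal (poissonKernel ε v) = 1 := by
  refine (lintegral_norm
    (fun r : ℝ => ENNReal.ofReal (ε / (Real.pi ^ 2 * (ε ^ 2 + r ^ 2) ^ 2))) (by fun_prop)).trans ?_
  have h : ∀ r ∈ Ioi (0 : ℝ), ENNReal.ofReal (4 * Real.pi * r ^ 2) *
      ENNReal.ofReal (ε / (Real.pi ^ 2 * (ε ^ 2 + r ^ 2) ^ 2)) =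
      ENNReal.ofReal (4 * ε / Real.pi * (r ^ 2 / (ε ^ 2 + r ^ 2) ^ 2)) := fun r _ => by
    rw [← ENNReal.ofReal_mul (by positivity)]
    congr 1
    field_simp
  rw [setLIntegral_congr_fun measurableSet_Ioi h, lintegral_Ioi_of_hasDerivAt
    (F := fun r => 2 / Real.pi * (Real.arctan (r / ε) - ε * (r / (ε ^ 2 + r ^ 2))))
    (L := 0) (M := 1)]
  · simp
  · intro r _
    have h1 : HasDerivAt (fun r : ℝ => Real.arctan (r / ε)) (1 / (1 + (r / ε) ^ 2) * (1 / ε)) r :=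
      ((hasDerivAt_id r).div_const ε).arctan
    have h2 : HasDerivAt (fun r : ℝ => r / (ε ^ 2 + r ^ 2))
        ((1 * (ε ^ 2 + r ^ 2) - r * (2 * r)) / (ε ^ 2 + r ^ 2) ^ 2) r := by
      have h3 : HasDerivAt (fun r : ℝ => ε ^ 2 + r ^ 2) (2 * r) r := by
        simpa using (hasDerivAt_pow 2 r).const_add (ε ^ 2)
      exact (hasDerivAt_id r).fun_div h3 (by positivity)
    refine ((h1.fun_sub (h2.const_mul ε)).const_mul (2 / Real.pi)).congr_deriv ?_
    have : ε ^ 2 + r ^ 2 ≠ 0 := by positivity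
    field_simp
    ring
  · intro r _; positivity
  · have hc : Continuous (fun r : ℝ => 2 / Real.pi *
        (Real.arctan (r / ε) - ε * (r / (ε ^ 2 + r ^ 2)))) := by
      refine continuous_const.mul ((Real.continuous_arctan.comp (by fun_prop)).sub
        (continuous_const.mul (continuous_id.div (by fun_prop) fun r => ?_)))
      positivity
    have := (hc.tendsto 0).mono_left (nhdsWithin_le_nhds (s := Ioi 0))
    refine this.trans (le_of_eq ?_)
    simp
  · have h1 : Tendsto (fun r : ℝ => Real.arctan (r / ε)) atTop (𝓝 (Real.pi / 2)) :=
      (tendsto_nhds_of_tendsto_nhdsWithin Real.tendsto_arctan_atTop).comp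
        (tendsto_id.atTop_div_const hε)
    have h2 : Tendsto (fun r : ℝ => r / (ε ^ 2 + r ^ 2)) atTop (𝓝 0) := by
      refine squeeze_zero' ?_ ?_ tendsto_inv_atTop_zero
      · filter_upwards [eventually_gt_atTop 0] with r hr using by positivity
      · filter_upwards [eventually_gt_atTop 0] with r hr
        rw [div_le_iff₀ (by positivity)]
        field_simp
        nlinarith [sq_nonneg ε]
    have := (h1.sub (h2.const_mul ε)).const_mul (2 / Real.pi)
    refine this.trans (le_of_eq ?_)
    congr 1
    field_simp
    ring

theorem bddKernel_poisson {ε : ℝ} (hε : 0 < ε) :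
    BddKernel (fun x y => poissonKernel ε (x - y)) 1 := by
  have hm : Measurable (Function.uncurry fun x y : R3 => poissonKernel ε (x - y)) :=
    (measurable_poissonKernel ε).comp (measurable_fst.sub measurable_snd)
  refine ⟨hm, fun f g => ?_⟩
  have h1 : ∀ x : R3, ∫⁻ y, ‖poissonKernel ε (x - y)‖ₑ = 1 := fun x => by
    rw [lintegral_sub_left_eq_self (fun v : R3 => ‖poissonKernel ε v‖ₑ) x]
    rw [← lintegral_poissonKernel hε]
    exact lintegral_congr fun v => Real.enorm_of_nonneg (poissonKernel_nonneg hε v)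
  have h2 : ∀ y : R3, ∫⁻ x, ‖poissonKernel ε (x - y)‖ₑ = 1 := fun x => by
    rw [lintegral_sub_right_eq_self (fun v : R3 => ‖poissonKernel ε v‖ₑ) x]
    rw [← lintegral_poissonKernel hε]
    exact lintegral_congr fun v => Real.enorm_of_nonneg (poissonKernel_nonneg hε v)
  have := schur_test (k := fun x y => ‖poissonKernel ε (x - y)‖ₑ) hm.enorm (u := fun _ => 1)
    (v := fun _ => 1) (a := fun _ => 1) (b := fun _ => 1) measurable_const measurable_const
    (by simp) (by simp) (ae_of_all _ fun x => by simp [h1]) (ae_of_all _ fun x => by simp [h2])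
    (F := fun x => ‖f x‖ₑ) (G := fun x => ‖g x‖ₑ) (Lp.aestronglyMeasurable f).enorm
    (Lp.aestronglyMeasurable g).enorm
  simpa [enorm_sq_eq_lintegral] using this

/-- The Poisson semigroup `e^(-ε |p|)`. -/
def poissonOp (ε : ℝ) : L2 →L[ℂ] L2 := fourierMul fun p => Real.exp (-ε * ‖p‖)

theorem bddSymbol_exp {ε : ℝ} (hε : 0 < ε) : BddSymbol fun p : R3 => Real.exp (-ε * ‖p‖) := by
  refine ⟨by fun_prop, 1, fun p => ?_⟩
  rw [abs_of_pos (Real.exp_pos _), Real.exp_le_one_iff]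
  nlinarith [norm_nonneg p]

/-- The multiplier `e^(-ε |p|)` acts as convolution with the Poisson kernel; shown on Schwartz functions
and extended by density, both sides being bounded on `L²`. -/
theorem inner_poissonOp {ε : ℝ} (hε : 0 < ε) (η ξ : L2) :
    inner ℂ η (poissonOp ε ξ) =
      ∫ z, kerFun (fun x y => poissonKernel ε (x - y)) η ξ z ∂((volume : Measure R3).prod volume) := by
  obtain ⟨T, hT⟩ := (bddKernel_poisson hε).exists_clm zero_le_one
  rw [← hT]
  suffices h : poissonOp ε = T by rw [h]
  have hdense := SchwartzMap.denseRange_toLpCLM (E := R3) (F := ℂ) (p := 2)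
    (μ := volume) (by norm_num)
  refine ContinuousLinearMap.ext fun ψ => congrFun (hdense.equalizer
    (poissonOp ε).continuous T.continuous (funext fun u => ?_)) ψ
  simp only [Function.comp_apply]
  rw [SchwartzMap.toLpCLM_apply]
  refine ext_inner_left ℂ fun η => ?_
  have hint := (bddKernel_poisson hε).integrable η (u.toLp 2)
  rw [hT, integral_prod _ hint, inner_eq_integral]
  set E : R3 → ℂ := fun x => (Real.exp (-(2 * Real.pi * ε) * ‖x‖) : ℂ) with hEdef
  have hEi : Integrable E := (integrable_exp_neg_norm (a := 2 * Real.pi * ε) (by positivity)).ofReal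
  have hEb : ∀ x, ‖E x‖ ≤ 1 := fun x => by
    rw [hEdef]
    simp only
    rw [Complex.norm_real, Real.norm_of_nonneg (Real.exp_pos _).le,
      Real.exp_le_one_iff]
    nlinarith [norm_nonneg x, Real.pi_pos, mul_pos Real.pi_pos hε]
  set φ : R3 → ℂ := fun x => E x * (𝓕 u : 𝓢(R3, ℂ)) x with hφ
  have hφ1 : Integrable φ := (𝓕 u : 𝓢(R3, ℂ)).integrable.bdd_mul (c := 1) hEi.1
    (ae_of_all _ hEb)
  have hφ2 : MemLp φ 2 := by
    refine MemLp.of_le ((𝓕 u : 𝓢(R3, ℂ)).memLp 2) hφ1.1 (ae_of_all _ fun x => ?_)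
    rw [hφ, norm_mul]
    exact mul_le_of_le_one_left (norm_nonneg _) (hEb x)
  have h1 : (𝓕 (poissonOp ε (u.toLp 2)) : L2) = hφ2.toLp φ := by
    refine Lp.ext ?_
    filter_upwards [fourier_fourierMul (bddSymbol_exp hε) (u.toLp 2), hφ2.coeFn_toLp,
      (𝓕 u : 𝓢(R3, ℂ)).coeFn_toLp 2] with x hx hx2 hx3
    rw [poissonOp, hx, hx2, SchwartzMap.toLp_fourier_eq, hx3, hφ, hEdef]
    simp only [norm_smul, Complex.ofReal_exp]
    rw [Real.norm_of_nonneg (by positivity : (0 : ℝ) ≤ 2 * Real.pi)]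
    push_cast
    ring_nf
  have h2 : poissonOp ε (u.toLp 2) =ᵐ[volume] (𝓕⁻ φ : R3 → ℂ) := by
    have : poissonOp ε (u.toLp 2) = 𝓕⁻ (hφ2.toLp φ) := by
      rw [← h1, FourierTransform.fourierInv_fourier_eq]
    rw [this]
    exact fourierInv_toLp_ae_eq hφ1 hφ2
  refine integral_congr_ae ?_
  filter_upwards [h2] with x hx
  have h3 : ∫ y, kerFun (fun x y => poissonKernel ε (x - y)) η (u.toLp 2) (x, y) =
      conj (η x) * ∫ y, u y * (poissonKernel ε (x - y) : ℂ) := by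
    rw [← integral_const_mul]
    refine integral_congr_ae ?_
    filter_upwards [u.coeFn_toLp 2] with y hy
    simp only [kerFun]
    rw [hy]; ring
  rw [hx, h3]
  congr 1
  have hG : Integrable (fun z : R3 => Complex.exp ((↑(2 * Real.pi * inner ℝ z x) * Complex.I)) * E z) := by
    refine hEi.bdd_mul (c := 1) (by fun_prop) (ae_of_all _ fun z => ?_)
    rw [Complex.norm_exp_ofReal_mul_I]
  have e2 := VectorFourier.integral_fourierIntegral_smul_eq_flip (L := innerₗ R3)
    (μ := (volume : Measure R3)) (ν := (volume : Measure R3))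
    Real.continuous_fourierChar continuous_inner u.integrable hG
  rw [flip_innerₗ] at e2
  rw [Real.fourierInv_eq']
  refine Eq.trans ?_ (e2.trans ?_)
  · refine integral_congr_ae (ae_of_all _ fun z => ?_)
    simp only [smul_eq_mul, hφ]
    change _ = 𝓕 (u : R3 → ℂ) z * _
    rw [← SchwartzMap.fourier_coe]
    ring
  · refine integral_congr_ae ?_
    have hne : ∀ᵐ y : R3, y ≠ x := by simp [ae_iff]
    filter_upwards [hne] with y hy
    rw [smul_eq_mul]
    congr 1
    have h4 := fourierInv_exp_neg_norm hε (v := x - y) (sub_ne_zero.2 hy.symm)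
    rw [← h4, Real.fourierInv_eq']
    change 𝓕 (fun z : R3 => Complex.exp ((↑(2 * Real.pi * inner ℝ z x) * Complex.I)) * E z) y = _
    rw [Real.fourier_eq']
    refine integral_congr_ae (ae_of_all _ fun z => ?_)
    simp only [smul_eq_mul, ← mul_assoc, ← Complex.exp_add]
    congr 2
    rw [inner_sub_right]
    push_cast
    ring

/-! ### Powers of the distance under the Poisson semigroup -/

theorem tendsto_sqrt_nhdsGT_zero : Tendsto (fun r : ℝ => √r) (𝓝[>] 0) (𝓝[>] 0) := by
  refine tendsto_nhdsWithin_iff.2 ⟨?_, ?_⟩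
  · have := (Real.continuous_sqrt.tendsto 0).mono_left (nhdsWithin_le_nhds (s := Ioi 0))
    simpa using this
  · filter_upwards [self_mem_nhdsWithin] with r hr using Real.sqrt_pos.2 hr

theorem hasDerivAt_sqrt_sub {ρ r : ℝ} (hr : 0 < r) :
    HasDerivAt (fun r => √r - ρ / √r) ((r + ρ) / (r * (2 * √r))) r := by
  have h1 := Real.hasDerivAt_sqrt hr.ne'
  have hs := Real.sqrt_pos.2 hr
  have h2 : HasDerivAt (fun r => ρ / √r) ((0 * √r - ρ * (1 / (2 * √r))) / √r ^ 2) r :=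
    (hasDerivAt_const r ρ).fun_div h1 hs.ne'
  refine (h1.fun_sub h2).congr_deriv ?_
  rw [Real.sq_sqrt hr.le]
  field_simp
  ring

theorem hasDerivAt_sqrt_add {ρ r : ℝ} (hr : 0 < r) :
    HasDerivAt (fun r => √r + ρ / √r) ((r - ρ) / (r * (2 * √r))) r := by
  have h := hasDerivAt_sqrt_sub (ρ := -ρ) hr
  simpa [neg_div, sub_eq_add_neg] using h

theorem hasDerivAt_arctan_sqrt {a ρ r : ℝ} (ha : 0 < a) (hr : 0 < r) :
    HasDerivAt (fun r => Real.arctan ((√r - ρ / √r) / a) / a)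
      ((r + ρ) / (2 * √r) / (r ^ 2 + ρ ^ 2 + (a ^ 2 - 2 * ρ) * r)) r := by
  have hs := Real.sqrt_pos.2 hr
  have hs2 := Real.sq_sqrt hr.le
  refine ((hasDerivAt_sqrt_sub (ρ := ρ) hr).div_const a).arctan.div_const a |>.congr_deriv ?_
  set s := √r
  have e : 1 + ((s - ρ / s) / a) ^ 2 = (r ^ 2 + ρ ^ 2 + (a ^ 2 - 2 * ρ) * r) / (r * a ^ 2) := by
    rw [← hs2]; field_simp; ring
  have h0 : 0 < 1 + ((s - ρ / s) / a) ^ 2 := by positivity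
  have h1 : 0 < r ^ 2 + ρ ^ 2 + (a ^ 2 - 2 * ρ) * r := by
    rw [e] at h0
    exact (div_pos_iff_of_pos_right (by positivity)).1 h0
  rw [e]
  field_simp

theorem hasDerivAt_log_sqrt {b ρ r : ℝ} (hb : 0 < b) (hr : 0 < r) (hbρ : b ^ 2 < 4 * ρ) :
    HasDerivAt (fun r => Real.log (((√r + ρ / √r) - b) / ((√r + ρ / √r) + b)) / (2 * b))
      ((r - ρ) / (2 * √r) / (r ^ 2 + ρ ^ 2 + (2 * ρ - b ^ 2) * r)) r := by
  have hs := Real.sqrt_pos.2 hr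
  have hs2 := Real.sq_sqrt hr.le
  have hd := hasDerivAt_sqrt_add (ρ := ρ) hr
  have hρ : 0 < ρ := by nlinarith
  set w := √r + ρ / √r with hw
  have hw0 : 0 < w := by positivity
  have hwb : b < w := by
    refine lt_of_pow_lt_pow_left₀ 2 hw0.le (hbρ.trans_le ?_)
    have : w ^ 2 - 4 * ρ = (√r - ρ / √r) ^ 2 := by rw [hw]; field_simp; ring
    nlinarith [sq_nonneg (√r - ρ / √r)]
  have hm : 0 < w - b := by linarith
  have hp : 0 < w + b := by linarith
  have h1 := ((hd.sub_const b).fun_div (hd.add_const b) hp.ne').log (div_pos hm hp).ne'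
  refine (h1.div_const (2 * b)).congr_deriv ?_
  rw [← hw]
  have e : (w - b) * (w + b) = (r ^ 2 + ρ ^ 2 + (2 * ρ - b ^ 2) * r) / r := by
    rw [hw]
    generalize √r = t at hs hs2
    subst hs2
    field_simp
    ring
  have e' : r ^ 2 + ρ ^ 2 + (2 * ρ - b ^ 2) * r = r * ((w - b) * (w + b)) := by
    rw [e]; field_simp
  rw [e']
  field_simp
  ring

theorem tendsto_sqrt_sub_atTop (ρ : ℝ) : Tendsto (fun r => √r - ρ / √r) atTop atTop := by
  have h : Tendsto (fun r => ρ / √r) atTop (𝓝 0) :=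
    tendsto_const_nhds.div_atTop Real.tendsto_sqrt_atTop
  simpa [sub_eq_add_neg] using Real.tendsto_sqrt_atTop.atTop_add h.neg

theorem tendsto_sqrt_add_zero {ρ : ℝ} (hρ : 0 < ρ) :
    Tendsto (fun r => √r + ρ / √r) (𝓝[>] 0) atTop := by
  have h : Tendsto (fun r => ρ / √r) (𝓝[>] 0) atTop := by
    simp only [div_eq_mul_inv]
    exact (tendsto_inv_nhdsGT_zero.comp tendsto_sqrt_nhdsGT_zero).const_mul_atTop hρ
  exact (tendsto_nhds_of_tendsto_nhdsWithin tendsto_sqrt_nhdsGT_zero).add_atTop h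

theorem tendsto_sqrt_sub_zero {ρ : ℝ} (hρ : 0 < ρ) :
    Tendsto (fun r => √r - ρ / √r) (𝓝[>] 0) atBot := by
  have h : Tendsto (fun r => ρ / √r) (𝓝[>] 0) atTop := by
    simp only [div_eq_mul_inv]
    exact (tendsto_inv_nhdsGT_zero.comp tendsto_sqrt_nhdsGT_zero).const_mul_atTop hρ
  simp only [sub_eq_add_neg]
  exact (tendsto_nhds_of_tendsto_nhdsWithin tendsto_sqrt_nhdsGT_zero).add_atBot
    (tendsto_neg_atTop_atBot.comp h)

theorem tendsto_log_ratio (b : ℝ) :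
    Tendsto (fun w : ℝ => Real.log ((w - b) / (w + b)) / (2 * b)) atTop (𝓝 0) := by
  have h1 : Tendsto (fun w : ℝ => 1 - 2 * b / (w + b)) atTop (𝓝 1) := by
    have : Tendsto (fun w : ℝ => 2 * b / (w + b)) atTop (𝓝 0) :=
      tendsto_const_nhds.div_atTop (tendsto_id.atTop_add tendsto_const_nhds)
    simpa using this.const_sub 1
  have h2 : Tendsto (fun w : ℝ => (w - b) / (w + b)) atTop (𝓝 1) := by
    refine h1.congr' ?_
    filter_upwards [eventually_gt_atTop (-b)] with w hw
    have : w + b ≠ 0 := by linarith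
    field_simp
    ring
  simpa using ((Real.continuousAt_log one_ne_zero).tendsto.comp h2).div_const (2 * b)

/-- The radial integral behind the action of the Poisson semigroup on `|y|^(-1/2)` (`s = 1`) and
on `|y|^(-3/2)` (`s = -1`). -/
theorem lintegral_poisson_radial {ε R s : ℝ} (hε : 0 < ε) (hR : 0 < R) (hs : s = 1 ∨ s = -1) :
    ∫⁻ r in Ioi (0 : ℝ), ENNReal.ofReal (((r + √(R ^ 2 + ε ^ 2)) + s * (r - √(R ^ 2 + ε ^ 2))) /
        (2 * √r) * (1 / (ε ^ 2 + (R - r) ^ 2) - 1 / (ε ^ 2 + (R + r) ^ 2))) =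
      ENNReal.ofReal (Real.pi * √(√(R ^ 2 + ε ^ 2) - ε) / ε) := by
  set ρ := √(R ^ 2 + ε ^ 2) with hρdef
  have hρ2 : ρ ^ 2 = R ^ 2 + ε ^ 2 := Real.sq_sqrt (by positivity)
  have hρ0 : 0 < ρ := Real.sqrt_pos.2 (by positivity)
  have hρR : R < ρ := lt_of_pow_lt_pow_left₀ 2 hρ0.le (by rw [hρ2]; nlinarith)
  have hρε : ε < ρ := lt_of_pow_lt_pow_left₀ 2 hρ0.le (by rw [hρ2]; nlinarith)
  -- with `a² = 2 (ρ - R)` and `b² = 2 (ρ + R)` both denominators factor through `√r ∓ ρ / √r`: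
  -- `r ((√r - ρ / √r)² + a²) = ε² + (R - r)²`, which is also `r ((√r + ρ / √r)² - b²)`;
  -- exchanging `a` and `b` gives `ε² + (R + r)²`
  set a := √(2 * (ρ - R)) with ha
  set b := √(2 * (ρ + R)) with hb
  have ha2 : a ^ 2 = 2 * (ρ - R) := Real.sq_sqrt (by linarith)
  have hb2 : b ^ 2 = 2 * (ρ + R) := Real.sq_sqrt (by linarith)
  have ha0 : 0 < a := Real.sqrt_pos.2 (by linarith)
  have hb0 : 0 < b := Real.sqrt_pos.2 (by linarith)
  have hab : a * b = 2 * ε := by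
    rw [← pow_left_inj₀ (by positivity) (by positivity) two_ne_zero, mul_pow, ha2, hb2]
    nlinarith
  have hlt : a < b := lt_of_pow_lt_pow_left₀ 2 hb0.le (by rw [ha2, hb2]; linarith)
  have hba : b - a = 2 * √(ρ - ε) := by
    rw [← pow_left_inj₀ (by linarith) (by positivity) two_ne_zero, mul_pow,
      Real.sq_sqrt (by linarith)]
    nlinarith
  have hval : Real.pi * √(ρ - ε) / ε = Real.pi / a - Real.pi / b := by
    have : √(ρ - ε) = (b - a) / 2 := by linarith
    rw [this, show ε = a * b / 2 by linarith]
    field_simp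
  rw [hval]
  rw [lintegral_Ioi_of_hasDerivAt
    (F := fun r => (Real.arctan ((√r - ρ / √r) / a) / a +
        s * (Real.log (((√r + ρ / √r) - b) / ((√r + ρ / √r) + b)) / (2 * b))) -
      (Real.arctan ((√r - ρ / √r) / b) / b +
        s * (Real.log (((√r + ρ / √r) - a) / ((√r + ρ / √r) + a)) / (2 * a))))
    (L := -(Real.pi / 2) / a - -(Real.pi / 2) / b) (M := Real.pi / 2 / a - Real.pi / 2 / b)]
  · congr 1; ring
  · intro r hr
    have h := ((hasDerivAt_arctan_sqrt (ρ := ρ) ha0 hr).fun_add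
      ((hasDerivAt_log_sqrt (ρ := ρ) hb0 hr (by rw [hb2]; linarith)).const_mul s)).fun_sub
      ((hasDerivAt_arctan_sqrt (ρ := ρ) hb0 hr).fun_add
      ((hasDerivAt_log_sqrt (ρ := ρ) ha0 hr (by rw [ha2]; linarith)).const_mul s))
    refine h.congr_deriv ?_
    rw [ha2, hb2]
    have e1 : r ^ 2 + ρ ^ 2 + (2 * (ρ - R) - 2 * ρ) * r = ε ^ 2 + (R - r) ^ 2 := by
      rw [hρ2]; ring
    have e2 : r ^ 2 + ρ ^ 2 + (2 * ρ - 2 * (ρ + R)) * r = ε ^ 2 + (R - r) ^ 2 := by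
      rw [hρ2]; ring
    have e3 : r ^ 2 + ρ ^ 2 + (2 * (ρ + R) - 2 * ρ) * r = ε ^ 2 + (R + r) ^ 2 := by
      rw [hρ2]; ring
    have e4 : r ^ 2 + ρ ^ 2 + (2 * ρ - 2 * (ρ - R)) * r = ε ^ 2 + (R + r) ^ 2 := by
      rw [hρ2]; ring
    rw [e1, e2, e3, e4]
    ring
  · intro r hr
    have h1 : 0 ≤ 1 / (ε ^ 2 + (R - r) ^ 2) - 1 / (ε ^ 2 + (R + r) ^ 2) := by
      rw [sub_nonneg]
      exact one_div_le_one_div_of_le (by positivity) (by nlinarith)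
    have h2 : 0 ≤ (r + ρ) + s * (r - ρ) := by
      rcases hs with rfl | rfl <;> linarith
    positivity
  · have hA : ∀ c, 0 < c → Tendsto (fun r => Real.arctan ((√r - ρ / √r) / c) / c) (𝓝[>] 0)
        (𝓝 (-(Real.pi / 2) / c)) := fun c hc =>
      ((tendsto_nhds_of_tendsto_nhdsWithin Real.tendsto_arctan_atBot).comp
        ((tendsto_sqrt_sub_zero hρ0).atBot_div_const hc)).div_const c
    have hB : ∀ c, Tendsto (fun r => s * (Real.log (((√r + ρ / √r) - c) / ((√r + ρ / √r) + c)) /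
        (2 * c))) (𝓝[>] 0) (𝓝 0) := fun c => by
      simpa using ((tendsto_log_ratio c).comp (tendsto_sqrt_add_zero hρ0)).const_mul s
    simpa using ((hA a ha0).add (hB b)).sub ((hA b hb0).add (hB a))
  · have hw : Tendsto (fun r => √r + ρ / √r) atTop atTop := by
      simpa [neg_div] using tendsto_sqrt_sub_atTop (-ρ)
    have hA : ∀ c, 0 < c → Tendsto (fun r => Real.arctan ((√r - ρ / √r) / c) / c) atTop
        (𝓝 (Real.pi / 2 / c)) := fun c hc =>
      ((tendsto_nhds_of_tendsto_nhdsWithin Real.tendsto_arctan_atTop).comp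
        ((tendsto_sqrt_sub_atTop ρ).atTop_div_const hc)).div_const c
    have hB : ∀ c, Tendsto (fun r => s * (Real.log (((√r + ρ / √r) - c) / ((√r + ρ / √r) + c)) /
        (2 * c))) atTop (𝓝 0) := fun c => by
      simpa using ((tendsto_log_ratio c).comp hw).const_mul s
    simpa using ((hA a ha0).add (hB b)).sub ((hA b hb0).add (hB a))

theorem lintegral_poisson_zonal {ε R r : ℝ} (hε : 0 < ε) (hR : 0 < R) (hr : 0 < r) :
    ∫⁻ z in Ioo (-r) r, ENNReal.ofReal (ε / (Real.pi ^ 2 * (ε ^ 2 + (R ^ 2 + r ^ 2 - 2 * R * z)) ^ 2)) =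
      ENNReal.ofReal (ε / (2 * Real.pi ^ 2 * R) *
        (1 / (ε ^ 2 + (R - r) ^ 2) - 1 / (ε ^ 2 + (R + r) ^ 2))) := by
  have hpos : ∀ z ∈ Icc (-r) r, 0 < ε ^ 2 + (R ^ 2 + r ^ 2 - 2 * R * z) := fun z hz => by
    nlinarith [sq_nonneg (R - r), mul_le_mul_of_nonneg_left hz.2 hR.le, pow_pos hε 2]
  have hd : ∀ z ∈ Icc (-r) r, HasDerivAt
      (fun z => ε / (2 * Real.pi ^ 2 * R) * (1 / (ε ^ 2 + (R ^ 2 + r ^ 2 - 2 * R * z))))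
      (ε / (Real.pi ^ 2 * (ε ^ 2 + (R ^ 2 + r ^ 2 - 2 * R * z)) ^ 2)) z := fun z hz => by
    have h0 := hpos z hz
    have h1 : HasDerivAt (fun z => ε ^ 2 + (R ^ 2 + r ^ 2 - 2 * R * z)) (-(2 * R)) z := by
      simpa using (((hasDerivAt_id z).const_mul (2 * R)).const_sub (R ^ 2 + r ^ 2)).const_add (ε ^ 2)
    refine (((hasDerivAt_const z (1 : ℝ)).fun_div h1 h0.ne').const_mul
      (ε / (2 * Real.pi ^ 2 * R))).congr_deriv ?_
    field_simp
    ring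
  have hcont : ContinuousOn (fun z => ε / (Real.pi ^ 2 * (ε ^ 2 + (R ^ 2 + r ^ 2 - 2 * R * z)) ^ 2))
      (Icc (-r) r) := by
    refine continuousOn_const.div (by fun_prop) fun z hz => ?_
    have := hpos z hz
    positivity
  rw [restrict_Ioo_eq_restrict_Ioc, ← ofReal_integral_eq_lintegral_ofReal]
  · congr 1
    rw [← intervalIntegral.integral_of_le (by linarith),
      intervalIntegral.integral_eq_sub_of_hasDerivAt (fun z hz => hd z (by
        rwa [uIcc_of_le (by linarith)] at hz)) (by
        rw [← uIcc_of_le (by linarith : -r ≤ r)] at hcont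
        exact hcont.intervalIntegrable), ← mul_sub]
    congr 3 <;> ring
  · exact (hcont.integrableOn_Icc).mono_set Ioc_subset_Icc_self
  · filter_upwards [ae_restrict_mem measurableSet_Ioc] with z hz
    have := hpos z ⟨hz.1.le, hz.2⟩
    simp only [Pi.zero_apply]
    positivity

/-- The Poisson kernel acting on a radial function, after the angular integration. -/
theorem lintegral_poisson_mul_radial {ε : ℝ} (hε : 0 < ε) {x : R3} (hx : x ≠ 0) {h : ℝ → ℝ}
    (hm : Measurable h) (hh : ∀ r, 0 < r → 0 ≤ h r) :
    ∫⁻ y, ENNReal.ofReal (poissonKernel ε (x - y)) * ENNReal.ofReal (h ‖y‖) =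
      ∫⁻ r in Ioi (0 : ℝ), ENNReal.ofReal (ε / (Real.pi * ‖x‖) * (r * h r *
        (1 / (ε ^ 2 + (‖x‖ - r) ^ 2) - 1 / (ε ^ 2 + (‖x‖ + r) ^ 2)))) := by
  set R := ‖x‖ with hRdef
  have hR : 0 < R := norm_pos_iff.2 hx
  set e : R3 := R⁻¹ • x with he
  have he1 : ‖e‖ = 1 := by rw [he, norm_smul, norm_inv, norm_norm, inv_mul_cancel₀ hR.ne']
  have hxe : x = R • e := by rw [he, smul_smul, mul_inv_cancel₀ hR.ne', one_smul]
  have hk : ∀ y : R3, poissonKernel ε (x - y) =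
      ε / (Real.pi ^ 2 * (ε ^ 2 + (R ^ 2 + ‖y‖ ^ 2 - 2 * R * inner ℝ e y)) ^ 2) := fun y => by
    rw [poissonKernel, norm_sub_sq_real, ← hRdef]
    have : inner ℝ x y = R * inner ℝ e y := by rw [hxe, real_inner_smul_left]
    rw [this]
    congr 4
    ring
  simp_rw [hk]
  rw [lintegral_norm_inner he1 (fun v => ENNReal.ofReal
    (ε / (Real.pi ^ 2 * (ε ^ 2 + (R ^ 2 + v.1 ^ 2 - 2 * R * v.2)) ^ 2)) * ENNReal.ofReal (h v.1))
    (by fun_prop)]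
  refine setLIntegral_congr_fun measurableSet_Ioi fun r hr => ?_
  have hr : 0 < r := hr
  simp only
  rw [lintegral_const_mul' _ _ ENNReal.ofReal_ne_top, lintegral_mul_const' _ _ ENNReal.ofReal_ne_top,
    lintegral_poisson_zonal hε hR hr, ← ENNReal.ofReal_mul' (hh r hr), ← ENNReal.ofReal_mul (by positivity)]
  congr 1
  field_simp

/-- The action of the Poisson semigroup on `|y|^(-1/2)`. -/
theorem lintegral_poisson_rpow_neg_half {ε : ℝ} (hε : 0 < ε) {x : R3} (hx : x ≠ 0) :
    ∫⁻ y, ENNReal.ofReal (poissonKernel ε (x - y)) * ENNReal.ofReal (1 / √‖y‖) =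
      ENNReal.ofReal (√(√(‖x‖ ^ 2 + ε ^ 2) - ε) / ‖x‖) := by
  have hR : 0 < ‖x‖ := norm_pos_iff.2 hx
  rw [lintegral_poisson_mul_radial hε hx (h := fun r => 1 / √r) (by fun_prop)
    (fun r _ => by positivity)]
  have h := lintegral_poisson_radial hε hR (s := 1) (Or.inl rfl)
  have h2 : ∀ r ∈ Ioi (0 : ℝ), ENNReal.ofReal (ε / (Real.pi * ‖x‖) * (r * (1 / √r) *
      (1 / (ε ^ 2 + (‖x‖ - r) ^ 2) - 1 / (ε ^ 2 + (‖x‖ + r) ^ 2)))) =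
      ENNReal.ofReal (ε / (Real.pi * ‖x‖)) * ENNReal.ofReal
      (((r + √(‖x‖ ^ 2 + ε ^ 2)) + 1 * (r - √(‖x‖ ^ 2 + ε ^ 2))) /
        (2 * √r) * (1 / (ε ^ 2 + (‖x‖ - r) ^ 2) - 1 / (ε ^ 2 + (‖x‖ + r) ^ 2))) := fun r hr => by
    have := Real.sqrt_pos.2 (mem_Ioi.1 hr)
    rw [← ENNReal.ofReal_mul (by positivity)]
    congr 2
    ring
  rw [setLIntegral_congr_fun measurableSet_Ioi h2, lintegral_const_mul' _ _ ENNReal.ofReal_ne_top, h,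
    ← ENNReal.ofReal_mul (by positivity)]
  congr 1
  field_simp

/-- The action of the Poisson semigroup on `|y|^(-3/2)`; the factor multiplying
`|x|^(-3/2)` is at most the one that multiplies `|x|^(-1/2)` in `lintegral_poisson_rpow_neg_half`. -/
theorem lintegral_poisson_rpow_neg_three_half {ε : ℝ} (hε : 0 < ε) {x : R3} (hx : x ≠ 0) :
    ∫⁻ y, ENNReal.ofReal (poissonKernel ε (x - y)) * ENNReal.ofReal (1 / (‖y‖ * √‖y‖)) =
      ENNReal.ofReal (√(√(‖x‖ ^ 2 + ε ^ 2) - ε) / (√(‖x‖ ^ 2 + ε ^ 2) * ‖x‖)) := by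
  have hR : 0 < ‖x‖ := norm_pos_iff.2 hx
  rw [lintegral_poisson_mul_radial hε hx (h := fun r => 1 / (r * √r)) (by fun_prop)
    (fun r _ => by positivity)]
  have h := lintegral_poisson_radial hε hR (s := -1) (Or.inr rfl)
  have hρ : 0 < √(‖x‖ ^ 2 + ε ^ 2) := Real.sqrt_pos.2 (by positivity)
  have h2 : ∀ r ∈ Ioi (0 : ℝ), ENNReal.ofReal (ε / (Real.pi * ‖x‖) * (r * (1 / (r * √r)) *
      (1 / (ε ^ 2 + (‖x‖ - r) ^ 2) - 1 / (ε ^ 2 + (‖x‖ + r) ^ 2)))) =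
      ENNReal.ofReal (ε / (Real.pi * ‖x‖ * √(‖x‖ ^ 2 + ε ^ 2))) * ENNReal.ofReal
      (((r + √(‖x‖ ^ 2 + ε ^ 2)) + (-1) * (r - √(‖x‖ ^ 2 + ε ^ 2))) /
        (2 * √r) * (1 / (ε ^ 2 + (‖x‖ - r) ^ 2) - 1 / (ε ^ 2 + (‖x‖ + r) ^ 2))) := fun r hr => by
    have hr : 0 < r := hr
    have := Real.sqrt_pos.2 hr
    rw [← ENNReal.ofReal_mul (by positivity)]
    congr 1
    have e : (r + √(‖x‖ ^ 2 + ε ^ 2)) + (-1) * (r - √(‖x‖ ^ 2 + ε ^ 2)) =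
      2 * √(‖x‖ ^ 2 + ε ^ 2) := by ring
    rw [e]
    field_simp
  rw [setLIntegral_congr_fun measurableSet_Ioi h2, lintegral_const_mul' _ _ ENNReal.ofReal_ne_top, h,
    ← ENNReal.ofReal_mul (by positivity)]
  congr 1
  field_simp

/-! ### Hardy and Kato inequalities -/

theorem enorm_ofReal_complex (w : ℝ) : ‖(w : ℂ)‖ₑ = ‖w‖ₑ := by
  rw [← ofReal_norm, Complex.norm_real, ofReal_norm]

theorem ae_ne_zero_R3 : ∀ᵐ y : R3, y ≠ 0 := by simp [ae_iff]

/-- `P_ε |y|^(-1/2) = poissonRatio ε |y| · |y|^(-1/2)`. -/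
def poissonRatio (ε r : ℝ) : ℝ := √(√(r ^ 2 + ε ^ 2) - ε) / √r

theorem measurable_poissonRatio (ε : ℝ) : Measurable (poissonRatio ε) := by
  unfold poissonRatio; fun_prop

theorem poissonRatio_nonneg (ε r : ℝ) : 0 ≤ poissonRatio ε r := by
  unfold poissonRatio; positivity

theorem sqrt_sq_add_sq_le {ε r : ℝ} (hε : 0 < ε) (hr : 0 < r) : √(r ^ 2 + ε ^ 2) ≤ r + ε :=
  Real.sqrt_le_iff.2 ⟨by positivity, by nlinarith [mul_pos hr hε]⟩

theorem lt_sqrt_sq_add_sq {ε r : ℝ} (hr : 0 < r) : ε < √(r ^ 2 + ε ^ 2) :=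
  Real.lt_sqrt_of_sq_lt (by nlinarith [pow_pos hr 2])

theorem le_sqrt_sq_add_sq (ε r : ℝ) : r ≤ √(r ^ 2 + ε ^ 2) :=
  Real.le_sqrt_of_sq_le (by nlinarith [sq_nonneg ε])

theorem poissonRatio_sq {ε r : ℝ} (hr : 0 < r) :
    poissonRatio ε r ^ 2 = (√(r ^ 2 + ε ^ 2) - ε) / r := by
  rw [poissonRatio, div_pow, Real.sq_sqrt hr.le,
    Real.sq_sqrt (by linarith [lt_sqrt_sq_add_sq (ε := ε) hr])]

theorem poissonRatio_le_one {ε r : ℝ} (hε : 0 < ε) (hr : 0 < r) : poissonRatio ε r ≤ 1 := by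
  have h : poissonRatio ε r ^ 2 ≤ 1 := by
    rw [poissonRatio_sq hr, div_le_one hr]
    linarith [sqrt_sq_add_sq_le hε hr]
  exact (sq_le_one_iff₀ (poissonRatio_nonneg _ _)).1 h

/-- By `2 t ≤ 1 + t²`. Divided by `ε`, the left side tends to `1 / (2 |y|)`, the sharp constant of
the bound obtained by differentiating at `ε = 0`. -/
theorem le_one_sub_poissonRatio {ε r : ℝ} (hr : 0 < r) :
    (r + ε - √(r ^ 2 + ε ^ 2)) / (2 * r) ≤ 1 - poissonRatio ε r := by
  have h : (r + ε - √(r ^ 2 + ε ^ 2)) / (2 * r) = (1 - poissonRatio ε r ^ 2) / 2 := by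
    rw [poissonRatio_sq hr]; field_simp; ring
  rw [h]
  nlinarith [sq_nonneg (1 - poissonRatio ε r)]

/-- A bounded nonnegative weight `W` for which `W |y|^(-1/2)` is a supersolution of the Poisson
semigroup with the same ratio `poissonRatio` as `|y|^(-1/2)` itself. -/
structure PoissonWeight (W : R3 → ℝ) : Prop where
  bdd : BddSymbol W
  nonneg : ∀ y, 0 ≤ W y
  le : ∀ ε, 0 < ε → ∀ x : R3, x ≠ 0 →
    ∫⁻ y, ENNReal.ofReal (poissonKernel ε (x - y)) * ENNReal.ofReal (W y * (1 / √‖y‖)) ≤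
      ENNReal.ofReal (W x * (√(√(‖x‖ ^ 2 + ε ^ 2) - ε) / ‖x‖))

theorem poissonWeight_one : PoissonWeight fun _ => 1 where
  bdd := ⟨measurable_const, 1, by simp⟩
  nonneg := by simp
  le ε hε x hx := by
    simp only [one_mul]
    exact (lintegral_poisson_rpow_neg_half hε hx).le

theorem poissonWeight_min {n : ℝ} (hn : 0 ≤ n) : PoissonWeight fun y => min (1 / ‖y‖) n where
  bdd := ⟨by fun_prop, n, fun p => by
    rw [abs_of_nonneg (by positivity)]; exact min_le_right _ _⟩
  nonneg y := by positivity
  le ε hε x hx := by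
    have hR : 0 < ‖x‖ := norm_pos_iff.2 hx
    have hρ := le_sqrt_sq_add_sq ε ‖x‖
    rw [min_mul_of_nonneg _ _ (by positivity), ENNReal.ofReal_min]
    refine le_min ?_ ?_
    · calc ∫⁻ y, ENNReal.ofReal (poissonKernel ε (x - y)) *
            ENNReal.ofReal (min (1 / ‖y‖) n * (1 / √‖y‖))
          ≤ ∫⁻ y, ENNReal.ofReal (poissonKernel ε (x - y)) *
            ENNReal.ofReal (1 / (‖y‖ * √‖y‖)) := by
            refine lintegral_mono fun y => mul_le_mul_right (ENNReal.ofReal_le_ofReal ?_) _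
            calc min (1 / ‖y‖) n * (1 / √‖y‖) ≤ 1 / ‖y‖ * (1 / √‖y‖) :=
                  mul_le_mul_of_nonneg_right (min_le_left _ _) (by positivity)
              _ = _ := by rw [div_mul_div_comm, one_mul]
        _ = _ := lintegral_poisson_rpow_neg_three_half hε hx
        _ ≤ _ := by
            refine ENNReal.ofReal_le_ofReal ?_
            rw [div_mul_div_comm, one_mul]
            exact div_le_div_of_nonneg_left (by positivity) (by positivity)
              (mul_le_mul_of_nonneg_right hρ hR.le)
    · calc ∫⁻ y, ENNReal.ofReal (poissonKernel ε (x - y)) *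
            ENNReal.ofReal (min (1 / ‖y‖) n * (1 / √‖y‖))
          ≤ ∫⁻ y, ENNReal.ofReal n * (ENNReal.ofReal (poissonKernel ε (x - y)) *
            ENNReal.ofReal (1 / √‖y‖)) := by
            refine lintegral_mono fun y => ?_
            rw [← mul_assoc, mul_comm (ENNReal.ofReal n), mul_assoc, ← ENNReal.ofReal_mul hn]
            exact mul_le_mul_right (ENNReal.ofReal_le_ofReal
              (mul_le_mul_of_nonneg_right (min_le_right _ _) (by positivity))) _
        _ = _ := by
            rw [lintegral_const_mul' _ _ ENNReal.ofReal_ne_top,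
              lintegral_poisson_rpow_neg_half hε hx, ENNReal.ofReal_mul hn]

theorem poissonKernel_sub_comm (ε : ℝ) (x y : R3) :
    poissonKernel ε (x - y) = poissonKernel ε (y - x) := by
  rw [poissonKernel, poissonKernel, norm_sub_rev]

/-- Schur's test with weight `|y|^(-1/2)`. -/
theorem PoissonWeight.lintegral_le {W : R3 → ℝ} (hW : PoissonWeight W) {ε : ℝ} (hε : 0 < ε)
    (ξ : L2) :
    ∫⁻ x, ∫⁻ y, ‖ξ x‖ₑ * ENNReal.ofReal (W x * poissonKernel ε (x - y)) * ‖ξ y‖ₑ ≤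
      ∫⁻ x, ENNReal.ofReal (W x * poissonRatio ε ‖x‖) * ‖ξ x‖ₑ ^ 2 := by
  have hWm := hW.bdd.1
  have hkm := measurable_poissonKernel ε
  have hm : Measurable (Function.uncurry fun x y : R3 =>
      ENNReal.ofReal (W x * poissonKernel ε (x - y))) :=
    ((hWm.comp measurable_fst).mul (hkm.comp (measurable_fst.sub measurable_snd))).ennreal_ofReal
  have hpt : ∀ x : R3, x ≠ 0 → W x * (√(√(‖x‖ ^ 2 + ε ^ 2) - ε) / ‖x‖) =
      W x * poissonRatio ε ‖x‖ * (1 / √‖x‖) := fun x hx => by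
    have : 0 < √‖x‖ := Real.sqrt_pos.2 (norm_pos_iff.2 hx)
    rw [poissonRatio]
    nth_rewrite 2 [← Real.mul_self_sqrt (norm_nonneg x)]
    field_simp
  have hu : ∀ᵐ y : R3, ENNReal.ofReal (1 / √‖y‖) ≠ 0 ∧ ENNReal.ofReal (1 / √‖y‖) ≠ ∞ := by
    filter_upwards [ae_ne_zero_R3] with y hy
    have : 0 < √‖y‖ := Real.sqrt_pos.2 (norm_pos_iff.2 hy)
    refine ⟨?_, ENNReal.ofReal_ne_top⟩
    rw [Ne, ENNReal.ofReal_eq_zero, not_le]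
    positivity
  have h := schur_test hm (u := fun y => ENNReal.ofReal (1 / √‖y‖))
    (v := fun y => ENNReal.ofReal (1 / √‖y‖))
    (a := fun x => ENNReal.ofReal (W x * poissonRatio ε ‖x‖))
    (b := fun x => ENNReal.ofReal (W x * poissonRatio ε ‖x‖))
    (by fun_prop) (by fun_prop) hu hu ?_ ?_ (F := fun x => ‖ξ x‖ₑ) (G := fun x => ‖ξ x‖ₑ)
    (Lp.aestronglyMeasurable ξ).enorm (Lp.aestronglyMeasurable ξ).enorm
  · rw [← two_mul] at h
    exact (ENNReal.mul_le_mul_iff_right two_ne_zero ENNReal.ofNat_ne_top).1 h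
  · filter_upwards [ae_ne_zero_R3] with x hx
    calc ∫⁻ y, ENNReal.ofReal (W x * poissonKernel ε (x - y)) * ENNReal.ofReal (1 / √‖y‖)
        = ENNReal.ofReal (W x) * ∫⁻ y, ENNReal.ofReal (poissonKernel ε (x - y)) *
            ENNReal.ofReal (1 / √‖y‖) := by
          rw [← lintegral_const_mul' _ _ ENNReal.ofReal_ne_top]
          refine lintegral_congr fun y => ?_
          rw [ENNReal.ofReal_mul (hW.nonneg x), mul_assoc]
      _ = ENNReal.ofReal (W x * (√(√(‖x‖ ^ 2 + ε ^ 2) - ε) / ‖x‖)) := by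
          rw [lintegral_poisson_rpow_neg_half hε hx, ENNReal.ofReal_mul (hW.nonneg x)]
      _ ≤ _ := by
          rw [hpt x hx, ENNReal.ofReal_mul (mul_nonneg (hW.nonneg x) (poissonRatio_nonneg _ _))]
  · filter_upwards [ae_ne_zero_R3] with y hy
    calc ∫⁻ x, ENNReal.ofReal (W x * poissonKernel ε (x - y)) * ENNReal.ofReal (1 / √‖x‖)
        = ∫⁻ x, ENNReal.ofReal (poissonKernel ε (y - x)) *
            ENNReal.ofReal (W x * (1 / √‖x‖)) := by
          refine lintegral_congr fun x => ?_
          rw [ENNReal.ofReal_mul (hW.nonneg x), ENNReal.ofReal_mul (hW.nonneg x),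
            poissonKernel_sub_comm]
          ring
      _ ≤ _ := hW.le ε hε y hy
      _ ≤ _ := by
          rw [hpt y hy, ENNReal.ofReal_mul (mul_nonneg (hW.nonneg y) (poissonRatio_nonneg _ _))]

theorem integrable_norm_sq_L2 (ξ : L2) : Integrable (fun p => ‖ξ p‖ ^ 2) :=
  (memLp_two_iff_integrable_sq_norm (Lp.aestronglyMeasurable ξ)).1 (Lp.memLp ξ)

/-- The sharp bound at positive time, before the semigroup is differentiated. -/
theorem PoissonWeight.re_inner_ge {W : R3 → ℝ} (hW : PoissonWeight W) {ε : ℝ} (hε : 0 < ε)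
    (ξ : L2) :
    ∫⁻ x, ENNReal.ofReal (W x * (1 - poissonRatio ε ‖x‖)) * ‖ξ x‖ₑ ^ 2 ≤
      ENNReal.ofReal (inner ℂ (mulOp W ξ) (ξ - poissonOp ε ξ)).re := by
  obtain ⟨C, hC⟩ := hW.bdd.2
  have hWm := hW.bdd.1
  have hrm := measurable_poissonRatio ε
  have hsq := integrable_norm_sq_L2 ξ
  have hI1 : Integrable (fun x => W x * ‖ξ x‖ ^ 2) :=
    hsq.bdd_mul (c := C) hWm.aestronglyMeasurable (ae_of_all _ hC)
  have hI2 : Integrable (fun x => W x * poissonRatio ε ‖x‖ * ‖ξ x‖ ^ 2) := by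
    refine hsq.bdd_mul (c := C) (by fun_prop) ?_
    filter_upwards [ae_ne_zero_R3] with x hx
    rw [Real.norm_eq_abs, abs_mul, abs_of_nonneg (poissonRatio_nonneg _ _)]
    exact (mul_le_of_le_one_right (abs_nonneg _)
      (poissonRatio_le_one hε (norm_pos_iff.2 hx))).trans (hC x)
  have hconv : ∀ w : ℝ, 0 ≤ w → ∀ z : ℂ, ENNReal.ofReal w * ‖z‖ₑ ^ 2 = ENNReal.ofReal (w * ‖z‖ ^ 2) :=
    fun w hw z => by
      rw [ENNReal.ofReal_mul hw, ← ofReal_norm, ENNReal.ofReal_pow (norm_nonneg _)]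
  have hn2 : ∀ x, 0 ≤ W x * poissonRatio ε ‖x‖ * ‖ξ x‖ ^ 2 := fun x =>
    mul_nonneg (mul_nonneg (hW.nonneg x) (poissonRatio_nonneg _ _)) (by positivity)
  have hP : (inner ℂ (mulOp W ξ) (poissonOp ε ξ)).re ≤ ∫ x, W x * poissonRatio ε ‖x‖ * ‖ξ x‖ ^ 2 := by
    refine (Complex.re_le_norm _).trans ?_
    rw [inner_poissonOp hε]
    have h1 := (bddKernel_poisson hε).1
    have h2 : ENNReal.ofReal ‖∫ z, kerFun (fun x y => poissonKernel ε (x - y)) (mulOp W ξ) ξ z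
        ∂((volume : Measure R3).prod volume)‖ ≤
        ENNReal.ofReal (∫ x, W x * poissonRatio ε ‖x‖ * ‖ξ x‖ ^ 2) := by
      rw [ofReal_norm]
      refine (enorm_integral_le_lintegral_enorm _).trans ?_
      rw [lintegral_enorm_kerFun h1 (Lp.aestronglyMeasurable _) (Lp.aestronglyMeasurable _),
        ofReal_integral_eq_lintegral_ofReal hI2 (ae_of_all _ hn2)]
      have h3 := hW.lintegral_le hε ξ
      calc _ = ∫⁻ x, ∫⁻ y, ‖ξ x‖ₑ * ENNReal.ofReal (W x * poissonKernel ε (x - y)) * ‖ξ y‖ₑ := by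
            refine lintegral_congr_ae ?_
            filter_upwards [mulOp_coe hW.bdd ξ] with x hx
            refine lintegral_congr fun y => ?_
            rw [hx, enorm_mul, enorm_ofReal_complex, Real.enorm_of_nonneg (hW.nonneg x),
              Real.enorm_of_nonneg (poissonKernel_nonneg hε _), ENNReal.ofReal_mul (hW.nonneg x)]
            ring
        _ ≤ _ := h3
        _ = _ := lintegral_congr fun x => hconv _
          (mul_nonneg (hW.nonneg x) (poissonRatio_nonneg _ _)) _
    exact (ENNReal.ofReal_le_ofReal_iff (integral_nonneg hn2)).1 h2
  have hid : (inner ℂ (mulOp W ξ) ξ).re = ∫ x, W x * ‖ξ x‖ ^ 2 := by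
    rw [inner_eq_integral]
    have : ∫ x, conj (mulOp W ξ x) * ξ x = ∫ x, ((W x * ‖ξ x‖ ^ 2 : ℝ) : ℂ) := by
      refine integral_congr_ae ?_
      filter_upwards [mulOp_coe hW.bdd ξ] with x hx
      rw [hx, map_mul, Complex.conj_ofReal, mul_assoc, mul_comm (conj _), Complex.mul_conj,
        Complex.normSq_eq_norm_sq]
      push_cast; ring
    rw [this, integral_complex_ofReal, Complex.ofReal_re]
  have hd : ∫ x, W x * (1 - poissonRatio ε ‖x‖) * ‖ξ x‖ ^ 2 =
      (∫ x, W x * ‖ξ x‖ ^ 2) - ∫ x, W x * poissonRatio ε ‖x‖ * ‖ξ x‖ ^ 2 := by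
    rw [← integral_sub hI1 hI2]
    congr 1; ext x; ring
  have hI3 : Integrable fun x => W x * (1 - poissonRatio ε ‖x‖) * ‖ξ x‖ ^ 2 := by
    refine (hI1.sub hI2).congr (ae_of_all _ fun x => ?_)
    simp only [Pi.sub_apply]; ring
  have hn3 : ∀ᵐ x : R3, 0 ≤ W x * (1 - poissonRatio ε ‖x‖) := by
    filter_upwards [ae_ne_zero_R3] with x hx
    exact mul_nonneg (hW.nonneg x)
      (sub_nonneg.2 (poissonRatio_le_one hε (norm_pos_iff.2 hx)))
  calc ∫⁻ x, ENNReal.ofReal (W x * (1 - poissonRatio ε ‖x‖)) * ‖ξ x‖ₑ ^ 2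
      = ∫⁻ x, ENNReal.ofReal (W x * (1 - poissonRatio ε ‖x‖) * ‖ξ x‖ ^ 2) := by
        refine lintegral_congr_ae ?_
        filter_upwards [hn3] with x hx
        rw [hconv _ hx]
    _ = ENNReal.ofReal (∫ x, W x * (1 - poissonRatio ε ‖x‖) * ‖ξ x‖ ^ 2) := by
        rw [ofReal_integral_eq_lintegral_ofReal hI3]
        filter_upwards [hn3] with x hx
        simp only [Pi.zero_apply]
        positivity
    _ ≤ _ := by
        refine ENNReal.ofReal_le_ofReal ?_
        rw [hd, inner_sub_right, Complex.sub_re, hid]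
        linarith

theorem tendsto_poisson_quotient {r : ℝ} (hr : 0 < r) :
    Tendsto (fun n : ℕ => (r + 1 / ((n : ℝ) + 1) - √(r ^ 2 + (1 / ((n : ℝ) + 1)) ^ 2)) / (2 * r) *
      ((n : ℝ) + 1)) atTop (𝓝 (1 / (2 * r))) := by
  have h0 : Tendsto (fun n : ℕ => 1 / ((n : ℝ) + 1)) atTop (𝓝 0) :=
    tendsto_one_div_add_atTop_nhds_zero_nat
  have h1 : Tendsto (fun n : ℕ => (1 - 1 / ((n : ℝ) + 1) /
      (r + √(r ^ 2 + (1 / ((n : ℝ) + 1)) ^ 2))) / (2 * r)) atTop (𝓝 ((1 - 0 / (r + √(r ^ 2 + 0 ^ 2))) / (2 * r))) := by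
    refine (tendsto_const_nhds.sub (h0.div (tendsto_const_nhds.add ?_) ?_)).div_const _
    · exact (Real.continuous_sqrt.tendsto _).comp (tendsto_const_nhds.add (h0.pow 2))
    · positivity
  have e : (1 - 0 / (r + √(r ^ 2 + 0 ^ 2))) / (2 * r) = 1 / (2 * r) := by simp
  rw [e] at h1
  refine h1.congr fun n => ?_
  have hn : (0 : ℝ) < (n : ℝ) + 1 := by positivity
  set ε := 1 / ((n : ℝ) + 1) with hε
  have hε0 : 0 < ε := by positivity
  have hnε : (n : ℝ) + 1 = 1 / ε := by rw [hε]; field_simp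
  have hs : √(r ^ 2 + ε ^ 2) ^ 2 = r ^ 2 + ε ^ 2 := Real.sq_sqrt (by positivity)
  have hs0 : 0 ≤ √(r ^ 2 + ε ^ 2) := Real.sqrt_nonneg _
  rw [hnε]
  generalize √(r ^ 2 + ε ^ 2) = ρ at hs hs0
  have : r + ρ ≠ 0 := by positivity
  field_simp
  linear_combination hs

/-- Differentiating the Poisson semigroup at time zero. -/
theorem PoissonWeight.lintegral_le_of_tendsto {W : R3 → ℝ} (hW : PoissonWeight W) (ξ : L2) {L : ℝ}
    (h : Tendsto (fun n : ℕ => (inner ℂ (mulOp W ξ) (ξ - poissonOp (1 / ((n : ℝ) + 1)) ξ)).re *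
      ((n : ℝ) + 1)) atTop (𝓝 L)) :
    ∫⁻ x, ENNReal.ofReal (W x * (1 / (2 * ‖x‖))) * ‖ξ x‖ₑ ^ 2 ≤ ENNReal.ofReal L := by
  have hWm := hW.bdd.1
  set q : ℕ → R3 → ℝ≥0∞ := fun n x => ENNReal.ofReal (W x * ((‖x‖ + 1 / ((n : ℝ) + 1) -
    √(‖x‖ ^ 2 + (1 / ((n : ℝ) + 1)) ^ 2)) / (2 * ‖x‖) * ((n : ℝ) + 1))) * ‖ξ x‖ₑ ^ 2 with hq
  have hqm : ∀ n, AEMeasurable (q n) := fun n => by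
    have := (Lp.aestronglyMeasurable ξ).enorm
    exact AEMeasurable.mul (by fun_prop) (this.pow_const 2)
  have hlim : ∀ᵐ x : R3, liminf (fun n => q n x) atTop =
      ENNReal.ofReal (W x * (1 / (2 * ‖x‖))) * ‖ξ x‖ₑ ^ 2 := by
    filter_upwards [ae_ne_zero_R3] with x hx
    refine Tendsto.liminf_eq ?_
    refine ENNReal.Tendsto.mul_const ?_ (Or.inr (by finiteness))
    exact ENNReal.tendsto_ofReal ((tendsto_poisson_quotient (norm_pos_iff.2 hx)).const_mul _)
  have hle : ∀ n, ∫⁻ x, q n x ≤ ENNReal.ofReal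
      ((inner ℂ (mulOp W ξ) (ξ - poissonOp (1 / ((n : ℝ) + 1)) ξ)).re * ((n : ℝ) + 1)) := fun n => by
    have hn : (0 : ℝ) < (n : ℝ) + 1 := by positivity
    have hε : 0 < 1 / ((n : ℝ) + 1) := by positivity
    rw [mul_comm, ENNReal.ofReal_mul hn.le]
    refine le_trans ?_ (mul_le_mul_right (hW.re_inner_ge hε ξ) _)
    rw [← lintegral_const_mul' _ _ ENNReal.ofReal_ne_top]
    refine lintegral_mono_ae ?_
    filter_upwards [ae_ne_zero_R3] with x hx
    rw [hq]
    simp only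
    rw [← mul_assoc (ENNReal.ofReal ((n : ℝ) + 1)), ← ENNReal.ofReal_mul hn.le]
    refine mul_le_mul_left (ENNReal.ofReal_le_ofReal ?_) _
    have h1 := le_one_sub_poissonRatio (ε := 1 / ((n : ℝ) + 1)) (norm_pos_iff.2 hx)
    have h2 := mul_le_mul_of_nonneg_left h1 (mul_nonneg hn.le (hW.nonneg x))
    calc _ = _ := by ring
      _ ≤ _ := h2
      _ = _ := by ring
  calc _ = ∫⁻ x, liminf (fun n => q n x) atTop := (lintegral_congr_ae hlim).symm
    _ ≤ liminf (fun n => ∫⁻ x, q n x) atTop := lintegral_liminf_le' hqm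
    _ ≤ liminf (fun n : ℕ => ENNReal.ofReal
      ((inner ℂ (mulOp W ξ) (ξ - poissonOp (1 / ((n : ℝ) + 1)) ξ)).re * ((n : ℝ) + 1))) atTop :=
        liminf_le_liminf (Eventually.of_forall hle)
    _ = _ := (ENNReal.tendsto_ofReal h).liminf_eq

theorem tendsto_one_sub_exp_mul (p : ℝ) :
    Tendsto (fun n : ℕ => (1 - Real.exp (-(1 / ((n : ℝ) + 1)) * p)) * ((n : ℝ) + 1)) atTop (𝓝 p) := by
  have hd : HasDerivAt (fun ε : ℝ => 1 - Real.exp (-ε * p)) p 0 := by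
    have : HasDerivAt (fun ε : ℝ => -ε * p) (-p) 0 := by
      simpa using ((hasDerivAt_id (0 : ℝ)).fun_neg).mul_const p
    simpa using this.exp.const_sub 1
  have h := hd.tendsto_slope_zero_right
  have h0 : Tendsto (fun n : ℕ => 1 / ((n : ℝ) + 1)) atTop (𝓝[>] 0) :=
    tendsto_nhdsWithin_iff.2 ⟨tendsto_one_div_add_atTop_nhds_zero_nat,
      Eventually.of_forall fun n => mem_Ioi.2 (by positivity)⟩
  refine (h.comp h0).congr fun n => ?_
  simp [mul_comm]

theorem one_sub_exp_mul_le (n : ℕ) {p : ℝ} (hp : 0 ≤ p) :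
    |(1 - Real.exp (-(1 / ((n : ℝ) + 1)) * p)) * ((n : ℝ) + 1)| ≤ p := by
  have hn : (0 : ℝ) < (n : ℝ) + 1 := by positivity
  have h1 : Real.exp (-(1 / ((n : ℝ) + 1)) * p) ≤ 1 := by
    rw [Real.exp_le_one_iff, neg_mul, neg_nonpos]; positivity
  rw [abs_of_nonneg (mul_nonneg (by linarith) hn.le)]
  have h2 := Real.add_one_le_exp (-(1 / ((n : ℝ) + 1)) * p)
  calc _ ≤ (1 / ((n : ℝ) + 1)) * p * ((n : ℝ) + 1) :=
        mul_le_mul_of_nonneg_right (by linarith) hn.le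
    _ = p := by field_simp

theorem tendsto_inner_sub_poissonOp (η ξ : L2)
    (h : Integrable fun p => (‖p‖ : ℂ) * (conj (fourierU η p) * fourierU ξ p)) :
    Tendsto (fun n : ℕ => (inner ℂ η (ξ - poissonOp (1 / ((n : ℝ) + 1)) ξ)).re * ((n : ℝ) + 1)) atTop
      (𝓝 (∫ p, (‖p‖ : ℂ) * (conj (fourierU η p) * fourierU ξ p)).re) := by
  have hlim : Tendsto (fun n : ℕ => ∫ p : R3,
      (((1 - Real.exp (-(1 / ((n : ℝ) + 1)) * ‖p‖)) * ((n : ℝ) + 1) : ℝ) : ℂ) *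
        (conj (fourierU η p) * fourierU ξ p)) atTop
      (𝓝 (∫ p, (‖p‖ : ℂ) * (conj (fourierU η p) * fourierU ξ p))) := by
    refine tendsto_integral_of_dominated_convergence _ (fun n => ?_) h.norm (fun n => ?_) ?_
    · exact (Complex.measurable_ofReal.comp (by fun_prop)).aestronglyMeasurable.mul
        (integrable_inner_L2 (fourierU η) (fourierU ξ)).1
    · refine ae_of_all _ fun p => ?_
      rw [norm_mul, Complex.norm_real, norm_mul (‖p‖ : ℂ), Complex.norm_real, norm_norm]
      exact mul_le_mul_of_nonneg_right (one_sub_exp_mul_le n (norm_nonneg p)) (norm_nonneg _)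
    · refine ae_of_all _ fun p => ?_
      exact ((Complex.continuous_ofReal.tendsto _).comp (tendsto_one_sub_exp_mul ‖p‖)).mul_const _
  refine ((Complex.continuous_re.tendsto _).comp hlim).congr fun n => ?_
  have hε : 0 < 1 / ((n : ℝ) + 1) := by positivity
  have e : inner ℂ η (ξ - poissonOp (1 / ((n : ℝ) + 1)) ξ) * (((n : ℝ) + 1 : ℝ) : ℂ) = ∫ p : R3,
      (((1 - Real.exp (-(1 / ((n : ℝ) + 1)) * ‖p‖)) * ((n : ℝ) + 1) : ℝ) : ℂ) *
        (conj (fourierU η p) * fourierU ξ p) := by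
    rw [← fourierU.inner_map_map, inner_eq_integral, ← integral_mul_const, map_sub]
    refine integral_congr_ae ?_
    filter_upwards [fourierU_fourierMul (bddSymbol_exp hε) ξ,
      Lp.coeFn_sub (fourierU ξ) (fourierU (poissonOp (1 / ((n : ℝ) + 1)) ξ))] with p h1 h2
    rw [h2, Pi.sub_apply]
    change fourierU (poissonOp _ ξ) p = _ at h1
    rw [h1]
    push_cast
    ring
  simp only [Function.comp_apply]
  rw [← e, Complex.re_mul_ofReal]

theorem norm_mulOp_le {m : R3 → ℝ} (h : BddSymbol m) {C : ℝ} (hC : ∀ p, |m p| ≤ C) (ψ : L2) :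
    ‖mulOp m ψ‖ ≤ C * ‖ψ‖ := by
  refine Lp.norm_le_mul_norm_of_ae_le_mul ?_
  filter_upwards [mulOp_coe h ψ] with p hp
  rw [hp, norm_mul, Complex.norm_real]
  exact mul_le_mul_of_nonneg_right (hC p) (norm_nonneg _)

theorem norm_fourierMul_le {m : R3 → ℝ} (h : BddSymbol m) {C : ℝ} (hC : ∀ p, |m p| ≤ C) (ψ : L2) :
    ‖fourierMul m ψ‖ ≤ C * ‖ψ‖ := by
  rw [← fourierU.norm_map, fourierU_fourierMul_eq, ← fourierU.norm_map ψ]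
  exact norm_mulOp_le h hC _

theorem abs_div_one_add_le_one (p : R3) : |‖p‖ / (1 + ‖p‖)| ≤ 1 := by
  rw [abs_of_nonneg (by positivity), div_le_one (by positivity)]
  linarith

theorem bddSymbol_div_one_add : BddSymbol fun p : R3 => ‖p‖ / (1 + ‖p‖) :=
  ⟨by fun_prop, 1, abs_div_one_add_le_one⟩

theorem abs_sqrt_div_one_add_le_one (p : R3) : |√(‖p‖ / (1 + ‖p‖))| ≤ 1 := by
  rw [abs_of_nonneg (by positivity), Real.sqrt_le_left (by norm_num), one_pow]
  exact (le_abs_self _).trans (abs_div_one_add_le_one p)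

theorem bddSymbol_sqrt_div_one_add : BddSymbol fun p : R3 => √(‖p‖ / (1 + ‖p‖)) :=
  ⟨by fun_prop, 1, abs_sqrt_div_one_add_le_one⟩

/-- The operator `|∇| (1 + |∇|)⁻¹`, that is `|∇|` read off on `H^1 = bessel 1 L²`. -/
def absDeriv : L2 →L[ℂ] L2 := fourierMul fun p => ‖p‖ / (1 + ‖p‖)

/-- The operator `(|∇| (1 + |∇|)⁻¹)^(1/2)`, that is `|∇|^(1/2)` read off on
`H^{1/2} = bessel (1/2) L²`. -/
def halfDeriv : L2 →L[ℂ] L2 := fourierMul fun p => √(‖p‖ / (1 + ‖p‖))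

theorem norm_absDeriv_le (χ : L2) : ‖absDeriv χ‖ ≤ ‖χ‖ :=
  (norm_fourierMul_le bddSymbol_div_one_add abs_div_one_add_le_one χ).trans_eq (one_mul _)

theorem norm_halfDeriv_le (ψ : L2) : ‖halfDeriv ψ‖ ≤ ‖ψ‖ :=
  (norm_fourierMul_le bddSymbol_sqrt_div_one_add abs_sqrt_div_one_add_le_one ψ).trans_eq
    (one_mul _)

theorem fourierU_absDeriv (χ : L2) :
    fourierU (absDeriv χ) =ᵐ[volume] fun p => (‖p‖ : ℂ) * fourierU (bessel 1 χ) p := by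
  filter_upwards [fourierU_fourierMul bddSymbol_div_one_add χ, fourierU_bessel zero_le_one χ]
    with p h1 h2
  change fourierU (absDeriv χ) p = _ at h1
  rw [h1, h2, Real.rpow_neg_one, ← mul_assoc, ← Complex.ofReal_mul, div_eq_mul_inv]

theorem fourierU_halfDeriv (ψ : L2) :
    fourierU (halfDeriv ψ) =ᵐ[volume]
      fun p => ((√‖p‖ : ℝ) : ℂ) * fourierU (bessel (1 / 2) ψ) p := by
  filter_upwards [fourierU_fourierMul bddSymbol_sqrt_div_one_add ψ,
    fourierU_bessel (s := 1 / 2) (by norm_num) ψ] with p h1 h2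
  change fourierU (halfDeriv ψ) p = _ at h1
  rw [h1, h2, ← mul_assoc, ← Complex.ofReal_mul, Real.sqrt_div (norm_nonneg p),
    Real.rpow_neg (by positivity), ← Real.sqrt_eq_rpow, div_eq_mul_inv]

theorem ofReal_mul_enorm_sq {w : ℝ} (hw : 0 ≤ w) (z : ℂ) :
    ENNReal.ofReal (w ^ 2) * ‖z‖ₑ ^ 2 = ‖(w : ℂ) * z‖ₑ ^ 2 := by
  rw [enorm_mul, mul_pow, enorm_ofReal_complex, Real.enorm_of_nonneg hw, ENNReal.ofReal_pow hw]

theorem enorm_sq_eq_ofReal (f : L2) : ‖f‖ₑ ^ 2 = ENNReal.ofReal (‖f‖ ^ 2) := by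
  rw [← ofReal_norm, ENNReal.ofReal_pow (norm_nonneg _)]

/-- Kato's inequality `∫ |ξ|² / |y| ≤ 2 ∫ |p| |ξ̂|²`. -/
theorem kato_inequality (ψ : L2) :
    ∫⁻ y, ‖((1 / √‖y‖ : ℝ) : ℂ) * bessel (1 / 2) ψ y‖ₑ ^ 2 ≤ ENNReal.ofReal (2 * ‖halfDeriv ψ‖ ^ 2) := by
  set ξ := bessel (1 / 2) ψ with hξ
  have hpt : (fun p => conj (fourierU (halfDeriv ψ) p) * fourierU (halfDeriv ψ) p) =ᵐ[volume]
      fun p => (‖p‖ : ℂ) * (conj (fourierU ξ p) * fourierU ξ p) := by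
    filter_upwards [fourierU_halfDeriv ψ] with p hp
    rw [hp, map_mul, Complex.conj_ofReal]
    nth_rewrite 3 [← Real.mul_self_sqrt (norm_nonneg p)]
    push_cast
    ring
  have hint := (integrable_inner_L2 (fourierU (halfDeriv ψ)) (fourierU (halfDeriv ψ))).congr hpt
  have hlim := tendsto_inner_sub_poissonOp ξ ξ hint
  rw [← integral_congr_ae hpt, ← inner_eq_integral, fourierU.inner_map_map] at hlim
  have h1 : mulOp (fun _ : R3 => (1 : ℝ)) ξ = ξ := by
    refine Lp.ext ?_
    filter_upwards [mulOp_coe poissonWeight_one.bdd ξ] with y hy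
    rw [hy]; simp
  have h := poissonWeight_one.lintegral_le_of_tendsto ξ
    (L := (inner ℂ (halfDeriv ψ) (halfDeriv ψ)).re) (by rw [h1]; exact hlim)
  have h2 : (inner ℂ (halfDeriv ψ) (halfDeriv ψ)).re = ‖halfDeriv ψ‖ ^ 2 :=
    inner_self_eq_norm_sq (𝕜 := ℂ) _
  rw [h2] at h
  calc _ = ENNReal.ofReal 2 * ∫⁻ y, ENNReal.ofReal (1 * (1 / (2 * ‖y‖))) * ‖ξ y‖ₑ ^ 2 := by
        rw [← lintegral_const_mul' _ _ ENNReal.ofReal_ne_top]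
        refine lintegral_congr fun y => ?_
        rw [← ofReal_mul_enorm_sq (by positivity), ← mul_assoc, ← ENNReal.ofReal_mul (by norm_num),
          div_pow, Real.sq_sqrt (norm_nonneg y)]
        congr 2
        by_cases hy : ‖y‖ = 0
        · simp [hy]
        · field_simp
    _ ≤ ENNReal.ofReal 2 * ENNReal.ofReal (‖halfDeriv ψ‖ ^ 2) := mul_le_mul_right h _
    _ = _ := (ENNReal.ofReal_mul (by norm_num)).symm

theorem exists_katoOp : ∃ V : L2 →L[ℂ] L2, ∀ ψ : L2,
    V ψ =ᵐ[volume] fun y => ((1 / √‖y‖ : ℝ) : ℂ) * bessel (1 / 2) ψ y :=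
  exists_mul_clm (bessel (1 / 2)) (w := fun y => 1 / √‖y‖)
    (by fun_prop : Measurable fun y : R3 => 1 / √‖y‖).aestronglyMeasurable 2 fun ψ => (kato_inequality ψ).trans (by
      rw [enorm_sq_eq_ofReal, ← ENNReal.ofReal_mul (by norm_num)]
      refine ENNReal.ofReal_le_ofReal ?_
      gcongr
      exact norm_halfDeriv_le ψ)

/-- Multiplication by `|y|^(-1/2)` on `H^{1/2} = bessel (1/2) L²`. -/
def katoOp : L2 →L[ℂ] L2 := exists_katoOp.choose

theorem katoOp_coe (ψ : L2) :
    katoOp ψ =ᵐ[volume] fun y => ((1 / √‖y‖ : ℝ) : ℂ) * bessel (1 / 2) ψ y :=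
  exists_katoOp.choose_spec ψ

theorem hardy_truncated (χ : L2) {n : ℝ} (hn : 0 ≤ n) :
    ‖mulOp (fun y => min (1 / ‖y‖) n) (bessel 1 χ)‖ ^ 2 ≤
      2 * (inner ℂ (mulOp (fun y => min (1 / ‖y‖) n) (bessel 1 χ)) (absDeriv χ)).re := by
  set ξ := bessel 1 χ with hξ
  have hW := poissonWeight_min hn
  set W : R3 → ℝ := fun y => min (1 / ‖y‖) n with hWdef
  set η := mulOp W ξ with hη
  have hpt : (fun p => conj (fourierU η p) * fourierU (absDeriv χ) p) =ᵐ[volume]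
      fun p => (‖p‖ : ℂ) * (conj (fourierU η p) * fourierU ξ p) := by
    filter_upwards [fourierU_absDeriv χ] with p hp
    rw [hp]; ring
  have hint := (integrable_inner_L2 (fourierU η) (fourierU (absDeriv χ))).congr hpt
  have hlim := tendsto_inner_sub_poissonOp η ξ hint
  rw [← integral_congr_ae hpt, ← inner_eq_integral, fourierU.inner_map_map] at hlim
  have h := hW.lintegral_le_of_tendsto ξ hlim
  have h1 : ENNReal.ofReal (‖η‖ ^ 2) ≤ ENNReal.ofReal (2 * (inner ℂ η (absDeriv χ)).re) := by
    rw [← enorm_sq_eq_ofReal, enorm_sq_eq_lintegral, ENNReal.ofReal_mul (by norm_num)]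
    refine le_trans ?_ (mul_le_mul_right h _)
    rw [← lintegral_const_mul' _ _ ENNReal.ofReal_ne_top]
    refine lintegral_mono_ae ?_
    filter_upwards [mulOp_coe hW.bdd ξ] with y hy
    rw [hy, ← ofReal_mul_enorm_sq (hW.nonneg y), ← mul_assoc,
      ← ENNReal.ofReal_mul (by norm_num)]
    refine mul_le_mul_left (ENNReal.ofReal_le_ofReal ?_) _
    have h2 : W y * W y ≤ W y * (1 / ‖y‖) :=
      mul_le_mul_of_nonneg_left (min_le_left _ _) (hW.nonneg y)
    calc W y ^ 2 ≤ W y * (1 / ‖y‖) := by rw [sq]; exact h2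
      _ = _ := by ring
  rcases ENNReal.ofReal_le_ofReal_iff'.1 h1 with h3 | h3
  · exact h3
  · have h4 : η = 0 := by
      rw [← norm_eq_zero]
      exact pow_eq_zero_iff two_ne_zero |>.1 (le_antisymm h3 (sq_nonneg _))
    simp [h4]

theorem hardy_liminf (ξ : L2) : ∫⁻ y, ‖((1 / ‖y‖ : ℝ) : ℂ) * ξ y‖ₑ ^ 2 ≤
    liminf (fun n : ℕ => ‖mulOp (fun y => min (1 / ‖y‖) n) ξ‖ₑ ^ 2) atTop := by
  have hW : ∀ n : ℕ, PoissonWeight fun y => min (1 / ‖y‖) (n : ℝ) := fun n =>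
    poissonWeight_min n.cast_nonneg
  have hmeas : ∀ n : ℕ, AEMeasurable (fun y => ‖mulOp (fun y => min (1 / ‖y‖) n) ξ y‖ₑ ^ 2) := fun n =>
    (Lp.aestronglyMeasurable _).enorm.pow_const 2
  have h := lintegral_liminf_le' (u := (atTop : Filter ℕ)) hmeas
  simp_rw [enorm_sq_eq_lintegral]
  refine le_trans (le_of_eq ?_) h
  refine lintegral_congr_ae ?_
  filter_upwards [ae_all_iff.2 fun n : ℕ => mulOp_coe (hW n).bdd ξ] with y hy
  refine (Tendsto.liminf_eq ?_).symm
  refine tendsto_const_nhds.congr' ?_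
  obtain ⟨N, hN⟩ := exists_nat_ge (1 / ‖y‖)
  filter_upwards [eventually_ge_atTop N] with n hn
  rw [hy n, min_eq_left (hN.trans (by exact_mod_cast hn))]

theorem hardy_inequality (χ : L2) :
    ∫⁻ y, ‖((1 / ‖y‖ : ℝ) : ℂ) * bessel 1 χ y‖ₑ ^ 2 ≤ ENNReal.ofReal 4 * ‖χ‖ₑ ^ 2 := by
  refine (hardy_liminf _).trans ?_
  refine liminf_le_of_frequently_le' (Frequently.of_forall fun n => ?_)
  rw [enorm_sq_eq_ofReal, enorm_sq_eq_ofReal, ← ENNReal.ofReal_mul (by norm_num)]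
  refine ENNReal.ofReal_le_ofReal ?_
  have h1 := hardy_truncated χ (n := (n : ℝ)) n.cast_nonneg
  set η := mulOp (fun y => min (1 / ‖y‖) (n : ℝ)) (bessel 1 χ)
  have h2 : (inner ℂ η (absDeriv χ)).re ≤ ‖η‖ * ‖χ‖ :=
    (Complex.re_le_norm _).trans ((norm_inner_le_norm _ _).trans
      (mul_le_mul_of_nonneg_left (norm_absDeriv_le χ) (norm_nonneg _)))
  nlinarith [sq_nonneg (‖η‖ - 2 * ‖χ‖)]

theorem exists_hardyOp : ∃ V : L2 →L[ℂ] L2, ∀ χ : L2,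
    V χ =ᵐ[volume] fun y => ((1 / ‖y‖ : ℝ) : ℂ) * bessel 1 χ y :=
  exists_mul_clm (bessel 1) (w := fun y => 1 / ‖y‖)
    (by fun_prop : Measurable fun y : R3 => 1 / ‖y‖).aestronglyMeasurable 4 hardy_inequality

/-- Multiplication by `|y|⁻¹` on `H^1 = bessel 1 L²`. -/
def hardyOp : L2 →L[ℂ] L2 := exists_hardyOp.choose

theorem hardyOp_coe (χ : L2) :
    hardyOp χ =ᵐ[volume] fun y => ((1 / ‖y‖ : ℝ) : ℂ) * bessel 1 χ y :=
  exists_hardyOp.choose_spec χ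

/-- The sharp lower bound `Re (|y|⁻¹ ξ, |∇| ξ) ≥ ½ ‖|y|⁻¹ ξ‖²`. -/
theorem norm_hardyOp_sq_le (χ : L2) :
    ‖hardyOp χ‖ ^ 2 ≤ 2 * (inner ℂ (hardyOp χ) (absDeriv χ)).re := by
  set ξ := bessel 1 χ with hξ
  have hW : ∀ n : ℕ, PoissonWeight fun y => min (1 / ‖y‖) (n : ℝ) := fun n =>
    poissonWeight_min n.cast_nonneg
  have hlim : Tendsto (fun n : ℕ => inner ℂ (mulOp (fun y => min (1 / ‖y‖) (n : ℝ)) ξ) (absDeriv χ))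
      atTop (𝓝 (inner ℂ (hardyOp χ) (absDeriv χ))) := by
    simp_rw [inner_eq_integral]
    refine tendsto_integral_of_dominated_convergence _
      (fun n => (integrable_inner_L2 _ (absDeriv χ)).1)
      (integrable_inner_L2 (hardyOp χ) (absDeriv χ)).norm (fun n => ?_) ?_
    · filter_upwards [mulOp_coe (hW n).bdd ξ, hardyOp_coe χ] with y h1 h2
      rw [h1, h2]
      simp only [norm_mul, RCLike.norm_conj, Complex.norm_real]
      gcongr
      rw [Real.norm_of_nonneg (by positivity), Real.norm_of_nonneg (by positivity)]
      exact min_le_left _ _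
    · filter_upwards [ae_all_iff.2 fun n : ℕ => mulOp_coe (hW n).bdd ξ, hardyOp_coe χ] with y h1 h2
      refine tendsto_const_nhds.congr' ?_
      obtain ⟨N, hN⟩ := exists_nat_ge (1 / ‖y‖)
      filter_upwards [eventually_ge_atTop N] with n hn
      rw [h1 n, min_eq_left (hN.trans (by exact_mod_cast hn)), h2]
  have hre := (((Complex.continuous_re.tendsto _).comp hlim).const_mul 2)
  have h : ENNReal.ofReal (‖hardyOp χ‖ ^ 2) ≤
      ENNReal.ofReal (2 * (inner ℂ (hardyOp χ) (absDeriv χ)).re) := by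
    rw [← (ENNReal.tendsto_ofReal hre).liminf_eq, ← enorm_sq_eq_ofReal, enorm_sq_eq_lintegral]
    calc _ = ∫⁻ y, ‖((1 / ‖y‖ : ℝ) : ℂ) * ξ y‖ₑ ^ 2 := by
          refine lintegral_congr_ae ?_
          filter_upwards [hardyOp_coe χ] with y hy
          rw [hy]
      _ ≤ _ := hardy_liminf ξ
      _ ≤ _ := by
          refine liminf_le_liminf (Eventually.of_forall fun n => ?_)
          rw [enorm_sq_eq_ofReal]
          exact ENNReal.ofReal_le_ofReal (hardy_truncated χ n.cast_nonneg)
  have hnn : 0 ≤ 2 * (inner ℂ (hardyOp χ) (absDeriv χ)).re :=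
    ge_of_tendsto' hre fun n => (sq_nonneg _).trans (hardy_truncated χ n.cast_nonneg)
  exact (ENNReal.ofReal_le_ofReal_iff hnn).1 h

/-! ### The gradient in momentum space -/

theorem lintegral_norm_sq_mul_fourier {φ : R3 → ℂ} (h : ContDiff ℝ 1 φ) (hs : HasCompactSupport φ) :
    ∫⁻ y, ENNReal.ofReal ((2 * Real.pi * ‖y‖) ^ 2) * ‖𝓕 φ y‖ₑ ^ 2 =
      ∑ j : Fin 3, ∫⁻ x, ‖fderiv ℝ φ x (EuclideanSpace.single j 1)‖ₑ ^ 2 := by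
  have hφ : Integrable φ := h.continuous.integrable_of_hasCompactSupport hs
  have hd := h.differentiable one_ne_zero
  have hf' : Continuous (fderiv ℝ φ) := h.continuous_fderiv one_ne_zero
  have hfs : HasCompactSupport (fderiv ℝ φ) := hs.fderiv ℝ
  have hfi : Integrable (fderiv ℝ φ) := hf'.integrable_of_hasCompactSupport hfs
  have key : ∀ j : Fin 3, ∫⁻ x, ‖fderiv ℝ φ x (EuclideanSpace.single j 1)‖ₑ ^ 2 =
      ∫⁻ y, ENNReal.ofReal ((2 * Real.pi * y j) ^ 2) * ‖𝓕 φ y‖ₑ ^ 2 := fun j => by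
    set e : R3 := EuclideanSpace.single j 1 with he
    set D : R3 → ℂ := fun x => fderiv ℝ φ x e with hD
    have hDc : Continuous D := hf'.clm_apply continuous_const
    have hDs : HasCompactSupport D := hfs.comp_left (g := fun L : R3 →L[ℝ] ℂ => L e) rfl
    have hD1 : Integrable D := hDc.integrable_of_hasCompactSupport hDs
    have hD2 : MemLp D 2 := hDc.memLp_of_hasCompactSupport hDs
    have e1 : ∫⁻ x, ‖D x‖ₑ ^ 2 = ‖hD2.toLp D‖ₑ ^ 2 := by
      rw [enorm_sq_eq_lintegral]
      refine lintegral_congr_ae ?_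
      filter_upwards [hD2.coeFn_toLp] with x hx
      rw [hx]
    have e2 : ‖(𝓕 (hD2.toLp D) : L2)‖ₑ = ‖hD2.toLp D‖ₑ := by
      rw [← ofReal_norm, ← ofReal_norm, Lp.norm_fourier_eq]
    rw [e1, ← e2, enorm_sq_eq_lintegral]
    refine lintegral_congr_ae ?_
    filter_upwards [fourier_toLp_ae_eq hD1 hD2] with y hy
    rw [hy]
    have e3 : 𝓕 D y = (𝓕 (fderiv ℝ φ) y) e := (Real.fourier_continuousLinearMap_apply hfi).symm
    rw [e3, Real.fourier_fderiv hφ hd hfi, VectorFourier.fourierSMulRight_apply]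
    simp only [neg_apply, innerSL_apply_apply ℝ]
    have e4 : inner ℝ y e = y j := by
      rw [he, EuclideanSpace.inner_single_right]; simp
    rw [e4, ← ofReal_norm, ← ofReal_norm, ← ENNReal.ofReal_pow (norm_nonneg _),
      ← ENNReal.ofReal_pow (norm_nonneg _), ← ENNReal.ofReal_mul (sq_nonneg _)]
    congr 1
    simp only [norm_smul, norm_neg, norm_mul, Complex.norm_I, mul_one, Complex.norm_real,
      Complex.norm_ofNat, Real.norm_eq_abs, abs_of_pos Real.pi_pos]
    rw [mul_pow, mul_pow, mul_pow |y j|, sq_abs]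
    ring
  simp_rw [key]
  rw [← lintegral_finsetSum' _ fun j _ => ?_]
  · refine lintegral_congr fun y => ?_
    rw [← Finset.sum_mul, ← ENNReal.ofReal_sum_of_nonneg fun j _ => sq_nonneg _]
    congr 2
    simp_rw [mul_pow]
    rw [← Finset.mul_sum, EuclideanSpace.real_norm_sq_eq]
  · have hc : Continuous (𝓕 φ : R3 → ℂ) :=
      VectorFourier.fourierIntegral_continuous Real.continuous_fourierChar continuous_inner hφ
    have : Continuous fun y : R3 => 2 * Real.pi * y j := by fun_prop
    exact ((this.pow 2).measurable.ennreal_ofReal.mul (hc.measurable.enorm.pow_const 2)).aemeasurable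

/-- Multiplication by `|y|` becomes the gradient under the Fourier transform. -/
theorem lintegral_norm_sq_mul_fourierU_symm {χ : R3 → ℂ} (h : ContDiff ℝ 1 χ)
    (hs : HasCompactSupport χ) (h2 : MemLp χ 2) :
    ∫⁻ y, ENNReal.ofReal (‖y‖ ^ 2) * ‖fourierU.symm (h2.toLp χ) y‖ₑ ^ 2 =
      ∑ j : Fin 3, ∫⁻ x, ‖fderiv ℝ χ x (EuclideanSpace.single j 1)‖ₑ ^ 2 := by
  have hpi : (0 : ℝ) < 2 * Real.pi := by positivity
  set ω := fourierU.symm (h2.toLp χ) with hω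
  set c : ℝ := (2 * Real.pi) ^ (3 / 2 : ℝ) with hc
  have hc0 : 0 < c := by positivity
  have hcc : c ^ 2 = (2 * Real.pi) ^ 3 := by
    rw [hc, ← Real.rpow_natCast, ← Real.rpow_mul hpi.le, ← Real.rpow_natCast]
    norm_num
  set φ : R3 → ℂ := fun x => (c : ℂ) * χ ((2 * Real.pi) • x) with hφ
  have hφC : ContDiff ℝ 1 φ := contDiff_const.mul (h.comp (contDiff_const_smul _))
  have hφs : HasCompactSupport φ := by
    have : HasCompactSupport fun x : R3 => χ ((2 * Real.pi) • x) :=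
      hs.comp_homeomorph (Homeomorph.smulOfNeZero (2 * Real.pi) hpi.ne')
    exact this.mul_left
  have hφ1 : Integrable φ := hφC.continuous.integrable_of_hasCompactSupport hφs
  have hφ2 : MemLp φ 2 := hφC.continuous.memLp_of_hasCompactSupport hφs
  have hfω : (𝓕 ω : L2) = hφ2.toLp φ := by
    refine Lp.ext ?_
    have h1 : hat ω =ᵐ[volume] χ := by
      refine (fourierU_coe ω).symm.trans ?_
      rw [hω, LinearIsometryEquiv.apply_symm_apply]
      exact h2.coeFn_toLp
    filter_upwards [(quasiMeasurePreserving_smul_R3 hpi).ae h1, hφ2.coeFn_toLp] with x hx hx2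
    rw [hx2, hφ]
    simp only
    rw [← hx, hat, smul_smul, inv_mul_cancel₀ hpi.ne', one_smul, ← mul_assoc, ← Complex.ofReal_mul,
      hc, ← Real.rpow_add hpi]
    norm_num
  have hωe : ω =ᵐ[volume] fun y => 𝓕 φ (-y) := by
    have : ω = 𝓕⁻ (hφ2.toLp φ) := by
      rw [← hfω, FourierTransform.fourierInv_fourier_eq]
    rw [this]
    refine (fourierInv_toLp_ae_eq hφ1 hφ2).trans (ae_of_all _ fun y => ?_)
    exact Real.fourierInv_eq_fourier_neg φ y
  have e1 : ∫⁻ y, ENNReal.ofReal (‖y‖ ^ 2) * ‖ω y‖ₑ ^ 2 =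
      ∫⁻ y, ENNReal.ofReal (‖y‖ ^ 2) * ‖𝓕 φ y‖ₑ ^ 2 := by
    rw [← lintegral_neg_eq_self (fun y => ENNReal.ofReal (‖y‖ ^ 2) * ‖𝓕 φ y‖ₑ ^ 2)]
    refine lintegral_congr_ae ?_
    filter_upwards [hωe] with y hy
    rw [hy, norm_neg]
  have e2 := lintegral_norm_sq_mul_fourier hφC hφs
  have e3 : ∫⁻ y, ENNReal.ofReal ((2 * Real.pi * ‖y‖) ^ 2) * ‖𝓕 φ y‖ₑ ^ 2 =
      ENNReal.ofReal ((2 * Real.pi) ^ 2) * ∫⁻ y, ENNReal.ofReal (‖y‖ ^ 2) * ‖𝓕 φ y‖ₑ ^ 2 := by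
    rw [← lintegral_const_mul' _ _ ENNReal.ofReal_ne_top]
    refine lintegral_congr fun y => ?_
    rw [mul_pow, ENNReal.ofReal_mul (sq_nonneg _), mul_assoc]
  have e4 : ∀ j : Fin 3, ∫⁻ x, ‖fderiv ℝ φ x (EuclideanSpace.single j 1)‖ₑ ^ 2 =
      ENNReal.ofReal ((2 * Real.pi) ^ 2) *
        ∫⁻ x, ‖fderiv ℝ χ x (EuclideanSpace.single j 1)‖ₑ ^ 2 := fun j => by
    have hfd : ∀ x, fderiv ℝ φ x (EuclideanSpace.single j 1) = ((c * (2 * Real.pi) : ℝ) : ℂ) *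
        fderiv ℝ χ ((2 * Real.pi) • x) (EuclideanSpace.single j 1) := fun x => by
      have h1 := (((h.differentiable one_ne_zero) ((2 * Real.pi) • x)).hasFDerivAt.comp x
        ((hasFDerivAt_id x).const_smul (2 * Real.pi))).const_mul (c : ℂ)
      rw [HasFDerivAt.fderiv (f := φ) h1]
      simp
      ring
    simp_rw [hfd]
    have hpt : ∀ x : R3, ‖((c * (2 * Real.pi) : ℝ) : ℂ) *
        fderiv ℝ χ ((2 * Real.pi) • x) (EuclideanSpace.single j 1)‖ₑ ^ 2 =
        ENNReal.ofReal ((c * (2 * Real.pi)) ^ 2) *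
        ‖fderiv ℝ χ ((2 * Real.pi) • x) (EuclideanSpace.single j 1)‖ₑ ^ 2 := fun x =>
      (ofReal_mul_enorm_sq (by positivity) _).symm
    simp_rw [hpt]
    rw [lintegral_const_mul' _ _ ENNReal.ofReal_ne_top,
      lintegral_comp_smul_R3 hpi (fun x => ‖fderiv ℝ χ x (EuclideanSpace.single j 1)‖ₑ ^ 2),
      ← mul_assoc, ← ENNReal.ofReal_mul (by positivity)]
    congr 2
    rw [mul_pow, hcc]
    field_simp
  rw [e3] at e2
  simp_rw [e4] at e2
  rw [← Finset.mul_sum] at e2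
  rw [e1]
  exact (ENNReal.mul_right_inj (by simp) ENNReal.ofReal_ne_top).1 e2

/-- Completing the square with a test function in momentum space. -/
theorem two_re_inner_sub_le {ξ ζ : L2} (hζ : ζ =ᵐ[volume] fun y => ((1 / ‖y‖ : ℝ) : ℂ) * ξ y)
    {χ : R3 → ℂ} (h : ContDiff ℝ 1 χ) (hs : HasCompactSupport χ) (h2 : MemLp χ 2) {G : ℝ}
    (hG0 : 0 ≤ G)
    (hG : ∑ j : Fin 3, ∫⁻ x, ‖fderiv ℝ χ x (EuclideanSpace.single j 1)‖ₑ ^ 2 ≤ ENNReal.ofReal G) :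
    2 * (inner ℂ (h2.toLp χ) (fourierU ξ)).re - G ≤ ‖ζ‖ ^ 2 := by
  set ω := fourierU.symm (h2.toLp χ) with hω
  have h1 := lintegral_norm_sq_mul_fourierU_symm h hs h2
  rw [← hω] at h1
  have hm : AEStronglyMeasurable (fun y => (‖y‖ : ℂ) * ω y) :=
    aestronglyMeasurable_weight_mul (w := fun y => ‖y‖) (by fun_prop) ω
  have hlin : ∫⁻ y, ‖(‖y‖ : ℂ) * ω y‖ₑ ^ 2 ≤ ENNReal.ofReal G := by
    refine le_trans (le_of_eq ?_) (h1.le.trans hG)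
    refine lintegral_congr fun y => (ofReal_mul_enorm_sq (norm_nonneg y) _).symm
  have hmem : MemLp (fun y => (‖y‖ : ℂ) * ω y) 2 :=
    (memLp_two_iff hm).2 (hlin.trans_lt ENNReal.ofReal_lt_top)
  set κ := hmem.toLp _ with hκ
  have hκG : ‖κ‖ ^ 2 ≤ G := by
    rw [← ENNReal.ofReal_le_ofReal_iff hG0, ← enorm_sq_eq_ofReal, enorm_sq_eq_lintegral]
    refine le_trans (le_of_eq ?_) hlin
    refine lintegral_congr_ae ?_
    filter_upwards [hmem.coeFn_toLp] with y hy
    rw [hκ, hy]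
  have hin : inner ℂ (h2.toLp χ) (fourierU ξ) = inner ℂ κ ζ := by
    have : h2.toLp χ = fourierU ω := by rw [hω, LinearIsometryEquiv.apply_symm_apply]
    rw [this, fourierU.inner_map_map, inner_eq_integral, inner_eq_integral]
    refine integral_congr_ae ?_
    filter_upwards [hmem.coeFn_toLp, hζ, ae_ne_zero_R3] with y hy hy2 hy0
    rw [hκ, hy, hy2, map_mul, Complex.conj_ofReal]
    have : (‖y‖ : ℂ) ≠ 0 := by simpa using hy0
    push_cast
    field_simp
  rw [hin]
  have h3 : (inner ℂ κ ζ).re ≤ ‖κ‖ * ‖ζ‖ := (Complex.re_le_norm _).trans (norm_inner_le_norm _ _)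
  nlinarith [sq_nonneg (‖κ‖ - ‖ζ‖)]

/-! ### A lower bound for the Newton potential -/

/-- The radial function on momentum space with radial derivative `-G`, vanishing for `|p| ≥ b`. -/
def radialPrimitive (G : ℝ → ℂ) (b : ℝ) (p : R3) : ℂ := ∫ t in ‖p‖..b, G t

theorem hasDerivAt_radialPrimitive_sqrt {G : ℝ → ℂ} {a b : ℝ} (hG : Continuous G) (ha : 0 < a)
    (hGa : ∀ t ≤ a, G t = 0) (s : ℝ) :
    HasDerivAt (fun s => ∫ t in √s..b, G t) (-(((1 / (2 * √s) : ℝ) : ℂ) * G √s)) s := by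
  rcases lt_or_ge 0 s with hs | hs
  · have h1 : HasDerivAt (fun u => ∫ t in u..b, G t) (-G √s) √s := by
      have := ((hG.integral_hasStrictDerivAt b √s).hasDerivAt).fun_neg
      refine this.congr_of_eventuallyEq (Eventually.of_forall fun u => ?_)
      exact intervalIntegral.integral_symm _ _
    have h2 := h1.scomp s (Real.hasDerivAt_sqrt hs.ne')
    refine h2.congr_deriv ?_
    rw [Complex.real_smul]; ring
  · rw [Real.sqrt_eq_zero_of_nonpos hs, hGa 0 ha.le]
    simp only [mul_zero, neg_zero]
    refine (hasDerivAt_const s (∫ t in (0 : ℝ)..b, G t)).congr_of_eventuallyEq ?_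
    filter_upwards [Iio_mem_nhds (show s < a ^ 2 by nlinarith)] with u hu
    have hua : √u ≤ a := Real.sqrt_le_iff.2 ⟨ha.le, (mem_Iio.1 hu).le⟩
    have h0 : ∫ t in (0 : ℝ)..√u, G t = 0 := by
      refine (intervalIntegral.integral_congr fun t ht => ?_).trans (intervalIntegral.integral_zero)
      rw [uIcc_of_le (Real.sqrt_nonneg u)] at ht
      exact hGa t (ht.2.trans hua)
    rw [← intervalIntegral.integral_add_adjacent_intervals (hG.intervalIntegrable 0 √u)
      (hG.intervalIntegrable √u b), h0, zero_add]

theorem radialPrimitive_eq_comp (G : ℝ → ℂ) (b : ℝ) :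
    radialPrimitive G b = (fun s => ∫ t in √s..b, G t) ∘ fun p : R3 => ‖p‖ ^ 2 := by
  ext p
  simp [radialPrimitive, Real.sqrt_sq]

theorem contDiff_radialPrimitive {G : ℝ → ℂ} {a b : ℝ} (hG : Continuous G) (ha : 0 < a)
    (hGa : ∀ t ≤ a, G t = 0) : ContDiff ℝ 1 (radialPrimitive G b) := by
  have hd := hasDerivAt_radialPrimitive_sqrt (b := b) hG ha hGa
  rw [radialPrimitive_eq_comp]
  refine ContDiff.comp (contDiff_one_iff_deriv.2 ⟨fun s => (hd s).differentiableAt, ?_⟩)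
    (contDiff_norm_sq ℝ)
  have e : deriv (fun s => ∫ t in √s..b, G t) =
      fun s => -(((1 / (2 * max √s a) : ℝ) : ℂ) * G √s) := by
    ext s
    rw [(hd s).deriv]
    rcases le_total √s a with h | h
    · simp [hGa _ h]
    · rw [max_eq_left h]
  rw [e]
  have h1 : Continuous fun s => 1 / (2 * max √s a) :=
    continuous_const.div (by fun_prop) fun s => by positivity
  exact ((Complex.continuous_ofReal.comp h1).mul (hG.comp Real.continuous_sqrt)).neg

theorem radialPrimitive_eq_zero {G : ℝ → ℂ} {b : ℝ} (hGb : ∀ t, b ≤ t → G t = 0) {p : R3}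
    (hp : b ≤ ‖p‖) : radialPrimitive G b p = 0 := by
  refine (intervalIntegral.integral_congr fun t ht => ?_).trans (intervalIntegral.integral_zero)
  rw [uIcc_of_ge hp] at ht
  exact hGb t ht.1

theorem hasCompactSupport_radialPrimitive {G : ℝ → ℂ} {b : ℝ} (hGb : ∀ t, b ≤ t → G t = 0) :
    HasCompactSupport (radialPrimitive G b) :=
  HasCompactSupport.intro (isCompact_closedBall (0 : R3) b) fun p hp =>
    radialPrimitive_eq_zero hGb (by simpa using (not_le.1 fun h => hp (by simpa using h)).le)

theorem sum_fderiv_radialPrimitive {G : ℝ → ℂ} {a b : ℝ} (hG : Continuous G) (ha : 0 < a)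
    (hGa : ∀ t ≤ a, G t = 0) (p : R3) :
    ∑ j : Fin 3, ‖fderiv ℝ (radialPrimitive G b) p (EuclideanSpace.single j 1)‖ₑ ^ 2 =
      ‖G ‖p‖‖ₑ ^ 2 := by
  have hd := hasDerivAt_radialPrimitive_sqrt (b := b) hG ha hGa (‖p‖ ^ 2)
  rw [Real.sqrt_sq (norm_nonneg p)] at hd
  have hf := HasFDerivAt.comp (𝕜 := ℝ) p hd.hasFDerivAt (hasStrictFDerivAt_norm_sq p).hasFDerivAt
  rw [← radialPrimitive_eq_comp] at hf
  have hval : ∀ j : Fin 3, fderiv ℝ (radialPrimitive G b) p (EuclideanSpace.single j 1) =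
      ((p j / ‖p‖ : ℝ) : ℂ) * -G ‖p‖ := fun j => by
    rw [hf.fderiv]
    simp [EuclideanSpace.inner_single_right]
    field_simp
  simp_rw [hval]
  have h2 : ∀ j : Fin 3, ‖((p j / ‖p‖ : ℝ) : ℂ) * -G ‖p‖‖ₑ ^ 2 =
      ENNReal.ofReal ((p j / ‖p‖) ^ 2) * ‖G ‖p‖‖ₑ ^ 2 := fun j => by
    rw [enorm_mul, enorm_neg, mul_pow, enorm_ofReal_complex, ← Real.enorm_abs,
      Real.enorm_of_nonneg (abs_nonneg _), ← ENNReal.ofReal_pow (abs_nonneg _), sq_abs]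
  simp_rw [h2]
  rw [← Finset.sum_mul, ← ENNReal.ofReal_sum_of_nonneg fun j _ => sq_nonneg _]
  simp_rw [div_pow]
  rw [← Finset.sum_div, ← EuclideanSpace.real_norm_sq_eq]
  by_cases hp : ‖p‖ = 0
  · simp [hp, hGa 0 ha.le]
  · rw [div_self (pow_ne_zero 2 hp)]
    simp

theorem radialPrimitive_eq_integral {G : ℝ → ℂ} {b : ℝ} (hGb : ∀ t, b ≤ t → G t = 0) (p : R3) :
    radialPrimitive G b p = ∫ t, ((if ‖p‖ < t then 1 else 0 : ℝ) : ℂ) * G t := by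
  have h1 : (fun t => ((if ‖p‖ < t then 1 else 0 : ℝ) : ℂ) * G t) = (Ioi ‖p‖).indicator G := by
    ext t
    by_cases h : ‖p‖ < t <;> simp [h]
  rw [h1, integral_indicator measurableSet_Ioi]
  rcases le_total ‖p‖ b with h | h
  · rw [radialPrimitive, intervalIntegral.integral_of_le h]
    refine (setIntegral_eq_of_subset_of_forall_sdiff_eq_zero measurableSet_Ioi Ioc_subset_Ioi_self
      fun t ht => hGb t ?_).symm
    by_contra hlt
    exact ht.2 ⟨ht.1, (not_le.1 hlt).le⟩
  · rw [radialPrimitive_eq_zero hGb h, setIntegral_eq_zero_of_forall_eq_zero]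
    exact fun t ht => hGb t (h.trans (mem_Ioi.1 ht).le)

theorem measurable_lt_indicator {α : Type*} [MeasurableSpace α] {t : α → ℝ} {q : α → R3}
    (ht : Measurable t) (hq : Measurable q) :
    Measurable fun x => ((if ‖q x‖ < t x then 1 else 0 : ℝ) : ℂ) :=
  Complex.measurable_ofReal.comp
    (Measurable.ite (measurableSet_lt hq.norm ht) measurable_const measurable_const)

/-- `∫_{|q| < t} f(q) dq`. -/
def ballIntegral (f : R3 → ℂ) (t : ℝ) : ℂ := ∫ q, ((if ‖q‖ < t then 1 else 0 : ℝ) : ℂ) * f q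

theorem norm_lt_indicator_mul_le (q : R3) (t : ℝ) (z : ℂ) :
    ‖((if ‖q‖ < t then 1 else 0 : ℝ) : ℂ) * z‖ ≤ ‖z‖ := by
  split_ifs <;> simp

theorem aestronglyMeasurable_lt_indicator_mul {f : R3 → ℂ} (hf : AEStronglyMeasurable f) (t : ℝ) :
    AEStronglyMeasurable fun q => ((if ‖q‖ < t then 1 else 0 : ℝ) : ℂ) * f q :=
  (measurable_lt_indicator measurable_const measurable_id).aestronglyMeasurable.mul hf

theorem ae_norm_ne (t : ℝ) : ∀ᵐ q : R3, ‖q‖ ≠ t := by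
  rw [ae_iff]
  have : {q : R3 | ¬‖q‖ ≠ t} = Metric.sphere 0 t := by ext; simp
  rw [this]
  exact Measure.addHaar_sphere _ _ _

theorem continuous_ballIntegral {f : R3 → ℂ} (hf : Integrable f) : Continuous (ballIntegral f) := by
  refine continuous_iff_continuousAt.2 fun t => ?_
  refine continuousAt_of_dominated (bound := fun q => ‖f q‖)
    (Eventually.of_forall fun s => aestronglyMeasurable_lt_indicator_mul hf.1 s)
    (Eventually.of_forall fun s => ae_of_all _ fun q => norm_lt_indicator_mul_le q s _) hf.norm ?_
  filter_upwards [ae_norm_ne t] with q hq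
  rcases lt_or_gt_of_ne hq with h | h
  · refine (continuousAt_const (y := f q)).congr ?_
    filter_upwards [lt_mem_nhds h] with s hs
    simp [hs]
  · refine (continuousAt_const (y := (0 : ℂ))).congr ?_
    filter_upwards [gt_mem_nhds h] with s hs
    simp [not_lt.2 hs.le]

/-- The kernel `∫_{max(|p|,|q|)}^∞ v`. -/
def tailKernel (v : ℝ → ℝ) (p q : R3) : ℝ :=
  ∫ t, v t * ((if ‖p‖ < t then 1 else 0) * (if ‖q‖ < t then 1 else 0))

/-- Layer-cake form of the energy of the kernel `∫_{max(|p|,|q|)}^∞ v`: it depends on `f` only through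
the charge enclosed in balls. -/
theorem integral_normSq_ballIntegral {f : R3 → ℂ} (hf : Integrable f) {v : ℝ → ℝ}
    (hv : Integrable v) :
    ∫ t, (v t : ℂ) * (conj (ballIntegral f t) * ballIntegral f t) =
      ∫ z, kerFun (tailKernel v) f f z ∂((volume : Measure R3).prod volume) := by
  set e : ℝ → R3 → ℂ := fun t q => ((if ‖q‖ < t then 1 else 0 : ℝ) : ℂ) with he
  set H : ℝ → R3 × R3 → ℂ := fun t z => (v t : ℂ) * (conj (e t z.1 * f z.1) * (e t z.2 * f z.2))
    with hH
  have h1 : ∀ t, (v t : ℂ) * (conj (ballIntegral f t) * ballIntegral f t) =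
      ∫ z, H t z ∂((volume : Measure R3).prod volume) := fun t => by
    simp only [hH, ballIntegral]
    rw [integral_const_mul, integral_prod_mul (fun p => conj (e t p * f p)) (fun q => e t q * f q),
      integral_conj]
  simp_rw [h1]
  have hmeas : AEStronglyMeasurable (Function.uncurry H)
      ((volume : Measure ℝ).prod ((volume : Measure R3).prod volume)) := by
    have m1 : AEStronglyMeasurable (fun w : ℝ × (R3 × R3) => (v w.1 : ℂ))
        ((volume : Measure ℝ).prod ((volume : Measure R3).prod volume)) :=
      (Complex.continuous_ofReal.comp_aestronglyMeasurable hv.1).comp_fst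
    have m2 : AEStronglyMeasurable (fun w : ℝ × (R3 × R3) => f w.2.1)
        ((volume : Measure ℝ).prod ((volume : Measure R3).prod volume)) :=
      (hf.1.comp_fst (ν := (volume : Measure R3))).comp_snd
    have m3 : AEStronglyMeasurable (fun w : ℝ × (R3 × R3) => f w.2.2)
        ((volume : Measure ℝ).prod ((volume : Measure R3).prod volume)) :=
      (hf.1.comp_snd (μ := (volume : Measure R3))).comp_snd
    have m4 : Measurable fun w : ℝ × (R3 × R3) => e w.1 w.2.1 :=
      measurable_lt_indicator measurable_fst (measurable_fst.comp measurable_snd)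
    have m5 : Measurable fun w : ℝ × (R3 × R3) => e w.1 w.2.2 :=
      measurable_lt_indicator measurable_fst (measurable_snd.comp measurable_snd)
    exact m1.mul ((Complex.continuous_conj.comp_aestronglyMeasurable
      (m4.aestronglyMeasurable.mul m2)).mul (m5.aestronglyMeasurable.mul m3))
  have hint : Integrable (Function.uncurry H)
      ((volume : Measure ℝ).prod ((volume : Measure R3).prod volume)) := by
    have hb := (hv.norm).mul_prod ((hf.norm).mul_prod hf.norm)
    refine hb.mono hmeas (ae_of_all _ fun w => ?_)
    simp only [Function.uncurry, hH, norm_mul, RCLike.norm_conj, Complex.norm_real, norm_norm]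
    gcongr
    · have := norm_lt_indicator_mul_le w.2.1 w.1 (f w.2.1)
      rwa [norm_mul] at this
    · have := norm_lt_indicator_mul_le w.2.2 w.1 (f w.2.2)
      rwa [norm_mul] at this
  rw [integral_integral_swap hint]
  refine integral_congr_ae (ae_of_all _ fun z => ?_)
  simp only [hH, kerFun, tailKernel, he]
  rw [← integral_complex_ofReal, mul_assoc, mul_comm (∫ t, _), ← mul_assoc, ← integral_const_mul]
  refine integral_congr_ae (ae_of_all _ fun t => ?_)
  simp only [map_mul, Complex.conj_ofReal]
  push_cast
  ring

/-- `newton_inequality` with a compactly supported `v ≤ t⁻²` in place of `t⁻²`. The square is completed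
with the potential of the spherically averaged charge as test function: the radial function with
derivative `-(1 / 4π) v(t) m(t)`, where `m(t)` is the charge in the ball of radius `t`. -/
theorem newton_truncated {ξ ζ : L2} (hζ : ζ =ᵐ[volume] fun y => ((1 / ‖y‖ : ℝ) : ℂ) * ξ y)
    {v : ℝ → ℝ} {a b : ℝ} (hv : Continuous v) (hv0 : ∀ t, 0 ≤ v t) (ha : 0 < a)
    (hva : ∀ t ≤ a, v t = 0) (hvb : ∀ t, b ≤ t → v t = 0) (hv1 : ∀ t, t ^ 2 * v t ≤ 1) :
    1 / (4 * Real.pi) * (∫ z, kerFun (tailKernel v) (fourierU ξ) (fourierU ξ) z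
      ∂((volume : Measure R3).prod volume)).re ≤ ‖ζ‖ ^ 2 := by
  have hpi := Real.pi_pos
  -- charge outside the ball of radius `b` plays no role, and inside `ξ̂` is integrable
  set f : R3 → ℂ := (Metric.ball (0 : R3) b).indicator (fourierU ξ) with hf
  have hfi : Integrable f := by
    rw [hf, integrable_indicator_iff measurableSet_ball]
    have : IsFiniteMeasure ((volume : Measure R3).restrict (Metric.ball 0 b)) :=
      ⟨by rw [Measure.restrict_apply_univ]; exact measure_ball_lt_top⟩
    exact ((Lp.memLp (fourierU ξ)).restrict _).integrable (by norm_num)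
  have hfeq : ∀ p, ‖p‖ < b → f p = fourierU ξ p := fun p hp => by
    rw [hf, indicator_of_mem (by simpa using hp)]
  have hfeq0 : ∀ p, b ≤ ‖p‖ → f p = 0 := fun p hp => by
    rw [hf, indicator_of_notMem (by simpa using hp)]
  have hvs : HasCompactSupport v := HasCompactSupport.intro (isCompact_Icc (a := a) (b := b))
    fun t ht => by
      by_contra h
      refine ht ⟨?_, ?_⟩ <;> by_contra h2
      · exact h (hva t (not_le.1 h2).le)
      · exact h (hvb t (not_le.1 h2).le)
  have hvi : Integrable v := hv.integrable_of_hasCompactSupport hvs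
  set m := ballIntegral f with hm
  have hmc : Continuous m := continuous_ballIntegral hfi
  set S : ℝ := ∫ t, v t * ‖m t‖ ^ 2 with hS
  have hSi : Integrable fun t => v t * ‖m t‖ ^ 2 :=
    (hv.mul (hmc.norm.pow 2)).integrable_of_hasCompactSupport hvs.mul_right
  have hS0 : 0 ≤ S := integral_nonneg fun t => mul_nonneg (hv0 t) (sq_nonneg _)
  have hconj : ∀ z : ℂ, conj z * z = ((‖z‖ ^ 2 : ℝ) : ℂ) := fun z => by
    rw [mul_comm, Complex.mul_conj, Complex.normSq_eq_norm_sq]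
  have hK : ∫ z, kerFun (tailKernel v) (fourierU ξ) (fourierU ξ) z
      ∂((volume : Measure R3).prod volume) = (S : ℂ) := by
    have h1 : kerFun (tailKernel v) (fourierU ξ) (fourierU ξ) = kerFun (tailKernel v) f f := by
      ext z
      have hz : ∀ p q : R3, b ≤ ‖p‖ ∨ b ≤ ‖q‖ → tailKernel v p q = 0 := fun p q h => by
        rw [tailKernel]
        refine integral_eq_zero_of_ae (ae_of_all _ fun t => ?_)
        simp only [Pi.zero_apply]
        rcases le_total b t with hb | hb
        · rw [hvb t hb, zero_mul]
        · rcases h with h | h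
          · rw [if_neg (not_lt.2 (hb.trans h))]; simp
          · rw [if_neg (not_lt.2 (hb.trans h))]; simp
      by_cases hc : b ≤ ‖z.1‖ ∨ b ≤ ‖z.2‖
      · simp [kerFun, hz _ _ hc]
      · push Not at hc
        simp only [kerFun]
        rw [hfeq _ hc.1, hfeq _ hc.2]
    rw [h1, ← integral_normSq_ballIntegral hfi hvi, hS, ← integral_complex_ofReal]
    refine integral_congr_ae (ae_of_all _ fun t => ?_)
    simp only [← hm]
    rw [hconj]; push_cast; ring
  rw [hK, Complex.ofReal_re]
  set G : ℝ → ℂ := fun t => ((1 / (4 * Real.pi) * v t : ℝ) : ℂ) * m t with hG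
  have hGc : Continuous G := (Complex.continuous_ofReal.comp (by fun_prop)).mul hmc
  have hGa : ∀ t ≤ a, G t = 0 := fun t ht => by simp [hG, hva t ht]
  have hGb : ∀ t, b ≤ t → G t = 0 := fun t ht => by simp [hG, hvb t ht]
  have hGi : Integrable G :=
    hGc.integrable_of_hasCompactSupport (HasCompactSupport.mul_right
      (hvs.comp_left (g := fun x => ((1 / (4 * Real.pi) * x : ℝ) : ℂ)) (by simp)))
  have hC1 : ContDiff ℝ 1 (radialPrimitive G b) := contDiff_radialPrimitive hGc ha hGa
  have hCs := hasCompactSupport_radialPrimitive hGb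
  have hC2 : MemLp (radialPrimitive G b) 2 := hC1.continuous.memLp_of_hasCompactSupport hCs
  have hnormG : ∀ t, ‖G t‖ₑ ^ 2 = ENNReal.ofReal ((1 / (4 * Real.pi) * v t) ^ 2 * ‖m t‖ ^ 2) :=
    fun t => by
      rw [hG]
      simp only
      rw [← ofReal_mul_enorm_sq (mul_nonneg (by positivity) (hv0 t)), ← ofReal_norm,
        ← ENNReal.ofReal_pow (norm_nonneg _), ← ENNReal.ofReal_mul (sq_nonneg _)]
  have hgrad : ∑ j : Fin 3, ∫⁻ x, ‖fderiv ℝ (radialPrimitive G b) x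
      (EuclideanSpace.single j 1)‖ₑ ^ 2 ≤ ENNReal.ofReal (1 / (4 * Real.pi) * S) := by
    rw [← lintegral_finsetSum _ fun j _ => ?_]
    · simp_rw [sum_fderiv_radialPrimitive hGc ha hGa]
      rw [lintegral_norm (fun r => ‖G r‖ₑ ^ 2) (hGc.measurable.enorm.pow_const 2), hS,
        ← integral_const_mul, ofReal_integral_eq_lintegral_ofReal (hSi.const_mul _)
          (ae_of_all _ fun t => mul_nonneg (by positivity) (mul_nonneg (hv0 t) (sq_nonneg _)))]
      refine (lintegral_mono fun t => ?_).trans (setLIntegral_le_lintegral _ _)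
      rw [hnormG, ← ENNReal.ofReal_mul (by positivity)]
      refine ENNReal.ofReal_le_ofReal ?_
      -- the weight `t²` of polar coordinates absorbs one factor `v` because `t² v ≤ 1`
      have h1 := mul_le_mul_of_nonneg_right (hv1 t) (mul_nonneg (hv0 t) (sq_nonneg ‖m t‖))
      calc _ = 1 / (4 * Real.pi) * (t ^ 2 * v t * (v t * ‖m t‖ ^ 2)) := by field_simp
        _ ≤ 1 / (4 * Real.pi) * (1 * (v t * ‖m t‖ ^ 2)) :=
          mul_le_mul_of_nonneg_left h1 (by positivity)
        _ = _ := by ring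
    · exact (((hC1.continuous_fderiv one_ne_zero).clm_apply continuous_const).measurable.enorm.pow_const 2)
  have hinner : inner ℂ (hC2.toLp _) (fourierU ξ) = ((1 / (4 * Real.pi) * S : ℝ) : ℂ) := by
    rw [inner_eq_integral]
    set e : ℝ → R3 → ℂ := fun t q => ((if ‖q‖ < t then 1 else 0 : ℝ) : ℂ) with he
    have h1 : ∫ p, conj (hC2.toLp _ p) * fourierU ξ p = ∫ p, ∫ t, conj (G t) * (e t p * f p) := by
      refine integral_congr_ae ?_
      filter_upwards [hC2.coeFn_toLp] with p hp
      have h2 : conj (radialPrimitive G b p) = ∫ t, conj (G t) * e t p := by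
        rw [radialPrimitive_eq_integral hGb, ← integral_conj]
        refine integral_congr_ae (ae_of_all _ fun t => ?_)
        simp only [map_mul, Complex.conj_ofReal, he]; ring
      rw [hp]
      have h3 : conj (radialPrimitive G b p) * fourierU ξ p = conj (radialPrimitive G b p) * f p := by
        rcases lt_or_ge ‖p‖ b with h | h
        · rw [hfeq p h]
        · rw [radialPrimitive_eq_zero hGb h]; simp
      rw [h3, h2, ← integral_mul_const]
      refine integral_congr_ae (ae_of_all _ fun t => ?_)
      simp only; ring
    have hint : Integrable (Function.uncurry fun (p : R3) (t : ℝ) => conj (G t) * (e t p * f p))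
        ((volume : Measure R3).prod volume) := by
      have hb := (hfi.norm).mul_prod hGi.norm
      refine hb.mono ?_ (ae_of_all _ fun w => ?_)
      · have m1 : AEStronglyMeasurable (fun w : R3 × ℝ => f w.1)
            ((volume : Measure R3).prod volume) := hfi.1.comp_fst
        have m4 : Measurable fun w : R3 × ℝ => e w.2 w.1 :=
          measurable_lt_indicator measurable_snd measurable_fst
        have m2 : Measurable fun w : R3 × ℝ => conj (G w.2) :=
          ((Complex.continuous_conj.comp hGc).comp continuous_snd).measurable
        exact m2.aestronglyMeasurable.mul (m4.aestronglyMeasurable.mul m1)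
      · simp only [Function.uncurry]
        rw [norm_mul, RCLike.norm_conj, norm_mul (‖f w.1‖), norm_norm, norm_norm, mul_comm]
        exact mul_le_mul_of_nonneg_right (norm_lt_indicator_mul_le _ _ _) (norm_nonneg _)
    rw [h1, integral_integral_swap hint, hS, ← integral_const_mul, ← integral_complex_ofReal]
    refine integral_congr_ae (ae_of_all _ fun t => ?_)
    simp only
    rw [integral_const_mul]
    change conj (G t) * m t = _
    rw [hG]
    simp only [map_mul, Complex.conj_ofReal]
    rw [mul_assoc, hconj]
    push_cast; ring
  have h := two_re_inner_sub_le hζ hC1 hCs hC2 (G := 1 / (4 * Real.pi) * S) (by positivity) hgrad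
  rw [hinner, Complex.ofReal_re] at h
  linarith

/-- Compactly supported truncations of `t ↦ t⁻²` on the half line. -/
def invSqCut (n : ℕ) (t : ℝ) : ℝ :=
  max 0 (min 1 (min (((n : ℝ) + 1) * t - 1) ((n : ℝ) + 1 - t))) / (max t (1 / ((n : ℝ) + 1))) ^ 2

theorem continuous_invSqCut (n : ℕ) : Continuous (invSqCut n) := by
  unfold invSqCut
  refine Continuous.div (by fun_prop) (by fun_prop) fun t => ?_
  positivity

theorem invSqCut_nonneg (n : ℕ) (t : ℝ) : 0 ≤ invSqCut n t := by
  unfold invSqCut; positivity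

theorem invSqCut_eq_zero_of_le (n : ℕ) {t : ℝ} (ht : t ≤ 1 / ((n : ℝ) + 1)) : invSqCut n t = 0 := by
  have hn : (0 : ℝ) < (n : ℝ) + 1 := by positivity
  rw [invSqCut, max_eq_left, zero_div]
  refine (min_le_right _ _).trans ((min_le_left _ _).trans ?_)
  rw [le_div_iff₀ hn] at ht
  linarith

theorem invSqCut_eq_zero_of_ge (n : ℕ) {t : ℝ} (ht : (n : ℝ) + 1 ≤ t) : invSqCut n t = 0 := by
  rw [invSqCut, max_eq_left, zero_div]
  exact (min_le_right _ _).trans ((min_le_right _ _).trans (by linarith))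

theorem sq_mul_invSqCut_le (n : ℕ) (t : ℝ) : t ^ 2 * invSqCut n t ≤ 1 := by
  have hn : (0 : ℝ) < (n : ℝ) + 1 := by positivity
  rcases le_total t (1 / ((n : ℝ) + 1)) with h | h
  · rw [invSqCut_eq_zero_of_le n h]; simp
  · have ht : 0 < t := lt_of_lt_of_le (by positivity) h
    rw [invSqCut, max_eq_left h, mul_div_cancel₀ _ (by positivity)]
    exact max_le zero_le_one (min_le_left _ _)

theorem invSqCut_le (n : ℕ) {t : ℝ} (ht : 0 < t) : invSqCut n t ≤ t ^ (-2 : ℝ) := by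
  have := sq_mul_invSqCut_le n t
  rw [Real.rpow_neg ht.le, Real.rpow_ofNat, inv_eq_one_div, le_div_iff₀ (by positivity), mul_comm]
  exact this

theorem eventually_invSqCut_eq {t : ℝ} (ht : 0 < t) :
    ∀ᶠ n : ℕ in atTop, invSqCut n t = t ^ (-2 : ℝ) := by
  obtain ⟨N, hN⟩ := exists_nat_ge (max (2 / t) (t + 1))
  filter_upwards [eventually_ge_atTop N] with n hn
  have hn' : (N : ℝ) ≤ n := by exact_mod_cast hn
  have h1 : 2 / t ≤ (n : ℝ) + 1 := by linarith [(le_max_left _ _).trans hN]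
  have h2 : t + 1 ≤ (n : ℝ) := ((le_max_right _ _).trans hN).trans hn'
  rw [div_le_iff₀ ht] at h1
  have h3 : 1 / ((n : ℝ) + 1) ≤ t := by
    rw [div_le_iff₀ (by positivity)]; linarith
  rw [invSqCut, max_eq_left h3, min_eq_left (le_min (by linarith) (by linarith)),
    max_eq_right zero_le_one, Real.rpow_neg ht.le, Real.rpow_ofNat, one_div]

theorem tailKernel_eq (v : ℝ → ℝ) (p q : R3) :
    tailKernel v p q = ∫ t in Ioi (max ‖p‖ ‖q‖), v t := by
  rw [tailKernel, ← integral_indicator measurableSet_Ioi]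
  refine integral_congr_ae (ae_of_all _ fun t => ?_)
  simp only [indicator, mem_Ioi, max_lt_iff]
  by_cases h1 : ‖p‖ < t <;> by_cases h2 : ‖q‖ < t <;> simp [h1, h2]

theorem integral_rpow_neg_two {M : ℝ} (hM : 0 < M) : ∫ t in Ioi M, t ^ (-2 : ℝ) = 1 / M := by
  rw [integral_Ioi_rpow_of_lt (by norm_num) hM]
  norm_num
  rw [Real.rpow_neg_one]

theorem tailKernel_invSqCut_le (n : ℕ) {p q : R3} (hp : p ≠ 0) :
    |tailKernel (invSqCut n) p q| ≤ 1 / max ‖p‖ ‖q‖ := by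
  have hM : 0 < max ‖p‖ ‖q‖ := lt_max_of_lt_left (norm_pos_iff.2 hp)
  rw [tailKernel_eq, abs_of_nonneg (setIntegral_nonneg measurableSet_Ioi fun t _ =>
    invSqCut_nonneg n t), ← integral_rpow_neg_two hM]
  refine integral_mono_of_nonneg (ae_of_all _ fun t => invSqCut_nonneg n t)
    (integrableOn_Ioi_rpow_of_lt (by norm_num) hM) ?_
  filter_upwards [ae_restrict_mem measurableSet_Ioi] with t ht
  exact invSqCut_le n (hM.trans ht)

theorem tendsto_tailKernel_invSqCut {p q : R3} (hp : p ≠ 0) :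
    Tendsto (fun n => tailKernel (invSqCut n) p q) atTop (𝓝 (1 / max ‖p‖ ‖q‖)) := by
  have hM : 0 < max ‖p‖ ‖q‖ := lt_max_of_lt_left (norm_pos_iff.2 hp)
  simp_rw [tailKernel_eq]
  rw [← integral_rpow_neg_two hM]
  refine tendsto_integral_of_dominated_convergence (fun t => t ^ (-2 : ℝ))
    (fun n => (continuous_invSqCut n).aestronglyMeasurable)
    (integrableOn_Ioi_rpow_of_lt (by norm_num) hM) (fun n => ?_) ?_
  · filter_upwards [ae_restrict_mem measurableSet_Ioi] with t ht
    rw [Real.norm_of_nonneg (invSqCut_nonneg n t)]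
    exact invSqCut_le n (hM.trans ht)
  · filter_upwards [ae_restrict_mem measurableSet_Ioi] with t ht
    exact tendsto_const_nhds.congr' ((eventually_invSqCut_eq (hM.trans ht)).mono fun n hn => hn.symm)

theorem measurable_tailKernel {v : ℝ → ℝ} (hv : Measurable v) :
    Measurable (Function.uncurry (tailKernel v)) := by
  have h : StronglyMeasurable fun w : (R3 × R3) × ℝ =>
      v w.2 * ((if ‖w.1.1‖ < w.2 then 1 else 0) * (if ‖w.1.2‖ < w.2 then 1 else 0)) := by
    refine Measurable.stronglyMeasurable ?_
    refine (hv.comp measurable_snd).mul (Measurable.mul ?_ ?_)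
    · exact Measurable.ite (measurableSet_lt (by fun_prop) (by fun_prop)) measurable_const
        measurable_const
    · exact Measurable.ite (measurableSet_lt (by fun_prop) (by fun_prop)) measurable_const
        measurable_const
  exact (h.integral_prod_right (ν := volume)).measurable

/-- Newton's theorem as an inequality: the Coulomb energy of a charge density in momentum space is
bounded below by that of its spherical average. -/
theorem newton_inequality {ξ ζ : L2} (hζ : ζ =ᵐ[volume] fun y => ((1 / ‖y‖ : ℝ) : ℂ) * ξ y)
    (hint : Integrable (kerFun (fun p q => 1 / max ‖p‖ ‖q‖) (fourierU ξ) (fourierU ξ))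
      ((volume : Measure R3).prod volume)) :
    1 / (4 * Real.pi) * (∫ z, kerFun (fun p q => 1 / max ‖p‖ ‖q‖) (fourierU ξ) (fourierU ξ) z
      ∂((volume : Measure R3).prod volume)).re ≤ ‖ζ‖ ^ 2 := by
  have hne : ∀ᵐ z ∂((volume : Measure R3).prod volume), z.1 ≠ 0 :=
    (Measure.quasiMeasurePreserving_fst (μ := (volume : Measure R3))
      (ν := (volume : Measure R3))).ae ae_ne_zero_R3
  have hlim : Tendsto (fun n => ∫ z, kerFun (tailKernel (invSqCut n)) (fourierU ξ) (fourierU ξ) z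
      ∂((volume : Measure R3).prod volume)) atTop
      (𝓝 (∫ z, kerFun (fun p q => 1 / max ‖p‖ ‖q‖) (fourierU ξ) (fourierU ξ) z
      ∂((volume : Measure R3).prod volume))) := by
    refine tendsto_integral_of_dominated_convergence _ (fun n => ?_) hint.norm (fun n => ?_) ?_
    · exact aestronglyMeasurable_kerFun (measurable_tailKernel (continuous_invSqCut n).measurable)
        (Lp.aestronglyMeasurable _) (Lp.aestronglyMeasurable _)
    · filter_upwards [hne] with z hz
      simp only [kerFun, norm_mul, RCLike.norm_conj, Complex.norm_real]
      gcongr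
      rw [Real.norm_of_nonneg (r := 1 / max ‖z.1‖ ‖z.2‖) (by positivity)]
      exact tailKernel_invSqCut_le n hz
    · filter_upwards [hne] with z hz
      exact (((Complex.continuous_ofReal.tendsto _).comp
        (tendsto_tailKernel_invSqCut hz)).const_mul _).mul_const _
  refine le_of_tendsto' (((Complex.continuous_re.tendsto _).comp hlim).const_mul _) fun n => ?_
  exact newton_truncated hζ (continuous_invSqCut n) (invSqCut_nonneg n)
    (show (0 : ℝ) < 1 / ((n : ℝ) + 1) by positivity) (fun t ht => invSqCut_eq_zero_of_le n ht)
    (fun t ht => invSqCut_eq_zero_of_ge n ht) (sq_mul_invSqCut_le n)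

/-! ### The Skornyakov–Ter-Martirosyan kernel: sharp constants -/

theorem log_ratio_nonneg {y p : ℝ} (hp : 0 < p) :
    0 ≤ Real.log ((y ^ 2 + 3 * p) / (y ^ 2 + p)) := by
  refine Real.log_nonneg ?_
  rw [one_le_div (by positivity)]
  linarith

theorem tendsto_mul_log_ratio {p : ℝ} (hp : 0 < p) {l : Filter ℝ} {y : ℝ → ℝ}
    (h : Tendsto (fun r => |y r|) l atTop) :
    Tendsto (fun r => y r * Real.log ((y r ^ 2 + 3 * p) / (y r ^ 2 + p))) l (𝓝 0) := by
  refine squeeze_zero_norm' (a := fun r => 2 * p / |y r|) ?_ (tendsto_const_nhds.div_atTop h)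
  filter_upwards [h.eventually_gt_atTop 0] with r hr
  have h1 := Real.log_le_sub_one_of_pos
    (show 0 < (y r ^ 2 + 3 * p) / (y r ^ 2 + p) by positivity)
  have h2 : (y r ^ 2 + 3 * p) / (y r ^ 2 + p) - 1 = 2 * p / (y r ^ 2 + p) := by
    field_simp; ring
  rw [norm_mul, Real.norm_eq_abs, Real.norm_of_nonneg (log_ratio_nonneg hp)]
  calc |y r| * Real.log ((y r ^ 2 + 3 * p) / (y r ^ 2 + p))
      ≤ |y r| * (2 * p / (y r ^ 2 + p)) := mul_le_mul_of_nonneg_left (h1.trans_eq h2) hr.le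
    _ ≤ |y r| * (2 * p / |y r| ^ 2) := by
        refine mul_le_mul_of_nonneg_left ?_ hr.le
        rw [sq_abs]
        exact div_le_div_of_nonneg_left (by positivity) (by rw [← sq_abs]; positivity) (by linarith)
    _ = 2 * p / |y r| := by field_simp

theorem hasDerivAt_mul_log_ratio {p : ℝ} (hp : 0 < p) (y : ℝ) :
    HasDerivAt (fun y => y * Real.log ((y ^ 2 + 3 * p) / (y ^ 2 + p)) +
      (2 * √(3 * p) * Real.arctan (y / √(3 * p)) - 2 * √p * Real.arctan (y / √p)))
      (Real.log ((y ^ 2 + 3 * p) / (y ^ 2 + p))) y := by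
  have h1 : HasDerivAt (fun y => y ^ 2 + 3 * p) (2 * y) y := by
    simpa using (hasDerivAt_pow 2 y).add_const (3 * p)
  have h2 : HasDerivAt (fun y => y ^ 2 + p) (2 * y) y := by
    simpa using (hasDerivAt_pow 2 y).add_const p
  have p1 : 0 < y ^ 2 + 3 * p := by positivity
  have p2 : 0 < y ^ 2 + p := by positivity
  have h3 := (h1.fun_div h2 p2.ne').log (div_pos p1 p2).ne'
  have hat : ∀ a, 0 < a → HasDerivAt (fun y => 2 * √a * Real.arctan (y / √a))
      (2 * a / (y ^ 2 + a)) y := fun a ha => by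
    have hs := Real.sqrt_pos.2 ha
    have hs2 := Real.sq_sqrt ha.le
    refine ((((hasDerivAt_id y).div_const √a).arctan).const_mul (2 * √a)).congr_deriv ?_
    simp only [id]
    rw [div_pow, hs2]
    field_simp
    ring
  refine (((hasDerivAt_id y).fun_mul h3).fun_add
    ((hat (3 * p) (by positivity)).fun_sub (hat p hp))).congr_deriv ?_
  simp only [id]
  field_simp
  ring

theorem lintegral_log_ratio {p : ℝ} (hp : 0 < p) :
    ∫⁻ r in Ioi (0 : ℝ), ENNReal.ofReal ((r + p) / (r * (2 * √r)) *
      Real.log ((r ^ 2 + p ^ 2 + p * r) / (r ^ 2 + p ^ 2 - p * r))) =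
      ENNReal.ofReal (2 * Real.pi * √p * (√3 - 1)) := by
  have hs := Real.sqrt_pos.2 hp
  have hlog : ∀ r : ℝ, 0 < r → (r ^ 2 + p ^ 2 + p * r) / (r ^ 2 + p ^ 2 - p * r) =
      ((√r - p / √r) ^ 2 + 3 * p) / ((√r - p / √r) ^ 2 + p) := fun r hr => by
    have hr1 := Real.sqrt_pos.2 hr
    have hr2 := Real.sq_sqrt hr.le
    have e1 : (√r - p / √r) ^ 2 + 3 * p = (r ^ 2 + p ^ 2 + p * r) / r := by
      generalize √r = t at hr1 hr2
      subst hr2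
      field_simp; ring
    have e2 : (√r - p / √r) ^ 2 + p = (r ^ 2 + p ^ 2 - p * r) / r := by
      generalize √r = t at hr1 hr2
      subst hr2
      field_simp; ring
    rw [e1, e2, div_div_div_cancel_right₀ hr.ne']
  have h3 : √(3 * p) = √3 * √p := Real.sqrt_mul (by norm_num) p
  have h3p : 0 < √3 := by positivity
  -- the substitution `y = √r - p / √r`
  rw [lintegral_Ioi_of_hasDerivAt (F := fun r => (fun y =>
      y * Real.log ((y ^ 2 + 3 * p) / (y ^ 2 + p)) +
      (2 * √(3 * p) * Real.arctan (y / √(3 * p)) - 2 * √p * Real.arctan (y / √p))) (√r - p / √r))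
    (L := 0 + (2 * √(3 * p) * (-(Real.pi / 2)) - 2 * √p * (-(Real.pi / 2))))
    (M := 0 + (2 * √(3 * p) * (Real.pi / 2) - 2 * √p * (Real.pi / 2)))]
  · congr 1
    rw [h3]; ring
  · intro r hr
    refine ((hasDerivAt_mul_log_ratio hp (√r - p / √r)).comp r
      (hasDerivAt_sqrt_sub (ρ := p) hr)).congr_deriv ?_
    rw [hlog r hr, mul_comm]
  · intro r hr
    rw [hlog r hr]
    have := log_ratio_nonneg (y := √r - p / √r) hp
    positivity
  · have hy := tendsto_sqrt_sub_zero hp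
    have hat : ∀ c, 0 < c → Tendsto (fun r => Real.arctan ((√r - p / √r) / c)) (𝓝[>] 0)
        (𝓝 (-(Real.pi / 2))) := fun c hc =>
      (tendsto_nhds_of_tendsto_nhdsWithin Real.tendsto_arctan_atBot).comp
        (hy.atBot_div_const hc)
    exact (tendsto_mul_log_ratio hp (tendsto_abs_atBot_atTop.comp hy)).add
      (((hat _ (by positivity)).const_mul _).sub ((hat _ hs).const_mul _))
  · have hy := tendsto_sqrt_sub_atTop p
    have hat : ∀ c, 0 < c → Tendsto (fun r => Real.arctan ((√r - p / √r) / c)) atTop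
        (𝓝 (Real.pi / 2)) := fun c hc =>
      (tendsto_nhds_of_tendsto_nhdsWithin Real.tendsto_arctan_atTop).comp
        (hy.atTop_div_const hc)
    exact (tendsto_mul_log_ratio hp (tendsto_abs_atTop_atTop.comp hy)).add
      (((hat _ (by positivity)).const_mul _).sub ((hat _ hs).const_mul _))

theorem lintegral_even_zonal {R r : ℝ} (hR : 0 < R) (hr : 0 < r) :
    ∫⁻ z in Ioo (-r) r, ENNReal.ofReal ((R ^ 2 + r ^ 2) / ((R ^ 2 + r ^ 2) ^ 2 - (R * z) ^ 2)) =
      ENNReal.ofReal (1 / R * Real.log ((r ^ 2 + R ^ 2 + R * r) / (r ^ 2 + R ^ 2 - R * r))) := by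
  have hA : R * r < R ^ 2 + r ^ 2 := by nlinarith [sq_nonneg (R - r), mul_pos hR hr]
  have hz : ∀ z ∈ Icc (-r) r, 0 < R ^ 2 + r ^ 2 - R * z ∧ 0 < R ^ 2 + r ^ 2 + R * z := fun z hz => by
    constructor <;> nlinarith [mul_le_mul_of_nonneg_left hz.1 hR.le, mul_le_mul_of_nonneg_left hz.2 hR.le]
  have hpos : ∀ z ∈ Icc (-r) r, 0 < (R ^ 2 + r ^ 2) ^ 2 - (R * z) ^ 2 := fun z h => by
    have := hz z h
    nlinarith [mul_pos this.1 this.2]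
  have hd : ∀ z ∈ Icc (-r) r, HasDerivAt
      (fun z => 1 / (2 * R) * Real.log ((R ^ 2 + r ^ 2 + R * z) / (R ^ 2 + r ^ 2 - R * z)))
      ((R ^ 2 + r ^ 2) / ((R ^ 2 + r ^ 2) ^ 2 - (R * z) ^ 2)) z := fun z h => by
    obtain ⟨m, p⟩ := hz z h
    have h0 := hpos z h
    have h1 : HasDerivAt (fun z => R ^ 2 + r ^ 2 + R * z) R z := by
      simpa using ((hasDerivAt_id z).const_mul R).const_add (R ^ 2 + r ^ 2)
    have h2 : HasDerivAt (fun z => R ^ 2 + r ^ 2 - R * z) (-R) z := by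
      simpa using ((hasDerivAt_id z).const_mul R).const_sub (R ^ 2 + r ^ 2)
    refine (((h1.fun_div h2 m.ne').log (div_pos p m).ne').const_mul (1 / (2 * R))).congr_deriv ?_
    have e : (R ^ 2 + r ^ 2) ^ 2 - (R * z) ^ 2 =
      (R ^ 2 + r ^ 2 + R * z) * (R ^ 2 + r ^ 2 - R * z) := by ring
    rw [e]
    field_simp
    ring
  have hcont : ContinuousOn (fun z => (R ^ 2 + r ^ 2) / ((R ^ 2 + r ^ 2) ^ 2 - (R * z) ^ 2))
      (Icc (-r) r) := continuousOn_const.div (by fun_prop) fun z h => (hpos z h).ne'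
  rw [restrict_Ioo_eq_restrict_Ioc, ← ofReal_integral_eq_lintegral_ofReal]
  · congr 1
    rw [← intervalIntegral.integral_of_le (by linarith),
      intervalIntegral.integral_eq_sub_of_hasDerivAt (fun z h => hd z (by
        rwa [uIcc_of_le (by linarith)] at h)) (by
        rw [← uIcc_of_le (by linarith : -r ≤ r)] at hcont
        exact hcont.intervalIntegrable), ← mul_sub]
    have m : 0 < r ^ 2 + R ^ 2 - R * r := by nlinarith
    have p : 0 < r ^ 2 + R ^ 2 + R * r := by positivity
    have e1 : (R ^ 2 + r ^ 2 + R * r) / (R ^ 2 + r ^ 2 - R * r) =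
        (r ^ 2 + R ^ 2 + R * r) / (r ^ 2 + R ^ 2 - R * r) := by rw [add_comm (R ^ 2)]
    have e2 : (R ^ 2 + r ^ 2 + R * -r) / (R ^ 2 + r ^ 2 - R * -r) =
        ((r ^ 2 + R ^ 2 + R * r) / (r ^ 2 + R ^ 2 - R * r))⁻¹ := by
      rw [inv_div]; congr 1 <;> ring
    rw [e1, e2, Real.log_inv]
    field_simp
    ring
  · exact (hcont.integrableOn_Icc).mono_set Ioc_subset_Icc_self
  · filter_upwards [ae_restrict_mem measurableSet_Ioc] with z hz
    have := hpos z ⟨hz.1.le, hz.2⟩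
    simp only [Pi.zero_apply]
    positivity

/-- The even part of the kernel `1 / (p² + q² + p·q)`. -/
def evenKernel (p q : R3) : ℝ :=
  (‖p‖ ^ 2 + ‖q‖ ^ 2) / ((‖p‖ ^ 2 + ‖q‖ ^ 2) ^ 2 - (inner ℝ p q) ^ 2)

theorem lintegral_zonal {F : ℝ × ℝ → ℝ≥0∞} (hF : Measurable F) {p : R3} (hp : p ≠ 0) :
    ∫⁻ q : R3, F (‖q‖, inner ℝ p q) = ∫⁻ r in Ioi (0 : ℝ), ∫⁻ z in Ioo (-r) r,
      ENNReal.ofReal (2 * Real.pi * r) * F (r, ‖p‖ * z) := by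
  have hR : 0 < ‖p‖ := norm_pos_iff.2 hp
  have he : ‖(‖p‖⁻¹ • p)‖ = 1 := by rw [norm_smul, norm_inv, norm_norm, inv_mul_cancel₀ hR.ne']
  have h := lintegral_norm_inner he (fun v => F (v.1, ‖p‖ * v.2)) (by fun_prop)
  rw [← h]
  refine lintegral_congr fun q => ?_
  rw [real_inner_smul_left, ← mul_assoc, mul_inv_cancel₀ hR.ne', one_mul]

/-- The kernel `(1/|p| + 1/|q|) · evenKernel`, homogeneous of degree `-3`, which dominates all the
kernels below. -/
def domKernel (p q : R3) : ℝ := (‖p‖ + ‖q‖) / (‖p‖ * ‖q‖) * evenKernel p q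

theorem inner_sq_le (p q : R3) : 4 * (inner ℝ p q) ^ 2 ≤ (‖p‖ ^ 2 + ‖q‖ ^ 2) ^ 2 := by
  have h := abs_real_inner_le_norm p q
  have h1 : (inner ℝ p q) ^ 2 ≤ (‖p‖ * ‖q‖) ^ 2 := sq_le_sq' (by linarith [(abs_le.1 h).1])
    (abs_le.1 h).2
  nlinarith [sq_nonneg (‖p‖ ^ 2 - ‖q‖ ^ 2)]

theorem evenKernel_nonneg (p q : R3) : 0 ≤ evenKernel p q := by
  have h := inner_sq_le p q
  have : 0 ≤ (‖p‖ ^ 2 + ‖q‖ ^ 2) ^ 2 - (inner ℝ p q) ^ 2 := by nlinarith [sq_nonneg (inner ℝ p q)]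
  unfold evenKernel; positivity

theorem domKernel_nonneg (p q : R3) : 0 ≤ domKernel p q := by
  have := evenKernel_nonneg p q
  unfold domKernel; positivity

theorem evenKernel_comm (p q : R3) : evenKernel p q = evenKernel q p := by
  rw [evenKernel, evenKernel, real_inner_comm, add_comm]

theorem domKernel_comm (p q : R3) : domKernel p q = domKernel q p := by
  rw [domKernel, domKernel, evenKernel_comm, add_comm, mul_comm ‖p‖]

theorem measurable_evenKernel : Measurable (Function.uncurry evenKernel) := by
  unfold evenKernel Function.uncurry; fun_prop

theorem measurable_domKernel : Measurable (Function.uncurry domKernel) := by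
  have := measurable_evenKernel
  have h : Measurable fun z : R3 × R3 => (‖z.1‖ + ‖z.2‖) / (‖z.1‖ * ‖z.2‖) := by fun_prop
  exact h.mul this

/-- The weight `|q|^(-3/2)` is an eigenfunction of `domKernel`. -/
theorem lintegral_domKernel {p : R3} (hp : p ≠ 0) :
    ∫⁻ q, ENNReal.ofReal (domKernel p q) * ENNReal.ofReal (1 / (‖q‖ * √‖q‖)) =
      ENNReal.ofReal (8 * Real.pi ^ 2 * (√3 - 1)) * ENNReal.ofReal (1 / (‖p‖ * √‖p‖)) := by
  have hR : 0 < ‖p‖ := norm_pos_iff.2 hp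
  have hpi := Real.pi_pos
  set R := ‖p‖ with hRdef
  refine (lintegral_zonal (F := fun v : ℝ × ℝ => ENNReal.ofReal ((R + v.1) / (R * v.1) *
      ((R ^ 2 + v.1 ^ 2) / ((R ^ 2 + v.1 ^ 2) ^ 2 - v.2 ^ 2))) *
      ENNReal.ofReal (1 / (v.1 * √v.1))) (by fun_prop) hp).trans ?_
  have hin : ∀ r ∈ Ioi (0 : ℝ), ∫⁻ z in Ioo (-r) r, ENNReal.ofReal (2 * Real.pi * r) *
      (fun v : ℝ × ℝ => ENNReal.ofReal ((R + v.1) / (R * v.1) *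
      ((R ^ 2 + v.1 ^ 2) / ((R ^ 2 + v.1 ^ 2) ^ 2 - v.2 ^ 2))) *
      ENNReal.ofReal (1 / (v.1 * √v.1))) (r, ‖p‖ * z) =
      ENNReal.ofReal (4 * Real.pi / R ^ 2) * ENNReal.ofReal ((r + R) / (r * (2 * √r)) *
      Real.log ((r ^ 2 + R ^ 2 + R * r) / (r ^ 2 + R ^ 2 - R * r))) := fun r hr => by
    have hr : 0 < r := hr
    have hs := Real.sqrt_pos.2 hr
    simp only [← hRdef]
    have e : ∀ z, ENNReal.ofReal (2 * Real.pi * r) * (ENNReal.ofReal ((R + r) / (R * r) *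
        ((R ^ 2 + r ^ 2) / ((R ^ 2 + r ^ 2) ^ 2 - (R * z) ^ 2))) * ENNReal.ofReal (1 / (r * √r))) =
        ENNReal.ofReal (2 * Real.pi * r * ((R + r) / (R * r)) * (1 / (r * √r))) *
        ENNReal.ofReal ((R ^ 2 + r ^ 2) / ((R ^ 2 + r ^ 2) ^ 2 - (R * z) ^ 2)) := fun z => by
      rw [ENNReal.ofReal_mul (p := (R + r) / (R * r)) (by positivity),
        ENNReal.ofReal_mul (p := 2 * Real.pi * r * ((R + r) / (R * r))) (by positivity),
        ENNReal.ofReal_mul (p := 2 * Real.pi * r) (by positivity)]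
      ring
    simp_rw [e]
    rw [lintegral_const_mul' _ _ ENNReal.ofReal_ne_top, lintegral_even_zonal hR hr,
      ← ENNReal.ofReal_mul (by positivity), ← ENNReal.ofReal_mul (by positivity)]
    congr 1
    field_simp
    ring
  rw [setLIntegral_congr_fun measurableSet_Ioi hin, lintegral_const_mul' _ _ ENNReal.ofReal_ne_top,
    lintegral_log_ratio hR, ← ENNReal.ofReal_mul (by positivity), ← ENNReal.ofReal_mul]
  · congr 1
    have h2 := Real.mul_self_sqrt hR.le
    have hs := Real.sqrt_pos.2 hR
    generalize √R = t at h2 hs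
    rw [← h2]
    field_simp
    ring
  · have : (1 : ℝ) ≤ √3 := Real.one_le_sqrt.2 (by norm_num)
    have : 0 ≤ √3 - 1 := by linarith
    positivity

/-- The Schur test for a symmetric kernel, nonnegative off the axes, with one weight. -/
theorem bddKernel_of_schur {k : R3 → R3 → ℝ} (hk : Measurable (Function.uncurry k))
    (h0 : ∀ p q, p ≠ 0 → q ≠ 0 → 0 ≤ k p q) (hsymm : ∀ p q, k p q = k q p) {w : R3 → ℝ}
    (hw : Measurable w) (hw0 : ∀ p, p ≠ 0 → 0 < w p) {C : ℝ}
    (h : ∀ p, p ≠ 0 → ∫⁻ q, ENNReal.ofReal (k p q) * ENNReal.ofReal (w q) ≤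
      ENNReal.ofReal C * ENNReal.ofReal (w p)) : BddKernel k C := by
  refine ⟨hk, fun f g => ?_⟩
  have hu : ∀ᵐ y : R3, ENNReal.ofReal (w y) ≠ 0 ∧ ENNReal.ofReal (w y) ≠ ∞ := by
    filter_upwards [ae_ne_zero_R3] with y hy
    refine ⟨?_, ENNReal.ofReal_ne_top⟩
    rw [Ne, ENNReal.ofReal_eq_zero, not_le]
    exact hw0 y hy
  have h1 : ∀ᵐ p : R3, ∫⁻ q, ‖k p q‖ₑ * ENNReal.ofReal (w q) ≤
      ENNReal.ofReal C * ENNReal.ofReal (w p) := by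
    filter_upwards [ae_ne_zero_R3] with p hp
    refine le_trans (le_of_eq (lintegral_congr_ae ?_)) (h p hp)
    filter_upwards [ae_ne_zero_R3] with q hq
    rw [Real.enorm_of_nonneg (h0 p q hp hq)]
  have := schur_test (k := fun p q => ‖k p q‖ₑ) hk.enorm
    (u := fun y => ENNReal.ofReal (w y)) (v := fun y => ENNReal.ofReal (w y))
    (a := fun _ => ENNReal.ofReal C) (b := fun _ => ENNReal.ofReal C) hw.ennreal_ofReal
    hw.ennreal_ofReal hu hu h1 (by simp_rw [fun p q => hsymm q p] at h1 ⊢; exact h1)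
    (F := fun x => ‖f x‖ₑ) (G := fun x => ‖g x‖ₑ)
    (Lp.aestronglyMeasurable f).enorm (Lp.aestronglyMeasurable g).enorm
  rwa [lintegral_const_mul' _ _ ENNReal.ofReal_ne_top, lintegral_const_mul' _ _ ENNReal.ofReal_ne_top,
    ← enorm_sq_eq_lintegral, ← enorm_sq_eq_lintegral, ← mul_add] at this

theorem BddKernel.mono {k k' : R3 → R3 → ℝ} {C c : ℝ} (h : BddKernel k C) (hc : 0 ≤ c)
    (hk' : Measurable (Function.uncurry k'))
    (hle : ∀ p q, p ≠ 0 → q ≠ 0 → |k' p q| ≤ c * |k p q|) : BddKernel k' (c * C) := by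
  refine ⟨hk', fun f g => ?_⟩
  rw [ENNReal.ofReal_mul hc, mul_assoc]
  refine le_trans ?_ (mul_le_mul_right (h.2 f g) _)
  rw [← mul_assoc, mul_comm (ENNReal.ofReal c), mul_assoc]
  refine mul_le_mul_right ?_ _
  rw [← lintegral_const_mul' _ _ ENNReal.ofReal_ne_top]
  refine lintegral_mono_ae ?_
  filter_upwards [ae_ne_zero_R3] with p hp
  rw [← lintegral_const_mul' _ _ ENNReal.ofReal_ne_top]
  refine lintegral_mono_ae ?_
  filter_upwards [ae_ne_zero_R3] with q hq
  have : ‖k' p q‖ₑ ≤ ENNReal.ofReal c * ‖k p q‖ₑ := by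
    rw [← ofReal_norm, ← ofReal_norm, ← ENNReal.ofReal_mul hc]
    exact ENNReal.ofReal_le_ofReal (hle p q hp hq)
  calc _ ≤ ‖f p‖ₑ * (ENNReal.ofReal c * ‖k p q‖ₑ) * ‖g q‖ₑ := by gcongr
    _ = _ := by ring

theorem one_le_sqrt_three : 1 ≤ √3 := Real.one_le_sqrt.2 (by norm_num)

/-- The Schur constant of `domKernel`. -/
def domConst : ℝ := 8 * Real.pi ^ 2 * (√3 - 1)

theorem domConst_nonneg : 0 ≤ domConst :=
  mul_nonneg (by positivity) (by linarith [one_le_sqrt_three])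

theorem bddKernel_domKernel : BddKernel domKernel domConst :=
  bddKernel_of_schur measurable_domKernel (fun p q _ _ => domKernel_nonneg p q) domKernel_comm
    (w := fun q => 1 / (‖q‖ * √‖q‖)) (by fun_prop)
    (fun p hp => by have := norm_pos_iff.2 hp; positivity) fun p hp => (lintegral_domKernel hp).le

theorem inv_sq_add_sq_le_evenKernel {p q : R3} (hp : p ≠ 0) :
    1 / (‖p‖ ^ 2 + ‖q‖ ^ 2) ≤ evenKernel p q := by
  have hR : 0 < ‖p‖ := norm_pos_iff.2 hp
  have h := inner_sq_le p q
  have hA : 0 < ‖p‖ ^ 2 + ‖q‖ ^ 2 := by positivity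
  rw [evenKernel, div_le_div_iff₀ hA (by nlinarith [sq_nonneg (inner ℝ p q), pow_pos hA 2])]
  nlinarith [sq_nonneg (inner ℝ p q)]

/-- The Newton kernel `1 / max(|p|, |q|)` acting on `|p| f`. -/
def newtonKernel (p q : R3) : ℝ := 1 / (‖p‖ * ‖q‖ * max ‖p‖ ‖q‖)

theorem measurable_newtonKernel : Measurable (Function.uncurry newtonKernel) := by
  unfold newtonKernel Function.uncurry; fun_prop

theorem newtonKernel_nonneg (p q : R3) : 0 ≤ newtonKernel p q := by
  unfold newtonKernel; positivity

theorem newtonKernel_le_domKernel {p q : R3} (hp : p ≠ 0) (hq : q ≠ 0) :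
    newtonKernel p q ≤ domKernel p q := by
  have hP : 0 < ‖p‖ := norm_pos_iff.2 hp
  have hQ : 0 < ‖q‖ := norm_pos_iff.2 hq
  refine le_trans ?_ (mul_le_mul_of_nonneg_left (inv_sq_add_sq_le_evenKernel (q := q) hp)
    (by positivity))
  have hM : 0 < max ‖p‖ ‖q‖ := lt_max_of_lt_left hP
  rw [newtonKernel, div_mul_div_comm, mul_one, div_le_div_iff₀ (by positivity) (by positivity)]
  have h : ‖p‖ ^ 2 + ‖q‖ ^ 2 ≤ (‖p‖ + ‖q‖) * max ‖p‖ ‖q‖ := by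
    nlinarith [le_max_left ‖p‖ ‖q‖, le_max_right ‖p‖ ‖q‖]
  nlinarith [mul_pos hP hQ]

/-- The weight `|q|^(-3/2)` is also an eigenfunction of `newtonKernel`, so the Schur constants of
`domKernel` and `newtonKernel` can be subtracted. -/
theorem lintegral_newtonKernel {p : R3} (hp : p ≠ 0) :
    ∫⁻ q, ENNReal.ofReal (newtonKernel p q) * ENNReal.ofReal (1 / (‖q‖ * √‖q‖)) =
      ENNReal.ofReal (16 * Real.pi) * ENNReal.ofReal (1 / (‖p‖ * √‖p‖)) := by
  have hR : 0 < ‖p‖ := norm_pos_iff.2 hp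
  have hpi := Real.pi_pos
  set R := ‖p‖ with hRdef
  have hsR := Real.sqrt_pos.2 hR
  refine (lintegral_norm (fun r => ENNReal.ofReal (1 / (R * r * max R r)) *
    ENNReal.ofReal (1 / (r * √r))) (by fun_prop)).trans ?_
  have hpt : ∀ r, 0 < r → ENNReal.ofReal (4 * Real.pi * r ^ 2) *
      (ENNReal.ofReal (1 / (R * r * max R r)) * ENNReal.ofReal (1 / (r * √r))) =
      ENNReal.ofReal (4 * Real.pi / R) * ENNReal.ofReal (1 / (max R r * √r)) := fun r hr => by
    have := Real.sqrt_pos.2 hr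
    have hM : 0 < max R r := lt_max_of_lt_left hR
    rw [← ENNReal.ofReal_mul (by positivity), ← ENNReal.ofReal_mul (by positivity),
      ← ENNReal.ofReal_mul (by positivity)]
    congr 1
    field_simp
  rw [setLIntegral_congr_fun measurableSet_Ioi fun r hr => hpt r hr,
    lintegral_const_mul' _ _ ENNReal.ofReal_ne_top]
  have h1 : ∫⁻ r in Ioc 0 R, ENNReal.ofReal (1 / (max R r * √r)) = ENNReal.ofReal (2 / √R) := by
    have e : ∀ r ∈ Ioc 0 R, ENNReal.ofReal (1 / (max R r * √r)) =
        ENNReal.ofReal (1 / R * r ^ (-(1 / 2) : ℝ)) := fun r hr => by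
      rw [max_eq_left hr.2, Real.rpow_neg hr.1.le, ← Real.sqrt_eq_rpow]
      congr 1; field_simp
    rw [setLIntegral_congr_fun measurableSet_Ioc e, ← ofReal_integral_eq_lintegral_ofReal]
    · rw [← intervalIntegral.integral_of_le hR.le, intervalIntegral.integral_const_mul,
        integral_rpow (Or.inl (by norm_num))]
      congr 1
      norm_num
      rw [← Real.sqrt_eq_rpow]
      nth_rewrite 1 [← Real.mul_self_sqrt hR.le]
      field_simp
    · exact ((intervalIntegrable_iff_integrableOn_Ioc_of_le hR.le).1
        (intervalIntegral.intervalIntegrable_rpow' (by norm_num))).const_mul _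
    · filter_upwards [ae_restrict_mem measurableSet_Ioc] with r hr
      have := hr.1
      simp only [Pi.zero_apply]
      positivity
  have h2 : ∫⁻ r in Ioi R, ENNReal.ofReal (1 / (max R r * √r)) = ENNReal.ofReal (2 / √R) := by
    have e : ∀ r ∈ Ioi R, ENNReal.ofReal (1 / (max R r * √r)) =
        ENNReal.ofReal (r ^ (-(3 / 2) : ℝ)) := fun r hr => by
      have hr0 : 0 < r := hR.trans hr
      rw [max_eq_right (le_of_lt hr), Real.sqrt_eq_rpow, Real.rpow_neg hr0.le]
      congr 1
      rw [one_div]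
      congr 1
      nth_rewrite 1 [← Real.rpow_one r]
      rw [← Real.rpow_add hr0]
      norm_num
    rw [setLIntegral_congr_fun measurableSet_Ioi e, ← ofReal_integral_eq_lintegral_ofReal]
    · rw [integral_Ioi_rpow_of_lt (by norm_num) hR]
      congr 1
      norm_num
      rw [Real.rpow_neg hR.le, ← Real.sqrt_eq_rpow]
      field_simp
    · exact integrableOn_Ioi_rpow_of_lt (by norm_num) hR
    · filter_upwards [ae_restrict_mem measurableSet_Ioi] with r hr
      have : 0 < r := hR.trans hr
      simp only [Pi.zero_apply]
      positivity
  rw [← Ioc_union_Ioi_eq_Ioi hR.le, lintegral_union measurableSet_Ioi Ioc_disjoint_Ioi_same, h1, h2,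
    ← ENNReal.ofReal_add (by positivity) (by positivity), ← ENNReal.ofReal_mul (by positivity),
    ← ENNReal.ofReal_mul (by positivity)]
  congr 1
  field_simp
  ring

/-- The even kernel minus the contribution of Newton's inequality. -/
def screenedKernel (g : ℝ) (p q : R3) : ℝ :=
  1 / (2 * Real.pi ^ 2) * domKernel p q - g / (8 * Real.pi) * newtonKernel p q

theorem screenedKernel_comm (g : ℝ) (p q : R3) : screenedKernel g p q = screenedKernel g q p := by
  rw [screenedKernel, screenedKernel, domKernel_comm, newtonKernel, newtonKernel, max_comm,
    mul_comm ‖p‖]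

theorem measurable_screenedKernel (g : ℝ) : Measurable (Function.uncurry (screenedKernel g)) :=
  (measurable_domKernel.const_mul _).sub (measurable_newtonKernel.const_mul _)

/-- The Schur constant of the screened kernel, which is still nonnegative for `g ≤ 6/5 < 4/π`. It is
below `√3 / 2` exactly when `g > 7/4 √3 - 2`. -/
theorem bddKernel_screenedKernel {g : ℝ} (h0 : 0 ≤ g) (hg : g ≤ 6 / 5) :
    BddKernel (screenedKernel g) (4 * (√3 - 1) - 2 * g) := by
  have hpi := Real.pi_pos
  have h3 := one_le_sqrt_three
  have hnn : ∀ p q : R3, p ≠ 0 → q ≠ 0 → 0 ≤ screenedKernel g p q := fun p q hp hq => by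
    have h1 := newtonKernel_le_domKernel hp hq
    have h2 : g / (8 * Real.pi) ≤ 1 / (2 * Real.pi ^ 2) := by
      rw [div_le_div_iff₀ (by positivity) (by positivity)]
      nlinarith [Real.pi_lt_d2]
    have := mul_le_mul h2 h1 (newtonKernel_nonneg p q) (by positivity)
    rw [screenedKernel]; linarith
  refine bddKernel_of_schur (measurable_screenedKernel g) hnn (screenedKernel_comm g)
    (w := fun q => 1 / (‖q‖ * √‖q‖)) (by fun_prop)
    (fun p hp => by have := norm_pos_iff.2 hp; positivity) fun p hp => ?_
  have hsum : (∫⁻ q, ENNReal.ofReal (screenedKernel g p q) * ENNReal.ofReal (1 / (‖q‖ * √‖q‖))) +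
      ENNReal.ofReal (g / (8 * Real.pi)) *
        ∫⁻ q, ENNReal.ofReal (newtonKernel p q) * ENNReal.ofReal (1 / (‖q‖ * √‖q‖)) =
      ENNReal.ofReal (1 / (2 * Real.pi ^ 2)) *
        ∫⁻ q, ENNReal.ofReal (domKernel p q) * ENNReal.ofReal (1 / (‖q‖ * √‖q‖)) := by
    have hm : Measurable fun q => ENNReal.ofReal (screenedKernel g p q) *
        ENNReal.ofReal (1 / (‖q‖ * √‖q‖)) :=
      ((measurable_screenedKernel g).of_uncurry_left (x := p)).ennreal_ofReal.mul (by fun_prop)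
    rw [← lintegral_const_mul' _ _ ENNReal.ofReal_ne_top,
      ← lintegral_const_mul' _ _ ENNReal.ofReal_ne_top, ← lintegral_add_left hm]
    refine lintegral_congr_ae ?_
    filter_upwards [ae_ne_zero_R3] with q hq
    rw [← mul_assoc, ← mul_assoc, ← add_mul, ← ENNReal.ofReal_mul (by positivity),
      ← ENNReal.ofReal_mul (by positivity), ← ENNReal.ofReal_add (hnn p q hp hq)
        (mul_nonneg (by positivity) (newtonKernel_nonneg p q)), screenedKernel]
    congr 2
    ring
  rw [lintegral_newtonKernel hp, lintegral_domKernel hp, ← mul_assoc, ← mul_assoc,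
    ← ENNReal.ofReal_mul (show 0 ≤ g / (8 * Real.pi) by positivity),
    ← ENNReal.ofReal_mul (show 0 ≤ 1 / (2 * Real.pi ^ 2) by positivity)] at hsum
  have e1 : g / (8 * Real.pi) * (16 * Real.pi) = 2 * g := by field_simp; ring
  have e2 : 1 / (2 * Real.pi ^ 2) * (8 * Real.pi ^ 2 * (√3 - 1)) = 4 * (√3 - 1) := by
    field_simp; ring
  rw [e1, e2] at hsum
  rw [ENNReal.ofReal_sub _ (by positivity), ENNReal.sub_mul (fun _ _ => ENNReal.ofReal_ne_top)]
  exact ENNReal.le_sub_of_add_le_right (ENNReal.mul_ne_top ENNReal.ofReal_ne_top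
    ENNReal.ofReal_ne_top) hsum.le

/-- The odd part of the kernel `1 / (p² + q² + p·q)`, up to sign. -/
def oddKernel (p q : R3) : ℝ :=
  inner ℝ p q / ((‖p‖ ^ 2 + ‖q‖ ^ 2) ^ 2 - (inner ℝ p q) ^ 2)

/-- The symmetrized odd kernel, acting on `|p| f`. -/
def oddDomKernel (p q : R3) : ℝ := (‖p‖ + ‖q‖) / (‖p‖ * ‖q‖) * oddKernel p q

theorem measurable_oddKernel : Measurable (Function.uncurry oddKernel) := by
  unfold oddKernel Function.uncurry; fun_prop

theorem measurable_oddDomKernel : Measurable (Function.uncurry oddDomKernel) := by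
  have h : Measurable fun z : R3 × R3 => (‖z.1‖ + ‖z.2‖) / (‖z.1‖ * ‖z.2‖) := by fun_prop
  exact h.mul measurable_oddKernel

theorem abs_oddKernel_le {p q : R3} (hp : p ≠ 0) :
    |oddKernel p q| ≤ 4 / 3 * (|inner ℝ p q| / (‖p‖ ^ 2 + ‖q‖ ^ 2) ^ 2) := by
  have hR : 0 < ‖p‖ := norm_pos_iff.2 hp
  have h := inner_sq_le p q
  have hA : 0 < ‖p‖ ^ 2 + ‖q‖ ^ 2 := by positivity
  have hD : 3 / 4 * (‖p‖ ^ 2 + ‖q‖ ^ 2) ^ 2 ≤ (‖p‖ ^ 2 + ‖q‖ ^ 2) ^ 2 - (inner ℝ p q) ^ 2 := by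
    linarith
  have hA2 := pow_pos hA 2
  rw [oddKernel, abs_div, abs_of_pos (a := _ - _) (by linarith)]
  calc _ ≤ |inner ℝ p q| / (3 / 4 * (‖p‖ ^ 2 + ‖q‖ ^ 2) ^ 2) :=
        div_le_div_of_nonneg_left (abs_nonneg _) (by positivity) hD
    _ = _ := by field_simp

theorem lintegral_abs_zonal {c r : ℝ} (hc : 0 ≤ c) (hr : 0 < r) :
    ∫⁻ z in Ioo (-r) r, ENNReal.ofReal |c * z| = ENNReal.ofReal (c * r ^ 2) := by
  have hint : ∀ a b : ℝ, IntervalIntegrable (fun z : ℝ => |c * z|) volume a b := fun a b =>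
    (by fun_prop : Continuous fun z : ℝ => |c * z|).intervalIntegrable a b
  rw [restrict_Ioo_eq_restrict_Ioc, ← ofReal_integral_eq_lintegral_ofReal
    ((intervalIntegrable_iff_integrableOn_Ioc_of_le (by linarith)).1 (hint _ _))
    (ae_of_all _ fun z => abs_nonneg _), ← intervalIntegral.integral_of_le (by linarith),
    ← intervalIntegral.integral_add_adjacent_intervals (hint (-r) 0) (hint 0 r)]
  have e1 : ∫ z in (-r)..0, |c * z| = ∫ z in (-r)..0, (-c) * z :=
    intervalIntegral.integral_congr fun z hz => by
      rw [uIcc_of_le (by linarith)] at hz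
      rw [abs_of_nonpos (mul_nonpos_of_nonneg_of_nonpos hc hz.2)]; ring
  have e2 : ∫ z in (0 : ℝ)..r, |c * z| = ∫ z in (0 : ℝ)..r, c * z :=
    intervalIntegral.integral_congr fun z hz => by
      rw [uIcc_of_le hr.le] at hz
      exact abs_of_nonneg (mul_nonneg hc hz.1)
  rw [e1, e2, intervalIntegral.integral_const_mul, intervalIntegral.integral_const_mul, integral_id,
    integral_id]
  congr 1
  ring

/-- The Schur integral, with the weight `|q|⁻¹`, of a majorant of the odd kernel; the constant is not
optimal, but enough for the odd part of `ξ̂`. -/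
theorem lintegral_odd {p : R3} (hp : p ≠ 0) :
    ∫⁻ q, ENNReal.ofReal ((‖p‖ + ‖q‖) / (‖p‖ * ‖q‖) * (|inner ℝ p q| / (‖p‖ ^ 2 + ‖q‖ ^ 2) ^ 2)) *
        ENNReal.ofReal (1 / ‖q‖) =
      ENNReal.ofReal (2 * Real.pi * (1 / 2 + Real.pi / 4)) * ENNReal.ofReal (1 / ‖p‖) := by
  have hR : 0 < ‖p‖ := norm_pos_iff.2 hp
  have hpi := Real.pi_pos
  set R := ‖p‖ with hRdef
  refine (lintegral_zonal (F := fun v : ℝ × ℝ => ENNReal.ofReal ((R + v.1) / (R * v.1) *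
      (|v.2| / (R ^ 2 + v.1 ^ 2) ^ 2)) * ENNReal.ofReal (1 / v.1)) (by fun_prop) hp).trans ?_
  have hin : ∀ r ∈ Ioi (0 : ℝ), ∫⁻ z in Ioo (-r) r, ENNReal.ofReal (2 * Real.pi * r) *
      (fun v : ℝ × ℝ => ENNReal.ofReal ((R + v.1) / (R * v.1) *
      (|v.2| / (R ^ 2 + v.1 ^ 2) ^ 2)) * ENNReal.ofReal (1 / v.1)) (r, ‖p‖ * z) =
      ENNReal.ofReal (2 * Real.pi) * ENNReal.ofReal ((R + r) * r / (R ^ 2 + r ^ 2) ^ 2) :=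
    fun r hr => by
      have hr : 0 < r := hr
      simp only [← hRdef]
      have e : ∀ z, ENNReal.ofReal (2 * Real.pi * r) * (ENNReal.ofReal ((R + r) / (R * r) *
          (|R * z| / (R ^ 2 + r ^ 2) ^ 2)) * ENNReal.ofReal (1 / r)) =
          ENNReal.ofReal (2 * Real.pi * ((R + r) / (R * r) / (R ^ 2 + r ^ 2) ^ 2)) *
          ENNReal.ofReal |R * z| := fun z => by
        rw [← ENNReal.ofReal_mul (by positivity), ← ENNReal.ofReal_mul (by positivity),
          ← ENNReal.ofReal_mul (by positivity)]
        congr 1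
        field_simp
      simp_rw [e]
      rw [lintegral_const_mul' _ _ ENNReal.ofReal_ne_top, lintegral_abs_zonal hR.le hr,
        ← ENNReal.ofReal_mul (by positivity), ← ENNReal.ofReal_mul (by positivity)]
      congr 1
      field_simp
  rw [setLIntegral_congr_fun measurableSet_Ioi hin, lintegral_const_mul' _ _ ENNReal.ofReal_ne_top,
    lintegral_Ioi_of_hasDerivAt (F := fun r => 1 / 2 * (1 / R) * Real.arctan (r / R) -
      1 / 2 * ((R + r) / (R ^ 2 + r ^ 2))) (L := -(1 / 2 * (1 / R)))
      (M := 1 / 2 * (1 / R) * (Real.pi / 2)), ← ENNReal.ofReal_mul (by positivity),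
    ← ENNReal.ofReal_mul (by positivity)]
  · congr 1; field_simp; ring
  · intro r hr
    have h1 : HasDerivAt (fun r : ℝ => Real.arctan (r / R)) (1 / (1 + (r / R) ^ 2) * (1 / R)) r :=
      ((hasDerivAt_id r).div_const R).arctan
    have h2 : HasDerivAt (fun r : ℝ => (R + r) / (R ^ 2 + r ^ 2))
        ((1 * (R ^ 2 + r ^ 2) - (R + r) * (2 * r)) / (R ^ 2 + r ^ 2) ^ 2) r := by
      have h3 : HasDerivAt (fun r : ℝ => R ^ 2 + r ^ 2) (2 * r) r := by
        simpa using (hasDerivAt_pow 2 r).const_add (R ^ 2)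
      exact ((hasDerivAt_id r).const_add R).fun_div h3 (by positivity)
    refine ((h1.const_mul _).fun_sub (h2.const_mul _)).congr_deriv ?_
    field_simp
    ring
  · intro r hr; positivity
  · have hc : Continuous (fun r : ℝ => 1 / 2 * (1 / R) * Real.arctan (r / R) -
      1 / 2 * ((R + r) / (R ^ 2 + r ^ 2))) := by
      refine (continuous_const.mul (Real.continuous_arctan.comp (by fun_prop))).sub
        (continuous_const.mul (Continuous.div (by fun_prop) (by fun_prop) fun r => ?_))
      positivity
    have := (hc.tendsto 0).mono_left (nhdsWithin_le_nhds (s := Ioi 0))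
    refine this.trans (le_of_eq ?_)
    simp
    field_simp
  · have h1 : Tendsto (fun r : ℝ => Real.arctan (r / R)) atTop (𝓝 (Real.pi / 2)) :=
      (tendsto_nhds_of_tendsto_nhdsWithin Real.tendsto_arctan_atTop).comp
        (tendsto_id.atTop_div_const hR)
    have h2 : Tendsto (fun r : ℝ => (R + r) / (R ^ 2 + r ^ 2)) atTop (𝓝 0) := by
      refine squeeze_zero' (g := fun r => 2 / r) ?_ ?_ (tendsto_const_nhds.div_atTop tendsto_id)
      · filter_upwards [eventually_gt_atTop 0] with r hr using by positivity
      · filter_upwards [eventually_gt_atTop 0] with r hr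
        rw [div_le_div_iff₀ (by positivity) hr]
        nlinarith [sq_nonneg (R - r), sq_nonneg R]
    have := (h1.const_mul (1 / 2 * (1 / R))).sub (h2.const_mul (1 / 2))
    simpa using this

theorem bddKernel_oddDomKernel :
    BddKernel oddDomKernel (4 / 3 * (2 * Real.pi * (1 / 2 + Real.pi / 4))) := by
  set k : R3 → R3 → ℝ := fun p q =>
    (‖p‖ + ‖q‖) / (‖p‖ * ‖q‖) * (|inner ℝ p q| / (‖p‖ ^ 2 + ‖q‖ ^ 2) ^ 2) with hk
  have h : BddKernel k (2 * Real.pi * (1 / 2 + Real.pi / 4)) :=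
    bddKernel_of_schur (w := fun q => 1 / ‖q‖) (by rw [hk]; unfold Function.uncurry; fun_prop)
      (fun p q _ _ => by positivity)
      (fun p q => by simp only [hk]; rw [real_inner_comm, add_comm, mul_comm ‖p‖, add_comm (‖p‖ ^ 2)])
      (by fun_prop) (fun p hp => by have := norm_pos_iff.2 hp; positivity)
      fun p hp => (lintegral_odd hp).le
  refine h.mono (by norm_num) measurable_oddDomKernel fun p q hp hq => ?_
  have h1 := abs_oddKernel_le (q := q) hp
  have h2 : 0 ≤ k p q := by simp only [hk]; positivity
  rw [abs_of_nonneg h2, oddDomKernel, abs_mul, abs_of_nonneg (by positivity)]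
  refine (mul_le_mul_of_nonneg_left h1 (by positivity)).trans_eq ?_
  simp only [hk]; ring

/-! ### Sesquilinear forms of kernels and parity -/

/-- The sesquilinear form `∬ conj (f p) k(p, q) g(q)`. -/
def kerInt (k : R3 → R3 → ℝ) (f g : R3 → ℂ) : ℂ :=
  ∫ z, kerFun k f g z ∂((volume : Measure R3).prod volume)

theorem kerInt_congr {k : R3 → R3 → ℝ} {f f' g g' : R3 → ℂ} (hf : f =ᵐ[volume] f')
    (hg : g =ᵐ[volume] g') : kerInt k f g = kerInt k f' g' :=
  integral_congr_ae (integrable_kerFun_congr hf hg)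

theorem ae_prod_of_ae {P Q : R3 → Prop} (hP : ∀ᵐ p, P p) (hQ : ∀ᵐ q, Q q) :
    ∀ᵐ z ∂((volume : Measure R3).prod volume), P z.1 ∧ Q z.2 := by
  filter_upwards [(Measure.quasiMeasurePreserving_fst (μ := (volume : Measure R3))
    (ν := (volume : Measure R3))).ae hP, (Measure.quasiMeasurePreserving_snd
    (μ := (volume : Measure R3)) (ν := (volume : Measure R3))).ae hQ] with z h1 h2 using ⟨h1, h2⟩

/-- Two kernel integrands agree if the kernels, with weights moved onto the functions, do. -/
theorem kerFun_ae_eq {k k' : R3 → R3 → ℝ} {f f' g g' : R3 → ℂ} {a b : R3 → ℝ}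
    (hf : f =ᵐ[volume] fun p => (a p : ℂ) * f' p) (hg : g =ᵐ[volume] fun p => (b p : ℂ) * g' p)
    (hk : ∀ p q, p ≠ 0 → q ≠ 0 → a p * k p q * b q = k' p q) :
    kerFun k f g =ᵐ[(volume : Measure R3).prod volume] kerFun k' f' g' := by
  filter_upwards [ae_prod_of_ae hf hg, ae_prod_of_ae ae_ne_zero_R3 ae_ne_zero_R3] with z h1 h2
  simp only [kerFun]
  rw [h1.1, h1.2, ← hk z.1 z.2 h2.1 h2.2, map_mul, Complex.conj_ofReal]
  push_cast
  ring

theorem kerInt_eq {k k' : R3 → R3 → ℝ} {f f' g g' : R3 → ℂ} {a b : R3 → ℝ}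
    (hf : f =ᵐ[volume] fun p => (a p : ℂ) * f' p) (hg : g =ᵐ[volume] fun p => (b p : ℂ) * g' p)
    (hk : ∀ p q, p ≠ 0 → q ≠ 0 → a p * k p q * b q = k' p q) :
    kerInt k f g = kerInt k' f' g' :=
  integral_congr_ae (kerFun_ae_eq hf hg hk)

theorem kerInt_congr_kernel {k k' : R3 → R3 → ℝ} (f g : R3 → ℂ)
    (hk : ∀ p q, p ≠ 0 → q ≠ 0 → k p q = k' p q) : kerInt k f g = kerInt k' f g :=
  kerInt_eq (a := fun _ => 1) (b := fun _ => 1) (by simp) (by simp)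
    fun p q hp hq => by rw [one_mul, mul_one, hk p q hp hq]

theorem kerInt_const_mul (c : ℝ) (k : R3 → R3 → ℝ) (f g : R3 → ℂ) :
    kerInt (fun p q => c * k p q) f g = c * kerInt k f g := by
  rw [kerInt, kerInt, ← integral_const_mul]
  refine integral_congr_ae (ae_of_all _ fun z => ?_)
  simp only [kerFun]
  push_cast; ring

theorem kerInt_add {k k' : R3 → R3 → ℝ} {C C' : ℝ} (h : BddKernel k C) (h' : BddKernel k' C')
    (f g : L2) :
    kerInt (fun p q => k p q + k' p q) f g = kerInt k f g + kerInt k' f g := by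
  rw [kerInt, kerInt, kerInt, ← integral_add (h.integrable f g) (h'.integrable f g)]
  refine integral_congr_ae (ae_of_all _ fun z => ?_)
  simp only [kerFun]
  push_cast; ring

theorem kerInt_swap (k : R3 → R3 → ℝ) (f g : R3 → ℂ) :
    kerInt (fun p q => k q p) f g = conj (kerInt k g f) := by
  rw [kerInt, kerInt, ← integral_conj, ← integral_prod_swap]
  refine integral_congr_ae (ae_of_all _ fun z => ?_)
  simp only [kerFun, Prod.fst_swap, Prod.snd_swap, map_mul, Complex.conj_ofReal, Complex.conj_conj]
  ring

theorem BddKernel.swap {k : R3 → R3 → ℝ} {C : ℝ} (h : BddKernel k C) :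
    BddKernel (fun p q => k q p) C := by
  have hm : Measurable (Function.uncurry fun p q => k q p) := h.1.comp measurable_swap
  refine ⟨hm, fun f g => ?_⟩
  have := h.2 g f
  rw [add_comm] at this
  refine le_trans (le_of_eq ?_) this
  congr 1
  rw [lintegral_lintegral_swap]
  · refine lintegral_congr fun q => lintegral_congr fun p => ?_
    ring
  · have h1 := (Lp.aestronglyMeasurable f).enorm.comp_quasiMeasurePreserving
      (Measure.quasiMeasurePreserving_fst (μ := (volume : Measure R3)) (ν := (volume : Measure R3)))
    have h2 := (Lp.aestronglyMeasurable g).enorm.comp_quasiMeasurePreserving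
      (Measure.quasiMeasurePreserving_snd (μ := (volume : Measure R3)) (ν := (volume : Measure R3)))
    exact (h1.mul hm.enorm.aemeasurable).mul h2

/-- Symmetrization of the real part of the quadratic form of a kernel. -/
theorem two_re_kerInt {k k' : R3 → R3 → ℝ} {C : ℝ} (h : BddKernel k C)
    (hk : ∀ p q, p ≠ 0 → q ≠ 0 → k p q + k q p = k' p q) (f : L2) :
    2 * (kerInt k f f).re = (kerInt k' f f).re := by
  rw [← kerInt_congr_kernel f f hk, kerInt_add h h.swap, kerInt_swap, Complex.add_re,
    Complex.conj_re]
  ring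

theorem BddKernel.norm_kerInt_le {k : R3 → R3 → ℝ} {C : ℝ} (hC : 0 ≤ C) (h : BddKernel k C) (f : L2) :
    ‖kerInt k f f‖ ≤ C * ‖f‖ ^ 2 := by
  have := h.norm_integral_le hC f f
  rw [kerInt]; linarith

/-- The bounded operator of a bounded kernel. -/
def BddKernel.op {k : R3 → R3 → ℝ} {C : ℝ} (h : BddKernel k C) (hC : 0 ≤ C) : L2 →L[ℂ] L2 :=
  (h.exists_clm hC).choose

theorem BddKernel.inner_op {k : R3 → R3 → ℝ} {C : ℝ} (h : BddKernel k C) (hC : 0 ≤ C) (f g : L2) :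
    inner ℂ f (h.op hC g) = kerInt k f g := (h.exists_clm hC).choose_spec f g

/-- The parity operator `f ↦ f(-·)`. -/
def parity : L2 →ₗᵢ[ℂ] L2 :=
  Lp.compMeasurePreservingₗᵢ ℂ (fun p : R3 => -p) (Measure.measurePreserving_neg volume)

theorem parity_coe (f : L2) : parity f =ᵐ[volume] fun p => f (-p) :=
  Lp.coeFn_compMeasurePreserving f (Measure.measurePreserving_neg volume)

theorem kerInt_neg_right (k : R3 → R3 → ℝ) (f g : L2) :
    kerInt k f (parity g) = kerInt (fun p q => k p (-q)) f g := by
  have hmp : MeasurePreserving (Prod.map id Neg.neg : R3 × R3 → R3 × R3)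
      ((volume : Measure R3).prod volume) ((volume : Measure R3).prod volume) :=
    (MeasurePreserving.id _).prod (Measure.measurePreserving_neg volume)
  have hme : MeasurableEmbedding (Prod.map id Neg.neg : R3 × R3 → R3 × R3) :=
    MeasurableEmbedding.id.prodMap (MeasurableEquiv.neg R3).measurableEmbedding
  rw [kerInt_congr (ae_eq_refl _) (parity_coe g), kerInt, ← hmp.integral_comp hme, kerInt]
  refine integral_congr_ae (ae_of_all _ fun z => ?_)
  simp only [kerFun, Prod.map_fst, Prod.map_snd, id, neg_neg]

theorem kerInt_neg_left (k : R3 → R3 → ℝ) (f g : L2) :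
    kerInt k (parity f) g = kerInt (fun p q => k (-p) q) f g := by
  have e := fun (k : R3 → R3 → ℝ) (f' : L2) => kerInt_swap (fun p q => k q p) f' g
  calc kerInt k (parity f) g = conj (kerInt (fun p q => k q p) g (parity f)) := e k _
    _ = conj (kerInt (fun p q => k (-q) p) g f) := by rw [kerInt_neg_right]
    _ = _ := (e (fun p q => k (-p) q) f).symm

theorem kerInt_parity_right {k : R3 → R3 → ℝ} {s : ℝ} (hk : ∀ p q, k p (-q) = s * k p q) (f g : L2) :
    kerInt k f (parity g) = s * kerInt k f g := by
  rw [kerInt_neg_right, ← kerInt_const_mul]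
  simp_rw [hk]

theorem kerInt_parity_left {k : R3 → R3 → ℝ} {s : ℝ} (hk : ∀ p q, k (-p) q = s * k p q) (f g : L2) :
    kerInt k (parity f) g = s * kerInt k f g := by
  rw [kerInt_neg_left, ← kerInt_const_mul]
  simp_rw [hk]

/-- The component of parity `s = ±1`. -/
def parityPart (s : ℝ) (f : L2) : L2 := (1 / 2 : ℂ) • (f + (s : ℂ) • parity f)

theorem norm_sq_parityPart_add (f : L2) :
    ‖parityPart 1 f‖ ^ 2 + ‖parityPart (-1) f‖ ^ 2 = ‖f‖ ^ 2 := by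
  have h := parallelogram_law_with_norm ℂ f (parity f)
  rw [LinearIsometry.norm_map] at h
  rw [parityPart, parityPart, norm_smul, norm_smul, mul_pow, mul_pow]
  push_cast
  rw [one_smul, neg_one_smul, ← sub_eq_add_neg]
  norm_num
  linarith

/-- A kernel of parity `s` in both variables sees only the component of parity `s`. -/
theorem kerInt_parityPart {k : R3 → R3 → ℝ} {C : ℝ} (h : BddKernel k C) (hC : 0 ≤ C) {s t : ℝ}
    (hl : ∀ p q, k (-p) q = s * k p q) (hr : ∀ p q, k p (-q) = s * k p q) (f : L2) :
    kerInt k (parityPart t f) (parityPart t f) = (((1 + t * s) / 2) ^ 2 : ℝ) * kerInt k f f := by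
  rw [← h.inner_op hC, parityPart, map_smul, map_add, map_smul, inner_smul_left, inner_smul_right,
    inner_add_left, inner_add_right, inner_add_right, inner_smul_left, inner_smul_left,
    inner_smul_right, inner_smul_right, h.inner_op, h.inner_op, h.inner_op, h.inner_op,
    kerInt_parity_left hl, kerInt_parity_right hr, kerInt_parity_left hl, kerInt_parity_right hr,
    Complex.conj_ofReal]
  simp only [map_div₀, map_one, map_ofNat]
  push_cast
  ring

theorem BddKernel.norm_kerInt_le_parityPart {k : R3 → R3 → ℝ} {C : ℝ} (h : BddKernel k C)
    (hC : 0 ≤ C) {s : ℝ} (hs : s ^ 2 = 1) (hl : ∀ p q, k (-p) q = s * k p q)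
    (hr : ∀ p q, k p (-q) = s * k p q) (f : L2) :
    ‖kerInt k f f‖ ≤ C * ‖parityPart s f‖ ^ 2 := by
  have h1 := kerInt_parityPart h hC (t := s) hl hr f
  have h2 : ((1 + s * s) / 2) ^ 2 = 1 := by rw [← sq, hs]; norm_num
  rw [h2, Complex.ofReal_one, one_mul] at h1
  rw [← h1]
  exact h.norm_kerInt_le hC _

/-! ### The form inequality for `ξ` tested against `|∇| ξ` -/

/-- The kernel `1 / (p² + q² + p·q + lam)`. -/
def stmKernel (lam : ℝ) (p q : R3) : ℝ := 1 / (‖p‖ ^ 2 + ‖q‖ ^ 2 + inner ℝ p q + lam)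

theorem measurable_stmKernel (lam : ℝ) : Measurable (Function.uncurry (stmKernel lam)) := by
  unfold stmKernel Function.uncurry; fun_prop

theorem two_mul_abs_inner_le (p q : R3) : 2 * |inner ℝ p q| ≤ ‖p‖ ^ 2 + ‖q‖ ^ 2 := by
  have h := abs_real_inner_le_norm p q
  nlinarith [sq_nonneg (‖p‖ - ‖q‖)]

theorem half_le_add_inner (p q : R3) :
    (‖p‖ ^ 2 + ‖q‖ ^ 2) / 2 ≤ ‖p‖ ^ 2 + ‖q‖ ^ 2 + inner ℝ p q := by
  have h1 := two_mul_abs_inner_le p q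
  have h2 := neg_abs_le (inner ℝ p q)
  linarith

theorem sq_add_sq_pos {p : R3} (hp : p ≠ 0) (q : R3) : 0 < ‖p‖ ^ 2 + ‖q‖ ^ 2 := by
  have := norm_pos_iff.2 hp
  positivity

theorem stmKernel_nonneg {lam : ℝ} (hl : 0 ≤ lam) (p q : R3) : 0 ≤ stmKernel lam p q := by
  have h := half_le_add_inner p q
  have : 0 ≤ ‖p‖ ^ 2 + ‖q‖ ^ 2 + inner ℝ p q + lam := by
    have : 0 ≤ (‖p‖ ^ 2 + ‖q‖ ^ 2) / 2 := by positivity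
    linarith
  unfold stmKernel; positivity

theorem stmKernel_le_evenKernel {lam : ℝ} (hl : 0 ≤ lam) {p : R3} (hp : p ≠ 0) (q : R3) :
    stmKernel lam p q ≤ 2 * evenKernel p q := by
  have h := half_le_add_inner p q
  have hA := sq_add_sq_pos hp q
  have h1 := inv_sq_add_sq_le_evenKernel (q := q) hp
  have h2 : stmKernel lam p q ≤ 1 / ((‖p‖ ^ 2 + ‖q‖ ^ 2) / 2) :=
    one_div_le_one_div_of_le (by positivity) (by linarith)
  have h3 : 1 / ((‖p‖ ^ 2 + ‖q‖ ^ 2) / 2) = 2 * (1 / (‖p‖ ^ 2 + ‖q‖ ^ 2)) := by field_simp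
  linarith

theorem evenKernel_div_le {p q : R3} (hp : p ≠ 0) (hq : q ≠ 0) :
    evenKernel p q / ‖q‖ ≤ domKernel p q := by
  have hP : 0 < ‖p‖ := norm_pos_iff.2 hp
  have hQ : 0 < ‖q‖ := norm_pos_iff.2 hq
  rw [domKernel, div_eq_mul_inv, mul_comm]
  refine mul_le_mul_of_nonneg_right ?_ (evenKernel_nonneg p q)
  rw [inv_eq_one_div, div_le_div_iff₀ hQ (by positivity)]
  nlinarith

theorem bddKernel_evenKernel_div : BddKernel (fun p q => evenKernel p q / ‖q‖) (1 * domConst) := by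
  refine bddKernel_domKernel.mono zero_le_one
    (measurable_evenKernel.div (by fun_prop)) fun p q hp hq => ?_
  rw [one_mul, abs_of_nonneg (domKernel_nonneg p q),
    abs_of_nonneg (div_nonneg (evenKernel_nonneg p q) (norm_nonneg q))]
  exact evenKernel_div_le hp hq

theorem bddKernel_stmKernel_div {lam : ℝ} (hl : 0 ≤ lam) :
    BddKernel (fun p q => stmKernel lam p q / ‖q‖) (2 * domConst) := by
  refine bddKernel_domKernel.mono zero_le_two
    ((measurable_stmKernel lam).div (by fun_prop)) fun p q hp hq => ?_
  rw [abs_of_nonneg (domKernel_nonneg p q),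
    abs_of_nonneg (div_nonneg (stmKernel_nonneg hl p q) (norm_nonneg q))]
  refine le_trans ?_ (mul_le_mul_of_nonneg_left (evenKernel_div_le hp hq) zero_le_two)
  rw [← mul_div_assoc]
  exact div_le_div_of_nonneg_right (stmKernel_le_evenKernel hl hp q) (norm_nonneg q)

theorem bddKernel_newtonKernel : BddKernel newtonKernel (1 * domConst) := by
  refine bddKernel_domKernel.mono zero_le_one measurable_newtonKernel fun p q hp hq => ?_
  rw [one_mul, abs_of_nonneg (domKernel_nonneg p q), abs_of_nonneg (newtonKernel_nonneg p q)]
  exact newtonKernel_le_domKernel hp hq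

theorem stmKernel_zero_eq {p : R3} (hp : p ≠ 0) (q : R3) :
    stmKernel 0 p q = evenKernel p q - oddKernel p q := by
  have h1 := two_mul_abs_inner_le p q
  have hA := sq_add_sq_pos hp q
  have h2 : 0 < ‖p‖ ^ 2 + ‖q‖ ^ 2 + inner ℝ p q := by
    have := half_le_add_inner p q; linarith
  have h3 : 0 < ‖p‖ ^ 2 + ‖q‖ ^ 2 - inner ℝ p q := by
    have := le_abs_self (inner ℝ p q); linarith
  rw [stmKernel, evenKernel, oddKernel, add_zero, ← sub_div, sq_sub_sq, div_mul_cancel_right₀ h3.ne',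
    one_div]

/-- Newton's inequality, with the charge density `ξ̂` written as `|p|⁻¹` times the transform of
`|∇| ξ`. -/
theorem newton_le_hardy (χ : L2) :
    1 / (4 * Real.pi) * (kerInt newtonKernel (fourierU (absDeriv χ)) (fourierU (absDeriv χ))).re ≤
      ‖hardyOp χ‖ ^ 2 := by
  have h := kerFun_ae_eq (k := newtonKernel) (k' := fun p q => 1 / max ‖p‖ ‖q‖)
    (a := fun p => ‖p‖) (b := fun p => ‖p‖) (fourierU_absDeriv χ) (fourierU_absDeriv χ)
    (fun p q hp hq => by
      have hP : 0 < ‖p‖ := norm_pos_iff.2 hp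
      have hQ : 0 < ‖q‖ := norm_pos_iff.2 hq
      have hM : 0 < max ‖p‖ ‖q‖ := lt_max_of_lt_left hP
      rw [newtonKernel]; field_simp)
  rw [kerInt, integral_congr_ae h]
  exact newton_inequality (hardyOp_coe χ)
    ((bddKernel_newtonKernel.integrable _ _).congr h)

theorem re_inner_hardyOp_nonneg (χ : L2) : 0 ≤ (inner ℂ (hardyOp χ) (absDeriv χ)).re := by
  have := norm_hardyOp_sq_le χ
  nlinarith [sq_nonneg ‖hardyOp χ‖]

/-- The even kernel is controlled by the regularizing term and the sharp Schur constant: a part `g` of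
the strength `γ` is spent on removing `newtonKernel` from the even kernel. -/
theorem screened_bound {g γ : ℝ} (h0 : 0 ≤ g) (hg : g ≤ 6 / 5) (hgγ : g ≤ γ) (χ : L2) :
    1 / (2 * Real.pi ^ 2) *
        (kerInt domKernel (fourierU (absDeriv χ)) (fourierU (absDeriv χ))).re ≤
      (4 * (√3 - 1) - 2 * g) * ‖parityPart 1 (fourierU (absDeriv χ))‖ ^ 2 +
        γ * (inner ℂ (hardyOp χ) (absDeriv χ)).re := by
  have hpi := Real.pi_pos
  set φ := fourierU (absDeriv χ) with hφ
  have hC : 0 ≤ 4 * (√3 - 1) - 2 * g := by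
    have : (8 / 5 : ℝ) ≤ √3 := Real.le_sqrt_of_sq_le (by norm_num)
    linarith
  have hB := bddKernel_screenedKernel h0 hg
  have e : kerInt domKernel φ φ = (2 * Real.pi ^ 2 : ℝ) * (kerInt (screenedKernel g) φ φ +
      (g / (8 * Real.pi) : ℝ) * kerInt newtonKernel φ φ) := by
    have hN : BddKernel (fun p q => g / (8 * Real.pi) * newtonKernel p q)
        (g / (8 * Real.pi) * (1 * domConst)) :=
      bddKernel_newtonKernel.mono (by positivity) (measurable_newtonKernel.const_mul _)
        fun p q _ _ => by rw [abs_mul, abs_of_nonneg (a := g / _) (by positivity)]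
    rw [← kerInt_const_mul, ← kerInt_add hB hN, ← kerInt_const_mul]
    refine kerInt_congr_kernel _ _ fun p q _ _ => ?_
    rw [screenedKernel]
    field_simp
    ring
  have h1 := hB.norm_kerInt_le_parityPart hC (s := 1) (by norm_num)
    (fun p q => by simp [screenedKernel, domKernel, evenKernel, newtonKernel])
    (fun p q => by simp [screenedKernel, domKernel, evenKernel, newtonKernel]) φ
  have h2 := (Complex.re_le_norm _).trans h1
  have h3 := newton_le_hardy χ
  have h4 := norm_hardyOp_sq_le χ
  have h5 := re_inner_hardyOp_nonneg χ
  rw [e, Complex.re_ofReal_mul, Complex.add_re, Complex.re_ofReal_mul, ← mul_assoc]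
  rw [show 1 / (2 * Real.pi ^ 2) * (2 * Real.pi ^ 2) = 1 by field_simp, one_mul]
  have h6 : g / (8 * Real.pi) * (kerInt newtonKernel φ φ).re ≤
      g * (inner ℂ (hardyOp χ) (absDeriv χ)).re := by
    have : g / (8 * Real.pi) * (kerInt newtonKernel φ φ).re =
        g / 2 * (1 / (4 * Real.pi) * (kerInt newtonKernel φ φ).re) := by field_simp; ring
    rw [this]
    have := mul_le_mul_of_nonneg_left (h3.trans h4) (show 0 ≤ g / 2 by linarith)
    linarith
  have h7 := mul_le_mul_of_nonneg_right hgγ h5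
  linarith

/-- The diagonal part, of strength `√3 / 2`, dominates the off-diagonal part with room to spare, for the
even part of the kernel and for the full kernel. This is where `γ > γ_c*` enters. -/
theorem exists_regularity_constant {γ : ℝ} (hγ : gammaCStar < γ) : ∃ c : ℝ, 0 < c ∧ c < √3 / 2 ∧
    ∀ χ : L2,
      1 / Real.pi ^ 2 * (kerInt (fun p q => evenKernel p q / ‖q‖) (fourierU (absDeriv χ))
          (fourierU (absDeriv χ))).re ≤
        (√3 / 2 - c) * ‖absDeriv χ‖ ^ 2 + γ * (inner ℂ (hardyOp χ) (absDeriv χ)).re ∧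
      1 / Real.pi ^ 2 * (kerInt (fun p q => stmKernel 0 p q / ‖q‖) (fourierU (absDeriv χ))
          (fourierU (absDeriv χ))).re ≤
        (√3 / 2 - c) * ‖absDeriv χ‖ ^ 2 + γ * (inner ℂ (hardyOp χ) (absDeriv χ)).re := by
  have hpi := Real.pi_pos
  have hpi3 := Real.pi_gt_three
  have s1 : (17 / 10 : ℝ) ≤ √3 := Real.le_sqrt_of_sq_le (by norm_num)
  have s2 : √3 ≤ 9 / 5 := Real.sqrt_le_iff.2 ⟨by norm_num, by norm_num⟩
  rw [gammaCStar] at hγ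
  -- `6 / 5` is above the threshold, and small enough for the screened kernel to be nonnegative
  set g := min γ (6 / 5) with hg
  have hg1 : 7 / 4 * √3 - 2 < g := lt_min hγ (by linarith)
  have hg0 : 0 ≤ g := by linarith
  have hg2 : g ≤ 6 / 5 := min_le_right _ _
  set Ce := 4 * (√3 - 1) - 2 * g with hCe
  set Co := 1 / (2 * Real.pi ^ 2) * (4 / 3 * (2 * Real.pi * (1 / 2 + Real.pi / 4))) with hCo
  have hCe0 : 0 ≤ Ce := by linarith
  have hCo' : Co = 2 / (3 * Real.pi) + 1 / 3 := by rw [hCo]; field_simp; ring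
  have hCo1 : Co ≤ 3 / 5 := by
    have : 2 / (3 * Real.pi) ≤ 2 / 9 := by
      rw [div_le_div_iff₀ (by positivity) (by norm_num)]; linarith
    rw [hCo']; linarith
  have hCo0 : 0 ≤ Co := by positivity
  -- the even kernel only sees the even part of `ξ̂`, the odd kernel only the odd part, so the larger of
  -- the two constants suffices
  set D := max Ce Co with hD
  have hD0 : 0 ≤ D := le_max_of_le_left hCe0
  have hDlt : D < √3 / 2 := max_lt (by rw [hCe]; linarith) (by linarith)
  refine ⟨(√3 / 2 - D) / 2, by linarith, by linarith, fun χ => ?_⟩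
  set φ := fourierU (absDeriv χ) with hφ
  have hnφ : ‖φ‖ = ‖absDeriv χ‖ := fourierU.norm_map _
  have hpar := norm_sq_parityPart_add φ
  rw [hnφ] at hpar
  have hs := screened_bound hg0 hg2 (min_le_left γ (6 / 5)) χ
  rw [← hCe, ← hφ] at hs
  have hDe : Ce * ‖parityPart 1 φ‖ ^ 2 ≤ D * ‖parityPart 1 φ‖ ^ 2 :=
    mul_le_mul_of_nonneg_right (le_max_left _ _) (sq_nonneg _)
  have hDo : Co * ‖parityPart (-1) φ‖ ^ 2 ≤ D * ‖parityPart (-1) φ‖ ^ 2 :=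
    mul_le_mul_of_nonneg_right (le_max_right _ _) (sq_nonneg _)
  have hDn := mul_nonneg hD0 (sq_nonneg ‖parityPart (-1) φ‖)
  have hDc : D * ‖absDeriv χ‖ ^ 2 ≤ (√3 / 2 - (√3 / 2 - D) / 2) * ‖absDeriv χ‖ ^ 2 :=
    mul_le_mul_of_nonneg_right (by linarith) (sq_nonneg _)
  have hDsum : D * ‖absDeriv χ‖ ^ 2 = D * ‖parityPart 1 φ‖ ^ 2 + D * ‖parityPart (-1) φ‖ ^ 2 := by
    rw [← hpar]; ring
  constructor
  · have e := two_re_kerInt (k' := domKernel) bddKernel_evenKernel_div (fun p q hp hq => by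
      have hP : 0 < ‖p‖ := norm_pos_iff.2 hp
      have hQ : 0 < ‖q‖ := norm_pos_iff.2 hq
      rw [evenKernel_comm q p, domKernel]; field_simp) φ
    have e2 : 1 / Real.pi ^ 2 * (kerInt (fun p q => evenKernel p q / ‖q‖) φ φ).re =
        1 / (2 * Real.pi ^ 2) * (kerInt domKernel φ φ).re := by
      rw [← e]; field_simp
    rw [e2]
    linarith
  · have hO : BddKernel (fun p q => (-1) * oddDomKernel p q) _ :=
      bddKernel_oddDomKernel.mono (c := 1) zero_le_one (measurable_oddDomKernel.const_mul _)
        fun p q _ _ => by simp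
    have e := two_re_kerInt (k' := fun p q => domKernel p q + (-1) * oddDomKernel p q)
      (bddKernel_stmKernel_div le_rfl) (fun p q hp hq => by
      have hP : 0 < ‖p‖ := norm_pos_iff.2 hp
      have hQ : 0 < ‖q‖ := norm_pos_iff.2 hq
      have e3 : stmKernel 0 q p = stmKernel 0 p q := by
        rw [stmKernel, stmKernel, real_inner_comm, add_comm (‖q‖ ^ 2)]
      rw [e3, stmKernel_zero_eq hp, domKernel, oddDomKernel]; field_simp; ring) φ
    rw [kerInt_add bddKernel_domKernel hO, kerInt_const_mul, Complex.add_re,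
      Complex.re_ofReal_mul] at e
    have ho := bddKernel_oddDomKernel.norm_kerInt_le_parityPart (by positivity) (s := -1)
      (by norm_num) (fun p q => by simp [oddDomKernel, oddKernel]; ring)
      (fun p q => by simp [oddDomKernel, oddKernel]; ring) φ
    have ho2 := (neg_le_abs _).trans ((Complex.abs_re_le_norm (kerInt oddDomKernel φ φ)).trans ho)
    have ho3 := mul_le_mul_of_nonneg_left ho2 (show 0 ≤ 1 / (2 * Real.pi ^ 2) by positivity)
    rw [← mul_assoc, ← hCo] at ho3
    have e2 : 1 / Real.pi ^ 2 * (kerInt (fun p q => stmKernel 0 p q / ‖q‖) φ φ).re =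
        1 / (2 * Real.pi ^ 2) * (kerInt domKernel φ φ).re +
        1 / (2 * Real.pi ^ 2) * -(kerInt oddDomKernel φ φ).re := by
      rw [← mul_add, show (kerInt domKernel φ φ).re + -(kerInt oddDomKernel φ φ).re =
        2 * (kerInt (fun p q => stmKernel 0 p q / ‖q‖) φ φ).re by rw [e]; ring]
      field_simp
    rw [e2]
    linarith

/-! ### From the operator inequality to the form inequality -/

/-- Cauchy-Schwarz for a nonnegative operator: `‖B x‖² ≤ N (x, B x)` if `‖B‖ ≤ N`. -/
theorem norm_sq_apply_le {H : Type*} [NormedAddCommGroup H] [InnerProductSpace ℂ H] (B : H →L[ℂ] H)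
    (hB : ∀ x y, inner ℂ (B x) y = inner ℂ x (B y)) (h0 : ∀ x, 0 ≤ (inner ℂ x (B x)).re) {N : ℝ}
    (hN : 0 < N) (hBN : ‖B‖ ≤ N) (x : H) : ‖B x‖ ^ 2 ≤ N * (inner ℂ x (B x)).re := by
  have h1 := h0 (x - ((N⁻¹ : ℝ) : ℂ) • B x)
  have e1 : (inner ℂ (B x) (B x)).re = ‖B x‖ ^ 2 := inner_self_eq_norm_sq (𝕜 := ℂ) _
  have e2 : (inner ℂ x (B (B x))).re = ‖B x‖ ^ 2 := by rw [← hB, e1]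
  have h2 : (inner ℂ (B x) (B (B x))).re ≤ N * ‖B x‖ ^ 2 := by
    calc _ ≤ ‖B x‖ * ‖B (B x)‖ := (Complex.re_le_norm _).trans (norm_inner_le_norm _ _)
      _ ≤ ‖B x‖ * (N * ‖B x‖) := by
        gcongr
        exact (B.le_opNorm _).trans (by gcongr)
      _ = _ := by ring
  have h3 : N⁻¹ * (N⁻¹ * (inner ℂ (B x) (B (B x))).re) ≤ N⁻¹ * ‖B x‖ ^ 2 := by
    have := mul_le_mul_of_nonneg_left h2 (show 0 ≤ N⁻¹ * N⁻¹ by positivity)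
    calc _ = N⁻¹ * N⁻¹ * (inner ℂ (B x) (B (B x))).re := by ring
      _ ≤ _ := this
      _ = _ := by field_simp
  simp only [map_sub, map_smul, inner_sub_left, inner_sub_right, inner_smul_left, inner_smul_right,
    Complex.conj_ofReal, Complex.sub_re, Complex.re_ofReal_mul, e1, e2] at h1
  have h4 : N⁻¹ * ‖B x‖ ^ 2 ≤ (inner ℂ x (B x)).re := by linarith
  rwa [inv_mul_le_iff₀ hN] at h4

/-- A symmetric operator `T` is nonnegative if `Re (A x, T x) ≥ 0` for some bounded, strictly
accretive `A`. -/
theorem re_inner_nonneg_of_accretive {H : Type*} [NormedAddCommGroup H] [InnerProductSpace ℂ H]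
    (T A : H →L[ℂ] H) (hT : ∀ x y, inner ℂ (T x) y = inner ℂ x (T y)) {r : ℝ} (hr : 0 < r)
    (hA : ∀ x, r * ‖x‖ ^ 2 ≤ (inner ℂ (A x) x).re) (h : ∀ x, 0 ≤ (inner ℂ (A x) (T x)).re) (x : H) :
    0 ≤ (inner ℂ x (T x)).re := by
  by_contra hneg
  push Not at hneg
  set s : Set ℝ := (fun y => (inner ℂ y (T y)).re) '' {y : H | ‖y‖ = 1} with hs
  have hx0 : x ≠ 0 := fun h => by simp [h] at hneg
  have hxn : 0 < ‖x‖ := norm_pos_iff.2 hx0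
  have hscale : ∀ y : H, y ≠ 0 → (inner ℂ y (T y)).re / ‖y‖ ^ 2 ∈ s := fun y hy => by
    have hyn : 0 < ‖y‖ := norm_pos_iff.2 hy
    refine ⟨((‖y‖⁻¹ : ℝ) : ℂ) • y, ?_, ?_⟩
    · rw [mem_ofPred_eq, norm_smul, Complex.norm_real, Real.norm_of_nonneg (by positivity),
        inv_mul_cancel₀ hyn.ne']
    · simp only [map_smul, inner_smul_left, inner_smul_right, Complex.conj_ofReal,
        Complex.re_ofReal_mul]
      field_simp
  have hbdd : BddBelow s := by
    refine ⟨-‖T‖, ?_⟩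
    rintro _ ⟨y, hy, rfl⟩
    rw [mem_ofPred_eq] at hy
    have h1 : ‖inner ℂ y (T y)‖ ≤ ‖T‖ := (norm_inner_le_norm _ _).trans (by
      have := T.le_opNorm y
      rw [hy] at this ⊢; linarith)
    exact (abs_le.1 ((Complex.abs_re_le_norm _).trans h1)).1
  set m := sInf s with hm
  have hm0 : m < 0 := (csInf_le hbdd (hscale x hx0)).trans_lt
    (div_neg_of_neg_of_pos hneg (by positivity))
  have hle : ∀ y, m * ‖y‖ ^ 2 ≤ (inner ℂ y (T y)).re := fun y => by
    by_cases hy : y = 0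
    · simp [hy]
    · have hyn : 0 < ‖y‖ := norm_pos_iff.2 hy
      exact (le_div_iff₀ (by positivity)).1 (csInf_le hbdd (hscale y hy))
  set B : H →L[ℂ] H := T - (m : ℂ) • ContinuousLinearMap.id ℂ H with hBdef
  have hBx : ∀ y, B y = T y - (m : ℂ) • y := fun y => by simp [hBdef]
  have hBre : ∀ y, (inner ℂ y (B y)).re = (inner ℂ y (T y)).re - m * ‖y‖ ^ 2 := fun y => by
    have e : (inner ℂ y y).re = ‖y‖ ^ 2 := inner_self_eq_norm_sq (𝕜 := ℂ) _
    rw [hBx, inner_sub_right, inner_smul_right, Complex.sub_re, Complex.re_ofReal_mul, e]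
  have hN : (0 : ℝ) < ‖B‖ + 1 := by positivity
  have hAN : (0 : ℝ) < ‖A‖ + 1 := by positivity
  have hq := norm_sq_apply_le B (fun y z => by
    rw [hBx, hBx, inner_sub_left, inner_sub_right, inner_smul_left, inner_smul_right,
      Complex.conj_ofReal, hT]) (fun y => by rw [hBre]; linarith [hle y]) hN (by linarith)
  set ε := (m * r) ^ 2 / ((‖A‖ + 1) ^ 2 * (‖B‖ + 1)) with hε
  have hε0 : 0 < ε := by
    have : m * r ≠ 0 := mul_ne_zero hm0.ne hr.ne'
    positivity
  -- the numerical range cannot come closer to its infimum `m` than `ε`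
  have key : ∀ v ∈ s, m + ε ≤ v := by
    rintro _ ⟨y, hy, rfl⟩
    rw [mem_ofPred_eq] at hy
    have h1 := h y
    have h2 := hA y
    have h3 := hq y
    have h4 : (inner ℂ (A y) (T y)).re = m * (inner ℂ (A y) y).re + (inner ℂ (A y) (B y)).re := by
      rw [hBx, inner_sub_right, inner_smul_right, Complex.sub_re, Complex.re_ofReal_mul]; ring
    have h5 : (inner ℂ (A y) (B y)).re ≤ (‖A‖ + 1) * ‖B y‖ :=
      (Complex.re_le_norm _).trans ((norm_inner_le_norm _ _).trans (by
        gcongr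
        have := A.le_opNorm y
        rw [hy] at this; linarith))
    rw [hy, one_pow, mul_one] at h2
    have h6 : -(m * r) ≤ (‖A‖ + 1) * ‖B y‖ := by
      have := mul_le_mul_of_nonpos_left h2 hm0.le
      linarith
    have h7 : (m * r) ^ 2 ≤ (‖A‖ + 1) ^ 2 * ‖B y‖ ^ 2 := by
      rw [← mul_pow, ← neg_sq]
      exact pow_le_pow_left₀ (by nlinarith) h6 2
    have h8 : ε ≤ (inner ℂ y (B y)).re := by
      rw [hε, div_le_iff₀ (by positivity)]
      have := mul_le_mul_of_nonneg_left h3 (show 0 ≤ (‖A‖ + 1) ^ 2 by positivity)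
      linarith
    rw [hBre, hy] at h8
    simp only
    linarith
  have := le_csInf ⟨_, hscale x hx0⟩ key
  linarith

theorem fourierMul_fourierMul {m m' m'' : R3 → ℝ} (h : BddSymbol m) (h' : BddSymbol m')
    (h'' : BddSymbol m'') (e : ∀ p, m p * m' p = m'' p) (ψ : L2) :
    fourierMul m (fourierMul m' ψ) = fourierMul m'' ψ := by
  refine fourierU.injective (Lp.ext ?_)
  filter_upwards [fourierU_fourierMul h (fourierMul m' ψ), fourierU_fourierMul h' ψ,
    fourierU_fourierMul h'' ψ] with p h1 h2 h3
  rw [h1, h2, h3, ← e p]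
  push_cast
  ring

/-- Cut-offs in momentum space tend strongly to the identity. -/
theorem tendsto_fourierMul_one {m : ℕ → R3 → ℝ} (hm : ∀ n, BddSymbol (m n))
    (h0 : ∀ n p, 0 ≤ m n p) (h1 : ∀ n p, m n p ≤ 1)
    (hlim : ∀ p, p ≠ 0 → ∀ᶠ n in atTop, m n p = 1) (ψ : L2) :
    Tendsto (fun n => fourierMul (m n) ψ) atTop (𝓝 ψ) := by
  rw [tendsto_iff_norm_sub_tendsto_zero]
  have h2 : Tendsto (fun n => ∫⁻ p, ENNReal.ofReal ((m n p - 1) ^ 2) * ‖fourierU ψ p‖ₑ ^ 2) atTop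
      (𝓝 (∫⁻ _ : R3, 0)) := by
    refine tendsto_lintegral_of_dominated_convergence' (fun p => ‖fourierU ψ p‖ₑ ^ 2)
      (fun n => (((hm n).1.sub_const 1).pow_const 2).ennreal_ofReal.aemeasurable.mul
        ((Lp.aestronglyMeasurable _).enorm.pow_const 2)) (fun n => ae_of_all _ fun p => ?_) ?_ ?_
    · refine mul_le_of_le_one_left zero_le ?_
      rw [← ENNReal.ofReal_one]
      refine ENNReal.ofReal_le_ofReal ?_
      nlinarith [h0 n p, h1 n p]
    · rw [← enorm_sq_eq_lintegral]; simp
    · filter_upwards [ae_ne_zero_R3] with p hp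
      refine tendsto_const_nhds.congr' ?_
      filter_upwards [hlim p hp] with n hn
      simp [hn]
  rw [lintegral_zero] at h2
  have h3 : ∀ n, ∫⁻ p, ENNReal.ofReal ((m n p - 1) ^ 2) * ‖fourierU ψ p‖ₑ ^ 2 =
      ENNReal.ofReal (‖fourierMul (m n) ψ - ψ‖ ^ 2) := fun n => by
    rw [← fourierU.norm_map, ← enorm_sq_eq_ofReal, enorm_sq_eq_lintegral, map_sub]
    refine lintegral_congr_ae ?_
    filter_upwards [fourierU_fourierMul (hm n) ψ, Lp.coeFn_sub (fourierU (fourierMul (m n) ψ))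
      (fourierU ψ)] with p e1 e2
    rw [e2, Pi.sub_apply, e1, ← sub_one_mul, ← Complex.ofReal_one, ← Complex.ofReal_sub, enorm_mul,
      mul_pow, enorm_ofReal_complex]
    congr 1
    rw [← sq_abs, ENNReal.ofReal_pow (abs_nonneg _), ← Real.enorm_eq_ofReal_abs]
  simp_rw [h3] at h2
  have h4 := (ENNReal.tendsto_toReal ENNReal.zero_ne_top).comp h2
  have h5 := (h4.sqrt)
  simp only [Function.comp_def, ENNReal.toReal_ofReal (sq_nonneg _), ENNReal.toReal_zero,
    Real.sqrt_sq (norm_nonneg _), Real.sqrt_zero] at h5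
  exact h5

/-- The kernel `(1 + p)^(-1/2) k(p, q) (1 + q)^(-1/2)`: the form of `k` on `H^{1/2}`, read off on
`L²` through `bessel (1/2)`. -/
def halfKernel (k : R3 → R3 → ℝ) (p q : R3) : ℝ :=
  (1 + ‖p‖) ^ (-(1 / 2) : ℝ) * k p q * (1 + ‖q‖) ^ (-(1 / 2) : ℝ)

theorem measurable_halfKernel {k : R3 → R3 → ℝ} (hk : Measurable (Function.uncurry k)) :
    Measurable (Function.uncurry (halfKernel k)) := by
  have h1 : Measurable fun z : R3 × R3 => (1 + ‖z.1‖) ^ (-(1 / 2) : ℝ) := by fun_prop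
  have h2 : Measurable fun z : R3 × R3 => (1 + ‖z.2‖) ^ (-(1 / 2) : ℝ) := by fun_prop
  exact (h1.mul hk).mul h2

theorem rpow_neg_half_mul_le {p q : R3} (hp : p ≠ 0) (hq : q ≠ 0) :
    (1 + ‖p‖) ^ (-(1 / 2) : ℝ) * (1 + ‖q‖) ^ (-(1 / 2) : ℝ) ≤ (‖p‖ + ‖q‖) / (‖p‖ * ‖q‖) := by
  have hP : 0 < ‖p‖ := norm_pos_iff.2 hp
  have hQ : 0 < ‖q‖ := norm_pos_iff.2 hq
  have h1 : ∀ r : ℝ, 0 < r → (1 + r) ^ (-(1 / 2) : ℝ) ≤ 1 / √r := fun r hr => by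
    rw [Real.rpow_neg (by positivity), ← Real.sqrt_eq_rpow, inv_eq_one_div]
    exact one_div_le_one_div_of_le (by positivity) (Real.sqrt_le_sqrt (by linarith))
  calc _ ≤ 1 / √‖p‖ * (1 / √‖q‖) := by
        gcongr
        · exact h1 _ hP
        · exact h1 _ hQ
    _ = √‖p‖ * √‖q‖ / (‖p‖ * ‖q‖) := by
        have e1 := Real.mul_self_sqrt hP.le
        have e2 := Real.mul_self_sqrt hQ.le
        have := Real.sqrt_pos.2 hP
        have := Real.sqrt_pos.2 hQ
        rw [div_mul_div_comm, div_eq_div_iff (by positivity) (by positivity)]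
        nlinarith
    _ ≤ _ := by
        gcongr
        nlinarith [Real.mul_self_sqrt hP.le, Real.mul_self_sqrt hQ.le, sq_nonneg (√‖p‖ - √‖q‖)]

theorem bddKernel_halfKernel {k : R3 → R3 → ℝ} (hk : Measurable (Function.uncurry k)) {c : ℝ}
    (hc : 0 ≤ c) (h : ∀ p q, p ≠ 0 → q ≠ 0 → |k p q| ≤ c * evenKernel p q) :
    BddKernel (halfKernel k) (c * domConst) := by
  refine bddKernel_domKernel.mono hc (measurable_halfKernel hk) fun p q hp hq => ?_
  rw [abs_of_nonneg (domKernel_nonneg p q), halfKernel, abs_mul, abs_mul,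
    abs_of_nonneg (a := (1 + ‖p‖) ^ _) (by positivity),
    abs_of_nonneg (a := (1 + ‖q‖) ^ _) (by positivity), domKernel]
  calc _ = (1 + ‖p‖) ^ (-(1 / 2) : ℝ) * (1 + ‖q‖) ^ (-(1 / 2) : ℝ) * |k p q| := by ring
    _ ≤ (‖p‖ + ‖q‖) / (‖p‖ * ‖q‖) * (c * evenKernel p q) :=
        mul_le_mul (rpow_neg_half_mul_le hp hq) (h p q hp hq) (abs_nonneg _) (by positivity)
    _ = _ := by ring

theorem bddKernel_halfKernel_even : BddKernel (halfKernel evenKernel) (1 * domConst) :=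
  bddKernel_halfKernel measurable_evenKernel zero_le_one fun p q _ _ => by
    rw [one_mul, abs_of_nonneg (evenKernel_nonneg p q)]

/-- The annulus `1 / R ≤ |p| ≤ R` in momentum space. -/
def annulus (R : ℝ) : Set R3 := {p | R⁻¹ ≤ ‖p‖ ∧ ‖p‖ ≤ R}

theorem measurableSet_annulus (R : ℝ) : MeasurableSet (annulus R) :=
  (measurableSet_le measurable_const measurable_norm).inter
    (measurableSet_le measurable_norm measurable_const)

theorem bddSymbol_indicator_annulus {g : R3 → ℝ} (hg : Measurable g) (R C : ℝ) (hC : 0 ≤ C)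
    (h : ∀ p ∈ annulus R, |g p| ≤ C) : BddSymbol ((annulus R).indicator g) := by
  refine ⟨hg.indicator (measurableSet_annulus R), C, fun p => ?_⟩
  by_cases hp : p ∈ annulus R
  · rw [indicator_of_mem hp]; exact h p hp
  · rw [indicator_of_notMem hp, abs_zero]; exact hC

theorem ofReal_smul_sub_add_inner (a b c : ℝ) (u v w x : L2) :
    (inner ℂ x ((a : ℂ) • u - (b : ℂ) • v + (c : ℂ) • w)).re =
      a * (inner ℂ x u).re - b * (inner ℂ x v).re + c * (inner ℂ x w).re := by
  rw [inner_add_right, inner_sub_right, inner_smul_right, inner_smul_right, inner_smul_right,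
    Complex.add_re, Complex.sub_re, Complex.re_ofReal_mul, Complex.re_ofReal_mul,
    Complex.re_ofReal_mul]

/-- The operator on `L²` conjugate, by the Fourier transform, to the one with kernel `k`. -/
def BddKernel.fourierOp {k : R3 → R3 → ℝ} {C : ℝ} (h : BddKernel k C) (hC : 0 ≤ C) : L2 →L[ℂ] L2 :=
  (fourierU.symm : L2 →L[ℂ] L2) ∘L h.op hC ∘L (fourierU : L2 →L[ℂ] L2)

theorem BddKernel.inner_fourierOp {k : R3 → R3 → ℝ} {C : ℝ} (h : BddKernel k C) (hC : 0 ≤ C)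
    (f g : L2) : inner ℂ f (h.fourierOp hC g) = kerInt k (fourierU f) (fourierU g) := by
  rw [← fourierU.inner_map_map, ← h.inner_op hC]
  simp [BddKernel.fourierOp]

theorem BddKernel.inner_fourierOp_left {k : R3 → R3 → ℝ} {C : ℝ} (h : BddKernel k C) (hC : 0 ≤ C)
    (hk : ∀ p q, k q p = k p q) (f g : L2) :
    inner ℂ (h.fourierOp hC f) g = inner ℂ f (h.fourierOp hC g) := by
  rw [← inner_conj_symm, h.inner_fourierOp, h.inner_fourierOp, ← kerInt_swap]
  simp_rw [hk]

theorem halfKernel_comm {k : R3 → R3 → ℝ} (hk : ∀ p q, k q p = k p q) (p q : R3) :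
    halfKernel k q p = halfKernel k p q := by
  rw [halfKernel, halfKernel, hk]; ring

/-- Powers of `|p|` cut off to an annulus are bounded symbols. -/
theorem annulus_symbols {R : ℝ} (hR : 1 ≤ R) :
    BddSymbol ((annulus R).indicator fun _ => 1) ∧
    BddSymbol ((annulus R).indicator fun p => ‖p‖) ∧
    BddSymbol ((annulus R).indicator fun p => (1 + ‖p‖) ^ (1 / 2 : ℝ)) ∧
    BddSymbol (fun p => 1 + (annulus R).indicator (fun p => ‖p‖ - 1) p) := by
  refine ⟨bddSymbol_indicator_annulus measurable_const R 1 zero_le_one (by simp),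
    bddSymbol_indicator_annulus measurable_norm R R (by linarith) fun p hp => ?_,
    bddSymbol_indicator_annulus (by fun_prop) R ((1 + R) ^ (1 / 2 : ℝ)) (by positivity)
      fun p hp => ?_, ?_, 1 + (R + 1), fun p => ?_⟩
  · rw [abs_norm]; exact hp.2
  · rw [abs_of_nonneg (by positivity)]
    exact Real.rpow_le_rpow (by positivity) (by linarith [hp.2]) (by norm_num)
  · exact measurable_const.add ((measurable_norm.sub_const 1).indicator (measurableSet_annulus R))
  · refine (abs_add_le _ _).trans ?_
    rw [abs_one]
    gcongr
    by_cases hp : p ∈ annulus R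
    · rw [indicator_of_mem hp]
      refine (abs_sub _ _).trans ?_
      rw [abs_norm, abs_one]
      linarith [hp.2]
    · rw [indicator_of_notMem hp, abs_zero]; linarith

theorem inner_katoOp_eq {φ ψ χ : L2} (h1 : bessel (1 / 2) φ = absDeriv χ)
    (h2 : bessel (1 / 2) ψ = bessel 1 χ) :
    inner ℂ (katoOp φ) (katoOp ψ) = inner ℂ (absDeriv χ) (hardyOp χ) := by
  rw [inner_eq_integral, inner_eq_integral]
  refine integral_congr_ae ?_
  filter_upwards [katoOp_coe φ, katoOp_coe ψ, hardyOp_coe χ] with y e1 e2 e3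
  rw [e1, e2, e3, h1, h2, map_mul, Complex.conj_ofReal]
  have : ((1 / ‖y‖ : ℝ) : ℂ) = ((1 / √‖y‖ : ℝ) : ℂ) * ((1 / √‖y‖ : ℝ) : ℂ) := by
    rw [← Complex.ofReal_mul, div_mul_div_comm, Real.mul_self_sqrt (norm_nonneg y), one_mul]
  rw [this]
  ring

/-- The inequality tested against `|∇| ξ` yields the form inequality on functions whose Fourier
transform is supported in an annulus. -/
theorem even_form_bound_annulus {γ c : ℝ} (h : ∀ χ : L2,
      1 / Real.pi ^ 2 * (kerInt (fun p q => evenKernel p q / ‖q‖) (fourierU (absDeriv χ))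
          (fourierU (absDeriv χ))).re ≤
        (√3 / 2 - c) * ‖absDeriv χ‖ ^ 2 + γ * (inner ℂ (hardyOp χ) (absDeriv χ)).re)
    (S : L2 →L[ℂ] L2) (hS : ∀ x y, inner ℂ (S x) y = inner ℂ x (S y))
    (hSr : ∀ x y, (inner ℂ x (S y)).re = (√3 / 2 - c) * (inner ℂ x (absDeriv y)).re -
      1 / Real.pi ^ 2 * (kerInt (halfKernel evenKernel) (fourierU x) (fourierU y)).re +
      γ * (inner ℂ (katoOp x) (katoOp y)).re) {R : ℝ} (hR : 1 ≤ R) (ψ : L2) :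
    0 ≤ (inner ℂ (fourierMul ((annulus R).indicator fun _ => 1) ψ)
      (S (fourierMul ((annulus R).indicator fun _ => 1) ψ))).re := by
  obtain ⟨hE, hP, hH, hA⟩ := annulus_symbols hR
  set E := fourierMul ((annulus R).indicator fun _ => 1) with hEdef
  have hEs : ∀ x y, inner ℂ (E x) y = inner ℂ x (E y) := inner_fourierMul_left hE
  rw [hEs]
  -- the accretive operator is `|∇|` on the annulus, completed by the identity off it, where
  -- `E ∘ S ∘ E` vanishes
  refine re_inner_nonneg_of_accretive (E ∘L S ∘L E)
    (fourierMul fun p => 1 + (annulus R).indicator (fun p => ‖p‖ - 1) p)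
    (fun x y => by simp only [ContinuousLinearMap.comp_apply]; rw [hEs, hS, hEs])
    (r := R⁻¹) (by positivity) (fun x => ?_) (fun x => ?_) ψ
  · rw [inner_fourierMul_left hA, ← fourierU.inner_map_map, ← fourierU.norm_map x,
      ← (inner_self_eq_norm_sq (𝕜 := ℂ) (fourierU x)), inner_eq_integral, inner_eq_integral,
      ← RCLike.re_eq_complex_re,
      ← integral_re (integrable_inner_L2 _ _), ← integral_re (integrable_inner_L2 _ _),
      ← integral_const_mul]
    refine integral_mono_ae ((integrable_inner_L2 _ _).re.const_mul _)
      (integrable_inner_L2 _ _).re ?_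
    filter_upwards [fourierU_fourierMul hA x] with p hp
    simp only [RCLike.re_eq_complex_re]
    rw [hp, mul_left_comm, Complex.re_ofReal_mul]
    have e : (conj (fourierU x p) * fourierU x p).re = ‖fourierU x p‖ ^ 2 := by
      rw [← Complex.normSq_eq_conj_mul_self, Complex.ofReal_re, Complex.normSq_eq_norm_sq]
    rw [e]
    refine mul_le_mul_of_nonneg_right ?_ (sq_nonneg _)
    by_cases hp : p ∈ annulus R
    · rw [indicator_of_mem hp]; linarith [hp.1]
    · rw [indicator_of_notMem hp, add_zero]; exact inv_le_one_of_one_le₀ hR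
  -- `χ` represents in `H^1` the function that `E x` represents in `H^{1/2}`
  · set χ := fourierMul ((annulus R).indicator fun p => (1 + ‖p‖) ^ (1 / 2 : ℝ)) x with hχ
    set y := fourierMul ((annulus R).indicator fun p => ‖p‖) x with hy
    have e1 : E (fourierMul (fun p => 1 + (annulus R).indicator (fun p => ‖p‖ - 1) p) x) = y := by
      refine fourierMul_fourierMul hE hA hP (fun p => ?_) x
      by_cases hp : p ∈ annulus R
      · simp [indicator_of_mem hp]
      · simp [indicator_of_notMem hp]
    have eχ := fourierU_fourierMul hH x
    have ey := fourierU_fourierMul hP x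
    have eE := fourierU_fourierMul hE x
    have hpow : ∀ p : R3, (1 + ‖p‖) ^ (-(1 / 2) : ℝ) * (1 + ‖p‖) ^ (1 / 2 : ℝ) = 1 := fun p => by
      rw [← Real.rpow_add (by positivity)]; norm_num
    have hpow2 : ∀ p : R3, (1 + ‖p‖) ^ (-1 : ℝ) * (1 + ‖p‖) ^ (1 / 2 : ℝ) =
        (1 + ‖p‖) ^ (-(1 / 2) : ℝ) := fun p => by
      rw [← Real.rpow_add (by positivity)]; norm_num
    have ebess : bessel (1 / 2) (E x) = bessel 1 χ := by
      refine fourierU.injective (Lp.ext ?_)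
      filter_upwards [fourierU_bessel (s := 1 / 2) (by norm_num) (E x),
        fourierU_bessel zero_le_one χ, eχ, eE] with p h1 h2 h3 h4
      rw [h1, h2, h3, h4, ← hpow2]
      by_cases hp : p ∈ annulus R
      · simp only [indicator_of_mem hp]; push_cast; ring
      · simp [indicator_of_notMem hp]
    have eabs : fourierU (absDeriv χ) =ᵐ[volume]
        fun p => (((1 + ‖p‖) ^ (-(1 / 2) : ℝ) : ℝ) : ℂ) * fourierU y p := by
      filter_upwards [fourierU_absDeriv χ, fourierU_bessel zero_le_one χ, eχ, ey] with p h1 h2 h3 h4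
      rw [h1, h2, h3, h4, ← hpow2]
      by_cases hp : p ∈ annulus R
      · simp only [indicator_of_mem hp]; push_cast; ring
      · simp [indicator_of_notMem hp]
    have eabs2 : bessel (1 / 2) y = absDeriv χ := by
      refine fourierU.injective (Lp.ext ?_)
      filter_upwards [fourierU_bessel (s := 1 / 2) (by norm_num) y, eabs] with p h1 h2
      rw [h1, h2]
    have eU1 : fourierU y =ᵐ[volume]
        fun p => (((1 + ‖p‖) ^ (1 / 2 : ℝ) : ℝ) : ℂ) * fourierU (absDeriv χ) p := by
      filter_upwards [eabs] with p h1
      rw [h1, ← mul_assoc, ← Complex.ofReal_mul, mul_comm ((1 + ‖p‖) ^ (1 / 2 : ℝ)), hpow]; simp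
    have eU2 : fourierU (E x) =ᵐ[volume]
        fun p => (((1 + ‖p‖) ^ (1 / 2 : ℝ) / ‖p‖ : ℝ) : ℂ) * fourierU (absDeriv χ) p := by
      filter_upwards [eU1, ey, eE, ae_ne_zero_R3] with p h1 h2 h3 h4
      have hP : (‖p‖ : ℂ) ≠ 0 := by simpa using h4
      rw [Complex.ofReal_div, div_mul_eq_mul_div, ← h1, h2, h3]
      by_cases hp : p ∈ annulus R
      · simp only [indicator_of_mem hp]; field_simp; simp
      · simp [indicator_of_notMem hp]
    have ek : kerInt (halfKernel evenKernel) (fourierU y) (fourierU (E x)) =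
        kerInt (fun p q => evenKernel p q / ‖q‖) (fourierU (absDeriv χ)) (fourierU (absDeriv χ)) := by
      refine kerInt_eq eU1 eU2 fun p q _ _ => ?_
      rw [halfKernel]
      calc _ = ((1 + ‖p‖) ^ (-(1 / 2) : ℝ) * (1 + ‖p‖) ^ (1 / 2 : ℝ)) * evenKernel p q *
            ((1 + ‖q‖) ^ (-(1 / 2) : ℝ) * (1 + ‖q‖) ^ (1 / 2 : ℝ)) / ‖q‖ := by ring
        _ = _ := by rw [hpow, hpow]; ring
    have en : inner ℂ y (absDeriv (E x)) = inner ℂ (absDeriv χ) (absDeriv χ) := by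
      rw [← fourierU.inner_map_map, ← fourierU.inner_map_map (absDeriv χ), inner_eq_integral,
        inner_eq_integral]
      refine integral_congr_ae ?_
      filter_upwards [eU1, fourierU_fourierMul bddSymbol_div_one_add (E x), eU2, ae_ne_zero_R3]
        with p h1 h2 h3 h4
      change fourierU (absDeriv (E x)) p = _ at h2
      have hP : ‖p‖ ≠ 0 := by simpa using h4
      have h5 : (1 + ‖p‖) ^ (1 / 2 : ℝ) * (‖p‖ / (1 + ‖p‖) * ((1 + ‖p‖) ^ (1 / 2 : ℝ) / ‖p‖)) = 1 := by
        have h6 : (1 + ‖p‖) ^ (1 / 2 : ℝ) * (1 + ‖p‖) ^ (1 / 2 : ℝ) = 1 + ‖p‖ := by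
          rw [← Real.rpow_add (by positivity)]; norm_num
        have h7 : 1 + ‖p‖ ≠ 0 := by positivity
        field_simp
        rw [sq, h6]
      have h8 := congrArg (fun t : ℝ => (t : ℂ)) h5
      rw [h1, h2, h3, map_mul, Complex.conj_ofReal]
      simp only [Complex.ofReal_mul, Complex.ofReal_one] at h8
      linear_combination (conj (fourierU (absDeriv χ) p) * fourierU (absDeriv χ) p) * h8
    have en2 : (inner ℂ (absDeriv χ) (absDeriv χ)).re = ‖absDeriv χ‖ ^ 2 :=
      inner_self_eq_norm_sq (𝕜 := ℂ) _
    have := h χ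
    rw [ContinuousLinearMap.comp_apply, ContinuousLinearMap.comp_apply, ← hEs, e1, hSr, en, en2, ek,
      inner_katoOp_eq eabs2 ebess, ← inner_conj_symm, Complex.conj_re]
    linarith

theorem inner_absDeriv_left (x y : L2) : inner ℂ (absDeriv x) y = inner ℂ x (absDeriv y) :=
  inner_fourierMul_left bddSymbol_div_one_add x y

/-- The form inequality on `H^{1/2}`, with the even part of the kernel only. -/
theorem even_form_bound {γ c : ℝ} (h : ∀ χ : L2,
      1 / Real.pi ^ 2 * (kerInt (fun p q => evenKernel p q / ‖q‖) (fourierU (absDeriv χ))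
          (fourierU (absDeriv χ))).re ≤
        (√3 / 2 - c) * ‖absDeriv χ‖ ^ 2 + γ * (inner ℂ (hardyOp χ) (absDeriv χ)).re) (ψ : L2) :
    1 / Real.pi ^ 2 * (kerInt (halfKernel evenKernel) (fourierU ψ) (fourierU ψ)).re ≤
      (√3 / 2 - c) * (inner ℂ ψ (absDeriv ψ)).re + γ * ‖katoOp ψ‖ ^ 2 := by
  have hB := bddKernel_halfKernel_even
  have hC : 0 ≤ 1 * domConst := by simpa using domConst_nonneg
  set S : L2 →L[ℂ] L2 := ((√3 / 2 - c : ℝ) : ℂ) • absDeriv -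
    ((1 / Real.pi ^ 2 : ℝ) : ℂ) • hB.fourierOp hC + (γ : ℂ) • (katoOp.adjoint ∘L katoOp) with hSdef
  have hSx : ∀ x, S x = ((√3 / 2 - c : ℝ) : ℂ) • absDeriv x -
      ((1 / Real.pi ^ 2 : ℝ) : ℂ) • hB.fourierOp hC x + (γ : ℂ) • katoOp.adjoint (katoOp x) :=
    fun x => rfl
  have hS : ∀ x y, inner ℂ (S x) y = inner ℂ x (S y) := fun x y => by
    simp only [hSx, inner_add_left, inner_sub_left, inner_smul_left, inner_add_right,
      inner_sub_right, inner_smul_right, Complex.conj_ofReal, inner_absDeriv_left,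
      hB.inner_fourierOp_left hC (halfKernel_comm fun p q => evenKernel_comm q p),
      ContinuousLinearMap.adjoint_inner_left, ContinuousLinearMap.adjoint_inner_right]
  have hSr : ∀ x y, (inner ℂ x (S y)).re = (√3 / 2 - c) * (inner ℂ x (absDeriv y)).re -
      1 / Real.pi ^ 2 * (kerInt (halfKernel evenKernel) (fourierU x) (fourierU y)).re +
      γ * (inner ℂ (katoOp x) (katoOp y)).re := fun x y => by
    rw [hSx, ofReal_smul_sub_add_inner, hB.inner_fourierOp, ContinuousLinearMap.adjoint_inner_right]
  have hE := tendsto_fourierMul_one (m := fun n : ℕ => (annulus (n + 1)).indicator fun _ => 1)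
    (fun n => (annulus_symbols (by simp)).1)
    (fun n p => indicator_nonneg (by simp) p)
    (fun n p => indicator_le_self' (by simp) p) (fun p hp => by
      obtain ⟨N, hN⟩ := exists_nat_ge (max ‖p‖ ‖p‖⁻¹)
      filter_upwards [eventually_ge_atTop N] with n hn
      have hn' : (N : ℝ) ≤ n := by exact_mod_cast hn
      have hP : 0 < ‖p‖ := norm_pos_iff.2 hp
      refine indicator_of_mem (s := annulus (n + 1)) (And.intro ?_ ?_) _
      · rw [inv_le_comm₀ (by positivity) hP]
        linarith [(le_max_right ‖p‖ ‖p‖⁻¹).trans hN]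
      · linarith [(le_max_left ‖p‖ ‖p‖⁻¹).trans hN]) ψ
  have hlim := (Complex.continuous_re.tendsto _).comp (hE.inner (𝕜 := ℂ) ((S.continuous.tendsto _).comp hE))
  have h0 := ge_of_tendsto' hlim fun n => even_form_bound_annulus h S hS hSr (by simp) ψ
  have hk : (inner ℂ (katoOp ψ) (katoOp ψ)).re = ‖katoOp ψ‖ ^ 2 := inner_self_eq_norm_sq (𝕜 := ℂ) _
  rw [hSr, hk] at h0
  linarith

/-! ### Positivity of the off-diagonal kernel -/

/-- A kernel `k(p, q) = ∫ F(a, p) F(a, q) dν(a)` is positive semidefinite. -/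
theorem re_kerInt_nonneg_of_factor {α : Type*} [MeasurableSpace α] (ν : Measure α) [SFinite ν]
    {F : α → R3 → ℝ} (hF : Measurable (Function.uncurry F)) (h0 : ∀ a p, 0 ≤ F a p)
    {k : R3 → R3 → ℝ} {C : ℝ} (hk : BddKernel k C) (hk0 : ∀ p q, p ≠ 0 → q ≠ 0 → 0 ≤ k p q)
    (h : ∀ p q, p ≠ 0 → q ≠ 0 → ∫⁻ a, ENNReal.ofReal (F a p * F a q) ∂ν = ENNReal.ofReal (k p q))
    (g : L2) : 0 ≤ (kerInt k g g).re := by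
  set Φ : R3 × R3 → α → ℂ := fun z a => conj (g z.1) * ((F a z.1 * F a z.2 : ℝ) : ℂ) * g z.2
  have hFm : ∀ p, Measurable fun a => F a p := fun p => hF.comp measurable_prodMk_right
  have hint : ∀ p q, p ≠ 0 → q ≠ 0 → Integrable (fun a => F a p * F a q) ν := fun p q hp hq => by
    refine ⟨((hFm p).mul (hFm q)).aestronglyMeasurable, ?_⟩
    rw [hasFiniteIntegral_iff_ofReal (ae_of_all _ fun a => mul_nonneg (h0 a p) (h0 a q)), h p q hp hq]
    exact ENNReal.ofReal_lt_top
  have hval : ∀ p q, p ≠ 0 → q ≠ 0 → ∫ a, F a p * F a q ∂ν = k p q := fun p q hp hq => by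
    rw [integral_eq_lintegral_of_nonneg_ae (ae_of_all _ fun a => mul_nonneg (h0 a p) (h0 a q))
      (hint p q hp hq).1, h p q hp hq, ENNReal.toReal_ofReal (hk0 p q hp hq)]
  have hne : ∀ᵐ z : R3 × R3 ∂((volume : Measure R3).prod volume), z.1 ≠ 0 ∧ z.2 ≠ 0 :=
    ae_prod_of_ae ae_ne_zero_R3 ae_ne_zero_R3
  have hg1 : AEStronglyMeasurable (fun z : (R3 × R3) × α => g z.1.1)
      (((volume : Measure R3).prod volume).prod ν) :=
    ((Lp.aestronglyMeasurable g).comp_quasiMeasurePreserving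
      (Measure.quasiMeasurePreserving_fst (μ := (volume : Measure R3))
        (ν := (volume : Measure R3)))).comp_quasiMeasurePreserving
      (Measure.quasiMeasurePreserving_fst (ν := ν))
  have hg2 : AEStronglyMeasurable (fun z : (R3 × R3) × α => g z.1.2)
      (((volume : Measure R3).prod volume).prod ν) :=
    ((Lp.aestronglyMeasurable g).comp_quasiMeasurePreserving
      (Measure.quasiMeasurePreserving_snd (μ := (volume : Measure R3))
        (ν := (volume : Measure R3)))).comp_quasiMeasurePreserving
      (Measure.quasiMeasurePreserving_fst (ν := ν))
  have hFF : Measurable fun z : (R3 × R3) × α => ((F z.2 z.1.1 * F z.2 z.1.2 : ℝ) : ℂ) :=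
    Complex.measurable_ofReal.comp
      ((hF.comp (by fun_prop : Measurable fun z : (R3 × R3) × α => (z.2, z.1.1))).mul
        (hF.comp (by fun_prop : Measurable fun z : (R3 × R3) × α => (z.2, z.1.2))))
  have hΦ : Integrable (Function.uncurry Φ) (((volume : Measure R3).prod volume).prod ν) := by
    have hm : AEStronglyMeasurable (Function.uncurry Φ)
        (((volume : Measure R3).prod volume).prod ν) :=
      ((Complex.continuous_conj.comp_aestronglyMeasurable hg1).mul
        hFF.aestronglyMeasurable).mul hg2
    rw [integrable_prod_iff hm]
    constructor
    · filter_upwards [hne] with z hz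
      have hz' : Integrable (fun a => ((F a z.1 * F a z.2 : ℝ) : ℂ)) ν :=
        (hint z.1 z.2 hz.1 hz.2).ofReal
      exact (hz'.const_mul (conj (g z.1))).mul_const (g z.2)
    · refine (hk.integrable g g).norm.congr ?_
      filter_upwards [hne] with z hz
      simp only [Function.uncurry_apply_pair, Φ, norm_mul, kerFun, RCLike.norm_conj,
        Complex.norm_real]
      rw [integral_mul_const, integral_const_mul, Real.norm_of_nonneg (hk0 _ _ hz.1 hz.2),
        ← hval z.1 z.2 hz.1 hz.2]
      simp_rw [Real.norm_of_nonneg (h0 _ _)]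
  have e1 : kerInt k g g = ∫ z, ∫ a, Φ z a ∂ν ∂((volume : Measure R3).prod volume) := by
    refine integral_congr_ae ?_
    filter_upwards [hne] with z hz
    simp only [Φ]
    rw [integral_mul_const, integral_const_mul, integral_complex_ofReal, hval z.1 z.2 hz.1 hz.2,
      kerFun]
  have e2 : ∀ a, ∫ z, Φ z a ∂((volume : Measure R3).prod volume) =
      ((‖∫ q, (F a q : ℂ) * g q‖ ^ 2 : ℝ) : ℂ) := fun a => by
    have e3 : ∀ z : R3 × R3, Φ z a = conj ((F a z.1 : ℂ) * g z.1) * ((F a z.2 : ℂ) * g z.2) :=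
      fun z => by
        simp only [Φ, map_mul, Complex.conj_ofReal]; push_cast; ring
    simp_rw [e3]
    rw [integral_prod_mul (fun p => conj ((F a p : ℂ) * g p)) (fun q => (F a q : ℂ) * g q),
      integral_conj, ← Complex.normSq_eq_conj_mul_self, Complex.normSq_eq_norm_sq]
  rw [e1, integral_integral_swap hΦ]
  simp_rw [e2]
  rw [integral_complex_ofReal, Complex.ofReal_re]
  exact integral_nonneg fun a => sq_nonneg _

theorem lintegral_gaussian {b : ℝ} (hb : 0 < b) (m : R3) :
    ∫⁻ z : R3, ENNReal.ofReal (Real.exp (-b * ‖z - m‖ ^ 2)) =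
      ENNReal.ofReal ((Real.pi / b) ^ (3 / 2 : ℝ)) := by
  rw [lintegral_sub_right_eq_self (fun z : R3 => ENNReal.ofReal (Real.exp (-b * ‖z‖ ^ 2))) m]
  have h := GaussianFourier.integral_rexp_neg_mul_sq_norm (V := R3) hb
  rw [finrank_euclideanSpace_fin] at h
  have hi : Integrable fun z : R3 => Real.exp (-b * ‖z‖ ^ 2) := by
    by_contra hn
    rw [integral_undef hn] at h
    have : 0 < (Real.pi / b) ^ (((3 : ℕ) : ℝ) / 2) := by have := Real.pi_pos; positivity
    linarith
  rw [← ofReal_integral_eq_lintegral_ofReal hi (ae_of_all _ fun z => (Real.exp_pos _).le), h]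
  norm_num

/-- Gaussian factor of `e^(-t (p² + q² - p·q))`, with the centre `z` as the summation variable. -/
def gaussFactor (t : ℝ) (z p : R3) : ℝ :=
  (2 * t / Real.pi) ^ (3 / 4 : ℝ) * Real.exp (-(t / 2) * ‖p‖ ^ 2) * Real.exp (-t * ‖z - p‖ ^ 2)

theorem lintegral_gaussFactor {t : ℝ} (ht : 0 < t) (p q : R3) :
    ∫⁻ z, ENNReal.ofReal (gaussFactor t z p * gaussFactor t z q) =
      ENNReal.ofReal (Real.exp (-t * (‖p‖ ^ 2 + ‖q‖ ^ 2 - inner ℝ p q))) := by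
  have hpi := Real.pi_pos
  have hmid : ∀ z : R3, ‖z - p‖ ^ 2 + ‖z - q‖ ^ 2 =
      2 * ‖z - (1 / 2 : ℝ) • (p + q)‖ ^ 2 + ‖p - q‖ ^ 2 / 2 := fun z => by
    rw [norm_sub_sq_real, norm_sub_sq_real, norm_sub_sq_real, norm_sub_sq_real, norm_smul, mul_pow,
      norm_add_sq_real, inner_smul_right, inner_add_right]
    norm_num
    ring
  have hc : (2 * t / Real.pi) ^ (3 / 4 : ℝ) * (2 * t / Real.pi) ^ (3 / 4 : ℝ) *
      (Real.pi / (2 * t)) ^ (3 / 2 : ℝ) = 1 := by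
    rw [← Real.rpow_add (by positivity)]
    norm_num
    rw [← Real.mul_rpow (by positivity) (by positivity)]
    rw [show 2 * t / Real.pi * (Real.pi / (2 * t)) = 1 by field_simp, Real.one_rpow]
  have e : ∀ z, gaussFactor t z p * gaussFactor t z q =
      (2 * t / Real.pi) ^ (3 / 4 : ℝ) * (2 * t / Real.pi) ^ (3 / 4 : ℝ) *
        Real.exp (-t * (‖p‖ ^ 2 + ‖q‖ ^ 2 - inner ℝ p q)) *
        Real.exp (-(2 * t) * ‖z - (1 / 2 : ℝ) • (p + q)‖ ^ 2) := fun z => by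
    have e1 : Real.exp (-t * (‖p‖ ^ 2 + ‖q‖ ^ 2 - inner ℝ p q)) *
        Real.exp (-(2 * t) * ‖z - (1 / 2 : ℝ) • (p + q)‖ ^ 2) =
        Real.exp (-(t / 2) * ‖p‖ ^ 2) * Real.exp (-t * ‖z - p‖ ^ 2) *
        (Real.exp (-(t / 2) * ‖q‖ ^ 2) * Real.exp (-t * ‖z - q‖ ^ 2)) := by
      rw [← Real.exp_add, ← Real.exp_add, ← Real.exp_add, ← Real.exp_add]
      congr 1
      have h1 := hmid z
      have h2 := norm_sub_sq_real p q
      linear_combination (t : ℝ) * h1 + t / 2 * h2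
    rw [gaussFactor, gaussFactor, mul_assoc _ (Real.exp (-t * _)) (Real.exp _), e1]
    ring
  simp_rw [e]
  simp_rw [ENNReal.ofReal_mul (show 0 ≤ (2 * t / Real.pi) ^ (3 / 4 : ℝ) *
    (2 * t / Real.pi) ^ (3 / 4 : ℝ) *
    Real.exp (-t * (‖p‖ ^ 2 + ‖q‖ ^ 2 - inner ℝ p q)) by positivity)]
  rw [lintegral_const_mul' _ _ ENNReal.ofReal_ne_top, lintegral_gaussian (by positivity),
    ← ENNReal.ofReal_mul (by positivity)]
  congr 1
  linear_combination Real.exp (-t * (‖p‖ ^ 2 + ‖q‖ ^ 2 - inner ℝ p q)) * hc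

/-- Laplace transforms, in `p² + q² - p·q`, of nonnegative functions are positive semidefinite. -/
theorem re_kerInt_halfKernel_nonneg_of_laplace {u : ℝ → ℝ} (hu : Measurable u)
    (hu0 : ∀ t, 0 < t → 0 ≤ u t) {k : R3 → R3 → ℝ} {C : ℝ} (hk : BddKernel (halfKernel k) C)
    (hk0 : ∀ p q, p ≠ 0 → q ≠ 0 → 0 ≤ k p q)
    (h : ∀ p q : R3, p ≠ 0 → q ≠ 0 → ∫⁻ t in Ioi 0, ENNReal.ofReal (u t) *
      ENNReal.ofReal (Real.exp (-t * (‖p‖ ^ 2 + ‖q‖ ^ 2 - inner ℝ p q))) = ENNReal.ofReal (k p q))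
    (g : L2) : 0 ≤ (kerInt (halfKernel k) g g).re := by
  set F : ℝ × R3 → R3 → ℝ := fun a p =>
    (1 + ‖p‖) ^ (-(1 / 2) : ℝ) * √(u a.1) * |gaussFactor a.1 a.2 p| with hF
  have hgm : Measurable fun x : (ℝ × R3) × R3 => gaussFactor x.1.1 x.1.2 x.2 := by
    unfold gaussFactor; fun_prop
  refine re_kerInt_nonneg_of_factor ((volume.restrict (Ioi (0 : ℝ))).prod (volume : Measure R3))
    (F := F) ?_ (fun a p => by positivity) hk (fun p q hp hq => ?_) (fun p q hp hq => ?_) g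
  · have h1 : Measurable fun x : (ℝ × R3) × R3 => (1 + ‖x.2‖) ^ (-(1 / 2) : ℝ) := by fun_prop
    exact (h1.mul (hu.comp (measurable_fst.comp measurable_fst)).sqrt).mul hgm.abs
  · have := hk0 p q hp hq
    rw [halfKernel]; positivity
  · have hm : ∀ r : R3, Measurable fun a : ℝ × R3 => F a r := fun r => by
      have h1 : Measurable fun a : ℝ × R3 => gaussFactor a.1 a.2 r :=
        hgm.comp (by fun_prop : Measurable fun a : ℝ × R3 => (a, r))
      exact ((hu.comp measurable_fst).sqrt.const_mul _).mul h1.abs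
    have hm2 : AEMeasurable (fun a => ENNReal.ofReal (F a p * F a q))
        ((volume.restrict (Ioi (0 : ℝ))).prod (volume : Measure R3)) :=
      ((hm p).mul (hm q)).ennreal_ofReal.aemeasurable
    rw [lintegral_prod _ hm2, halfKernel,
      mul_right_comm, ENNReal.ofReal_mul (by positivity), ← h p q hp hq,
      ← lintegral_const_mul' _ _ ENNReal.ofReal_ne_top]
    refine setLIntegral_congr_fun measurableSet_Ioi fun t ht => ?_
    rw [mem_Ioi] at ht
    have hg0 : ∀ z r, 0 ≤ gaussFactor t z r := fun z r => by
      have := Real.pi_pos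
      rw [gaussFactor]; positivity
    have e : ∀ z : R3, F (t, z) p * F (t, z) q =
        (1 + ‖p‖) ^ (-(1 / 2) : ℝ) * (1 + ‖q‖) ^ (-(1 / 2) : ℝ) * u t *
          (gaussFactor t z p * gaussFactor t z q) := fun z => by
      simp only [hF]
      rw [abs_of_nonneg (hg0 z p), abs_of_nonneg (hg0 z q)]
      linear_combination (1 + ‖p‖) ^ (-(1 / 2) : ℝ) * (1 + ‖q‖) ^ (-(1 / 2) : ℝ) *
        (gaussFactor t z p * gaussFactor t z q) * Real.mul_self_sqrt (hu0 t ht)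
    have hu1 := hu0 t ht
    simp only [e, ENNReal.ofReal_mul (show 0 ≤ (1 + ‖p‖) ^ (-(1 / 2) : ℝ) *
      (1 + ‖q‖) ^ (-(1 / 2) : ℝ) * u t by positivity)]
    rw [lintegral_const_mul' _ _ ENNReal.ofReal_ne_top, lintegral_gaussFactor ht,
      ENNReal.ofReal_mul (by positivity), mul_assoc]

theorem lintegral_laplace_exp {b : ℝ} (hb : 0 < b) :
    ∫⁻ t in Ioi (0 : ℝ), ENNReal.ofReal (Real.exp (-t * b)) = ENNReal.ofReal (1 / b) := by
  have h1 : ∀ t : ℝ, Real.exp (-t * b) = Real.exp (-b * t) := fun t => by ring_nf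
  simp_rw [h1]
  rw [← ofReal_integral_eq_lintegral_ofReal (integrableOn_exp_mul_Ioi (neg_neg_of_pos hb) 0)
    (ae_of_all _ fun t => (Real.exp_pos _).le), integral_exp_mul_Ioi (neg_neg_of_pos hb)]
  simp

theorem lintegral_laplace_one_sub_exp {b lam : ℝ} (hb : 0 < b) (hl : 0 ≤ lam) :
    ∫⁻ t in Ioi (0 : ℝ), ENNReal.ofReal (1 - Real.exp (-t * lam)) *
      ENNReal.ofReal (Real.exp (-t * b)) = ENNReal.ofReal (1 / b - 1 / (b + lam)) := by
  have hi : ∀ c : ℝ, 0 < c → IntegrableOn (fun t : ℝ => Real.exp (-t * c)) (Ioi 0) := fun c hc => by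
    have h1 : ∀ t : ℝ, Real.exp (-t * c) = Real.exp (-c * t) := fun t => by ring_nf
    simp_rw [h1]
    exact integrableOn_exp_mul_Ioi (neg_neg_of_pos hc) 0
  have hv : ∀ c : ℝ, 0 < c → ∫ t in Ioi (0 : ℝ), Real.exp (-t * c) = 1 / c := fun c hc => by
    have h1 : ∀ t : ℝ, Real.exp (-t * c) = Real.exp (-c * t) := fun t => by ring_nf
    simp_rw [h1]
    rw [integral_exp_mul_Ioi (neg_neg_of_pos hc)]
    simp
  rw [← hv b hb, ← hv (b + lam) (by linarith), ← integral_sub (hi b hb) (hi _ (by linarith)),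
    ofReal_integral_eq_lintegral_ofReal (f := fun t => Real.exp (-t * b) - Real.exp (-t * (b + lam)))
      ((hi b hb).sub (hi _ (by linarith)))]
  · refine setLIntegral_congr_fun measurableSet_Ioi fun t ht => ?_
    rw [mem_Ioi] at ht
    rw [← ENNReal.ofReal_mul]
    · congr 1
      rw [mul_add, Real.exp_add]; ring
    · have : Real.exp (-t * lam) ≤ 1 := Real.exp_le_one_iff.2 (by nlinarith)
      linarith
  · refine (ae_restrict_iff' measurableSet_Ioi).2 (ae_of_all _ fun t ht => ?_)
    rw [mem_Ioi] at ht
    have : Real.exp (-t * (b + lam)) ≤ Real.exp (-t * b) := Real.exp_le_exp.2 (by nlinarith)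
    simp only [Pi.zero_apply]
    linarith

theorem stmKernel_neg_right (lam : ℝ) (p q : R3) :
    stmKernel lam p (-q) = 1 / (‖p‖ ^ 2 + ‖q‖ ^ 2 - inner ℝ p q + lam) := by
  rw [stmKernel, norm_neg, inner_neg_right, ← sub_eq_add_neg]

theorem sub_inner_pos {p : R3} (hp : p ≠ 0) (q : R3) : 0 < ‖p‖ ^ 2 + ‖q‖ ^ 2 - inner ℝ p q := by
  have h1 := half_le_add_inner p (-q)
  have h2 := sq_add_sq_pos hp q
  rw [norm_neg, inner_neg_right] at h1
  linarith

theorem evenKernel_neg_right (p q : R3) : evenKernel p (-q) = evenKernel p q := by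
  simp [evenKernel]

theorem measurable_neg_right {k : R3 → R3 → ℝ} (hk : Measurable (Function.uncurry k)) :
    Measurable (Function.uncurry fun p q => k p (-q)) :=
  hk.comp (by fun_prop : Measurable fun z : R3 × R3 => (z.1, -z.2))

theorem bddKernel_half_stmKernel {lam : ℝ} (hl : 0 ≤ lam) :
    BddKernel (halfKernel (stmKernel lam)) (2 * domConst) :=
  bddKernel_halfKernel (measurable_stmKernel lam) zero_le_two fun p q hp _ => by
    rw [abs_of_nonneg (stmKernel_nonneg hl p q)]
    exact stmKernel_le_evenKernel hl hp q

theorem bddKernel_half_stmKernel_neg {lam : ℝ} (hl : 0 ≤ lam) :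
    BddKernel (halfKernel fun p q => stmKernel lam p (-q)) (2 * domConst) :=
  bddKernel_halfKernel (measurable_neg_right (measurable_stmKernel lam)) zero_le_two
    fun p q hp _ => by
      rw [abs_of_nonneg (stmKernel_nonneg hl p _), ← evenKernel_neg_right]
      exact stmKernel_le_evenKernel hl hp _

/-- The kernel `1 / (p² + q² - p·q + lam)` is positive semidefinite. -/
theorem re_kerInt_stmKernel_neg_nonneg {lam : ℝ} (hl : 0 ≤ lam) (g : L2) :
    0 ≤ (kerInt (halfKernel fun p q => stmKernel lam p (-q)) g g).re := by
  refine re_kerInt_halfKernel_nonneg_of_laplace (u := fun t => Real.exp (-t * lam)) (by fun_prop)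
    (fun t _ => (Real.exp_pos _).le) (bddKernel_half_stmKernel_neg hl)
    (fun p q _ _ => stmKernel_nonneg hl p _) (fun p q hp _ => ?_) g
  have hb := sub_inner_pos hp q
  rw [stmKernel_neg_right, ← lintegral_laplace_exp (by linarith)]
  refine lintegral_congr fun t => ?_
  rw [← ENNReal.ofReal_mul (Real.exp_pos _).le, ← Real.exp_add]
  ring_nf

/-- The kernel `1 / (p² + q² - p·q + lam)` decreases in `lam`, in the sense of forms. -/
theorem re_kerInt_stmKernel_neg_le {lam : ℝ} (hl : 0 ≤ lam) (g : L2) :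
    (kerInt (halfKernel fun p q => stmKernel lam p (-q)) g g).re ≤
      (kerInt (halfKernel fun p q => stmKernel 0 p (-q)) g g).re := by
  have hle : ∀ p q : R3, p ≠ 0 → q ≠ 0 → stmKernel lam p (-q) ≤ stmKernel 0 p (-q) :=
    fun p q hp _ => by
      have hb := sub_inner_pos hp q
      rw [stmKernel_neg_right, stmKernel_neg_right]
      exact one_div_le_one_div_of_le (by linarith) (by linarith)
  have hB : BddKernel (halfKernel fun p q => stmKernel 0 p (-q) - stmKernel lam p (-q))
      (2 * domConst) := by
    refine bddKernel_halfKernel (k := fun p q => stmKernel 0 p (-q) - stmKernel lam p (-q))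
      ((measurable_neg_right (measurable_stmKernel 0)).sub
      (measurable_neg_right (measurable_stmKernel lam))) zero_le_two fun p q hp hq => ?_
    rw [abs_of_nonneg (sub_nonneg.2 (hle p q hp hq)), ← evenKernel_neg_right]
    linarith [stmKernel_le_evenKernel le_rfl hp (-q), stmKernel_nonneg hl p (-q)]
  have h := re_kerInt_halfKernel_nonneg_of_laplace (u := fun t => 1 - Real.exp (-t * lam))
    (by fun_prop) (fun t ht => sub_nonneg.2 (Real.exp_le_one_iff.2 (by nlinarith))) hB
    (fun p q hp hq => sub_nonneg.2 (hle p q hp hq)) (fun p q hp _ => by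
      rw [lintegral_laplace_one_sub_exp (sub_inner_pos hp q) hl, stmKernel_neg_right,
        stmKernel_neg_right, add_zero]) g
  have e := kerInt_add hB (bddKernel_half_stmKernel_neg hl) g g
  rw [kerInt_congr_kernel (k' := halfKernel fun p q => stmKernel 0 p (-q)) g g
    fun p q _ _ => by simp only [halfKernel]; ring] at e
  rw [e, Complex.add_re]
  linarith

/-- The even and odd parts of a kernel are its restrictions to even and odd functions. -/
theorem BddKernel.kerInt_parityPart_eq {k k' : R3 → R3 → ℝ} {C : ℝ} (h : BddKernel k C) (hC : 0 ≤ C)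
    (hr : ∀ p q, k p (-q) = k' p q) (hl : ∀ p q, k (-p) q = k' p q) {s : ℝ} (hs : s ^ 2 = 1)
    (f : L2) : (kerInt k (parityPart s f) (parityPart s f)).re =
      ((kerInt k f f).re + s * (kerInt k' f f).re) / 2 := by
  have e1 : ∀ g : L2, kerInt k g (parity f) = kerInt k' g f := fun g => by
    rw [kerInt_neg_right]; simp_rw [hr]
  have e2 : kerInt k (parity f) f = kerInt k' f f := by
    rw [kerInt_neg_left]; simp_rw [hl]
  have e3 : kerInt k' (parity f) f = kerInt k f f := by
    have h1 : ∀ p q, k' (-p) q = k p q := fun p q => by rw [← hl, neg_neg]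
    rw [kerInt_neg_left]; simp_rw [h1]
  have hs' : (s : ℂ) * s = 1 := by rw [← sq]; exact_mod_cast hs
  have e : kerInt k (parityPart s f) (parityPart s f) =
      ((1 / 2 : ℝ) : ℂ) * (kerInt k f f + s * kerInt k' f f) := by
    rw [← h.inner_op hC, parityPart, map_smul, map_add, map_smul, inner_smul_left,
      inner_smul_right, inner_add_left, inner_add_right, inner_add_right, inner_smul_left,
      inner_smul_left, inner_smul_right, inner_smul_right, h.inner_op, h.inner_op, h.inner_op,
      h.inner_op, e1, e1, e2, e3, Complex.conj_ofReal]
    simp only [map_div₀, map_one, map_ofNat]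
    push_cast
    linear_combination (1 / 4 : ℂ) * kerInt k f f * hs'
  rw [e, Complex.re_ofReal_mul, Complex.add_re, Complex.re_ofReal_mul]
  ring

/-- The off-diagonal form at any `lam` is dominated by the even part of the one at `lam = 0`. -/
theorem re_kerInt_half_stmKernel_le {lam : ℝ} (hl : 0 ≤ lam) (f : L2) :
    (kerInt (halfKernel (stmKernel lam)) f f).re ≤ (kerInt (halfKernel evenKernel) f f).re := by
  have hD : 0 ≤ 2 * domConst := by linarith [domConst_nonneg]
  have hpar := fun {l : ℝ} (h : 0 ≤ l) {s : ℝ} (hs : s ^ 2 = 1) =>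
    (bddKernel_half_stmKernel_neg h).kerInt_parityPart_eq hD (k' := halfKernel (stmKernel l))
      (fun p q => by simp [halfKernel]) (fun p q => by simp [halfKernel, stmKernel]) hs f
  have h1 := re_kerInt_stmKernel_neg_nonneg hl (parityPart (-1) f)
  have h2 := re_kerInt_stmKernel_neg_le hl (parityPart 1 f)
  rw [hpar hl (by norm_num)] at h1 h2
  rw [hpar le_rfl (by norm_num)] at h2
  have e := kerInt_add (bddKernel_half_stmKernel_neg le_rfl) (bddKernel_half_stmKernel le_rfl) f f
  rw [kerInt_congr_kernel (k' := fun p q => 2 * halfKernel evenKernel p q) f f fun p q hp _ => by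
      have e1 := stmKernel_zero_eq hp q
      have e2 := stmKernel_zero_eq hp (-q)
      have e3 : oddKernel p (-q) = -oddKernel p q := by simp [oddKernel, neg_div]
      rw [evenKernel_neg_right, e3] at e2
      simp only [halfKernel]
      rw [e1, e2]; ring, kerInt_const_mul] at e
  have e' := congrArg Complex.re e
  rw [Complex.re_ofReal_mul, Complex.add_re] at e'
  linarith

/-! ### Quadratic forms of Fourier multipliers -/

theorem integrable_mul_norm_sq {m : R3 → ℝ} (h : BddSymbol m) (f : L2) :
    Integrable fun p => m p * ‖f p‖ ^ 2 := by
  obtain ⟨hm, C, hC⟩ := h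
  exact (integrable_norm_sq_L2 f).bdd_mul hm.aestronglyMeasurable (ae_of_all _ hC)

theorem re_inner_fourierMul {m : R3 → ℝ} (h : BddSymbol m) (ψ : L2) :
    (inner ℂ ψ (fourierMul m ψ)).re = ∫ p, m p * ‖fourierU ψ p‖ ^ 2 := by
  rw [← fourierU.inner_map_map, inner_eq_integral]
  have e : (fun p => conj (fourierU ψ p) * fourierU (fourierMul m ψ) p) =ᵐ[volume]
      fun p => ((m p * ‖fourierU ψ p‖ ^ 2 : ℝ) : ℂ) := by
    filter_upwards [fourierU_fourierMul h ψ] with p hp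
    rw [hp, mul_left_comm, ← Complex.normSq_eq_conj_mul_self, Complex.normSq_eq_norm_sq]
    push_cast; ring
  rw [integral_congr_ae e, integral_complex_ofReal, Complex.ofReal_re]

theorem re_inner_fourierMul_mono {m m' : R3 → ℝ} (h : BddSymbol m) (h' : BddSymbol m')
    (hle : ∀ p, m p ≤ m' p) (ψ : L2) :
    (inner ℂ ψ (fourierMul m ψ)).re ≤ (inner ℂ ψ (fourierMul m' ψ)).re := by
  rw [re_inner_fourierMul h, re_inner_fourierMul h']
  exact integral_mono (integrable_mul_norm_sq h _) (integrable_mul_norm_sq h' _)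
    fun p => mul_le_mul_of_nonneg_right (hle p) (sq_nonneg _)

theorem re_inner_self (ψ : L2) : (inner ℂ ψ ψ).re = ‖ψ‖ ^ 2 := inner_self_eq_norm_sq (𝕜 := ℂ) ψ

theorem inner_bessel_left {s : ℝ} (hs : 0 ≤ s) (x y : L2) :
    inner ℂ (bessel s x) y = inner ℂ x (bessel s y) :=
  inner_fourierMul_left (bddSymbol_bessel hs) x y

theorem norm_bessel_le {s : ℝ} (hs : 0 ≤ s) (ψ : L2) : ‖bessel s ψ‖ ≤ ‖ψ‖ :=
  (norm_fourierMul_le (bddSymbol_bessel hs) (C := 1) (fun p => by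
    rw [abs_of_nonneg (by positivity)]
    exact Real.rpow_le_one_of_one_le_of_nonpos (by linarith [norm_nonneg p]) (by linarith))
    ψ).trans_eq (one_mul _)

theorem bessel_bessel {s t : ℝ} (hs : 0 ≤ s) (ht : 0 ≤ t) (ψ : L2) :
    bessel s (bessel t ψ) = bessel (s + t) ψ :=
  fourierMul_fourierMul (bddSymbol_bessel hs) (bddSymbol_bessel ht) (bddSymbol_bessel (by linarith))
    (fun p => by rw [← Real.rpow_add (by positivity)]; ring_nf) ψ

theorem re_inner_bessel_one (ψ : L2) : (inner ℂ ψ (bessel 1 ψ)).re = ‖bessel (1 / 2) ψ‖ ^ 2 := by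
  rw [← re_inner_self, inner_bessel_left (by norm_num), bessel_bessel (by norm_num) (by norm_num)]
  norm_num

theorem absDeriv_add_bessel (ψ : L2) : absDeriv ψ + bessel 1 ψ = ψ := by
  refine fourierU.injective (Lp.ext ?_)
  rw [map_add]
  filter_upwards [fourierU_absDeriv ψ, fourierU_bessel zero_le_one ψ,
    Lp.coeFn_add (fourierU (absDeriv ψ)) (fourierU (bessel 1 ψ))] with p h1 h2 h3
  have h4 : (1 + (‖p‖ : ℂ)) ≠ 0 := by
    have : (1 + ‖p‖ : ℝ) ≠ 0 := by positivity
    exact_mod_cast this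
  rw [h3, Pi.add_apply, h1, h2, Real.rpow_neg_one]
  push_cast
  field_simp
  ring

/-! ### Comparison of Sobolev norms -/

theorem sq_sobolevNorm_bessel {s : ℝ} (hs : 0 ≤ s) (ψ : L2)
    (hb : BddSymbol fun p : R3 => (1 + ‖p‖ ^ 2) ^ s * ((1 + ‖p‖) ^ (-s)) ^ 2) :
    sobolevNorm s (bessel s ψ) ^ 2 =
      (inner ℂ ψ (fourierMul (fun p => (1 + ‖p‖ ^ 2) ^ s * ((1 + ‖p‖) ^ (-s)) ^ 2) ψ)).re := by
  rw [sobolevNorm, Real.sq_sqrt (integral_nonneg fun p => by positivity), re_inner_fourierMul hb]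
  refine integral_congr_ae ?_
  filter_upwards [fourierU_coe (bessel s ψ), fourierU_bessel hs ψ] with p h1 h2
  rw [← h1, h2, norm_mul, Complex.norm_real, Real.norm_of_nonneg (by positivity), mul_pow, mul_assoc]

theorem sobolev_weight_le_one {s : ℝ} (hs : 0 ≤ s) (p : R3) :
    (1 + ‖p‖ ^ 2) ^ s * ((1 + ‖p‖) ^ (-s)) ^ 2 ≤ 1 := by
  have h1 : 0 < 1 + ‖p‖ := by positivity
  have h2 : ((1 + ‖p‖) ^ (-s)) ^ 2 = (((1 + ‖p‖) ^ 2) ^ s)⁻¹ := by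
    rw [Real.rpow_neg h1.le, inv_pow, ← Real.rpow_natCast, ← Real.rpow_natCast, ← Real.rpow_mul h1.le,
      ← Real.rpow_mul h1.le, mul_comm]
  rw [h2, ← div_eq_mul_inv, div_le_one (by positivity)]
  exact Real.rpow_le_rpow (by positivity) (by nlinarith [norm_nonneg p]) hs

theorem bddSymbol_sobolev_weight {s : ℝ} (hs : 0 ≤ s) :
    BddSymbol fun p : R3 => (1 + ‖p‖ ^ 2) ^ s * ((1 + ‖p‖) ^ (-s)) ^ 2 :=
  ⟨by fun_prop, 1, fun p => by
    rw [abs_of_nonneg (by positivity)]; exact sobolev_weight_le_one hs p⟩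

theorem bddSymbol_const (c : ℝ) : BddSymbol fun _ : R3 => c := ⟨measurable_const, |c|, fun _ => le_rfl⟩

theorem fourierMul_const (c : ℝ) (ψ : L2) : fourierMul (fun _ => c) ψ = (c : ℂ) • ψ := by
  refine fourierU.injective (Lp.ext ?_)
  rw [map_smul]
  filter_upwards [fourierU_fourierMul (bddSymbol_const c) ψ, Lp.coeFn_smul (c : ℂ) (fourierU ψ)]
    with p h1 h2
  rw [h1, h2, Pi.smul_apply, smul_eq_mul]

theorem sq_sobolevNorm_bessel_le {s : ℝ} (hs : 0 ≤ s) (ψ : L2) :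
    sobolevNorm s (bessel s ψ) ^ 2 ≤ ‖ψ‖ ^ 2 := by
  rw [sq_sobolevNorm_bessel hs ψ (bddSymbol_sobolev_weight hs)]
  refine (re_inner_fourierMul_mono (bddSymbol_sobolev_weight hs) (bddSymbol_const 1)
    (sobolev_weight_le_one hs) ψ).trans_eq ?_
  rw [fourierMul_const, Complex.ofReal_one, one_smul, re_inner_self]

theorem half_norm_sq_le_sobolevNorm (ψ : L2) :
    1 / 2 * ‖ψ‖ ^ 2 ≤ sobolevNorm (1 / 2) (bessel (1 / 2) ψ) ^ 2 := by
  have hs : (0 : ℝ) ≤ 1 / 2 := by norm_num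
  rw [sq_sobolevNorm_bessel hs ψ (bddSymbol_sobolev_weight hs)]
  refine Eq.trans_le ?_ (re_inner_fourierMul_mono (bddSymbol_const (1 / 2))
    (bddSymbol_sobolev_weight hs) (fun p => ?_) ψ)
  · rw [fourierMul_const, inner_smul_right, Complex.re_ofReal_mul, re_inner_self]
  · have h1 : 0 < 1 + ‖p‖ := by positivity
    rw [Real.rpow_neg h1.le, ← Real.sqrt_eq_rpow, ← Real.sqrt_eq_rpow, inv_pow, Real.sq_sqrt h1.le,
      ← div_eq_mul_inv, le_div_iff₀ h1]
    refine Real.le_sqrt_of_sq_le ?_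
    nlinarith [sq_nonneg (1 - ‖p‖)]

/-! ### The form as a bounded operator -/

/-- The symbol `(3/4 p² + lam)^(1/2) / (1 + p)`. -/
def diagSymbol (lam : ℝ) (p : R3) : ℝ := √(3 / 4 * ‖p‖ ^ 2 + lam) / (1 + ‖p‖)

theorem bddSymbol_diagSymbol (lam : ℝ) : BddSymbol (diagSymbol lam) := by
  refine ⟨by unfold diagSymbol; fun_prop, 1 + √|lam|, fun p => ?_⟩
  have h1 : 0 < 1 + ‖p‖ := by positivity
  rw [diagSymbol, abs_of_nonneg (by positivity), div_le_iff₀ h1]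
  refine Real.sqrt_le_iff.2 ⟨by positivity, ?_⟩
  have h2 : √|lam| ^ 2 = |lam| := Real.sq_sqrt (abs_nonneg _)
  have h3 := le_abs_self lam
  have h4 := Real.sqrt_nonneg |lam|
  have h5 : ‖p‖ + √|lam| ≤ (1 + √|lam|) * (1 + ‖p‖) := by nlinarith [norm_nonneg p, mul_nonneg h4 (norm_nonneg p)]
  refine le_trans ?_ (pow_le_pow_left₀ (by positivity) h5 2)
  nlinarith [norm_nonneg p, mul_nonneg h4 (norm_nonneg p)]

theorem formDiag_eq {lam : ℝ} {η ξ φ ψ : L2} {s t : ℝ} (hst : s + t = 1) (hη : fourierU η =ᵐ[volume]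
      fun p => (((1 + ‖p‖) ^ (-s) : ℝ) : ℂ) * fourierU φ p)
    (hξ : fourierU ξ =ᵐ[volume] fun p => (((1 + ‖p‖) ^ (-t) : ℝ) : ℂ) * fourierU ψ p) :
    formDiag lam η ξ = inner ℂ φ (fourierMul (diagSymbol lam) ψ) := by
  rw [← fourierU.inner_map_map, inner_eq_integral, formDiag]
  refine integral_congr_ae ?_
  filter_upwards [fourierU_coe η, fourierU_coe ξ, hη, hξ,
    fourierU_fourierMul (bddSymbol_diagSymbol lam) ψ] with p h1 h2 h3 h4 h5
  rw [← h1, ← h2, h3, h4, h5, map_mul, Complex.conj_ofReal, diagSymbol]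
  have h6 : (1 + ‖p‖) ^ (-s) * √(3 / 4 * ‖p‖ ^ 2 + lam) * (1 + ‖p‖) ^ (-t) =
      √(3 / 4 * ‖p‖ ^ 2 + lam) / (1 + ‖p‖) := by
    rw [mul_right_comm, ← Real.rpow_add (by positivity), ← neg_add, hst, Real.rpow_neg_one]
    field_simp
  rw [← h6]
  push_cast
  ring

theorem formOff_eq {lam : ℝ} {η ξ φ ψ : L2} {a b : R3 → ℝ} {k : R3 → R3 → ℝ} {C : ℝ}
    (hB : BddKernel k C) (hη : fourierU η =ᵐ[volume] fun p => (a p : ℂ) * fourierU φ p)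
    (hξ : fourierU ξ =ᵐ[volume] fun p => (b p : ℂ) * fourierU ψ p)
    (hk : ∀ p q, p ≠ 0 → q ≠ 0 → a p * stmKernel lam p q * b q = k p q) :
    formOff lam η ξ = -(((1 / Real.pi ^ 2 : ℝ) : ℂ) * kerInt k (fourierU φ) (fourierU ψ)) := by
  have h1 := kerFun_ae_eq ((fourierU_coe η).symm.trans hη) ((fourierU_coe ξ).symm.trans hξ) hk
  have hi := (hB.integrable (fourierU φ) (fourierU ψ)).congr h1.symm
  rw [formOff, kerInt, ← integral_congr_ae h1, integral_prod _ hi]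
  congr 2
  refine integral_congr_ae (ae_of_all _ fun p => ?_)
  simp only [kerFun]
  rw [← integral_const_mul]
  refine integral_congr_ae (ae_of_all _ fun q => ?_)
  simp only [stmKernel]
  push_cast
  ring

theorem quasiMeasurePreserving_norm_R3 : Measure.QuasiMeasurePreserving (fun y : R3 => ‖y‖) volume
    (volume.restrict (Ioi (0 : ℝ))) := by
  refine ⟨measurable_norm, Measure.AbsolutelyContinuous.mk fun s hs h0 => ?_⟩
  rw [Measure.map_apply measurable_norm hs, ← lintegral_indicator_one (measurable_norm hs)]
  have h := lintegral_norm (s.indicator 1) (measurable_one.indicator hs)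
  have e : ∀ y : R3, ((fun y : R3 => ‖y‖) ⁻¹' s).indicator (1 : R3 → ℝ≥0∞) y = s.indicator 1 ‖y‖ :=
    fun y => rfl
  simp_rw [e]
  rw [h, lintegral_eq_zero_iff (by fun_prop (disch := measurability))]
  have h1 : ∀ᵐ r ∂(volume.restrict (Ioi (0 : ℝ))), r ∉ s := measure_eq_zero_iff_ae_notMem.1 h0
  filter_upwards [h1] with r hr
  simp [indicator_of_notMem hr]

/-- The bounded part of the regularizing multiplication function: `Γ_reg(|y|) = γ / |y| + w(y)`. -/
theorem exists_bounded_remainder {θ : ℝ → ℝ} (hθ : CutoffH1 θ) (β γ : ℝ) :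
    ∃ W : L2 →L[ℂ] L2, ∀ ψ : L2, W ψ =ᵐ[volume]
      fun y => ((regFun β γ θ ‖y‖ - γ / ‖y‖ : ℝ) : ℂ) * ψ y := by
  obtain ⟨hmem, c, hc, hle⟩ := hθ
  refine exists_mul_bounded ?_ (|β| + |γ| * c) ?_
  · have h1 : AEStronglyMeasurable (fun y : R3 => θ ‖y‖) :=
      hmem.1.comp_quasiMeasurePreserving quasiMeasurePreserving_norm_R3
    have h2 : AEStronglyMeasurable fun y : R3 => γ / ‖y‖ :=
      (by fun_prop : Measurable fun y : R3 => γ / ‖y‖).aestronglyMeasurable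
    exact (aestronglyMeasurable_const.add (h2.mul h1)).sub h2
  · filter_upwards [quasiMeasurePreserving_norm_R3.ae hle, ae_ne_zero_R3] with y h1 h2
    have hy : 0 < ‖y‖ := norm_pos_iff.2 h2
    have e : regFun β γ θ ‖y‖ - γ / ‖y‖ = β + γ / ‖y‖ * (θ ‖y‖ - 1) := by rw [regFun]; ring
    rw [e]
    refine (abs_add_le _ _).trans ?_
    gcongr
    rw [abs_mul, abs_div, abs_of_pos hy]
    calc |γ| / ‖y‖ * |θ ‖y‖ - 1| ≤ |γ| / ‖y‖ * (c * ‖y‖) := by gcongr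
      _ = |γ| * c := by field_simp

variable {β γ lam : ℝ} {θ : ℝ → ℝ} {W : L2 →L[ℂ] L2}

theorem formReg_half (hW : ∀ ψ : L2, W ψ =ᵐ[volume]
      fun y => ((regFun β γ θ ‖y‖ - γ / ‖y‖ : ℝ) : ℂ) * ψ y) (φ ψ : L2) :
    formReg β γ θ (bessel (1 / 2) φ) (bessel (1 / 2) ψ) =
      γ * inner ℂ (katoOp φ) (katoOp ψ) + inner ℂ (bessel (1 / 2) φ) (W (bessel (1 / 2) ψ)) := by
  rw [inner_eq_integral, inner_eq_integral, ← integral_const_mul,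
    ← integral_add ((integrable_inner_L2 _ _).const_mul _) (integrable_inner_L2 _ _), formReg]
  refine integral_congr_ae ?_
  filter_upwards [katoOp_coe φ, katoOp_coe ψ, hW (bessel (1 / 2) ψ)] with y h1 h2 h3
  have e : regFun β γ θ ‖y‖ = γ * (1 / √‖y‖ * (1 / √‖y‖)) + (regFun β γ θ ‖y‖ - γ / ‖y‖) := by
    rw [div_mul_div_comm, Real.mul_self_sqrt (norm_nonneg y)]; ring
  rw [h1, h2, h3, map_mul, Complex.conj_ofReal]
  nth_rewrite 1 [e]
  push_cast
  ring

theorem formReg_one (hW : ∀ ψ : L2, W ψ =ᵐ[volume]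
      fun y => ((regFun β γ θ ‖y‖ - γ / ‖y‖ : ℝ) : ℂ) * ψ y) (η χ : L2) :
    formReg β γ θ η (bessel 1 χ) = γ * inner ℂ η (hardyOp χ) + inner ℂ η (W (bessel 1 χ)) := by
  rw [inner_eq_integral, inner_eq_integral, ← integral_const_mul,
    ← integral_add ((integrable_inner_L2 _ _).const_mul _) (integrable_inner_L2 _ _), formReg]
  refine integral_congr_ae ?_
  filter_upwards [hardyOp_coe χ, hW (bessel 1 χ)] with y h2 h3
  have e : regFun β γ θ ‖y‖ = γ * (1 / ‖y‖) + (regFun β γ θ ‖y‖ - γ / ‖y‖) := by ring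
  rw [h2, h3]
  nth_rewrite 1 [e]
  push_cast
  ring

theorem two_mul_domConst_nonneg : 0 ≤ 2 * domConst := by linarith [domConst_nonneg]

/-- The kernel of the off-diagonal form on `L² × H^1`, read off on `L²` through `bessel 1`. -/
theorem bddKernel_stmKernel_one {lam : ℝ} (hl : 0 ≤ lam) :
    BddKernel (fun p q => stmKernel lam p q * (1 + ‖q‖) ^ (-1 : ℝ)) (1 * (2 * domConst)) := by
  refine (bddKernel_stmKernel_div hl).mono zero_le_one
    ((measurable_stmKernel lam).mul (by fun_prop)) fun p q _ hq => ?_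
  have hQ : 0 < ‖q‖ := norm_pos_iff.2 hq
  rw [one_mul, abs_mul, abs_div, abs_norm, Real.rpow_neg_one, abs_of_nonneg (a := (1 + ‖q‖)⁻¹)
    (by positivity), div_eq_mul_inv]
  gcongr
  linarith

/-- The operator representing the form on `H^{1/2}`, read off on `L²` through `bessel (1/2)`. -/
def halfOp (γ : ℝ) (W : L2 →L[ℂ] L2) {lam : ℝ} (hl : 0 ≤ lam) : L2 →L[ℂ] L2 :=
  fourierMul (diagSymbol lam) -
    ((1 / Real.pi ^ 2 : ℝ) : ℂ) • (bddKernel_half_stmKernel hl).fourierOp two_mul_domConst_nonneg +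
    (γ : ℂ) • (katoOp.adjoint ∘L katoOp) + bessel (1 / 2) ∘L W ∘L bessel (1 / 2)

/-- The operator `χ ↦ Γ (bessel 1 χ)`. -/
def oneOp (γ : ℝ) (W : L2 →L[ℂ] L2) {lam : ℝ} (hl : 0 ≤ lam) : L2 →L[ℂ] L2 :=
  fourierMul (diagSymbol lam) -
    ((1 / Real.pi ^ 2 : ℝ) : ℂ) • (bddKernel_stmKernel_one hl).fourierOp
      (by simpa using two_mul_domConst_nonneg) +
    (γ : ℂ) • hardyOp + W ∘L bessel 1

theorem inner_halfOp (hl : 0 ≤ lam) (φ ψ : L2) : inner ℂ φ (halfOp γ W hl ψ) =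
    inner ℂ φ (fourierMul (diagSymbol lam) ψ) - ((1 / Real.pi ^ 2 : ℝ) : ℂ) *
      kerInt (halfKernel (stmKernel lam)) (fourierU φ) (fourierU ψ) +
      γ * inner ℂ (katoOp φ) (katoOp ψ) + inner ℂ (bessel (1 / 2) φ) (W (bessel (1 / 2) ψ)) := by
  simp only [halfOp, add_apply, sub_apply,
    smul_apply, ContinuousLinearMap.comp_apply, inner_add_right,
    inner_sub_right, inner_smul_right, BddKernel.inner_fourierOp,
    ContinuousLinearMap.adjoint_inner_right]
  rw [inner_bessel_left (by norm_num)]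

theorem inner_oneOp (hl : 0 ≤ lam) (η χ : L2) : inner ℂ η (oneOp γ W hl χ) =
    inner ℂ η (fourierMul (diagSymbol lam) χ) - ((1 / Real.pi ^ 2 : ℝ) : ℂ) *
      kerInt (fun p q => stmKernel lam p q * (1 + ‖q‖) ^ (-1 : ℝ)) (fourierU η) (fourierU χ) +
      γ * inner ℂ η (hardyOp χ) + inner ℂ η (W (bessel 1 χ)) := by
  simp only [oneOp, add_apply, sub_apply,
    smul_apply, ContinuousLinearMap.comp_apply, inner_add_right,
    inner_sub_right, inner_smul_right, BddKernel.inner_fourierOp]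

theorem form_bessel_half (hW : ∀ ψ : L2, W ψ =ᵐ[volume]
      fun y => ((regFun β γ θ ‖y‖ - γ / ‖y‖ : ℝ) : ℂ) * ψ y) (hl : 0 ≤ lam) (φ ψ : L2) :
    form β γ θ lam (bessel (1 / 2) φ) (bessel (1 / 2) ψ) = inner ℂ φ (halfOp γ W hl ψ) := by
  have hs : (0 : ℝ) ≤ 1 / 2 := by norm_num
  rw [inner_halfOp, form, formReg_half hW,
    formDiag_eq (by norm_num) (fourierU_bessel hs φ) (fourierU_bessel hs ψ),
    formOff_eq (bddKernel_half_stmKernel hl) (fourierU_bessel hs φ) (fourierU_bessel hs ψ)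
      fun p q _ _ => rfl]
  ring

theorem form_bessel_one (hW : ∀ ψ : L2, W ψ =ᵐ[volume]
      fun y => ((regFun β γ θ ‖y‖ - γ / ‖y‖ : ℝ) : ℂ) * ψ y) (hl : 0 ≤ lam) (η χ : L2) :
    form β γ θ lam η (bessel 1 χ) = inner ℂ η (oneOp γ W hl χ) := by
  rw [inner_oneOp, form, formReg_one hW,
    formDiag_eq (s := 0) (t := 1) (η := η) (φ := η) (by norm_num) (by simp)
      (fourierU_bessel zero_le_one χ),
    formOff_eq (a := fun _ => 1) (η := η) (φ := η) (bddKernel_stmKernel_one hl) (by simp)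
      (fourierU_bessel zero_le_one χ) fun p q _ _ => by rw [one_mul]]
  ring

/-! ### Coercivity for large `lam` -/

/-- Slightly below its asymptotic slope `√3 / 2`, the diagonal symbol can be given any head start by
taking `lam` large. -/
theorem exists_shift_le_sqrt {α : ℝ} (k : ℝ) (hα : 0 ≤ α) (h : α < √3 / 2) :
    ∃ l₀ : ℝ, 0 < l₀ ∧ ∀ lam, l₀ < lam → ∀ r : ℝ, 0 ≤ r → α * r + k ≤ √(3 / 4 * r ^ 2 + lam) := by
  have h2 : α ^ 2 < 3 / 4 := by
    have h3 : √3 ^ 2 = 3 := Real.sq_sqrt (by norm_num)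
    nlinarith
  have hd : 0 < 3 / 4 - α ^ 2 := by linarith
  refine ⟨k ^ 2 + (α * k) ^ 2 / (3 / 4 - α ^ 2) + 1, by positivity, fun lam hlam r hr => ?_⟩
  refine Real.le_sqrt_of_sq_le ?_
  have h4 : 0 ≤ ((3 / 4 - α ^ 2) * r - α * k) ^ 2 / (3 / 4 - α ^ 2) := by positivity
  have h5 : ∀ d : ℝ, d ≠ 0 → (d * r - α * k) ^ 2 / d =
      d * r ^ 2 - 2 * (α * k) * r + (α * k) ^ 2 / d := fun d hd => by
    field_simp; ring
  rw [h5 _ hd.ne'] at h4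
  nlinarith

theorem re_inner_diag_ge {α k : ℝ}
    (h : ∀ r : ℝ, 0 ≤ r → α * r + k ≤ √(3 / 4 * r ^ 2 + lam)) (ψ : L2) :
    α * (inner ℂ ψ (absDeriv ψ)).re + k * (inner ℂ ψ (bessel 1 ψ)).re ≤
      (inner ℂ ψ (fourierMul (diagSymbol lam) ψ)).re := by
  have hb1 := bddSymbol_bessel zero_le_one
  have e1 : (inner ℂ ψ (absDeriv ψ)).re = _ := re_inner_fourierMul bddSymbol_div_one_add ψ
  have e2 : (inner ℂ ψ (bessel 1 ψ)).re = _ := re_inner_fourierMul hb1 ψ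
  have i1 := integrable_mul_norm_sq bddSymbol_div_one_add (fourierU ψ)
  have i2 := integrable_mul_norm_sq hb1 (fourierU ψ)
  rw [e1, e2, re_inner_fourierMul (bddSymbol_diagSymbol lam), ← integral_const_mul,
    ← integral_const_mul, ← integral_add (i1.const_mul _) (i2.const_mul _)]
  refine integral_mono ((i1.const_mul _).add (i2.const_mul _))
    (integrable_mul_norm_sq (bddSymbol_diagSymbol lam) _) fun p => ?_
  have hp : 0 < 1 + ‖p‖ := by positivity
  simp only
  rw [← mul_assoc, ← mul_assoc, ← add_mul]
  refine mul_le_mul_of_nonneg_right ?_ (sq_nonneg _)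
  rw [diagSymbol, Real.rpow_neg_one, le_div_iff₀ hp]
  rw [show (α * (‖p‖ / (1 + ‖p‖)) + k * (1 + ‖p‖)⁻¹) * (1 + ‖p‖) = α * ‖p‖ + k by field_simp]
  exact h ‖p‖ (norm_nonneg p)

/-- The off-diagonal part is dominated by its even part at `lam = 0`, which the form inequality bounds by
a multiple of `|∇|` below `√3 / 2` and the singular part of the regularization. -/
theorem coercive_of_large (hθ : CutoffH1 θ) (hγ : gammaCStar < γ) :
    ∃ l₀ : ℝ, 0 < l₀ ∧ ∀ lam, l₀ < lam → Coercive β γ θ lam := by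
  obtain ⟨W, hW⟩ := exists_bounded_remainder hθ β γ
  obtain ⟨c, hc, hc2, hreg⟩ := exists_regularity_constant hγ
  obtain ⟨l₀, hl₀, hl⟩ := exists_shift_le_sqrt (α := √3 / 2 - c / 2) (‖W‖ + 1) (by linarith)
    (by linarith)
  refine ⟨l₀, hl₀, fun lam hlam => ⟨min (c / 2) 1, by positivity, fun ξ hξ => ?_⟩⟩
  have hs : (0 : ℝ) ≤ 1 / 2 := by norm_num
  have hl0 : 0 ≤ lam := by linarith
  obtain ⟨ψ, rfl⟩ := exists_bessel_of_mem_sobolev hs hξ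
  rw [form_bessel_half hW hl0, inner_halfOp, Complex.add_re, Complex.add_re, Complex.sub_re,
    Complex.re_ofReal_mul, Complex.re_ofReal_mul, re_inner_self]
  -- for `lam` large the symbol `(3/4 p² + lam)^(1/2)` exceeds `(√3/2 - c/2) |p|` by `‖W‖ + 1`, which
  -- absorbs the bounded remainder `W`
  have h1 := re_inner_diag_ge (hl lam hlam) ψ
  have h2 := re_kerInt_half_stmKernel_le hl0 (fourierU ψ)
  have h3 := even_form_bound (fun χ => (hreg χ).1) ψ
  have h4 : -(‖W‖ * ‖bessel (1 / 2) ψ‖ ^ 2) ≤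
      (inner ℂ (bessel (1 / 2) ψ) (W (bessel (1 / 2) ψ))).re := by
    refine neg_le_of_abs_le ((Complex.abs_re_le_norm _).trans ((norm_inner_le_norm _ _).trans ?_))
    have := mul_le_mul_of_nonneg_left (W.le_opNorm (bessel (1 / 2) ψ))
      (norm_nonneg (bessel (1 / 2) ψ))
    linarith
  have h5 := mul_le_mul_of_nonneg_left h2 (show 0 ≤ 1 / Real.pi ^ 2 by positivity)
  have h6 : (inner ℂ ψ (absDeriv ψ)).re + (inner ℂ ψ (bessel 1 ψ)).re = ‖ψ‖ ^ 2 := by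
    rw [← Complex.add_re, ← inner_add_right, absDeriv_add_bessel, re_inner_self]
  have h7 : 0 ≤ (inner ℂ ψ (absDeriv ψ)).re := by
    have e1 : (inner ℂ ψ (absDeriv ψ)).re = _ := re_inner_fourierMul bddSymbol_div_one_add ψ
    rw [e1]
    exact integral_nonneg fun p => by positivity
  have h8 := re_inner_bessel_one ψ
  have h9 := sq_sobolevNorm_bessel_le hs ψ
  have h10 : min (c / 2) 1 * sobolevNorm (1 / 2) (bessel (1 / 2) ψ) ^ 2 ≤ min (c / 2) 1 * ‖ψ‖ ^ 2 :=
    mul_le_mul_of_nonneg_left h9 (by positivity)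
  have h11 := mul_le_mul_of_nonneg_right (min_le_left (c / 2) 1) h7
  have h12 := mul_le_mul_of_nonneg_right (min_le_right (c / 2) 1)
    (sq_nonneg ‖bessel (1 / 2) ψ‖)
  rw [← h6] at h10
  rw [h8] at h1 h10
  nlinarith

/-! ### Regularity -/

theorem stmKernel_zero_sub_nonneg {lam : ℝ} (hl : 0 ≤ lam) {p : R3} (hp : p ≠ 0) (q : R3) :
    0 ≤ stmKernel 0 p q - stmKernel lam p q := by
  have h1 := half_le_add_inner p q
  have h2 := sq_add_sq_pos hp q
  exact sub_nonneg.2 (one_div_le_one_div_of_le (by linarith) (by linarith))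

/-- The dependence of the off-diagonal form on `lam` is a bounded perturbation. -/
theorem bddKernel_stmKernel_zero_sub {lam : ℝ} (hl : 0 ≤ lam) :
    BddKernel (fun p q => stmKernel 0 p q - stmKernel lam p q) (2 * (lam + 1) * domConst) := by
  refine bddKernel_domKernel.mono (by positivity)
    ((measurable_stmKernel 0).sub (measurable_stmKernel lam)) fun p q hp hq => ?_
  have hP : 0 < ‖p‖ := norm_pos_iff.2 hp
  have hQ : 0 < ‖q‖ := norm_pos_iff.2 hq
  have h1 := half_le_add_inner p q
  have h2 := sq_add_sq_pos hp q
  rw [abs_of_nonneg (domKernel_nonneg p q), abs_of_nonneg (stmKernel_zero_sub_nonneg hl hp q)]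
  have h3 := stmKernel_le_evenKernel le_rfl hp q
  set B := ‖p‖ ^ 2 + ‖q‖ ^ 2 + inner ℝ p q with hB
  have hB0 : 0 < B := by linarith
  have e : stmKernel 0 p q - stmKernel lam p q = lam / (B + lam) * stmKernel 0 p q := by
    rw [stmKernel, stmKernel, ← hB, add_zero]
    have : B + lam ≠ 0 := by positivity
    field_simp
    ring
  have h4 : lam / (B + lam) ≤ (lam + 1) * ((‖p‖ + ‖q‖) / (‖p‖ * ‖q‖)) := by
    have h5 : lam / (B + lam) ≤ (lam + 1) * (1 / ‖p‖) := by
      rw [mul_one_div, div_le_div_iff₀ (by positivity) hP]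
      nlinarith [sq_nonneg (‖p‖ - 1), sq_nonneg ‖q‖, mul_nonneg hl (sq_nonneg (‖p‖ - 1)),
        mul_nonneg hl hl, mul_le_mul_of_nonneg_left h1 hl, mul_nonneg hl (sq_nonneg ‖q‖)]
    refine h5.trans (mul_le_mul_of_nonneg_left ?_ (by positivity))
    rw [div_le_div_iff₀ hP (by positivity)]
    nlinarith
  rw [e, domKernel]
  calc _ ≤ (lam + 1) * ((‖p‖ + ‖q‖) / (‖p‖ * ‖q‖)) * (2 * evenKernel p q) :=
        mul_le_mul h4 h3 (stmKernel_nonneg le_rfl p q) (by positivity)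
    _ = _ := by ring

/-- The off-diagonal form tested against `|∇| ξ`: the kernel at `lam = 0` in terms of `|∇| ξ` alone,
minus a bounded perturbation. -/
theorem kerInt_stmKernel_one {lam : ℝ} (hl : 0 ≤ lam) (χ : L2) :
    kerInt (fun p q => stmKernel lam p q * (1 + ‖q‖) ^ (-1 : ℝ)) (fourierU (absDeriv χ))
        (fourierU χ) =
      kerInt (fun p q => stmKernel 0 p q / ‖q‖) (fourierU (absDeriv χ)) (fourierU (absDeriv χ)) -
      kerInt (fun p q => stmKernel 0 p q - stmKernel lam p q) (fourierU (absDeriv χ))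
        (fourierU (bessel 1 χ)) := by
  have h1 : kerFun (stmKernel lam) (fourierU (absDeriv χ)) (fourierU (bessel 1 χ)) =ᵐ[_] _ :=
    kerFun_ae_eq (k' := fun p q => stmKernel lam p q * (1 + ‖q‖) ^ (-1 : ℝ)) (a := fun _ => 1)
      (f' := fourierU (absDeriv χ)) (by simp) (fourierU_bessel zero_le_one χ)
      fun p q _ _ => by rw [one_mul]
  have h2 := kerFun_ae_eq (k := fun p q => stmKernel 0 p q / ‖q‖) (k' := stmKernel 0)
    (a := fun _ => 1) (f := fourierU (absDeriv χ)) (f' := fourierU (absDeriv χ)) (by simp)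
    (fourierU_absDeriv χ) fun p q _ hq => by
      rw [one_mul, div_mul_cancel₀ _ (norm_ne_zero_iff.2 hq)]
  have i2 := (bddKernel_stmKernel_div le_rfl).integrable (fourierU (absDeriv χ))
    (fourierU (absDeriv χ))
  have i3 := (bddKernel_stmKernel_zero_sub hl).integrable (fourierU (absDeriv χ))
    (fourierU (bessel 1 χ))
  rw [kerInt, kerInt, kerInt, ← integral_congr_ae h1, ← integral_sub i2 i3]
  refine integral_congr_ae ?_
  filter_upwards [h2] with z hz
  rw [hz]
  simp only [kerFun]
  push_cast
  ring

theorem re_inner_absDeriv_diag_ge {lam : ℝ} (hl : 0 ≤ lam) (χ : L2) :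
    √3 / 2 * ‖absDeriv χ‖ ^ 2 ≤ (inner ℂ (absDeriv χ) (fourierMul (diagSymbol lam) χ)).re := by
  have hd := bddSymbol_diagSymbol lam
  have hm : ∀ {m m' : R3 → ℝ}, BddSymbol m → BddSymbol m' → BddSymbol fun p => m p * m' p :=
    fun h h' => by
      obtain ⟨hm, C, hC⟩ := h
      obtain ⟨hm', C', hC'⟩ := h'
      exact ⟨hm.mul hm', C * C', fun p => by
        rw [abs_mul]
        exact mul_le_mul (hC p) (hC' p) (abs_nonneg _) ((abs_nonneg _).trans (hC p))⟩
  have h1 := hm bddSymbol_div_one_add hd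
  have h2 := hm bddSymbol_div_one_add (hm (bddSymbol_const (√3 / 2)) bddSymbol_div_one_add)
  have e1 : absDeriv (fourierMul (diagSymbol lam) χ) = _ :=
    fourierMul_fourierMul bddSymbol_div_one_add hd h1 (fun p => rfl) χ
  have e3 : fourierMul (fun _ => √3 / 2) (absDeriv χ) = _ :=
    fourierMul_fourierMul (bddSymbol_const (√3 / 2)) bddSymbol_div_one_add
      (hm (bddSymbol_const (√3 / 2)) bddSymbol_div_one_add) (fun p => rfl) χ
  have e2 : absDeriv (fourierMul (fun _ => √3 / 2) (absDeriv χ)) = _ := (congrArg absDeriv e3).trans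
    (fourierMul_fourierMul bddSymbol_div_one_add
      (hm (bddSymbol_const (√3 / 2)) bddSymbol_div_one_add) h2 (fun p => rfl) χ)
  have e4 : √3 / 2 * ‖absDeriv χ‖ ^ 2 =
      (inner ℂ χ (absDeriv (fourierMul (fun _ => √3 / 2) (absDeriv χ)))).re := by
    rw [← inner_absDeriv_left, fourierMul_const, inner_smul_right, Complex.re_ofReal_mul,
      re_inner_self]
  rw [e4, inner_absDeriv_left, e2, e1]
  refine re_inner_fourierMul_mono h2 h1 (fun p => ?_) χ
  refine mul_le_mul_of_nonneg_left ?_ (by positivity)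
  rw [diagSymbol, ← mul_div_assoc]
  refine div_le_div_of_nonneg_right ?_ (by positivity)
  refine Real.le_sqrt_of_sq_le ?_
  rw [mul_pow, div_pow, Real.sq_sqrt (by norm_num)]
  linarith

variable {β γ lam : ℝ} {θ : ℝ → ℝ}

/-- `Γ` tested against `|∇| ξ` controls `‖|∇| ξ‖²` up to lower order terms. -/
theorem exists_re_inner_absDeriv_oneOp_ge (hγ : gammaCStar < γ) (W : L2 →L[ℂ] L2) (hl : 0 ≤ lam) :
    ∃ c C : ℝ, 0 < c ∧ 0 ≤ C ∧ ∀ χ : L2,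
      c * ‖absDeriv χ‖ ^ 2 - C * (‖absDeriv χ‖ * ‖bessel 1 χ‖) ≤
        (inner ℂ (absDeriv χ) (oneOp γ W hl χ)).re := by
  obtain ⟨c, hc, -, hreg⟩ := exists_regularity_constant hγ
  have hD : 0 ≤ 2 * (lam + 1) * domConst := mul_nonneg (by linarith) domConst_nonneg
  set K := (bddKernel_stmKernel_zero_sub hl).op hD with hK
  refine ⟨c, ‖W‖ + 1 / Real.pi ^ 2 * ‖K‖, hc, by positivity, fun χ => ?_⟩
  rw [inner_oneOp, Complex.add_re, Complex.add_re, Complex.sub_re, Complex.re_ofReal_mul,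
    Complex.re_ofReal_mul, kerInt_stmKernel_one hl, Complex.sub_re,
    ← (bddKernel_stmKernel_zero_sub hl).inner_op hD, ← hK]
  have hbd : ∀ (T : L2 →L[ℂ] L2) (x y : L2), |(inner ℂ x (T y)).re| ≤ ‖T‖ * (‖x‖ * ‖y‖) :=
    fun T x y => (Complex.abs_re_le_norm _).trans ((norm_inner_le_norm _ _).trans (by
      have := mul_le_mul_of_nonneg_left (T.le_opNorm y) (norm_nonneg x)
      linarith))
  have h1 := re_inner_absDeriv_diag_ge hl χ
  have h2 := (hreg χ).2
  have h3 := (abs_le.1 (hbd W (absDeriv χ) (bessel 1 χ))).1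
  have h4 := (abs_le.1 (hbd K (fourierU (absDeriv χ)) (fourierU (bessel 1 χ)))).1
  rw [fourierU.norm_map, fourierU.norm_map] at h4
  have h5 := mul_le_mul_of_nonneg_left h4 (show 0 ≤ 1 / Real.pi ^ 2 by positivity)
  have h6 : (inner ℂ (hardyOp χ) (absDeriv χ)).re = (inner ℂ (absDeriv χ) (hardyOp χ)).re := by
    rw [← inner_conj_symm, Complex.conj_re]
  rw [h6] at h2
  linarith

/-- `Γ + μ` is coercive when tested against `(1 + |∇|) ξ`, for `μ` large. -/
theorem exists_shift_oneOp_coercive (hγ : gammaCStar < γ) (W : L2 →L[ℂ] L2) (hl : 0 ≤ lam) :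
    ∃ c μ : ℝ, 0 < c ∧ 0 ≤ μ ∧ ∀ χ : L2,
      c * ‖χ‖ ^ 2 ≤ (inner ℂ χ (oneOp γ W hl χ + (μ : ℂ) • bessel 1 χ)).re := by
  obtain ⟨c, C, hc, hC, h⟩ := exists_re_inner_absDeriv_oneOp_ge hγ W hl
  set N := ‖oneOp γ W hl‖ with hN
  have hN0 : 0 ≤ N := norm_nonneg _
  -- `μ` pays for the mixed terms `(C + N) a b` and `N b²`, and leaves `c / 2` for `b²`
  refine ⟨c / 4, (C + N) ^ 2 / (2 * c) + N + c / 2, by positivity, by positivity, fun χ => ?_⟩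
  set a := ‖absDeriv χ‖ with ha
  set b := ‖bessel 1 χ‖ with hb
  have ha0 : 0 ≤ a := norm_nonneg _
  have hb0 : 0 ≤ b := norm_nonneg _
  have hχ : ‖χ‖ ≤ a + b := by
    calc ‖χ‖ = ‖absDeriv χ + bessel 1 χ‖ := by rw [absDeriv_add_bessel]
      _ ≤ _ := norm_add_le _ _
  have h1 := h χ
  have h2 : -(N * ((a + b) * b)) ≤ (inner ℂ (bessel 1 χ) (oneOp γ W hl χ)).re := by
    refine neg_le_of_abs_le ((Complex.abs_re_le_norm _).trans ((norm_inner_le_norm _ _).trans ?_))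
    have h3 := mul_le_mul_of_nonneg_left ((oneOp γ W hl).le_opNorm χ) hb0
    have h4 := mul_le_mul_of_nonneg_left hχ (mul_nonneg hb0 hN0)
    rw [← hN] at h3
    nlinarith
  have h5 : (inner ℂ χ (oneOp γ W hl χ)).re = (inner ℂ (absDeriv χ) (oneOp γ W hl χ)).re +
      (inner ℂ (bessel 1 χ) (oneOp γ W hl χ)).re := by
    rw [← Complex.add_re, ← inner_add_left, absDeriv_add_bessel]
  have h6 : b ^ 2 ≤ (inner ℂ χ (bessel 1 χ)).re := by
    rw [re_inner_bessel_one]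
    have h7 : bessel 1 χ = bessel (1 / 2) (bessel (1 / 2) χ) := by
      rw [bessel_bessel (by norm_num) (by norm_num)]; norm_num
    rw [hb, h7]
    exact pow_le_pow_left₀ (norm_nonneg _) (norm_bessel_le (by norm_num) _) 2
  rw [inner_add_right, inner_smul_right, Complex.add_re, Complex.re_ofReal_mul, h5]
  set μ := (C + N) ^ 2 / (2 * c) + N + c / 2 with hμ
  have hμ0 : 0 ≤ μ := by positivity
  have h8 := mul_le_mul_of_nonneg_left h6 hμ0
  -- `(C + N) a b ≤ (c / 2) a² + (C + N)² / (2 c) b²`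
  have h9 : (C + N) * (a * b) ≤ c / 2 * a ^ 2 + (C + N) ^ 2 / (2 * c) * b ^ 2 := by
    have h10 : 0 ≤ (c * a - (C + N) * b) ^ 2 / (2 * c) := by positivity
    have h11 : (c * a - (C + N) * b) ^ 2 / (2 * c) =
        c / 2 * a ^ 2 - (C + N) * (a * b) + (C + N) ^ 2 / (2 * c) * b ^ 2 := by
      field_simp; ring
    linarith
  have h12 : ‖χ‖ ^ 2 ≤ 2 * a ^ 2 + 2 * b ^ 2 := by
    nlinarith [sq_nonneg (a - b), pow_le_pow_left₀ (norm_nonneg χ) hχ 2]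
  have h13 := mul_le_mul_of_nonneg_left h12 (show 0 ≤ c / 4 by positivity)
  rw [hμ] at h8
  nlinarith

/-- The Lax-Milgram theorem for an operator. -/
theorem bijective_of_coercive {H : Type*} [NormedAddCommGroup H] [InnerProductSpace ℂ H]
    [CompleteSpace H] (T : H →L[ℂ] H) {c : ℝ} (hc : 0 < c)
    (h : ∀ x, c * ‖x‖ ^ 2 ≤ (inner ℂ x (T x)).re) : Function.Bijective T := by
  refine ContinuousLinearMap.isUnit_iff_bijective.1
    (ContinuousLinearMap.isUnit_of_forall_le_norm_inner_map T (c := ⟨c, hc.le⟩) (by exact_mod_cast hc)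
      fun x => ?_)
  rw [norm_inner_symm, mul_comm]
  exact (h x).trans (Complex.re_le_norm _)

theorem norm_le_of_coercive {H : Type*} [NormedAddCommGroup H] [InnerProductSpace ℂ H]
    (T : H →L[ℂ] H) {c : ℝ} (h : ∀ x, c * ‖x‖ ^ 2 ≤ (inner ℂ x (T x)).re) (x : H) :
    c * ‖x‖ ≤ ‖T x‖ := by
  by_cases hx : x = 0
  · simp [hx]
  have hn : 0 < ‖x‖ := norm_pos_iff.2 hx
  refine le_of_mul_le_mul_right ?_ hn
  calc c * ‖x‖ * ‖x‖ = c * ‖x‖ ^ 2 := by ring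
    _ ≤ _ := h x
    _ ≤ ‖x‖ * ‖T x‖ := (Complex.re_le_norm _).trans (norm_inner_le_norm _ _)
    _ = _ := by ring

/-- The equation `Γ ξ = g` in terms of `halfOp`, for `ξ = bessel (1/2) ψ`. -/
theorem represents_bessel_half_iff {W : L2 →L[ℂ] L2} (hW : ∀ ψ : L2, W ψ =ᵐ[volume]
      fun y => ((regFun β γ θ ‖y‖ - γ / ‖y‖ : ℝ) : ℂ) * ψ y) (hl : 0 ≤ lam) (ψ g : L2) :
    Represents β γ θ lam (bessel (1 / 2) ψ) g ↔ halfOp γ W hl ψ = bessel (1 / 2) g := by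
  have hs : (0 : ℝ) ≤ 1 / 2 := by norm_num
  constructor
  · intro h
    refine ext_inner_left ℂ fun φ => ?_
    rw [← form_bessel_half hW hl, h _ (bessel_mem_sobolev hs φ), inner_bessel_left hs]
  · intro h η hη
    obtain ⟨φ, rfl⟩ := exists_bessel_of_mem_sobolev hs hη
    rw [form_bessel_half hW hl, h, inner_bessel_left hs]

/-- Elements of the operator domain are in `H^1`: `ξ` is compared with the solution `bessel 1 χ` in
`H^1` of the shifted equation `(Γ + μ) ξ' = g + μ ξ`. -/
theorem exists_bessel_one_eq_of_represents (hγ : gammaCStar < γ) {W : L2 →L[ℂ] L2}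
    (hW : ∀ ψ : L2, W ψ =ᵐ[volume]
      fun y => ((regFun β γ θ ‖y‖ - γ / ‖y‖ : ℝ) : ℂ) * ψ y) (hl : 0 ≤ lam) {c : ℝ} (hc : 0 < c)
    (hco : ∀ ψ, c * ‖ψ‖ ^ 2 ≤ (inner ℂ ψ (halfOp γ W hl ψ)).re) :
    ∃ C : ℝ, 0 < C ∧ ∀ ψ g : L2, halfOp γ W hl ψ = bessel (1 / 2) g →
      ∃ χ, bessel 1 χ = bessel (1 / 2) ψ ∧ ‖χ‖ ≤ C * ‖g‖ := by
  have hs : (0 : ℝ) ≤ 1 / 2 := by norm_num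
  obtain ⟨c₁, μ, hc₁, hμ, h1⟩ := exists_shift_oneOp_coercive hγ W hl
  set T := oneOp γ W hl + (μ : ℂ) • bessel 1 with hT
  have h1' : ∀ χ, c₁ * ‖χ‖ ^ 2 ≤ (inner ℂ χ (T χ)).re := h1
  refine ⟨(1 + μ / c) / c₁, by positivity, fun ψ g hψ => ?_⟩
  obtain ⟨χ, hχ⟩ := (bijective_of_coercive T hc₁ h1').2 (g + (μ : ℂ) • bessel (1 / 2) ψ)
  have hχ' : oneOp γ W hl χ + (μ : ℂ) • bessel 1 χ = g + (μ : ℂ) • bessel (1 / 2) ψ := hχ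
  have e1 : bessel 1 χ = bessel (1 / 2) (bessel (1 / 2) χ) := by
    rw [bessel_bessel hs hs]; norm_num
  refine ⟨χ, ?_, ?_⟩
  · -- the difference `δ` solves `Γ δ = -μ δ`, hence vanishes by coercivity
    set δ := ψ - bessel (1 / 2) χ with hδ
    have e2 : halfOp γ W hl (bessel (1 / 2) χ) = bessel (1 / 2) (oneOp γ W hl χ) := by
      refine ext_inner_left ℂ fun φ => ?_
      rw [← form_bessel_half hW hl, ← e1, form_bessel_one hW hl, inner_bessel_left hs]
    have e3 : halfOp γ W hl δ = -((μ : ℂ) • bessel (1 / 2) (bessel (1 / 2) δ)) := by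
      have e4 : oneOp γ W hl χ = g + (μ : ℂ) • bessel (1 / 2) ψ - (μ : ℂ) • bessel 1 χ :=
        eq_sub_of_add_eq hχ'
      rw [hδ, map_sub, hψ, e2, e4, e1]
      simp only [map_sub, map_add, map_smul, smul_sub]
      abel
    have h2 := hco δ
    rw [e3, inner_neg_right, inner_smul_right, ← inner_bessel_left hs, Complex.neg_re,
      Complex.re_ofReal_mul, re_inner_self] at h2
    have h3 : δ = 0 := by
      rw [← norm_eq_zero]
      have h4 : ‖δ‖ ^ 2 ≤ 0 := by
        have := mul_nonneg hμ (sq_nonneg ‖bessel (1 / 2) δ‖)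
        by_contra h5
        push Not at h5
        nlinarith
      exact pow_eq_zero_iff two_ne_zero |>.1 (le_antisymm h4 (sq_nonneg _))
    rw [e1, ← sub_eq_zero.1 h3]
  · have h2 := norm_le_of_coercive T h1' χ
    rw [hχ] at h2
    have h3 := norm_le_of_coercive _ hco ψ
    rw [hψ] at h3
    have h4 : ‖ψ‖ ≤ ‖g‖ / c := by
      rw [le_div_iff₀ hc, mul_comm]
      exact h3.trans (norm_bessel_le hs g)
    have h5 : ‖g + (μ : ℂ) • bessel (1 / 2) ψ‖ ≤ ‖g‖ + μ * (‖g‖ / c) := by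
      refine (norm_add_le _ _).trans ?_
      rw [norm_smul, Complex.norm_real, Real.norm_of_nonneg hμ]
      gcongr
      exact (norm_bessel_le hs ψ).trans h4
    rw [div_mul_eq_mul_div, le_div_iff₀ hc₁, mul_comm]
    calc _ ≤ _ := h2.trans h5
      _ = _ := by ring

end ThreeBosons

end

theorem propositionA1 (θ : ℝ → ℝ) (hθ : ThreeBosons.CutoffH1 θ) (β γ : ℝ)
    (hγ : ThreeBosons.gammaCStar < γ) :
    (∃ lam₀ : ℝ, 0 < lam₀ ∧ ∀ lam : ℝ, lam₀ < lam → ThreeBosons.Coercive β γ θ lam) ∧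
    ∀ lam : ℝ, 0 < lam → ThreeBosons.Coercive β γ θ lam →
      (∀ f : ThreeBosons.L2, ∃! ξ : ThreeBosons.gammaDomain β γ θ lam,
        ThreeBosons.gammaOp β γ θ lam ξ = f) ∧
      (∃ c : ℝ, 0 < c ∧ ∀ (f : ThreeBosons.L2) (ξ : ThreeBosons.gammaDomain β γ θ lam),
        ThreeBosons.gammaOp β γ θ lam ξ = f →
          (ξ : ThreeBosons.L2) ∈ ThreeBosons.sobolev 1 ∧
          ThreeBosons.sobolevNorm 1 (ξ : ThreeBosons.L2) ≤ c * ‖f‖) ∧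
      ThreeBosons.gammaDomain β γ θ lam = ThreeBosons.sobolev 1 := by
  have hs : (0 : ℝ) ≤ 1 / 2 := by norm_num
  obtain ⟨W, hW⟩ := ThreeBosons.exists_bounded_remainder hθ β γ
  refine ⟨ThreeBosons.coercive_of_large hθ hγ, fun lam hlam ⟨c₀, hc₀, hco⟩ => ?_⟩
  have hl := hlam.le
  have hco' : ∀ ψ, c₀ * (1 / 2) * ‖ψ‖ ^ 2 ≤ (inner ℂ ψ (ThreeBosons.halfOp γ W hl ψ)).re := fun ψ => by
    rw [← ThreeBosons.form_bessel_half hW hl, mul_assoc]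
    exact (mul_le_mul_of_nonneg_left (ThreeBosons.half_norm_sq_le_sobolevNorm ψ) hc₀.le).trans
      (hco _ (ThreeBosons.bessel_mem_sobolev hs ψ))
  have hc : 0 < c₀ * (1 / 2) := by positivity
  obtain ⟨C, hC, hreg⟩ := ThreeBosons.exists_bessel_one_eq_of_represents hγ hW hl hc hco'
  have hbij := ThreeBosons.bijective_of_coercive _ hc hco'
  -- elements of the domain, through their representation `ξ = bessel (1/2) ψ`
  have hdom : ∀ ξ : ThreeBosons.gammaDomain β γ θ lam, ∃ ψ, ThreeBosons.bessel (1 / 2) ψ = ξ ∧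
      ThreeBosons.halfOp γ W hl ψ = ThreeBosons.bessel (1 / 2) (ThreeBosons.gammaOp β γ θ lam ξ) := fun ξ => by
    obtain ⟨ψ, hψ⟩ := ThreeBosons.exists_bessel_of_mem_sobolev hs ξ.2.1
    refine ⟨ψ, hψ, (ThreeBosons.represents_bessel_half_iff hW hl ψ _).1 ?_⟩
    rw [hψ]
    exact (ThreeBosons.gammaOp_eq_iff ξ _).1 rfl
  refine ⟨fun f => ?_, ⟨C, hC, fun f ξ hξ => ?_⟩, Set.Subset.antisymm (fun ξ hξ => ?_) fun ξ hξ => ?_⟩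
  · obtain ⟨ψ, hψ⟩ := hbij.2 (ThreeBosons.bessel (1 / 2) f)
    have hrep := (ThreeBosons.represents_bessel_half_iff hW hl ψ f).2 hψ
    refine ⟨⟨ThreeBosons.bessel (1 / 2) ψ, ThreeBosons.bessel_mem_sobolev hs ψ, f, hrep⟩, (ThreeBosons.gammaOp_eq_iff _ f).2 hrep,
      fun ξ hξ => Subtype.ext ?_⟩
    obtain ⟨ψ', h1, h2⟩ := hdom ξ
    rw [hξ, ← hψ] at h2
    rw [← h1, hbij.1 h2]
  · obtain ⟨ψ, h1, h2⟩ := hdom ξ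
    obtain ⟨χ, h3, h4⟩ := hreg ψ _ h2
    rw [← h1, ← h3, ← hξ]
    exact ⟨ThreeBosons.bessel_mem_sobolev zero_le_one χ,
      (le_of_sq_le_sq (ThreeBosons.sq_sobolevNorm_bessel_le zero_le_one χ) (norm_nonneg _)).trans h4⟩
  · obtain ⟨ψ, h1, h2⟩ := hdom ⟨ξ, hξ⟩
    obtain ⟨χ, h3, -⟩ := hreg ψ _ h2
    change ThreeBosons.bessel (1 / 2) ψ = ξ at h1
    rw [← h1, ← h3]
    exact ThreeBosons.bessel_mem_sobolev zero_le_one χ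
  · obtain ⟨χ, rfl⟩ := ThreeBosons.exists_bessel_of_mem_sobolev zero_le_one hξ
    exact ⟨ThreeBosons.sobolev_mono hs (by norm_num) hξ, ThreeBosons.oneOp γ W hl χ,
      fun η _ => ThreeBosons.form_bessel_one hW hl η χ⟩
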